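/- Fix $M\in\mathbb N$ and let $\mathfrak h=L^2(\mathbb R^3\times\{1,\dots,M\})$, with points $\mathbf x=(x,\sigma)$, $\int d\mathbf x=\sum_\sigma\int dx$, complex conjugation $\mathcal C$, $\overline A=\mathcal CA\mathcal C$ and $A^T=\overline{A^*}$. Let $N\ge 1$ be real and $\varepsilon=N^{-1/3}$. Let $V\in L^1(\mathbb R^3)$ be real-valued and even with $\int|\hat V(p)|(1+|p|^2)\,dp\le C_0$, where $\hat V(p)=(2\pi)^{-3}\int e^{-ip\cdot x}V(x)\,dx$. Let $(\omega_N,\alpha_N)$ be the one-particle density matrix and the pairing matrix of a pure quasi-free state with $N$ particles on average, that is, $\omega_N$ is trace class with $\operatorname{tr}\omega_N=N$, $\alpha_N^T=-\alpha_N$, and $$\Gamma_N=\begin{pmatrix}\omega_N&\alpha_N\\ \alpha_N^*&1-\overline{\omega_N}\end{pmatrix}\quad\text{on }\mathfrak h\oplus\mathfrak h\quad\text{satisfies}\quad 0\le\Gamma_N\le 1,\quad \Gamma_N^2=\Gamma_N .$$ Suppose that $$\sup_{p\in\mathbb R^3}\frac{\|[\omega_N,e^{ip\cdot\hat x}]\|_{HS}}{1+|p|}\le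 C_0N^{1/3},\qquad \|[\omega_N,\varepsilon\nabla]\|_{HS}\le C_0N^{1/3},\qquad \|[\alpha_N,\varepsilon\nabla]\|_{HS}\le C_0N^{1/3}.$$ (Commutators with $\nabla$ are understood as quadratic forms on Schwartz functions; a bound on the Hilbert-Schmidt norm means that the form is that of a Hilbert-Schmidt operator obeying the bound.) Let $(\omega_{N,t},\alpha_{N,t})_{t\ge 0}$, continuous in $t$ in trace norm and in Hilbert-Schmidt norm respectively, be a mild (Duhamel) solution, with initial datum $(\omega_N,\alpha_N)$, of the Hartree-Fock-Bogoliubov equation $$i\varepsilon\partial_t\omega_{N,t}=[h_{HF}(t),\omega_{N,t}]+\Pi_t\alpha_{N,t}^*-\alpha_{N,t}\Pi_t^*,$$ $$i\varepsilon\partial_t\alpha_{N,t}=h_{HF}(t)\alpha_{N,t}+\alpha_{N,t}\overline{h_{HF}(t)}+\Pi_t(1-\overline{\omega_{N,t}})-\omega_{N,t}\Pi_t ,$$ where $h_{HF}(t)=-\varepsilon^2\Delta+\rho_t*V-X_t$, $\rho_t(\mathbf x)=\frac1N\omega_{N,t}(\mathbf x;\mathbf x)$, $(\rho_t*V)(x)=\int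 d\mathbf y\,V(x-y)\rho_t(\mathbf y)$, and $X_t$, $\Pi_t$ have the integral kernels $\frac1NV(x-y)\omega_{N,t}(\mathbf x;\mathbf y)$ and $\frac1NV(x-y)\alpha_{N,t}(\mathbf x;\mathbf y)$. Then there are constants $C,c>0$ depending only on $C_0$ such that for all $t\ge 0$ $$\sup_{p\in\mathbb R^3}\frac{\|[\omega_{N,t},e^{ip\cdot\hat x}]\|_{HS}}{1+|p|},\quad \|[\omega_{N,t},\varepsilon\nabla]\|_{HS},\quad \|[\alpha_{N,t},\varepsilon\nabla]\|_{HS}$$ are each at most $Ce^{c|t|}\big(N^{1/3}+|t|\,\|\alpha_N\|_{HS}\big)$. Furthermore $$\|\omega_{N,t}\|_{HS}^2\le\|\omega_N\|_{\mathrm{tr}},\qquad \|\alpha_{N,t}\|_{HS}\le e^{C|t|/(N\varepsilon)}\|\alpha_N\|_{HS}.$$ -/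

import Mathlib

open MeasureTheory Filter Topology
open scoped ENNReal InnerProductSpace SchwartzMap

noncomputable section

namespace HFB

/-! ### The one-particle space and operators on it -/

/-- Position space `ℝ³` with its Euclidean structure. -/
abbrev R3 : Type := EuclideanSpace ℝ (Fin 3)

/-- The spin space `ℂ^M`. -/
abbrev Spin (M : ℕ) : Type := EuclideanSpace ℂ (Fin M)

/-- The one-particle Hilbert space `L²(ℝ³ × {1,…,M})`, realised as `L²(ℝ³; ℂ^M)`:
`f(x, σ)` is the component `f x σ`. -/
abbrev H (M : ℕ) : Type := Lp (Spin M) 2 (volume : Measure R3)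

/-- Bounded operators on the one-particle space. -/
abbrev Op (M : ℕ) : Type := H M →L[ℂ] H M

/-- Complex conjugation on the spin space. -/
def conjSpin (M : ℕ) : Spin M →L⋆[ℂ] Spin M :=
  LinearMap.mkContinuous
    { toFun := fun v => WithLp.toLp 2 fun i => (starRingEnd ℂ) (v i)
      map_add' := fun v w => by ext i; simp
      map_smul' := fun c v => by ext i; simp }
    1 (fun v => by simp [EuclideanSpace.norm_eq])

/-- Complex conjugation `𝒞` on the one-particle space, `(𝒞 f)(x, σ) = conj (f(x, σ))`. -/
def conjH (M : ℕ) : H M →L⋆[ℂ] H M := (conjSpin M).compLpL 2 volume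

/-- The conjugate operator `Ā = 𝒞 A 𝒞`. -/
def conjOp {M : ℕ} (A : Op M) : Op M := ((conjH M).comp A).comp (conjH M)

/-- The transposed operator, i.e. the conjugate of the adjoint. -/
def transposeOp {M : ℕ} (A : Op M) : Op M := conjOp (ContinuousLinearMap.adjoint A)

/-- The commutator `[A, B] = A B - B A` of bounded operators. -/
def comm {M : ℕ} (A B : Op M) : Op M := A ∘L B - B ∘L A

open Classical in
/-- The operator of multiplication by an essentially bounded function `φ` of the position
(and `0` if `φ` is not essentially bounded). -/
def mulOp (M : ℕ) (φ : R3 → ℂ) : Op M :=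
  if h : MemLp φ ∞ (volume : Measure R3) then
    (ContinuousLinearMap.lsmul ℂ ℂ : ℂ →L[ℂ] Spin M →L[ℂ] Spin M).holderL volume ∞ 2 2 (h.toLp φ)
  else 0

/-- The multiplication operator `e^{i p · x̂}`. -/
def expOp (M : ℕ) (p : R3) : Op M :=
  mulOp M fun x => Complex.exp (Complex.I * ((⟪p, x⟫_ℝ : ℝ) : ℂ))

/-! ### Traces and Schatten norms -/

/-- An index set of a fixed orthonormal (Hilbert) basis of the one-particle space. -/
def basisIndex (M : ℕ) : Set (H M) := (exists_hilbertBasis ℂ (H M)).choose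

/-- A fixed orthonormal (Hilbert) basis of the one-particle space. The Hilbert-Schmidt norm, and
the trace of a trace class operator, do not depend on its choice. -/
def basis (M : ℕ) : HilbertBasis (basisIndex M) ℂ (H M) :=
  (exists_hilbertBasis ℂ (H M)).choose_spec.choose

/-- The Hilbert-Schmidt norm `(∑ᵢ ‖A eᵢ‖²)^{1/2}`, with value `∞` if `A` is not Hilbert-Schmidt. -/
def hsNorm {M : ℕ} (A : Op M) : ℝ≥0∞ :=
  (∑' i, ‖A (basis M i)‖ₑ ^ 2) ^ (1 / 2 : ℝ)

/-- The trace norm, as the supremum of `∑ᵢ |⟨eᵢ, A fᵢ⟩|` over all pairs of finite orthonormal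
systems; it is `∞` if `A` is not trace class. -/
def traceNorm {M : ℕ} (A : Op M) : ℝ≥0∞ :=
  ⨆ (n : ℕ) (e : Fin n → H M) (f : Fin n → H M) (_ : Orthonormal ℂ e) (_ : Orthonormal ℂ f),
    ∑ i, ‖⟪e i, A (f i)⟫_ℂ‖ₑ

/-- The trace of a trace class operator. -/
def trace {M : ℕ} (A : Op M) : ℂ := ∑' i, ⟪basis M i, A (basis M i)⟫_ℂ

/-! ### Commutators with the gradient -/

/-- `B` is the commutator `[A, ε ∂ⱼ] = A ε ∂ⱼ - ε ∂ⱼ A`, understood as a quadratic form on Schwartz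
functions: `⟨f, B g⟩ = ε ⟨f, A ∂ⱼ g⟩ + ε ⟨∂ⱼ f, A g⟩`. At most one bounded `B` has this property. -/
def IsGradComm {M : ℕ} (ε : ℝ) (A : Op M) (j : Fin 3) (B : Op M) : Prop :=
  ∀ f g : 𝓢(R3, Spin M),
    ⟪f.toLp 2, B (g.toLp 2)⟫_ℂ =
      (ε : ℂ) * ⟪f.toLp 2,
        A ((LineDeriv.lineDerivOp (EuclideanSpace.single j (1 : ℝ)) g : 𝓢(R3, Spin M)).toLp 2)⟫_ℂ
      + (ε : ℂ) * ⟪(LineDeriv.lineDerivOp (EuclideanSpace.single j (1 : ℝ)) f :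
          𝓢(R3, Spin M)).toLp 2, A (g.toLp 2)⟫_ℂ

/-- The Hilbert-Schmidt norm of `[A, ε ∂ⱼ]`, with value `∞` if this commutator does not extend
to a Hilbert-Schmidt operator. -/
def partialCommHS {M : ℕ} (ε : ℝ) (A : Op M) (j : Fin 3) : ℝ≥0∞ :=
  ⨅ (B : Op M) (_ : IsGradComm ε A j B), hsNorm B

/-- The Hilbert-Schmidt norm `‖[A, ε ∇]‖_HS = (∑ⱼ ‖[A, ε ∂ⱼ]‖_HS²)^{1/2}`. -/
def gradCommHS {M : ℕ} (ε : ℝ) (A : Op M) : ℝ≥0∞ :=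
  (∑ j, partialCommHS ε A j ^ 2) ^ (1 / 2 : ℝ)

/-- `sup_p (1 + |p|)⁻¹ ‖[A, e^{i p · x̂}]‖_HS`. -/
def expCommHS {M : ℕ} (A : Op M) : ℝ≥0∞ :=
  ⨆ p : R3, hsNorm (comm A (expOp M p)) / ENNReal.ofReal (1 + ‖p‖)

/-! ### Integral kernels and densities -/

/-- `A` is the Hilbert-Schmidt operator with the square integrable integral kernel `K`:
`(A f)(x, σ) = ∑_σ' ∫ K(x, σ; y, σ') f(y, σ') dy`. -/
def HasKernel {M : ℕ} (A : Op M) (K : R3 × Fin M → R3 × Fin M → ℂ) : Prop :=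
  (∀ σ τ : Fin M, MemLp (fun z : R3 × R3 => K (z.1, σ) (z.2, τ)) 2 volume) ∧
  ∀ f : H M, ∀ᵐ x : R3, ∀ σ : Fin M, A f x σ = ∑ τ, ∫ y : R3, K (x, σ) (y, τ) * f y τ

open Classical in
/-- The operator with integral kernel `N⁻¹ V(x - y) A(x, σ; y, σ')`, where `A(x, σ; y, σ')` is the
kernel of the Hilbert-Schmidt operator `A`. For `A = ω` it is the exchange operator `X`, for
`A = α` it is the pairing operator `Π`. (It exists and is unique for every Hilbert-Schmidt
operator `A` and every essentially bounded `V`.) -/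
def kernelMul {M : ℕ} (V : R3 → ℝ) (N : ℝ) (A : Op M) : Op M :=
  if h : ∃ B : Op M, ∃ K : R3 × Fin M → R3 × Fin M → ℂ,
      HasKernel A K ∧ HasKernel B fun z w => ((N⁻¹ * V (z.1 - w.1) : ℝ) : ℂ) * K z w
  then h.choose else 0

/-- `ρ` is the density `ρ(x) = ∑_σ A(x, σ; x, σ)` of the trace class operator `A`, i.e. the
integrable function with `∫ φ ρ = tr (A φ)` for all bounded functions `φ` of the position. -/
def IsDensity {M : ℕ} (A : Op M) (ρ : R3 → ℂ) : Prop :=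
  Integrable ρ ∧ ∀ φ : R3 → ℂ, MemLp φ ∞ (volume : Measure R3) →
    trace (A ∘L mulOp M φ) = ∫ x, φ x * ρ x

open Classical in
/-- The density of a trace class operator (it exists and is unique almost everywhere). -/
def density {M : ℕ} (A : Op M) : R3 → ℂ :=
  if h : ∃ ρ : R3 → ℂ, IsDensity A ρ then h.choose else 0

/-- The multiplication operator `ρ * V` with `ρ(y) = N⁻¹ ∑_σ ω(y, σ; y, σ)`. -/
def directOp {M : ℕ} (V : R3 → ℝ) (N : ℝ) (ω : Op M) : Op M :=
  mulOp M fun x => ∫ y, (V (x - y) : ℂ) * ((N : ℂ)⁻¹ * density ω y)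

/-! ### The Hartree-Fock-Bogoliubov equation -/

/-- The semiclassical parameter `ε = N^{-1/3}`. -/
def eps (N : ℝ) : ℝ := N ^ (-(1 / 3) : ℝ)

/-- The free propagator `e^{i ε t Δ}`, generated by `i ε ∂ₜ f = - ε² Δ f`: in Fourier space, with
`𝓕 f (ξ) = ∫ e^{-2πi ξ·x} f(x) dx`, it is the multiplication by `e^{-i ε t |2πξ|²}`. -/
def freeProp (M : ℕ) (ε t : ℝ) : Op M :=
  ((Lp.fourierTransformₗᵢ R3 (Spin M)).symm : Op M) ∘L
    mulOp M (fun ξ => Complex.exp (-Complex.I * ((ε * t * (2 * Real.pi * ‖ξ‖) ^ 2 : ℝ) : ℂ))) ∘L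
    ((Lp.fourierTransformₗᵢ R3 (Spin M)) : Op M)

/-- The interaction part `ρ * V - X` of the Hartree-Fock Hamiltonian
`h_HF = - ε² Δ + ρ * V - X`. -/
def hfPotential {M : ℕ} (V : R3 → ℝ) (N : ℝ) (ω : Op M) : Op M :=
  directOp V N ω - kernelMul V N ω

/-- The interaction part `[ρ * V - X, ω] + Π α* - α Π*` of the equation for `ω`. -/
def omegaForce {M : ℕ} (V : R3 → ℝ) (N : ℝ) (ω α : Op M) : Op M :=
  comm (hfPotential V N ω) ω
    + kernelMul V N α ∘L ContinuousLinearMap.adjoint α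
    - α ∘L ContinuousLinearMap.adjoint (kernelMul V N α)

/-- The interaction part `(ρ * V - X) α + α conj(ρ * V - X) + Π (1 - conj ω) - ω Π` of the
equation for `α`. -/
def alphaForce {M : ℕ} (V : R3 → ℝ) (N : ℝ) (ω α : Op M) : Op M :=
  hfPotential V N ω ∘L α + α ∘L conjOp (hfPotential V N ω)
    + kernelMul V N α ∘L (ContinuousLinearMap.id ℂ (H M) - conjOp ω)
    - ω ∘L kernelMul V N α

/-- `(ω t, α t)`, `t ≥ 0`, is a (mild) solution of the time-dependent Hartree-Fock-Bogoliubov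
equation
`i ε ∂ₜ ω = [h_HF, ω] + Π α* - α Π*`,
`i ε ∂ₜ α = h_HF α + α conj(h_HF) + Π (1 - conj ω) - ω Π`
with initial datum `(ω₀, α₀)`: `t ↦ ω t` is continuous in trace norm, `t ↦ α t` is continuous in
Hilbert-Schmidt norm, and the equation holds in its Duhamel form
`ω t = e^{iεtΔ} ω₀ e^{-iεtΔ} + (iε)⁻¹ ∫₀ᵗ e^{iε(t-s)Δ} F(s) e^{-iε(t-s)Δ} ds`,
`α t = e^{iεtΔ} α₀ e^{iεtΔ} + (iε)⁻¹ ∫₀ᵗ e^{iε(t-s)Δ} G(s) e^{iε(t-s)Δ} ds`,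
where `F` and `G` are the interaction parts of the right-hand sides. -/
structure IsSolution {M : ℕ} (V : R3 → ℝ) (N : ℝ) (ω₀ α₀ : Op M) (ω α : ℝ → Op M) : Prop where
  omega_zero : ω 0 = ω₀
  alpha_zero : α 0 = α₀
  omega_traceClass : ∀ t, 0 ≤ t → traceNorm (ω t) < ∞
  alpha_hilbertSchmidt : ∀ t, 0 ≤ t → hsNorm (α t) < ∞
  omega_continuous : ∀ s, 0 ≤ s →
    Tendsto (fun t => traceNorm (ω t - ω s)) (𝓝[Set.Ici 0] s) (𝓝 0)
  alpha_continuous : ∀ s, 0 ≤ s →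
    Tendsto (fun t => hsNorm (α t - α s)) (𝓝[Set.Ici 0] s) (𝓝 0)
  omega_eq : ∀ t, 0 ≤ t → ∀ f g : H M,
    ⟪f, ω t g⟫_ℂ =
      ⟪f, (freeProp M (eps N) t ∘L ω₀ ∘L freeProp M (eps N) (-t)) g⟫_ℂ
      + (Complex.I * (eps N : ℂ))⁻¹ * ∫ s in (0 : ℝ)..t,
        ⟪f, (freeProp M (eps N) (t - s) ∘L omegaForce V N (ω s) (α s)
          ∘L freeProp M (eps N) (-(t - s))) g⟫_ℂ
  alpha_eq : ∀ t, 0 ≤ t → ∀ f g : H M,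
    ⟪f, α t g⟫_ℂ =
      ⟪f, (freeProp M (eps N) t ∘L α₀ ∘L freeProp M (eps N) t) g⟫_ℂ
      + (Complex.I * (eps N : ℂ))⁻¹ * ∫ s in (0 : ℝ)..t,
        ⟪f, (freeProp M (eps N) (t - s) ∘L alphaForce V N (ω s) (α s)
          ∘L freeProp M (eps N) (t - s)) g⟫_ℂ

/-! ### Assumptions on the potential and on the initial datum -/

/-- The Fourier transform `V̂(p) = (2π)⁻³ ∫ e^{-i p·x} V(x) dx`, normalised such that
`V(x) = ∫ V̂(p) e^{i p·x} dp`. -/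
def vHat (V : R3 → ℝ) (p : R3) : ℂ :=
  (((2 * Real.pi) ^ 3 : ℝ) : ℂ)⁻¹ *
    ∫ x, Complex.exp (-Complex.I * ((⟪p, x⟫_ℝ : ℝ) : ℂ)) * (V x : ℂ)

/-- Integrable, even, real-valued potentials with `∫ |V̂(p)| (1 + |p|²) dp ≤ C₀`. -/
structure IsPotential (C₀ : ℝ) (V : R3 → ℝ) : Prop where
  integrable : Integrable V
  even : ∀ x, V x = V (-x)
  fourier_integrable : Integrable fun p => ‖vHat V p‖ * (1 + ‖p‖ ^ 2)
  fourier_bound : ∫ p, ‖vHat V p‖ * (1 + ‖p‖ ^ 2) ≤ C₀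

/-- The generalised one-particle density matrix `Γ = (ω, α; α*, 1 - conj ω)` on `𝔥 ⊕ 𝔥`. -/
def genDensity {M : ℕ} (ω α : Op M) : WithLp 2 (H M × H M) →L[ℂ] WithLp 2 (H M × H M) :=
  ((WithLp.prodContinuousLinearEquiv 2 ℂ (H M) (H M)).symm :
      H M × H M →L[ℂ] WithLp 2 (H M × H M)) ∘L
    ((ω ∘L ContinuousLinearMap.fst ℂ (H M) (H M) + α ∘L ContinuousLinearMap.snd ℂ (H M) (H M)).prod
      (ContinuousLinearMap.adjoint α ∘L ContinuousLinearMap.fst ℂ (H M) (H M)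
        + (ContinuousLinearMap.id ℂ (H M) - conjOp ω) ∘L
          ContinuousLinearMap.snd ℂ (H M) (H M))) ∘L
    ((WithLp.prodContinuousLinearEquiv 2 ℂ (H M) (H M)) :
      WithLp 2 (H M × H M) →L[ℂ] H M × H M)

/-- `Γ = (ω, α; α*, 1 - conj ω)` is the one-particle density matrix of a pure quasi-free state
with `N` particles on average: `0 ≤ Γ ≤ 1`, `Γ² = Γ`, `αᵀ = -α` and `tr ω = N`. -/
structure IsPureQuasiFree {M : ℕ} (N : ℝ) (ω α : Op M) : Prop where
  nonneg : (genDensity ω α).IsPositive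
  le_one : (ContinuousLinearMap.id ℂ (WithLp 2 (H M × H M)) - genDensity ω α).IsPositive
  proj : genDensity ω α ∘L genDensity ω α = genDensity ω α
  antisymm : transposeOp α = -α
  traceClass : traceNorm ω < ∞
  trace_eq : trace ω = (N : ℂ)

/-- The commutator bounds with constant `C₀` that express the semiclassical structure. -/
structure IsSemiclassical {M : ℕ} (C₀ N : ℝ) (ω α : Op M) : Prop where
  exp_comm : expCommHS ω ≤ ENNReal.ofReal (C₀ * N ^ (1 / 3 : ℝ))
  omega_grad : gradCommHS (eps N) ω ≤ ENNReal.ofReal (C₀ * N ^ (1 / 3 : ℝ))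
  alpha_grad : gradCommHS (eps N) α ≤ ENNReal.ofReal (C₀ * N ^ (1 / 3 : ℝ))

end HFB

end

/-! The estimate is a Grönwall argument for differences `A - W A W*`, where `W` is a translation
`τ_a` or a boost `e^{ip·x̂}`. Both kinds of commutator are encoded this way. By unitarity, the
Hilbert-Schmidt norm of `[ω, e^{ip·x̂}]` equals that of `ω - e^{ip·x̂} ω e^{-ip·x̂}`. A
Hilbert-Schmidt bound on `[A, ε∇]` is equivalent, up to a factor 3 each way, to the Lipschitz bound
`‖A - τ_a A τ_{-a}‖ ≤ const · |a|/ε` (`hsNorm_sub_trans_le`, `gradCommHS_le_of_trans`). Hence no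
unbounded operator has to be commuted with the solution.

The Laplacian is removed by following the free flow: `U(-h) A U(±h)` has the same Hilbert-Schmidt
norm as `A`, and along this pull-back the Duhamel formula gives a one-sided derivative that contains
only bounded interaction terms (`comovingDeriv_of_duhamel`). Norms are then controlled through Dini
derivatives. A contribution `i(SY + YS')` with `S`, `S'` selfadjoint does not move `‖Y‖` to first
order, so only the remainder counts (`DiniLE.of_generator`).

Writing `V = ∫ V̂(q) e^{iq·x} dq`, the exchange and pairing operators become averages `N⁻¹ ∫ V̂(q)
e^{iq·x̂} A e^{-iq·x̂} dq`. They are bounded by `C₀/N` times `A`, both in operator and in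
Hilbert-Schmidt norm, which is harmless because `N ε ≥ 1`. The direct term becomes `∫ V̂(q) ρ̂(q)
e^{iq·x̂} dq` with `ρ̂(q) = N⁻¹ tr(ω e^{-iq·x̂})`.

The algebraic structure of the datum persists: `ω - ω*`, `α + αᵀ` and the blocks of `Γ² - Γ` each
satisfy a homogeneous linear inequality and start at zero (`star_om`, `transpose_al`, `purity`).
Therefore `‖ω‖ ≤ 1`, `‖α‖ ≤ 1` in operator norm, and `tr(ωB)` can be written with Hilbert-Schmidt
inner products. The quantity `‖ω‖² + ‖α‖²` (Hilbert-Schmidt norms) keeps the value `N`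
(`norm_sq_add_eq`), so `|ρ̂| ≤ 1`. The bound on `ω` in Hilbert-Schmidt norm and the growth of `α`
(`norm_al_le`) follow from this.

For the commutators, translating the direct potential by `a` inserts `1 - e^{iq·a}`, of size
`|q||a|`, in front of `[e^{iq·x̂}, ω]`; the moment `∫|V̂(q)||q|(1+|q|)` then converts a bound on all
boosts into a source for translations (`diniLE_omTrans`). In the equation for `α` the same
difference acts on `α` itself and produces the term with `‖α_N‖` (`diniLE_alTrans`). For boosts the
direct term commutes with `e^{ip·x̂}`, but the kinetic energy turns a boost over time `h` into a
translation by `2εhp`, which costs `2|p|` times the Lipschitz constant; the powers of `ε` cancel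
(`diniLE_omBoost`).

The two families thus control each other. The suprema over `a` and `p` are never differentiated: all
comparisons are made for fixed `a` or `p`, and the loop is closed by a contraction. A bound `A
e^{λs}(1+|p|)` on the boosts with `λ = 20 C₀ + 4` reproduces itself with `A` replaced by `c + A/8`,
whence `A ≤ 8c/7` (`norm_trans_le`, `norm_omBoost_le_of_trans`, `norm_omBoost_le`). -/

noncomputable section

namespace HFB

/-! ### Shortcut instances for the algebra of bounded operators. -/

section Coercions

instance (M : ℕ) : CoeFun (Op M) fun _ => H M → H M := ⟨fun A => DFunLike.coe A⟩

instance (M : ℕ) : NormedRing (Op M) := inferInstance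
instance (M : ℕ) : NormedAlgebra ℂ (Op M) := inferInstance
instance (M : ℕ) : SeminormedAddCommGroup (Op M) := inferInstance
instance (M : ℕ) : Ring (Op M) := inferInstance
instance (M : ℕ) : Semiring (Op M) := inferInstance
instance (M : ℕ) : Algebra ℂ (Op M) := inferInstance
instance (M : ℕ) : Module ℂ (Op M) := inferInstance
instance (M : ℕ) : AddCommGroup (Op M) := inferInstance

end Coercions

/-! ### The Hilbert-Schmidt operators as an inner product space and a bimodule over the bounded
operators. -/

section HilbertSchmidt

variable {M : ℕ}

theorem enorm_sq_eq_ofReal (z : ℝ) {E : Type*} [SeminormedAddCommGroup E] (x : E)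
    (h : ‖x‖ ^ 2 = z) : ‖x‖ₑ ^ 2 = ENNReal.ofReal z := by
  rw [← h, ← ofReal_norm, ENNReal.ofReal_pow (norm_nonneg _)]

theorem parseval_enorm {ι : Type*} (b : HilbertBasis ι ℂ (H M)) (x : H M) :
    ∑' i, ‖⟪b i, x⟫_ℂ‖ₑ ^ 2 = ‖x‖ₑ ^ 2 := by
  have h := b.hasSum_inner_mul_inner x x
  have h2 : HasSum (fun i => ‖⟪b i, x⟫_ℂ‖ ^ 2) (‖x‖ ^ 2) := by
    have h3 := Complex.hasSum_re h
    convert! h3 using 1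
    · ext i
      rw [← inner_conj_symm x (b i), ← Complex.normSq_eq_conj_mul_self, Complex.ofReal_re,
        Complex.normSq_eq_norm_sq]
    · rw [inner_self_eq_norm_sq_to_K]; norm_cast
  rw [enorm_sq_eq_ofReal (‖x‖ ^ 2) x rfl, ← h2.tsum_eq,
    ENNReal.ofReal_tsum_of_nonneg (fun i => by positivity) h2.summable]
  exact tsum_congr fun i => enorm_sq_eq_ofReal _ _ rfl

/-- Both sides are the double sum of `|⟨c_j, A b_i⟩|²`, by Parseval and exchange of summation.
Taking two different bases shows that the Hilbert-Schmidt norm does not depend on the basis. -/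
theorem tsum_enorm_sq_adjoint {ι κ : Type*} (b : HilbertBasis ι ℂ (H M))
    (c : HilbertBasis κ ℂ (H M)) (A : Op M) :
    ∑' i, ‖A (b i)‖ₑ ^ 2 = ∑' j, ‖ContinuousLinearMap.adjoint A (c j)‖ₑ ^ 2 := by
  calc ∑' i, ‖A (b i)‖ₑ ^ 2 = ∑' i, ∑' j, ‖⟪c j, A (b i)⟫_ℂ‖ₑ ^ 2 :=
        tsum_congr fun i => (parseval_enorm c _).symm
    _ = ∑' j, ∑' i, ‖⟪c j, A (b i)⟫_ℂ‖ₑ ^ 2 := ENNReal.tsum_comm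
    _ = ∑' j, ‖ContinuousLinearMap.adjoint A (c j)‖ₑ ^ 2 := by
        refine tsum_congr fun j => ?_
        rw [← parseval_enorm b (ContinuousLinearMap.adjoint A (c j))]
        refine tsum_congr fun i => ?_
        rw [← ContinuousLinearMap.adjoint_inner_left, ← inner_conj_symm, RCLike.enorm_conj]

theorem hsNorm_sq (A : Op M) : hsNorm A ^ 2 = ∑' i, ‖A (basis M i)‖ₑ ^ 2 := by
  rw [hsNorm, ← ENNReal.rpow_natCast, ← ENNReal.rpow_mul]; norm_num

theorem hsNorm_le_of_sq_le {A : Op M} {c : ℝ≥0∞} (h : ∑' i, ‖A (basis M i)‖ₑ ^ 2 ≤ c ^ 2) :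
    hsNorm A ≤ c := by
  rw [← hsNorm_sq] at h
  exact (ENNReal.pow_le_pow_left_iff two_ne_zero).1 h

theorem hsNorm_sq_eq_of_basis {ι : Type*} (b : HilbertBasis ι ℂ (H M)) (A : Op M) :
    hsNorm A ^ 2 = ∑' i, ‖A (b i)‖ₑ ^ 2 := by
  rw [hsNorm_sq, tsum_enorm_sq_adjoint (basis M) (basis M), tsum_enorm_sq_adjoint b (basis M)]

theorem hsNorm_adjoint (A : Op M) : hsNorm (ContinuousLinearMap.adjoint A) = hsNorm A := by
  rw [hsNorm, hsNorm, tsum_enorm_sq_adjoint (basis M) (basis M) A]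

theorem hsNorm_comp_left (B A : Op M) : hsNorm (B * A) ≤ ‖B‖ₑ * hsNorm A := by
  refine hsNorm_le_of_sq_le ?_
  rw [mul_pow, hsNorm_sq, ← ENNReal.tsum_mul_left]
  refine ENNReal.tsum_le_tsum fun i => ?_
  rw [← mul_pow]
  gcongr
  exact ContinuousLinearMap.le_opENorm B (A (basis M i))

theorem enorm_adjoint (A : Op M) : ‖ContinuousLinearMap.adjoint A‖ₑ = ‖A‖ₑ := by
  rw [← ofReal_norm, ← ofReal_norm, LinearIsometryEquiv.norm_map]

theorem hsNorm_comp_right (A B : Op M) : hsNorm (A * B) ≤ hsNorm A * ‖B‖ₑ := by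
  rw [← hsNorm_adjoint, ← ContinuousLinearMap.star_eq_adjoint, star_mul, mul_comm]
  refine (hsNorm_comp_left _ _).trans ?_
  rw [ContinuousLinearMap.star_eq_adjoint, ContinuousLinearMap.star_eq_adjoint, hsNorm_adjoint,
    enorm_adjoint]

theorem enorm_sq_apply_le (A : Op M) (x : H M) : ‖A x‖ₑ ≤ hsNorm A * ‖x‖ₑ := by
  rw [← ENNReal.pow_le_pow_left_iff two_ne_zero, mul_pow, ← parseval_enorm (basis M) (A x),
    ← hsNorm_adjoint, hsNorm_sq, ← ENNReal.tsum_mul_right]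
  refine ENNReal.tsum_le_tsum fun i => ?_
  rw [← ContinuousLinearMap.adjoint_inner_left, ← mul_pow]
  gcongr
  rw [← ofReal_norm, ← ofReal_norm, ← ofReal_norm,
    ← ENNReal.ofReal_mul (norm_nonneg _)]
  exact ENNReal.ofReal_le_ofReal (norm_inner_le_norm _ _)

theorem memℓp_of_hsNorm {A : Op M} (h : hsNorm A < ∞) : Memℓp (fun i => A (basis M i)) 2 := by
  have h2 : ∑' i, ‖A (basis M i)‖ₑ ^ 2 ≠ ∞ := by
    rw [← hsNorm_sq]; exact (ENNReal.pow_lt_top h).ne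
  refine memℓp_gen ?_
  have h3 := ENNReal.summable_toReal h2
  convert! h3 using 2 with i
  simp

theorem hsNorm_lt_top_of_memℓp {A : Op M} (h : Memℓp (fun i => A (basis M i)) 2) : hsNorm A < ∞ := by
  have h1 := h.summable (by norm_num)
  have h2 : Summable fun i => ‖A (basis M i)‖ ^ 2 := by
    convert! h1 using 2 with i; simp
  have h3 : ∑' i, ‖A (basis M i)‖ₑ ^ 2 = ENNReal.ofReal (∑' i, ‖A (basis M i)‖ ^ 2) := by
    rw [ENNReal.ofReal_tsum_of_nonneg (fun i => by positivity) h2]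
    exact tsum_congr fun i => enorm_sq_eq_ofReal _ _ rfl
  rw [hsNorm, h3]
  exact ENNReal.rpow_lt_top_of_nonneg (by norm_num) ENNReal.ofReal_ne_top

/-- The Hilbert-Schmidt operators as a subspace of the bounded operators. -/
def hsSubmodule (M : ℕ) : Submodule ℂ (Op M) where
  carrier := {A | hsNorm A < ∞}
  add_mem' {A B} ha hb :=
    hsNorm_lt_top_of_memℓp ((memℓp_of_hsNorm ha).add (memℓp_of_hsNorm hb))
  zero_mem' := by simp [hsNorm]
  smul_mem' c A ha := hsNorm_lt_top_of_memℓp ((memℓp_of_hsNorm ha).const_smul c)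

/-- The space of Hilbert-Schmidt operators, with the Hilbert-Schmidt norm. -/
def HS (M : ℕ) : Type := hsSubmodule M

namespace HS

instance : AddCommGroup (HS M) := inferInstanceAs (AddCommGroup (hsSubmodule M))
instance : Module ℂ (HS M) := inferInstanceAs (Module ℂ (hsSubmodule M))

/-- The bounded operator underlying a Hilbert-Schmidt operator. -/
def op : HS M →ₗ[ℂ] Op M := (hsSubmodule M).subtype

instance : CoeFun (HS M →ₗ[ℂ] Op M) fun _ => HS M → Op M := ⟨fun A => DFunLike.coe A⟩

/-- A bounded operator of finite Hilbert-Schmidt norm as an element of `HS M`. -/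
def mk (A : Op M) (h : hsNorm A < ∞) : HS M := (⟨A, h⟩ : hsSubmodule M)

@[simp] theorem op_mk (A : Op M) (h : hsNorm A < ∞) : op (mk A h) = A := rfl

theorem hsNorm_op_lt_top (A : HS M) : hsNorm (op A) < ∞ := Subtype.property (p := (· ∈ hsSubmodule M)) A

theorem op_injective : Function.Injective (op : HS M → Op M) := Subtype.val_injective

@[ext] theorem ext {A B : HS M} (h : op A = op B) : A = B := op_injective h

/-- The family of images of the basis vectors. -/
def toLp : HS M →ₗ[ℂ] lp (fun _ : basisIndex M => H M) 2 where
  toFun A := ⟨fun i => op A (basis M i), memℓp_of_hsNorm A.hsNorm_op_lt_top⟩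
  map_add' A B := by ext1; funext i; simp; rfl
  map_smul' c A := by ext1; funext i; simp

theorem toLp_apply (A : HS M) (i : basisIndex M) : toLp A i = op A (basis M i) := rfl

theorem toLp_injective : Function.Injective (toLp : HS M → _) := by
  intro A B h
  have h1 : ∀ i, op A (basis M i) = op B (basis M i) := fun i => by
    rw [← toLp_apply, ← toLp_apply, h]
  refine ext (ContinuousLinearMap.ext_on (s := Set.range (basis M)) ?_ ?_)
  · have := (basis M).dense_span
    rw [Submodule.dense_iff_topologicalClosure_eq_top]; exact this
  · rintro _ ⟨i, rfl⟩; exact h1 i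

instance : NormedAddCommGroup (HS M) := NormedAddCommGroup.induced (HS M) _ toLp toLp_injective

instance : InnerProductSpace ℂ (HS M) where
  norm_smul_le c A := by
    change ‖toLp (c • A)‖ ≤ ‖c‖ * ‖toLp A‖
    rw [map_smul]; exact norm_smul_le c _
  inner A B := ⟪toLp A, toLp B⟫_ℂ
  norm_sq_eq_re_inner A := norm_sq_eq_re_inner (𝕜 := ℂ) (toLp A)
  conj_inner_symm A B := inner_conj_symm (toLp A) (toLp B)
  add_left A B C := by rw [map_add]; exact inner_add_left _ _ _
  smul_left A B c := by rw [map_smul]; exact inner_smul_left _ _ _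

theorem inner_eq_tsum (A B : HS M) : ⟪A, B⟫_ℂ = ∑' i, ⟪op A (basis M i), op B (basis M i)⟫_ℂ :=
  lp.inner_eq_tsum (toLp A) (toLp B)

theorem hasSum_inner (A B : HS M) :
    HasSum (fun i => ⟪op A (basis M i), op B (basis M i)⟫_ℂ) ⟪A, B⟫_ℂ :=
  lp.hasSum_inner (toLp A) (toLp B)

theorem hsNorm_op (A : HS M) : hsNorm (op A) = ENNReal.ofReal ‖A‖ := by
  have h1 : HasSum (fun i => ‖op A (basis M i)‖ ^ 2) (‖A‖ ^ 2) := by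
    have := Complex.hasSum_re (hasSum_inner A A)
    convert! this using 1
    · ext i; rw [inner_self_eq_norm_sq_to_K]; norm_cast
    · rw [inner_self_eq_norm_sq_to_K]; norm_cast
  refine (ENNReal.pow_right_strictMono two_ne_zero).injective ?_
  rw [hsNorm_sq,
    ← ENNReal.ofReal_pow (norm_nonneg _), ← h1.tsum_eq,
    ENNReal.ofReal_tsum_of_nonneg (fun i => by positivity) h1.summable]
  exact tsum_congr fun i => enorm_sq_eq_ofReal _ _ rfl

theorem norm_eq (A : HS M) : ‖A‖ = (hsNorm (op A)).toReal := by
  rw [hsNorm_op, ENNReal.toReal_ofReal (norm_nonneg _)]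

theorem norm_mk (A : Op M) (h : hsNorm A < ∞) : ‖mk A h‖ = (hsNorm A).toReal := by
  rw [norm_eq, op_mk]

theorem norm_le_of_hsNorm_le {A : HS M} {c : ℝ} (hc : 0 ≤ c)
    (h : hsNorm (op A) ≤ ENNReal.ofReal c) : ‖A‖ ≤ c := by
  rwa [hsNorm_op, ENNReal.ofReal_le_ofReal_iff hc] at h

theorem norm_op_le (A : HS M) : ‖op A‖ ≤ ‖A‖ := by
  refine ContinuousLinearMap.opNorm_le_bound _ (norm_nonneg _) fun x => ?_
  have h := enorm_sq_apply_le (op A) x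
  rw [hsNorm_op, ← ofReal_norm, ← ofReal_norm,
    ← ENNReal.ofReal_mul (norm_nonneg _)] at h
  exact (ENNReal.ofReal_le_ofReal_iff (by positivity)).1 h

theorem continuous_op : Continuous (op : HS M → Op M) :=
  (LinearMap.mkContinuous op 1 fun A => by simpa using norm_op_le A).continuous

theorem hsNorm_comp_left_lt (B : Op M) (A : HS M) : hsNorm (B * op A) < ∞ :=
  (hsNorm_comp_left B (op A)).trans_lt (ENNReal.mul_lt_top enorm_lt_top A.hsNorm_op_lt_top)

theorem hsNorm_comp_right_lt (A : HS M) (B : Op M) : hsNorm (op A * B) < ∞ :=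
  (hsNorm_comp_right (op A) B).trans_lt (ENNReal.mul_lt_top A.hsNorm_op_lt_top enorm_lt_top)

/-- Composition of a Hilbert-Schmidt operator with a bounded operator on the left. -/
def lmul (B : Op M) : HS M →L[ℂ] HS M :=
  LinearMap.mkContinuous
    { toFun := fun A => mk (B * op A) (hsNorm_comp_left_lt B A)
      map_add' := fun A A' => by ext1; simp [mul_add]
      map_smul' := fun c A => by ext1; simp }
    ‖B‖ fun A => norm_le_of_hsNorm_le (by positivity) <| by
      rw [ENNReal.ofReal_mul (norm_nonneg _), ofReal_norm, ← hsNorm_op]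
      exact hsNorm_comp_left B (op A)

/-- Composition of a Hilbert-Schmidt operator with a bounded operator on the right. -/
def rmul (B : Op M) : HS M →L[ℂ] HS M :=
  LinearMap.mkContinuous
    { toFun := fun A => mk (op A * B) (hsNorm_comp_right_lt A B)
      map_add' := fun A A' => by ext1; simp [add_mul]
      map_smul' := fun c A => by ext1; simp }
    ‖B‖ fun A => norm_le_of_hsNorm_le (by positivity) <| by
      rw [ENNReal.ofReal_mul (norm_nonneg _), ofReal_norm, ← hsNorm_op, mul_comm]
      exact hsNorm_comp_right (op A) B

instance : CoeFun (HS M →L[ℂ] HS M) fun _ => HS M → HS M := ⟨fun A => DFunLike.coe A⟩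

@[simp] theorem op_lmul (B : Op M) (A : HS M) : op (lmul B A) = B * op A := rfl

@[simp] theorem op_rmul (A : HS M) (B : Op M) : op (rmul B A) = op A * B := rfl

theorem norm_lmul_le (B : Op M) (A : HS M) : ‖lmul B A‖ ≤ ‖B‖ * ‖A‖ :=
  ((lmul B).le_opNorm A).trans <| by
    gcongr; exact LinearMap.mkContinuous_norm_le _ (norm_nonneg _) _

theorem norm_rmul_le (B : Op M) (A : HS M) : ‖rmul B A‖ ≤ ‖A‖ * ‖B‖ := by
  rw [mul_comm]
  exact ((rmul B).le_opNorm A).trans <| by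
    gcongr; exact LinearMap.mkContinuous_norm_le _ (norm_nonneg _) _

theorem lmul_sub (B B' : Op M) (A : HS M) : lmul (B - B') A = lmul B A - lmul B' A := by
  ext1; simp [sub_mul]

theorem rmul_sub (B B' : Op M) (A : HS M) : rmul (B - B') A = rmul B A - rmul B' A := by
  ext1; simp [mul_sub]

/-- The adjoint of a Hilbert-Schmidt operator. -/
def adj (A : HS M) : HS M := mk (star (op A)) (by
  rw [ContinuousLinearMap.star_eq_adjoint, hsNorm_adjoint]; exact A.hsNorm_op_lt_top)

@[simp] theorem op_adj (A : HS M) : op (adj A) = star (op A) := rfl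

theorem adj_add (A B : HS M) : adj (A + B) = adj A + adj B := by ext1; simp

@[simp] theorem norm_adj (A : HS M) : ‖adj A‖ = ‖A‖ := by
  rw [norm_eq, norm_eq, op_adj, ContinuousLinearMap.star_eq_adjoint, hsNorm_adjoint]

theorem continuous_adj : Continuous (adj : HS M → HS M) :=
  (AddMonoidHomClass.isometry_of_norm
    (AddMonoidHom.mk' (adj : HS M → HS M) adj_add) norm_adj).continuous

/-- Polarisation of `norm_adj`: the norm identities for `A + B` and `A + iB` give the sum and the
difference of the two mixed inner products. -/
theorem inner_adj (A B : HS M) : ⟪adj A, adj B⟫_ℂ = ⟪B, A⟫_ℂ := by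
  have h : ∀ A : HS M, (⟪adj A, adj A⟫_ℂ : ℂ) = ⟪A, A⟫_ℂ := fun A => by
    rw [inner_self_eq_norm_sq_to_K, inner_self_eq_norm_sq_to_K, norm_adj]
  have h1 := h (A + B)
  have h2 := h (A + Complex.I • B)
  have h3 := h A
  have h4 := h B
  have h5 : adj (A + Complex.I • B) = adj A - Complex.I • adj B := by
    ext1; simp [sub_eq_add_neg]
  rw [adj_add] at h1
  rw [h5] at h2
  simp only [inner_add_left, inner_add_right, inner_sub_left, inner_sub_right, inner_smul_left,
    inner_smul_right, Complex.conj_I] at h1 h2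
  have e1 : (⟪adj A, adj B⟫_ℂ : ℂ) + ⟪adj B, adj A⟫_ℂ = ⟪A, B⟫_ℂ + ⟪B, A⟫_ℂ := by
    linear_combination h1 - h3 - h4
  have e2 : (⟪adj A, adj B⟫_ℂ : ℂ) - ⟪adj B, adj A⟫_ℂ = ⟪B, A⟫_ℂ - ⟪A, B⟫_ℂ := by
    linear_combination Complex.I * h2 - Complex.I * h3 +
      (⟪adj A, adj B⟫_ℂ - ⟪adj B, adj A⟫_ℂ + ⟪A, B⟫_ℂ - ⟪B, A⟫_ℂ
        + Complex.I * (⟪adj B, adj B⟫_ℂ - ⟪B, B⟫_ℂ)) * Complex.I_mul_I - Complex.I * h4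
  linear_combination (e1 + e2) / 2

theorem inner_lmul (B : Op M) (A C : HS M) : ⟪A, lmul B C⟫_ℂ = ⟪lmul (star B) A, C⟫_ℂ := by
  rw [inner_eq_tsum, inner_eq_tsum]
  refine tsum_congr fun i => ?_
  rw [op_lmul, op_lmul, mul_apply_eq_comp, mul_apply_eq_comp,
    ContinuousLinearMap.star_eq_adjoint, ContinuousLinearMap.adjoint_inner_left]

theorem inner_rmul (B : Op M) (A C : HS M) : ⟪A, rmul B C⟫_ℂ = ⟪rmul (star B) A, C⟫_ℂ := by
  have h : ∀ (D : HS M) (B : Op M), adj (rmul B D) = lmul (star B) (adj D) := fun D B => by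
    ext1; simp
  have h1 : adj (rmul (star B) A) = lmul B (adj A) := by rw [h, star_star]
  rw [← inner_adj (rmul B C) A, h, ← inner_adj C, h1, inner_lmul]

end HS

end HilbertSchmidt

/-! ### Splitting a selfadjoint operator into a difference of two squares with disjoint supports. -/

section SelfAdjointDecomposition

variable {E : Type*} [NormedAddCommGroup E] [InnerProductSpace ℂ E] [CompleteSpace E]

/-- `S` and `T` are the square roots of the positive and the negative part, whose product vanishes.
-/
theorem exists_selfAdjoint_sq_sub_sq (A : E →L[ℂ] E) (hA : IsSelfAdjoint A) :
    ∃ S T : E →L[ℂ] E, IsSelfAdjoint S ∧ IsSelfAdjoint T ∧ A = S * S - T * T ∧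
      (S * S) * (T * T) = 0 := by
  refine ⟨CFC.sqrt A⁺, CFC.sqrt A⁻, (CFC.sqrt_nonneg _).isSelfAdjoint,
    (CFC.sqrt_nonneg _).isSelfAdjoint, ?_, ?_⟩
  · rw [CFC.sqrt_mul_sqrt_self _ (CFC.posPart_nonneg A),
      CFC.sqrt_mul_sqrt_self _ (CFC.negPart_nonneg A), CFC.posPart_sub_negPart A hA]
  · rw [CFC.sqrt_mul_sqrt_self _ (CFC.posPart_nonneg A),
      CFC.sqrt_mul_sqrt_self _ (CFC.negPart_nonneg A), CFC.posPart_mul_negPart]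

/-- A basis of `K` is extended to the whole space; the added vectors are orthogonal to the old ones
and hence to `K`. -/
theorem exists_hilbertBasis_adapted (K : Submodule ℂ E) [CompleteSpace K] :
    ∃ (w : Set E) (b : HilbertBasis w ℂ E), ∀ i, b i ∈ K ∨ b i ∈ Kᗮ := by
  obtain ⟨s, c, hc⟩ := exists_hilbertBasis ℂ K
  have hs : Orthonormal ℂ (Subtype.val : ((↑) '' s : Set E) → E) := by
    have h1 : Orthonormal ℂ (fun i : s => ((c i : K) : E)) :=
      c.orthonormal.comp_linearIsometry K.subtypeₗᵢ
    have h2 := h1.toSubtypeRange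
    have h3 : Set.range (fun i : s => ((c i : K) : E)) = (↑) '' s := by
      ext x; simp [hc]
    rw [h3] at h2
    exact h2
  obtain ⟨w, b, hsw, hb⟩ := hs.exists_hilbertBasis_extension
  refine ⟨w, b, fun i => ?_⟩
  by_cases h : (i : E) ∈ ((↑) '' s : Set E)
  · obtain ⟨y, _, hy⟩ := h
    left; rw [hb]; rw [← hy]; exact y.2
  · right
    rw [hb, Submodule.mem_orthogonal]
    intro u hu
    have h1 : ∀ j : s, ⟪((c j : K) : E), (i : E)⟫_ℂ = 0 := fun j => by
      have hmem : ((c j : K) : E) ∈ ((↑) '' s : Set E) := ⟨c j, by rw [hc]; exact j.2, rfl⟩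
      have h2 := b.orthonormal.2 (i := ⟨_, hsw hmem⟩) (j := i)
        (fun h' => h (by rw [← h']; exact hmem))
      rwa [hb] at h2
    have h2 := (c.hasSum_repr ⟨u, hu⟩).mapL K.subtypeL
    have h3 := h2.mapL (innerSL ℂ (i : E))
    have h4 : ⟪(i : E), u⟫_ℂ = 0 := by
      refine h3.unique ?_
      convert! hasSum_zero using 1
      ext j
      simp [inner_smul_right]
      right
      rw [← inner_conj_symm, h1, map_zero]
    rw [← inner_conj_symm, h4, map_zero]

end SelfAdjointDecomposition

/-! ### Trace class operators through squares of Hilbert-Schmidt operators; the trace. -/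

section TraceClass

variable {M : ℕ}

theorem enorm_inner_self (x : H M) : ‖⟪x, x⟫_ℂ‖ₑ = ‖x‖ₑ ^ 2 := by
  rw [← ofReal_norm, ← ofReal_norm, ← ENNReal.ofReal_pow (norm_nonneg _),
    inner_self_eq_norm_sq_to_K]
  congr 1; simp

theorem sum_enorm_inner_le_traceNorm (A : Op M) {ι : Type*} (s : Finset ι) (e f : ι → H M)
    (he : Orthonormal ℂ e) (hf : Orthonormal ℂ f) :
    ∑ i ∈ s, ‖⟪e i, A (f i)⟫_ℂ‖ₑ ≤ traceNorm A := by
  have h := le_iSup_of_le (α := ℝ≥0∞) (a := ∑ i ∈ s, ‖⟪e i, A (f i)⟫_ℂ‖ₑ)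
    (f := fun n : ℕ => ⨆ (e : Fin n → H M) (f : Fin n → H M) (_ : Orthonormal ℂ e)
      (_ : Orthonormal ℂ f), ∑ i, ‖⟪e i, A (f i)⟫_ℂ‖ₑ) s.card
  refine h ?_
  refine le_iSup₂_of_le (fun k => e (s.equivFin.symm k)) (fun k => f (s.equivFin.symm k)) ?_
  refine le_iSup₂_of_le (he.comp _ ?_) (hf.comp _ ?_) ?_
  · exact Subtype.val_injective.comp s.equivFin.symm.injective
  · exact Subtype.val_injective.comp s.equivFin.symm.injective
  · rw [← Finset.sum_coe_sort]
    exact (Equiv.sum_comp s.equivFin.symm (fun i : s => ‖⟪e i, A (f i)⟫_ℂ‖ₑ)).ge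

theorem traceNorm_le {A : Op M} {c : ℝ≥0∞}
    (h : ∀ (n : ℕ) (e f : Fin n → H M), Orthonormal ℂ e → Orthonormal ℂ f →
      ∑ i, ‖⟪e i, A (f i)⟫_ℂ‖ₑ ≤ c) : traceNorm A ≤ c :=
  iSup_le fun n => iSup₂_le fun e f => iSup₂_le fun he hf => h n e f he hf

theorem traceNorm_add (A B : Op M) : traceNorm (A + B) ≤ traceNorm A + traceNorm B := by
  refine traceNorm_le fun n e f he hf => ?_
  refine le_trans ?_ (add_le_add (sum_enorm_inner_le_traceNorm A Finset.univ e f he hf)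
    (sum_enorm_inner_le_traceNorm B Finset.univ e f he hf))
  rw [← Finset.sum_add_distrib]
  gcongr with i
  rw [_root_.add_apply, inner_add_right]
  exact enorm_add_le _ _

theorem traceNorm_smul (c : ℂ) (A : Op M) : traceNorm (c • A) ≤ ‖c‖ₑ * traceNorm A := by
  refine traceNorm_le fun n e f he hf => ?_
  refine le_trans (le_of_eq ?_) (mul_le_mul_right
    (sum_enorm_inner_le_traceNorm A Finset.univ e f he hf) _)
  rw [Finset.mul_sum]
  refine Finset.sum_congr rfl fun i _ => ?_
  rw [_root_.smul_apply, inner_smul_right, enorm_mul]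

theorem traceNorm_neg (A : Op M) : traceNorm (-A) = traceNorm A := by
  simp [traceNorm]

theorem traceNorm_sub (A B : Op M) : traceNorm (A - B) ≤ traceNorm A + traceNorm B := by
  rw [sub_eq_add_neg, ← traceNorm_neg B]; exact traceNorm_add _ _

theorem traceNorm_star (A : Op M) : traceNorm (star A) ≤ traceNorm A := by
  refine traceNorm_le fun n e f he hf => ?_
  refine le_trans (le_of_eq ?_) (sum_enorm_inner_le_traceNorm A Finset.univ f e hf he)
  refine Finset.sum_congr rfl fun i _ => ?_
  rw [ContinuousLinearMap.star_eq_adjoint, ContinuousLinearMap.adjoint_inner_right,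
    ← inner_conj_symm, RCLike.enorm_conj]

/-- In a basis adapted to `ker T²` the diagonal of `A` dominates that of `S²`: on the kernel `A`
acts as `S²`, and on its complement `S` vanishes. This replaces the spectral theorem for compact
operators. -/
theorem hsNorm_sq_le_traceNorm {A S T : Op M} (hS : IsSelfAdjoint S)
    (hA : A = S * S - T * T) (hT : IsSelfAdjoint T) (hST : (S * S) * (T * T) = 0) :
    hsNorm S ^ 2 ≤ traceNorm A := by
  have hS' : ∀ x y, ⟪S x, y⟫_ℂ = ⟪x, S y⟫_ℂ := fun x y => by
    rw [← ContinuousLinearMap.adjoint_inner_right, ← ContinuousLinearMap.star_eq_adjoint,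
      hS.star_eq]
  have hTS : (T * T) * (S * S) = 0 := by
    have := congrArg star hST
    simpa only [star_mul, star_zero, hS.star_eq, hT.star_eq, mul_assoc] using this
  let K : Submodule ℂ (H M) := LinearMap.ker (T * T : Op M).toLinearMap
  have : CompleteSpace K := (ContinuousLinearMap.isClosed_ker (T * T)).completeSpace_coe
  obtain ⟨w, b, hb⟩ := exists_hilbertBasis_adapted K
  rw [hsNorm_sq_eq_of_basis b, ENNReal.tsum_eq_iSup_sum]
  refine iSup_le fun F => ?_
  refine le_trans ?_ (sum_enorm_inner_le_traceNorm A F b b b.orthonormal b.orthonormal)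
  gcongr with i
  rcases hb i with h | h
  · have h1 : (T * T) (b i) = 0 := h
    have h2 : ⟪b i, A (b i)⟫_ℂ = ⟪S (b i), S (b i)⟫_ℂ := by
      rw [hA, _root_.sub_apply, h1, sub_zero, hS', mul_apply_eq_comp]
    rw [h2, enorm_inner_self]
  -- `T² S² = 0` puts `S² b_i` into the kernel of `T²`, to which `b_i` is orthogonal, so `‖S b_i‖² =
  -- ⟨b_i, S² b_i⟩ = 0`.
  · have h1 : S (b i) = 0 := by
      rw [← inner_self_eq_zero (𝕜 := ℂ), hS']
      have h3 : (S * S) (b i) ∈ K := by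
        change (T * T) ((S * S) (b i)) = 0
        rw [← mul_apply_eq_comp, hTS]; rfl
      rw [← inner_conj_symm]
      have := (Submodule.mem_orthogonal _ _).1 h _ h3
      rw [mul_apply_eq_comp] at this
      rw [this, map_zero]
    simp [h1]

theorem exists_hs_sq_of_selfAdjoint {A : Op M} (hA : IsSelfAdjoint A) (h : traceNorm A < ∞) :
    ∃ S T : HS M, star (HS.op S) = HS.op S ∧ star (HS.op T) = HS.op T ∧
      A = HS.op S * HS.op S - HS.op T * HS.op T ∧
      ‖S‖ ^ 2 ≤ (traceNorm A).toReal ∧ ‖T‖ ^ 2 ≤ (traceNorm A).toReal := by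
  obtain ⟨S, T, hS, hT, hA', hST⟩ := exists_selfAdjoint_sq_sub_sq A hA
  have hTS : (T * T) * (S * S) = 0 := by
    have := congrArg star hST
    simpa only [star_mul, star_zero, hS.star_eq, hT.star_eq, mul_assoc] using this
  have h1 := hsNorm_sq_le_traceNorm hS hA' hT hST
  have h2 := hsNorm_sq_le_traceNorm (A := -A) hT (by rw [hA']; abel) hS hTS
  rw [traceNorm_neg] at h2
  have f1 : hsNorm S < ∞ := by
    by_contra hc
    rw [not_lt, top_le_iff] at hc
    rw [hc] at h1; simp at h1; exact h.ne h1
  have f2 : hsNorm T < ∞ := by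
    by_contra hc
    rw [not_lt, top_le_iff] at hc
    rw [hc] at h2; simp at h2; exact h.ne h2
  refine ⟨HS.mk S f1, HS.mk T f2, hS.star_eq, hT.star_eq, hA', ?_, ?_⟩
  · rw [HS.norm_mk, ← ENNReal.toReal_pow]; exact ENNReal.toReal_mono h.ne h1
  · rw [HS.norm_mk, ← ENNReal.toReal_pow]; exact ENNReal.toReal_mono h.ne h2

/-- A trace class operator is a combination of four squares of selfadjoint Hilbert-Schmidt
operators. -/
theorem exists_hs_sq {A : Op M} (h : traceNorm A < ∞) :
    ∃ (S : Fin 4 → HS M) (c : Fin 4 → ℂ), (∀ k, star (HS.op (S k)) = HS.op (S k)) ∧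
      A = ∑ k, c k • (HS.op (S k) * HS.op (S k)) ∧ (∀ k, ‖c k‖ = 1) ∧
      ∀ k, ‖S k‖ ^ 2 ≤ (traceNorm A).toReal := by
  set R : Op M := (1 / 2 : ℂ) • (A + star A) with hR
  set J : Op M := (-Complex.I / 2 : ℂ) • (A - star A) with hJ
  have hRs : IsSelfAdjoint R := by
    rw [isSelfAdjoint_iff, hR, star_smul, star_add, star_star, add_comm]; simp
  have hJs : IsSelfAdjoint J := by
    rw [isSelfAdjoint_iff, hJ, star_smul, star_sub, star_star, ← neg_sub A, smul_neg, ← neg_smul]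
    congr 1; simp; ring
  have half : ‖(1 / 2 : ℂ)‖ₑ = 1 / 2 := by
    rw [← ofReal_norm, show ‖(1 / 2 : ℂ)‖ = (2 : ℝ)⁻¹ by norm_num,
      ENNReal.ofReal_inv_of_pos (by norm_num)]
    simp
  have half' : ‖(-Complex.I / 2 : ℂ)‖ₑ = 1 / 2 := by
    rw [← half, ← ofReal_norm, ← ofReal_norm]; congr 1; simp
  have key : ∀ x : ℝ≥0∞, (1 / 2 : ℝ≥0∞) * (x + x) = x := fun x => by
    rw [← two_mul, ← mul_assoc, one_div, ENNReal.inv_mul_cancel (by simp) (by simp), one_mul]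
  have hRn : traceNorm R ≤ traceNorm A := by
    refine (traceNorm_smul _ _).trans ?_
    rw [half]
    refine (mul_le_mul_right ((traceNorm_add _ _).trans
      (add_le_add_right (traceNorm_star A) _)) _).trans (key _).le
  have hJn : traceNorm J ≤ traceNorm A := by
    refine (traceNorm_smul _ _).trans ?_
    rw [half']
    refine (mul_le_mul_right ((traceNorm_sub _ _).trans
      (add_le_add_right (traceNorm_star A) _)) _).trans (key _).le
  obtain ⟨S₁, T₁, a1, a2, a3, a4, a5⟩ := exists_hs_sq_of_selfAdjoint hRs (hRn.trans_lt h)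
  obtain ⟨S₂, T₂, b1, b2, b3, b4, b5⟩ := exists_hs_sq_of_selfAdjoint hJs (hJn.trans_lt h)
  have r1 := ENNReal.toReal_mono h.ne hRn
  have r2 := ENNReal.toReal_mono h.ne hJn
  refine ⟨![S₁, T₁, S₂, T₂], ![1, -1, Complex.I, -Complex.I], ?_, ?_, ?_, ?_⟩
  · intro k; fin_cases k <;> assumption
  · have e1 : A = R + Complex.I • J := by
      rw [hR, hJ, smul_smul]
      have : Complex.I * (-Complex.I / 2) = 1 / 2 := by
        linear_combination (-1 / 2 : ℂ) * Complex.I_mul_I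
      rw [this, ← smul_add, add_add_sub_cancel, ← two_smul ℂ A, smul_smul]; norm_num
    rw [Fin.sum_univ_four, e1, a3, b3]
    simp [smul_sub, sub_eq_add_neg, add_assoc]
  · intro k; fin_cases k <;> simp
  · intro k; fin_cases k <;> simp <;> linarith

/-- Bessel's inequality applied to the vectors `A* b_j`, so that the orthonormal system need not be
part of a basis. -/
theorem sum_norm_sq_le (A : HS M) {n : ℕ} (e : Fin n → H M) (he : Orthonormal ℂ e) :
    ∑ i, ‖HS.op A (e i)‖ ^ 2 ≤ ‖A‖ ^ 2 := by
  have h1 : ∑ i, ‖HS.op A (e i)‖ₑ ^ 2 ≤ hsNorm (HS.op A) ^ 2 := by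
    rw [← hsNorm_adjoint, hsNorm_sq]
    calc ∑ i, ‖HS.op A (e i)‖ₑ ^ 2 = ∑ i, ∑' j, ‖⟪basis M j, HS.op A (e i)⟫_ℂ‖ₑ ^ 2 :=
          Finset.sum_congr rfl fun i _ => (parseval_enorm _ _).symm
      _ = ∑' j, ∑ i, ‖⟪basis M j, HS.op A (e i)⟫_ℂ‖ₑ ^ 2 :=
          (Summable.tsum_finsetSum fun i _ => ENNReal.summable).symm
      _ ≤ _ := by
          refine ENNReal.tsum_le_tsum fun j => ?_
          have := he.sum_inner_products_le (s := Finset.univ)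
            (ContinuousLinearMap.adjoint (HS.op A) (basis M j))
          have := ENNReal.ofReal_le_ofReal this
          rw [ENNReal.ofReal_sum_of_nonneg (fun i _ => by positivity),
            ENNReal.ofReal_pow (norm_nonneg _), ofReal_norm] at this
          refine le_trans (le_of_eq (Finset.sum_congr rfl fun i _ => ?_)) this
          rw [ENNReal.ofReal_pow (norm_nonneg _), ofReal_norm, ← inner_conj_symm,
            RCLike.enorm_conj, ContinuousLinearMap.adjoint_inner_right]
  rw [HS.hsNorm_op, ← ENNReal.ofReal_pow (norm_nonneg _)] at h1
  have h2 : ∑ i, ‖HS.op A (e i)‖ₑ ^ 2 = ENNReal.ofReal (∑ i, ‖HS.op A (e i)‖ ^ 2) := by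
    rw [ENNReal.ofReal_sum_of_nonneg (fun i _ => by positivity)]
    exact Finset.sum_congr rfl fun i _ => enorm_sq_eq_ofReal _ _ rfl
  rw [h2] at h1
  exact (ENNReal.ofReal_le_ofReal_iff (by positivity)).1 h1

/-- Cauchy-Schwarz for `⟨S* e_i, T f_i⟩`, first in the Hilbert space and then in the sum over `i`.
-/
theorem traceNorm_mul_le (S T : HS M) :
    traceNorm (HS.op S * HS.op T) ≤ ENNReal.ofReal (‖S‖ * ‖T‖) := by
  refine traceNorm_le fun n e f he hf => ?_
  have h2 : ∑ i, ‖⟪e i, (HS.op S * HS.op T) (f i)⟫_ℂ‖ₑ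
      = ENNReal.ofReal (∑ i, ‖⟪e i, (HS.op S * HS.op T) (f i)⟫_ℂ‖) := by
    rw [ENNReal.ofReal_sum_of_nonneg (fun i _ => by positivity)]
    exact Finset.sum_congr rfl fun i _ => (ofReal_norm _).symm
  rw [h2]
  refine ENNReal.ofReal_le_ofReal ?_
  have h3 : ∑ i, ‖⟪e i, (HS.op S * HS.op T) (f i)⟫_ℂ‖
      ≤ ∑ i, ‖HS.op (HS.adj S) (e i)‖ * ‖HS.op T (f i)‖ := by
    gcongr with i
    rw [mul_apply_eq_comp, ← ContinuousLinearMap.adjoint_inner_left]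
    exact norm_inner_le_norm _ _
  refine h3.trans ?_
  have h5 := sum_norm_sq_le (HS.adj S) e he
  have h6 := sum_norm_sq_le T f hf
  rw [HS.norm_adj] at h5
  exact (Real.sum_mul_le_sqrt_mul_sqrt _ _ _).trans
    (mul_le_mul (Real.sqrt_le_iff.2 ⟨norm_nonneg _, h5⟩) (Real.sqrt_le_iff.2 ⟨norm_nonneg _, h6⟩)
      (Real.sqrt_nonneg _) (norm_nonneg _))

theorem traceNorm_sum_le {ι : Type*} (s : Finset ι) (A : ι → Op M) :
    traceNorm (∑ i ∈ s, A i) ≤ ∑ i ∈ s, traceNorm (A i) := by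
  classical
  induction s using Finset.induction_on with
  | empty => simp [traceNorm]
  | insert i s hi ih =>
    rw [Finset.sum_insert hi, Finset.sum_insert hi]
    exact (traceNorm_add _ _).trans (add_le_add_right ih _)

/-- Each of the four squares of `exists_hs_sq` factors as `(B S)(S C)`. The constant 4 counts the
squares; it is not sharp, and it only enters where finiteness or continuity is at stake. -/
theorem traceNorm_mul_mul_le {A : Op M} (h : traceNorm A < ∞) (B C : Op M) :
    traceNorm (B * A * C) ≤ ENNReal.ofReal (4 * ‖B‖ * ‖C‖ * (traceNorm A).toReal) := by
  obtain ⟨S, c, -, hA, hc, hn⟩ := exists_hs_sq h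
  have h1 : B * A * C = ∑ k, c k • (HS.op (HS.lmul B (S k)) * HS.op (HS.rmul C (S k))) := by
    nth_rewrite 1 [hA]
    rw [Finset.mul_sum, Finset.sum_mul]
    refine Finset.sum_congr rfl fun k _ => ?_
    simp [mul_assoc]
  rw [h1]
  refine (traceNorm_sum_le _ _).trans ?_
  have h2 : ∀ k, traceNorm (c k • (HS.op (HS.lmul B (S k)) * HS.op (HS.rmul C (S k))))
      ≤ ENNReal.ofReal (‖B‖ * ‖C‖ * (traceNorm A).toReal) := fun k => by
    refine (traceNorm_smul _ _).trans ?_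
    rw [← ofReal_norm, hc, ENNReal.ofReal_one, one_mul]
    refine (traceNorm_mul_le _ _).trans (ENNReal.ofReal_le_ofReal ?_)
    calc _ ≤ (‖B‖ * ‖S k‖) * (‖S k‖ * ‖C‖) := by
          gcongr
          · exact HS.norm_lmul_le _ _
          · exact HS.norm_rmul_le _ _
      _ = ‖B‖ * ‖C‖ * ‖S k‖ ^ 2 := by ring
      _ ≤ _ := by gcongr; exact hn k
  refine (Finset.sum_le_sum fun k _ => h2 k).trans (le_of_eq ?_)
  rw [Finset.sum_const, nsmul_eq_mul, Finset.card_univ, Fintype.card_fin,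
    show 4 * ‖B‖ * ‖C‖ * (traceNorm A).toReal = 4 * (‖B‖ * ‖C‖ * (traceNorm A).toReal) by ring,
    ENNReal.ofReal_mul (p := 4) (by norm_num)]
  norm_num

theorem hsNorm_le_traceNorm {A : Op M} (h : traceNorm A < ∞) :
    hsNorm A ≤ ENNReal.ofReal (4 * (traceNorm A).toReal) := by
  obtain ⟨S, c, -, hA, hc, hn⟩ := exists_hs_sq h
  have h1 : A = HS.op (∑ k, c k • HS.lmul (HS.op (S k)) (S k)) := by
    rw [map_sum]; nth_rewrite 1 [hA]; simp
  nth_rewrite 1 [h1]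
  rw [HS.hsNorm_op]
  refine ENNReal.ofReal_le_ofReal ((norm_sum_le _ _).trans ?_)
  have h2 : ∀ k, ‖c k • HS.lmul (HS.op (S k)) (S k)‖ ≤ (traceNorm A).toReal := fun k => by
    rw [norm_smul, hc, one_mul]
    refine (HS.norm_lmul_le _ _).trans (le_trans ?_ (hn k))
    rw [sq]; gcongr; exact HS.norm_op_le _
  refine (Finset.sum_le_sum fun k _ => h2 k).trans (le_of_eq ?_)
  simp

theorem hasSum_trace_mul (S T : HS M) :
    HasSum (fun i => ⟪basis M i, (HS.op S * HS.op T) (basis M i)⟫_ℂ) ⟪HS.adj S, T⟫_ℂ := by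
  convert! HS.hasSum_inner (HS.adj S) T using 1
  ext i
  rw [mul_apply_eq_comp, HS.op_adj, ContinuousLinearMap.star_eq_adjoint,
    ContinuousLinearMap.adjoint_inner_left]

theorem trace_mul (S T : HS M) : trace (HS.op S * HS.op T) = ⟪HS.adj S, T⟫_ℂ :=
  (hasSum_trace_mul S T).tsum_eq

theorem summable_trace {A : Op M} (h : traceNorm A < ∞) :
    Summable fun i => ⟪basis M i, A (basis M i)⟫_ℂ := by
  obtain ⟨S, c, -, hA, hc, hn⟩ := exists_hs_sq h
  rw [hA]
  have : Summable fun i => ∑ k, c k • ⟪basis M i, (HS.op (S k) * HS.op (S k)) (basis M i)⟫_ℂ :=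
    summable_sum fun k _ => (hasSum_trace_mul (S k) (S k)).summable.const_smul _
  convert! this using 2 with i
  simp [inner_sum, inner_smul_right]

theorem trace_add {A B : Op M} (hA : traceNorm A < ∞) (hB : traceNorm B < ∞) :
    trace (A + B) = trace A + trace B := by
  rw [trace, trace, trace, ← (summable_trace hA).tsum_add (summable_trace hB)]
  simp [inner_add_right]

theorem trace_sub {A B : Op M} (hA : traceNorm A < ∞) (hB : traceNorm B < ∞) :
    trace (A - B) = trace A - trace B := by
  rw [trace, trace, trace, ← (summable_trace hA).tsum_sub (summable_trace hB)]
  simp [inner_sub_right]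

theorem norm_trace_le {A : Op M} (hA : traceNorm A < ∞) : ‖trace A‖ ≤ (traceNorm A).toReal := by
  rw [← ENNReal.ofReal_le_ofReal_iff ENNReal.toReal_nonneg, ENNReal.ofReal_toReal hA.ne,
    ofReal_norm, trace]
  refine (enorm_tsum_le_tsum_enorm).trans ?_
  rw [ENNReal.tsum_eq_iSup_sum]
  exact iSup_le fun F => sum_enorm_inner_le_traceNorm A F _ _ (basis M).orthonormal
    (basis M).orthonormal

/-- Isometries map orthonormal systems to orthonormal systems, so every competitor on the left is
one on the right. -/
theorem traceNorm_unitary_le {U V : Op M} (hU : ∀ x, ‖U x‖ = ‖x‖) (hV : ∀ x, ‖V x‖ = ‖x‖)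
    (A : Op M) : traceNorm (star U * A * V) ≤ traceNorm A := by
  refine traceNorm_le fun n e f he hf => ?_
  have h1 := he.comp_linearIsometry ⟨U.toLinearMap, hU⟩
  have h2 := hf.comp_linearIsometry ⟨V.toLinearMap, hV⟩
  refine le_trans (le_of_eq ?_) (sum_enorm_inner_le_traceNorm A Finset.univ _ _ h1 h2)
  refine Finset.sum_congr rfl fun i _ => ?_
  rw [mul_apply_eq_comp, mul_apply_eq_comp, ContinuousLinearMap.star_eq_adjoint,
    ContinuousLinearMap.adjoint_inner_right]
  rfl

end TraceClass

/-! ### Operator-valued integrals in the weak sense, and norm bounds for them. -/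

section WeakIntegral

variable {M : ℕ} {Q : Type*} [MeasurableSpace Q] {μ : Measure Q}

/-- `B = ∫ Φ dμ` in the weak sense. -/
def IsWeakIntegral (μ : Measure Q) (Φ : Q → Op M) (B : Op M) : Prop :=
  ∀ f g, Integrable (fun q => ⟪f, Φ q g⟫_ℂ) μ ∧ ⟪f, B g⟫_ℂ = ∫ q, ⟪f, Φ q g⟫_ℂ ∂μ

namespace IsWeakIntegral

variable {Φ Ψ : Q → Op M} {B B' : Op M}

theorem unique (h : IsWeakIntegral μ Φ B) (h' : IsWeakIntegral μ Φ B') : B = B' := by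
  ext1 g
  refine ext_inner_left ℂ fun f => ?_
  rw [(h f g).2, (h' f g).2]

theorem congr (h : IsWeakIntegral μ Φ B) (hΦ : ∀ q, Φ q = Ψ q) : IsWeakIntegral μ Ψ B := by
  rwa [funext hΦ] at h

theorem add (h : IsWeakIntegral μ Φ B) (h' : IsWeakIntegral μ Ψ B') :
    IsWeakIntegral μ (fun q => Φ q + Ψ q) (B + B') := fun f g => by
  have e : (fun q => ⟪f, (Φ q + Ψ q) g⟫_ℂ) = fun q => ⟪f, Φ q g⟫_ℂ + ⟪f, Ψ q g⟫_ℂ := by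
    ext q; rw [_root_.add_apply, inner_add_right]
  refine ⟨by rw [e]; exact (h f g).1.add (h' f g).1, ?_⟩
  rw [e, integral_add (h f g).1 (h' f g).1, _root_.add_apply, inner_add_right, (h f g).2,
    (h' f g).2]

theorem smul (h : IsWeakIntegral μ Φ B) (c : ℂ) :
    IsWeakIntegral μ (fun q => c • Φ q) (c • B) := fun f g => by
  have e : (fun q => ⟪f, (c • Φ q) g⟫_ℂ) = fun q => c * ⟪f, Φ q g⟫_ℂ := by
    ext q; rw [_root_.smul_apply, inner_smul_right]
  refine ⟨by rw [e]; exact (h f g).1.const_mul c, ?_⟩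
  rw [e, integral_const_mul, _root_.smul_apply, inner_smul_right, (h f g).2]

theorem neg (h : IsWeakIntegral μ Φ B) : IsWeakIntegral μ (fun q => -Φ q) (-B) := by
  simpa using h.smul (-1)

theorem sub (h : IsWeakIntegral μ Φ B) (h' : IsWeakIntegral μ Ψ B') :
    IsWeakIntegral μ (fun q => Φ q - Ψ q) (B - B') := by
  simpa only [sub_eq_add_neg] using h.add h'.neg

theorem mul_mul (h : IsWeakIntegral μ Φ B) (L R : Op M) :
    IsWeakIntegral μ (fun q => L * Φ q * R) (L * B * R) := fun f g => by
  have e : ∀ A : Op M, ⟪f, (L * A * R) g⟫_ℂ = ⟪star L f, A (R g)⟫_ℂ := fun A => by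
    rw [mul_apply_eq_comp, mul_apply_eq_comp, ContinuousLinearMap.star_eq_adjoint,
      ContinuousLinearMap.adjoint_inner_left]
  simp only [e]
  exact h _ _

theorem mul_left (h : IsWeakIntegral μ Φ B) (L : Op M) :
    IsWeakIntegral μ (fun q => L * Φ q) (L * B) := by
  simpa using h.mul_mul L 1

theorem mul_right (h : IsWeakIntegral μ Φ B) (R : Op M) :
    IsWeakIntegral μ (fun q => Φ q * R) (B * R) := by
  simpa using h.mul_mul 1 R

theorem star (h : IsWeakIntegral μ Φ B) :
    IsWeakIntegral μ (fun q => star (Φ q)) (star B) := fun f g => by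
  have e : ∀ A : Op M, ⟪f, (Star.star A) g⟫_ℂ = (starRingEnd ℂ) ⟪g, A f⟫_ℂ := fun A => by
    rw [ContinuousLinearMap.star_eq_adjoint, ContinuousLinearMap.adjoint_inner_right,
      inner_conj_symm]
  simp only [e]
  refine ⟨(RCLike.conjCLE (K := ℂ)).toContinuousLinearMap.integrable_comp (h g f).1, ?_⟩
  rw [(h g f).2]; exact integral_conj.symm

/-- Duality with `B` itself: on finitely many basis vectors, `∑ ‖B e_i‖²` is the integral of `∑ ⟨B
e_i, Φ(q) e_i⟩`, which Cauchy-Schwarz bounds by its own square root times `∫ c`. No measurability of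
`Φ` in Hilbert-Schmidt norm is needed, only a majorant. -/
theorem hsNorm_le (h : IsWeakIntegral μ Φ B) {c : Q → ℝ} (hc : Integrable c μ)
    (hc0 : ∀ q, 0 ≤ c q) (hΦ : ∀ q, hsNorm (Φ q) ≤ ENNReal.ofReal (c q)) :
    hsNorm B ≤ ENNReal.ofReal (∫ q, c q ∂μ) := by
  have hI : 0 ≤ ∫ q, c q ∂μ := integral_nonneg hc0
  refine hsNorm_le_of_sq_le ?_
  rw [ENNReal.tsum_eq_iSup_sum, ← ENNReal.ofReal_pow hI]
  refine iSup_le fun F => ?_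
  set n2 : ℝ := ∑ i ∈ F, ‖B (basis M i)‖ ^ 2 with hn2
  have h0 : 0 ≤ n2 := by positivity
  have h1 : ∑ i ∈ F, ‖B (basis M i)‖ₑ ^ 2 = ENNReal.ofReal n2 := by
    rw [hn2, ENNReal.ofReal_sum_of_nonneg (fun i _ => by positivity)]
    exact Finset.sum_congr rfl fun i _ => enorm_sq_eq_ofReal _ _ rfl
  rw [h1]
  refine ENNReal.ofReal_le_ofReal ?_
  have hq : ∀ q, ∑ i ∈ F, ‖⟪B (basis M i), Φ q (basis M i)⟫_ℂ‖ ≤ √n2 * c q := fun q => by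
    have hfin : hsNorm (Φ q) < ∞ := (hΦ q).trans_lt ENNReal.ofReal_lt_top
    have e1 : ∑ i ∈ F, ‖Φ q (basis M i)‖ ^ 2 ≤ c q ^ 2 := by
      rw [← ENNReal.ofReal_le_ofReal_iff (by positivity),
        ENNReal.ofReal_sum_of_nonneg (fun i _ => by positivity), ENNReal.ofReal_pow (hc0 q)]
      refine le_trans ?_ (pow_le_pow_left' (hΦ q) 2)
      rw [hsNorm_sq]
      refine le_trans (le_of_eq ?_) (ENNReal.sum_le_tsum F)
      exact Finset.sum_congr rfl fun i _ => (enorm_sq_eq_ofReal _ _ rfl).symm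
    calc _ ≤ ∑ i ∈ F, ‖B (basis M i)‖ * ‖Φ q (basis M i)‖ := by
          gcongr with i; exact norm_inner_le_norm _ _
      _ ≤ √(∑ i ∈ F, ‖B (basis M i)‖ ^ 2) * √(∑ i ∈ F, ‖Φ q (basis M i)‖ ^ 2) :=
          Real.sum_mul_le_sqrt_mul_sqrt _ _ _
      _ ≤ √n2 * c q := by
          gcongr
          exact Real.sqrt_le_iff.2 ⟨hc0 q, e1⟩
  have h2 : n2 ≤ √n2 * ∫ q, c q ∂μ := by
    have e2 : ((n2 : ℝ) : ℂ) = ∫ q, ∑ i ∈ F, ⟪B (basis M i), Φ q (basis M i)⟫_ℂ ∂μ := by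
      rw [integral_finsetSum _ fun i _ => (h _ _).1, hn2]
      push_cast
      refine Finset.sum_congr rfl fun i _ => ?_
      rw [← (h _ _).2, inner_self_eq_norm_sq_to_K]; norm_cast
    have e3 : ‖((n2 : ℝ) : ℂ)‖ = n2 := by rw [Complex.norm_real, Real.norm_of_nonneg h0]
    rw [e2] at e3
    refine e3.symm.le.trans ?_
    rw [← integral_const_mul]
    refine norm_integral_le_of_norm_le (hc.const_mul _) (Eventually.of_forall fun q => ?_)
    exact (norm_sum_le _ _).trans (hq q)
  by_cases hz : n2 = 0
  · rw [hz]; positivity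
  · have hp : 0 < √n2 := Real.sqrt_pos.2 (lt_of_le_of_ne h0 (Ne.symm hz))
    have h3 : √n2 * √n2 ≤ √n2 * ∫ q, c q ∂μ := by rwa [Real.mul_self_sqrt h0]
    have h4 := le_of_mul_le_mul_left h3 hp
    rw [← Real.sq_sqrt h0]; gcongr

theorem norm_le (h : IsWeakIntegral μ Φ B) {c : Q → ℝ} (hc : Integrable c μ)
    (hc0 : ∀ q, 0 ≤ c q) (hΦ : ∀ q, ‖Φ q‖ ≤ c q) : ‖B‖ ≤ ∫ q, c q ∂μ := by
  have hI : 0 ≤ ∫ q, c q ∂μ := integral_nonneg hc0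
  refine ContinuousLinearMap.opNorm_le_bound _ hI fun g => ?_
  have h1 : ‖⟪B g, B g⟫_ℂ‖ ≤ ∫ q, c q * (‖B g‖ * ‖g‖) ∂μ := by
    rw [(h _ _).2]
    refine norm_integral_le_of_norm_le (hc.mul_const _) (Eventually.of_forall fun q => ?_)
    refine (norm_inner_le_norm _ _).trans ?_
    have := (Φ q).le_of_opNorm_le (hΦ q) g
    calc ‖B g‖ * ‖Φ q g‖ ≤ ‖B g‖ * (c q * ‖g‖) := by gcongr
      _ = _ := by ring
  rw [integral_mul_const, inner_self_eq_norm_sq_to_K, norm_pow] at h1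
  simp only [RCLike.norm_ofReal, abs_norm] at h1
  by_cases hz : ‖B g‖ = 0
  · rw [hz]; positivity
  · have hp : 0 < ‖B g‖ := lt_of_le_of_ne (norm_nonneg _) (Ne.symm hz)
    refine le_of_mul_le_mul_left ?_ hp
    calc ‖B g‖ * ‖B g‖ = ‖B g‖ ^ 2 := by ring
      _ ≤ _ := h1
      _ = _ := by ring

theorem traceNorm_le (h : IsWeakIntegral μ Φ B) {c : Q → ℝ} (hc : Integrable c μ)
    (hc0 : ∀ q, 0 ≤ c q) (hΦ : ∀ q, traceNorm (Φ q) ≤ ENNReal.ofReal (c q)) :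
    traceNorm B ≤ ENNReal.ofReal (∫ q, c q ∂μ) := by
  refine HFB.traceNorm_le fun n e f he hf => ?_
  have h2 : ∀ A : Op M, ∑ i, ‖⟪e i, A (f i)⟫_ℂ‖ₑ
      = ENNReal.ofReal (∑ i, ‖⟪e i, A (f i)⟫_ℂ‖) := fun A => by
    rw [ENNReal.ofReal_sum_of_nonneg (fun i _ => by positivity)]
    exact Finset.sum_congr rfl fun i _ => (ofReal_norm _).symm
  rw [h2]
  refine ENNReal.ofReal_le_ofReal ?_
  calc ∑ i, ‖⟪e i, B (f i)⟫_ℂ‖ ≤ ∑ i, ∫ q, ‖⟪e i, Φ q (f i)⟫_ℂ‖ ∂μ := by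
        gcongr with i; rw [(h _ _).2]; exact norm_integral_le_integral_norm _
    _ = ∫ q, ∑ i, ‖⟪e i, Φ q (f i)⟫_ℂ‖ ∂μ :=
        (integral_finsetSum _ fun i _ => (h _ _).1.norm).symm
    _ ≤ ∫ q, c q ∂μ := by
        refine integral_mono (integrable_finsetSum _ fun i _ => (h _ _).1.norm) hc fun q => ?_
        rw [← ENNReal.ofReal_le_ofReal_iff (hc0 q)]
        refine le_trans ?_ (hΦ q)
        rw [← h2]
        exact sum_enorm_inner_le_traceNorm _ _ _ _ he hf

end IsWeakIntegral

end WeakIntegral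

/-! ### Multiplication operators and the boosts `e^{ip·x̂}`. -/

section Multiplication

variable {M : ℕ}

theorem mulOp_ae {φ : R3 → ℂ} (h : MemLp φ ∞ (volume : Measure R3)) (f : H M) :
    mulOp M φ f =ᵐ[volume] fun x => φ x • f x := by
  rw [mulOp, dif_pos h]
  filter_upwards [ContinuousLinearMap.coeFn_holder (r := 2)
    (ContinuousLinearMap.lsmul ℂ ℂ : ℂ →L[ℂ] Spin M →L[ℂ] Spin M) (h.toLp φ) f,
    h.coeFn_toLp] with x hx hx'
  simp only [ContinuousLinearMap.holderL_apply_apply]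
  rw [hx, hx']; rfl

theorem ext_ae {A B : Op M} (h : ∀ f : H M, A f =ᵐ[volume] B f) : A = B := by
  ext1 f; exact Lp.ext (h f)

theorem mulOp_mul {φ ψ : R3 → ℂ} (hφ : MemLp φ ∞ (volume : Measure R3))
    (hψ : MemLp ψ ∞ (volume : Measure R3)) (h : MemLp (fun x => φ x * ψ x) ∞ (volume : Measure R3)) :
    mulOp M φ * mulOp M ψ = mulOp M fun x => φ x * ψ x := by
  refine ext_ae fun f => ?_
  rw [mul_apply_eq_comp]
  filter_upwards [mulOp_ae hφ (mulOp M ψ f), mulOp_ae hψ f, mulOp_ae h f] with x h1 h2 h3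
  rw [h1, h2, h3, smul_smul]

theorem mulOp_sub {φ ψ : R3 → ℂ} (hφ : MemLp φ ∞ (volume : Measure R3))
    (hψ : MemLp ψ ∞ (volume : Measure R3)) :
    mulOp M φ - mulOp M ψ = mulOp M fun x => φ x - ψ x := by
  refine ext_ae fun f => ?_
  rw [_root_.sub_apply]
  filter_upwards [mulOp_ae hφ f, mulOp_ae hψ f, mulOp_ae (hφ.sub hψ) f,
    Lp.coeFn_sub (mulOp M φ f) (mulOp M ψ f)] with x h1 h2 h3 h4
  rw [h4, Pi.sub_apply, h1, h2, ← sub_smul]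
  exact h3.symm

theorem mulOp_one : mulOp M (fun _ => 1) = 1 := by
  refine ext_ae fun f => ?_
  filter_upwards [mulOp_ae (M := M) (memLp_top_const (1 : ℂ)) f] with x h1
  rw [h1, one_smul]; rfl

theorem inner_mulOp {φ : R3 → ℂ} (h : MemLp φ ∞ (volume : Measure R3)) (f g : H M) :
    ⟪f, mulOp M φ g⟫_ℂ = ∫ x, φ x * ⟪f x, g x⟫_ℂ := by
  rw [L2.inner_def]
  refine integral_congr_ae ?_
  filter_upwards [mulOp_ae h g] with x hx
  rw [hx, inner_smul_right]

theorem memLp_top_conj {φ : R3 → ℂ} (h : MemLp φ ∞ (volume : Measure R3)) :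
    MemLp (fun x => (starRingEnd ℂ) (φ x)) ∞ (volume : Measure R3) :=
  ⟨Complex.continuous_conj.comp_aestronglyMeasurable h.1, by
    rw [eLpNorm_congr_norm_ae (g := φ) (Eventually.of_forall fun x => by simp)]; exact h.2⟩

theorem star_mulOp {φ : R3 → ℂ} (h : MemLp φ ∞ (volume : Measure R3)) :
    star (mulOp M φ) = mulOp M fun x => (starRingEnd ℂ) (φ x) := by
  rw [ContinuousLinearMap.star_eq_adjoint]
  symm
  rw [ContinuousLinearMap.eq_adjoint_iff]
  intro f g
  rw [inner_mulOp h, L2.inner_def]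
  refine integral_congr_ae ?_
  filter_upwards [mulOp_ae (memLp_top_conj h) f] with x hx
  rw [hx, inner_smul_left, Complex.conj_conj]

theorem norm_mulOp_le {φ : R3 → ℂ} {C : ℝ} (hC : 0 ≤ C) (h : ∀ x, ‖φ x‖ ≤ C) :
    ‖mulOp M φ‖ ≤ C := by
  by_cases hm : MemLp φ ∞ (volume : Measure R3)
  · refine ContinuousLinearMap.opNorm_le_bound _ hC fun f => ?_
    refine Lp.norm_le_mul_norm_of_ae_le_mul ?_
    filter_upwards [mulOp_ae hm f] with x hx
    rw [hx, norm_smul]; gcongr; exact h x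
  · rw [mulOp, dif_neg hm]; simpa using hC

theorem norm_mulOp_apply {φ : R3 → ℂ} (hm : MemLp φ ∞ (volume : Measure R3))
    (h : ∀ x, ‖φ x‖ = 1) (f : H M) : ‖mulOp M φ f‖ = ‖f‖ := by
  refine le_antisymm ?_ ?_ <;>
  · refine Lp.norm_le_norm_of_ae_le ?_
    filter_upwards [mulOp_ae hm f] with x hx
    rw [hx, norm_smul, h, one_mul]

/-- Dominated convergence. It yields the strong continuity of the boosts and, after a Fourier
transform, of translations and of the free propagator. -/
theorem tendsto_mulOp_apply {ι : Type*} {l : Filter ι} [l.IsCountablyGenerated]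
    {φ : ι → R3 → ℂ} {ψ : R3 → ℂ} {C : ℝ} (hφ : ∀ i, MemLp (φ i) ∞ (volume : Measure R3))
    (hψ : MemLp ψ ∞ (volume : Measure R3)) (hb : ∀ i x, ‖φ i x‖ ≤ C) (hb' : ∀ x, ‖ψ x‖ ≤ C)
    (h : ∀ x, Tendsto (fun i => φ i x) l (𝓝 (ψ x))) (f : H M) :
    Tendsto (fun i => mulOp M (φ i) f) l (𝓝 (mulOp M ψ f)) := by
  rw [tendsto_iff_norm_sub_tendsto_zero]
  have e : ∀ i, ‖mulOp M (φ i) f - mulOp M ψ f‖ ^ 2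
      = ∫ x, ‖φ i x - ψ x‖ ^ 2 * ‖f x‖ ^ 2 := fun i => by
    have h1 : ((‖mulOp M (φ i) f - mulOp M ψ f‖ ^ 2 : ℝ) : ℂ)
        = ((∫ x, ‖φ i x - ψ x‖ ^ 2 * ‖f x‖ ^ 2 : ℝ) : ℂ) := by
      rw [← integral_complex_ofReal, ← _root_.sub_apply, mulOp_sub (hφ i) hψ]
      have := inner_self_eq_norm_sq_to_K (𝕜 := ℂ) (mulOp M (fun x => φ i x - ψ x) f)
      push_cast
      refine this.symm.trans ?_
      rw [L2.inner_def]
      refine integral_congr_ae ?_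
      filter_upwards [mulOp_ae ((hφ i).sub hψ) f] with x hx
      have hx' : mulOp M (fun x => φ i x - ψ x) f x = (φ i x - ψ x) • f x := hx
      rw [hx', inner_self_eq_norm_sq_to_K, norm_smul]
      push_cast
      rw [mul_pow]; rfl
    exact_mod_cast h1
  have hf : Integrable (fun x => ‖f x‖ ^ 2) := (Lp.memLp f).integrable_norm_pow two_ne_zero
  have h2 : Tendsto (fun i => ∫ x, ‖φ i x - ψ x‖ ^ 2 * ‖f x‖ ^ 2) l
      (𝓝 (∫ _x : R3, (0 : ℝ))) := by
    refine tendsto_integral_filter_of_dominated_convergence (fun x => (C + C) ^ 2 * ‖f x‖ ^ 2)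
      (Eventually.of_forall fun i => ?_) (Eventually.of_forall fun i => ?_) (hf.const_mul _) ?_
    · exact (((hφ i).sub hψ).1.norm.pow 2).mul hf.1
    · refine Eventually.of_forall fun x => ?_
      rw [Real.norm_of_nonneg (by positivity)]
      gcongr
      exact (norm_sub_le _ _).trans (add_le_add (hb i x) (hb' x))
    · refine Eventually.of_forall fun x => ?_
      have := (((h x).sub_const (ψ x)).norm.pow 2).mul_const (‖f x‖ ^ 2)
      simpa using this
  simp_rw [← e] at h2
  rw [integral_zero] at h2
  have h3 := (Real.continuous_sqrt.tendsto 0).comp h2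
  simpa [Function.comp_def, Real.sqrt_sq] using h3

/-- The phase `e^{i p · x}`. -/
def phase (p x : R3) : ℂ := Complex.exp (Complex.I * ((⟪p, x⟫_ℝ : ℝ) : ℂ))

theorem norm_phase (p x : R3) : ‖phase p x‖ = 1 := by
  rw [phase, mul_comm]; exact Complex.norm_exp_ofReal_mul_I _

theorem continuous_phase : Continuous fun z : R3 × R3 => phase z.1 z.2 := by
  unfold phase; fun_prop

theorem continuous_phase_right (p : R3) : Continuous (phase p) :=
  continuous_phase.comp (by fun_prop : Continuous fun x : R3 => (p, x))

theorem phase_add (p q x : R3) : phase (p + q) x = phase p x * phase q x := by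
  rw [phase, phase, phase, ← Complex.exp_add, inner_add_left]; push_cast; ring_nf

theorem phase_add_right (p x y : R3) : phase p (x + y) = phase p x * phase p y := by
  rw [phase, phase, phase, ← Complex.exp_add, inner_add_right]; push_cast; ring_nf

theorem phase_neg (p x : R3) : phase (-p) x = (starRingEnd ℂ) (phase p x) := by
  rw [phase, phase, ← Complex.exp_conj, map_mul, Complex.conj_I, Complex.conj_ofReal,
    inner_neg_left]
  push_cast; ring_nf

theorem phase_neg_right (p x : R3) : phase p (-x) = (starRingEnd ℂ) (phase p x) := by
  rw [← phase_neg, phase, phase, inner_neg_left, inner_neg_right]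

theorem phase_zero (x : R3) : phase 0 x = 1 := by simp [phase]

theorem memLp_top_of_norm_le {φ : R3 → ℂ} (h : AEStronglyMeasurable φ volume) {C : ℝ}
    (hb : ∀ x, ‖φ x‖ ≤ C) : MemLp φ ∞ (volume : Measure R3) :=
  memLp_top_of_bound h C (Eventually.of_forall hb)

theorem memLp_phase (p : R3) : MemLp (phase p) ∞ (volume : Measure R3) :=
  memLp_top_of_norm_le (continuous_phase_right p).aestronglyMeasurable
    (fun x => (norm_phase p x).le)

theorem expOp_eq (p : R3) : expOp M p = mulOp M (phase p) := rfl

theorem expOp_mul (p q : R3) : expOp M p * expOp M q = expOp M (p + q) := by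
  have e : (fun x => phase p x * phase q x) = phase (p + q) := funext fun x => (phase_add p q x).symm
  rw [expOp_eq, expOp_eq, mulOp_mul (memLp_phase p) (memLp_phase q), e, expOp_eq]
  rw [e]; exact memLp_phase _

theorem expOp_zero : expOp M 0 = 1 := by
  rw [expOp_eq, ← mulOp_one]; congr 1; ext x; exact phase_zero x

theorem star_expOp (p : R3) : star (expOp M p) = expOp M (-p) := by
  rw [expOp_eq, star_mulOp (memLp_phase p), expOp_eq]
  congr 1; ext x; rw [phase_neg]

theorem expOp_mul_neg (p : R3) : expOp M p * expOp M (-p) = 1 := by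
  rw [expOp_mul, add_neg_cancel, expOp_zero]

theorem expOp_neg_mul (p : R3) : expOp M (-p) * expOp M p = 1 := by
  rw [expOp_mul, neg_add_cancel, expOp_zero]

theorem norm_expOp_apply (p : R3) (f : H M) : ‖expOp M p f‖ = ‖f‖ :=
  norm_mulOp_apply (memLp_phase p) (norm_phase p) f

theorem norm_expOp_le (p : R3) : ‖expOp M p‖ ≤ 1 :=
  norm_mulOp_le zero_le_one fun x => (norm_phase p x).le

theorem continuous_expOp_apply (f : H M) : Continuous fun p => expOp M p f := by
  refine continuous_iff_continuousAt.2 fun p => ?_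
  refine tendsto_mulOp_apply (C := 1) (fun q => memLp_phase q) (memLp_phase p)
    (fun q x => (norm_phase q x).le) (fun x => (norm_phase p x).le) (fun x => ?_) f
  exact (continuous_phase.comp (by fun_prop : Continuous fun q : R3 => (q, x))).tendsto p

theorem expOp_mul_mulOp (p : R3) {φ : R3 → ℂ} (h : MemLp φ ∞ (volume : Measure R3)) :
    expOp M p * mulOp M φ = mulOp M φ * expOp M p := by
  refine ext_ae fun f => ?_
  rw [mul_apply_eq_comp, mul_apply_eq_comp]
  filter_upwards [mulOp_ae (memLp_phase p) (mulOp M φ f), mulOp_ae h f,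
    mulOp_ae h (expOp M p f), mulOp_ae (memLp_phase p) f] with x h1 h2 h3 h4
  rw [h3, expOp_eq, h4, h1, h2, smul_comm]

end Multiplication

/-! ### Translation operators and their commutation relations with boosts. -/

section Translation

variable {M : ℕ}

/-- The translation operator `(τ_a f)(x) = f(x + a)`. -/
def transOp (M : ℕ) (a : R3) : Op M :=
  (Lp.compMeasurePreservingₗᵢ ℂ (fun x : R3 => x + a)
    (measurePreserving_add_right volume a)).toContinuousLinearMap

theorem transOp_ae (a : R3) (f : H M) : transOp M a f =ᵐ[volume] fun x => f (x + a) :=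
  Lp.coeFn_compMeasurePreserving f (measurePreserving_add_right volume a)

theorem norm_transOp_apply (a : R3) (f : H M) : ‖transOp M a f‖ = ‖f‖ :=
  LinearIsometry.norm_map _ f

theorem ae_comp_add {p : R3 → Prop} (a : R3) (h : ∀ᵐ x : R3, p x) : ∀ᵐ x : R3, p (x + a) :=
  (measurePreserving_add_right volume a).quasiMeasurePreserving.ae h

theorem transOp_mul (a b : R3) : transOp M a * transOp M b = transOp M (a + b) := by
  refine ext_ae fun f => ?_
  rw [mul_apply_eq_comp]
  filter_upwards [transOp_ae a (transOp M b f), ae_comp_add a (transOp_ae b f),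
    transOp_ae (a + b) f] with x h1 h2 h3
  rw [h1, h2, h3, add_assoc]

theorem transOp_zero : transOp M 0 = 1 := by
  refine ext_ae fun f => ?_
  filter_upwards [transOp_ae 0 f] with x h1
  rw [h1, add_zero]; rfl

theorem transOp_mul_neg (a : R3) : transOp M a * transOp M (-a) = 1 := by
  rw [transOp_mul, add_neg_cancel, transOp_zero]

theorem transOp_neg_mul (a : R3) : transOp M (-a) * transOp M a = 1 := by
  rw [transOp_mul, neg_add_cancel, transOp_zero]

theorem star_of_isometry_of_inverse {U V : Op M} (hU : ∀ x, ‖U x‖ = ‖x‖) (hUV : U * V = 1) :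
    star U = V := by
  have h1 : star U * U = 1 := by
    rw [ContinuousLinearMap.star_eq_adjoint]
    exact (ContinuousLinearMap.norm_map_iff_adjoint_comp_self U).1 hU
  calc star U = star U * (U * V) := by rw [hUV, mul_one]
    _ = V := by rw [← mul_assoc, h1, one_mul]

theorem star_transOp (a : R3) : star (transOp M a) = transOp M (-a) :=
  star_of_isometry_of_inverse (norm_transOp_apply a) (transOp_mul_neg a)

theorem transOp_mulOp (a : R3) {φ : R3 → ℂ} (h : MemLp φ ∞ (volume : Measure R3))
    (h' : MemLp (fun x => φ (x + a)) ∞ (volume : Measure R3)) :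
    transOp M a * mulOp M φ = mulOp M (fun x => φ (x + a)) * transOp M a := by
  refine ext_ae fun f => ?_
  rw [mul_apply_eq_comp, mul_apply_eq_comp]
  filter_upwards [transOp_ae a (mulOp M φ f), ae_comp_add a (mulOp_ae h f),
    mulOp_ae h' (transOp M a f), transOp_ae a f] with x h1 h2 h3 h4
  rw [h1, h2, h3, h4]

theorem transOp_expOp (a p : R3) :
    transOp M a * expOp M p = phase p a • (expOp M p * transOp M a) := by
  refine ext_ae fun f => ?_
  rw [_root_.smul_apply, mul_apply_eq_comp, mul_apply_eq_comp]
  filter_upwards [transOp_ae a (expOp M p f), ae_comp_add a (mulOp_ae (memLp_phase p) f),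
    mulOp_ae (memLp_phase p) (transOp M a f), transOp_ae a f,
    Lp.coeFn_smul (phase p a) (expOp M p (transOp M a f))] with x h1 h2 h3 h4 h5
  rw [h5, Pi.smul_apply, h1, expOp_eq, h2, h3, h4, phase_add_right, smul_smul, mul_comm]

end Translation

/-! ### Complex conjugation of vectors and operators. -/

section Conjugation

variable {M : ℕ}

theorem conjH_ae (f : H M) : conjH M f =ᵐ[volume] fun x => conjSpin M (f x) :=
  ContinuousLinearMap.coeFn_compLpL _ f

theorem conjSpin_apply (v : Spin M) (i : Fin M) : conjSpin M v i = (starRingEnd ℂ) (v i) := rfl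

theorem conjSpin_conjSpin (v : Spin M) : conjSpin M (conjSpin M v) = v := by
  ext i; simp [conjSpin_apply]

theorem inner_conjSpin (v w : Spin M) : ⟪conjSpin M v, conjSpin M w⟫_ℂ = ⟪w, v⟫_ℂ := by
  simp [PiLp.inner_apply, conjSpin_apply, mul_comm]

theorem conjH_conjH (f : H M) : conjH M (conjH M f) = f := by
  refine Lp.ext ?_
  filter_upwards [conjH_ae (conjH M f), conjH_ae f] with x h1 h2
  rw [h1, h2, conjSpin_conjSpin]

theorem inner_conjH (f g : H M) : ⟪conjH M f, conjH M g⟫_ℂ = ⟪g, f⟫_ℂ := by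
  rw [L2.inner_def, L2.inner_def]
  refine integral_congr_ae ?_
  filter_upwards [conjH_ae f, conjH_ae g] with x h1 h2
  rw [h1, h2, inner_conjSpin]

theorem norm_conjH (f : H M) : ‖conjH M f‖ = ‖f‖ := by
  rw [← sq_eq_sq₀ (norm_nonneg _) (norm_nonneg _)]
  have := inner_conjH f f
  rw [inner_self_eq_norm_sq_to_K, inner_self_eq_norm_sq_to_K] at this
  exact_mod_cast this

theorem conjOp_apply (A : Op M) (f : H M) : conjOp A f = conjH M (A (conjH M f)) := rfl

theorem conjOp_conjOp (A : Op M) : conjOp (conjOp A) = A := by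
  ext1 f; simp [conjOp_apply, conjH_conjH]

theorem conjOp_mul (A B : Op M) : conjOp (A * B) = conjOp A * conjOp B := by
  ext1 f; simp [conjOp_apply, conjH_conjH]

theorem conjOp_add (A B : Op M) : conjOp (A + B) = conjOp A + conjOp B := by
  ext1 f; simp [conjOp_apply]

theorem conjOp_sub (A B : Op M) : conjOp (A - B) = conjOp A - conjOp B := by
  ext1 f; simp [conjOp_apply]

theorem conjOp_one : conjOp (1 : Op M) = 1 := by
  ext1 f; simp [conjOp_apply, conjH_conjH]

theorem conjOp_smul (c : ℂ) (A : Op M) : conjOp (c • A) = (starRingEnd ℂ) c • conjOp A := by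
  ext1 f; simp [conjOp_apply]

theorem inner_conjOp (A : Op M) (f g : H M) :
    ⟪f, conjOp A g⟫_ℂ = (starRingEnd ℂ) ⟪conjH M f, A (conjH M g)⟫_ℂ := by
  rw [conjOp_apply, inner_conj_symm, ← inner_conjH, conjH_conjH]

theorem star_conjOp (A : Op M) : star (conjOp A) = conjOp (star A) := by
  rw [ContinuousLinearMap.star_eq_adjoint]
  symm
  rw [ContinuousLinearMap.eq_adjoint_iff]
  intro f g
  rw [inner_conjOp, ← inner_conj_symm, inner_conjOp, Complex.conj_conj, inner_conj_symm,
    ContinuousLinearMap.star_eq_adjoint, ContinuousLinearMap.adjoint_inner_right,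
    ]

theorem norm_conjOp_le (A : Op M) : ‖conjOp A‖ ≤ ‖A‖ := by
  refine ContinuousLinearMap.opNorm_le_bound _ (norm_nonneg _) fun f => ?_
  rw [conjOp_apply, norm_conjH, ← norm_conjH f]
  exact A.le_opNorm _

theorem norm_conjOp (A : Op M) : ‖conjOp A‖ = ‖A‖ :=
  le_antisymm (norm_conjOp_le A) (by simpa [conjOp_conjOp] using norm_conjOp_le (conjOp A))

theorem enorm_conjH (f : H M) : ‖conjH M f‖ₑ = ‖f‖ₑ := by
  rw [← ofReal_norm, ← ofReal_norm, norm_conjH]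

/-- The sum is passed to the adjoint, where the conjugated basis vectors `𝒞 e_i` enter only through
Parseval; so it need not be shown that they form a basis. -/
theorem hsNorm_conjOp (A : Op M) : hsNorm (conjOp A) = hsNorm A := by
  refine (ENNReal.pow_right_strictMono two_ne_zero).injective ?_
  simp only [hsNorm_sq]
  calc ∑' i, ‖conjOp A (basis M i)‖ₑ ^ 2
      = ∑' i, ∑' j, ‖⟪basis M j, A (conjH M (basis M i))⟫_ℂ‖ₑ ^ 2 :=
        tsum_congr fun i => by rw [parseval_enorm, conjOp_apply, enorm_conjH]
    _ = ∑' j, ∑' i, ‖⟪basis M j, A (conjH M (basis M i))⟫_ℂ‖ₑ ^ 2 := ENNReal.tsum_comm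
    _ = ∑' j, ‖ContinuousLinearMap.adjoint A (basis M j)‖ₑ ^ 2 := by
        refine tsum_congr fun j => ?_
        rw [← enorm_conjH, ← parseval_enorm (basis M)]
        refine tsum_congr fun i => ?_
        rw [← ContinuousLinearMap.adjoint_inner_left, ← inner_conjH, conjH_conjH]
    _ = _ := (tsum_enorm_sq_adjoint _ _ A).symm

theorem conjOp_mulOp {φ : R3 → ℂ} (h : MemLp φ ∞ (volume : Measure R3)) :
    conjOp (mulOp M φ) = mulOp M fun x => (starRingEnd ℂ) (φ x) := by
  refine ext_ae fun f => ?_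
  rw [conjOp_apply]
  filter_upwards [conjH_ae (mulOp M φ (conjH M f)), mulOp_ae h (conjH M f), conjH_ae f,
    mulOp_ae (memLp_top_conj h) f] with x h1 h2 h3 h4
  rw [h1, h2, h3, h4, map_smulₛₗ, conjSpin_conjSpin]

theorem conjOp_expOp (p : R3) : conjOp (expOp M p) = expOp M (-p) := by
  rw [expOp_eq, conjOp_mulOp (memLp_phase p), expOp_eq]
  congr 1; ext x; rw [phase_neg]

theorem conjOp_transOp (a : R3) : conjOp (transOp M a) = transOp M a := by
  refine ext_ae fun f => ?_
  rw [conjOp_apply]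
  filter_upwards [conjH_ae (transOp M a (conjH M f)), transOp_ae a (conjH M f),
    ae_comp_add a (conjH_ae f), transOp_ae a f] with x h1 h2 h3 h4
  rw [h1, h2, h3, h4, conjSpin_conjSpin]

end Conjugation

/-! ### The Fourier transform intertwines translations and boosts, and conjugation inverts it. -/

section FourierTransform

open FourierTransform

variable {M : ℕ}

/-- The Fourier transform on the one-particle space as a bounded operator. -/
def fourierOp (M : ℕ) : Op M := (Lp.fourierTransformₗᵢ R3 (Spin M) : H M →L[ℂ] H M)

/-- The inverse Fourier transform on the one-particle space as a bounded operator. -/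
def fourierInvOp (M : ℕ) : Op M := ((Lp.fourierTransformₗᵢ R3 (Spin M)).symm : H M →L[ℂ] H M)

theorem fourierInvOp_mul : fourierInvOp M * fourierOp M = 1 := by
  ext1 f; exact (Lp.fourierTransformₗᵢ R3 (Spin M)).symm_apply_apply f

theorem fourierOp_mul : fourierOp M * fourierInvOp M = 1 := by
  ext1 f; exact (Lp.fourierTransformₗᵢ R3 (Spin M)).apply_symm_apply f

theorem fourierOp_schwartz (f : 𝓢(R3, Spin M)) : fourierOp M (f.toLp 2) = (𝓕 f).toLp 2 :=
  SchwartzMap.toLp_fourier_eq f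

theorem fourierInvOp_schwartz (f : 𝓢(R3, Spin M)) :
    fourierInvOp M (f.toLp 2) = (𝓕⁻ f).toLp 2 :=
  SchwartzMap.toLp_fourierInv_eq f

theorem norm_fourierOp_apply (f : H M) : ‖fourierOp M f‖ = ‖f‖ :=
  (Lp.fourierTransformₗᵢ R3 (Spin M)).norm_map f

theorem norm_fourierInvOp_apply (f : H M) : ‖fourierInvOp M f‖ = ‖f‖ :=
  (Lp.fourierTransformₗᵢ R3 (Spin M)).symm.norm_map f

theorem denseRange_schwartz :
    DenseRange fun f : 𝓢(R3, Spin M) => (f.toLp 2 : H M) :=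
  SchwartzMap.denseRange_toLpCLM (p := 2) ENNReal.ofNat_ne_top

theorem op_ext_schwartz {A B : Op M}
    (h : ∀ f : 𝓢(R3, Spin M), A (f.toLp 2) = B (f.toLp 2)) : A = B := by
  ext1 f
  exact congrFun (denseRange_schwartz.equalizer A.continuous B.continuous (funext h)) f

theorem transOp_schwartz (a : R3) (f : 𝓢(R3, Spin M)) :
    transOp M a (f.toLp 2) = (SchwartzMap.compSubConstCLM ℂ (-a) f).toLp 2 := by
  refine Lp.ext ?_
  filter_upwards [transOp_ae a (f.toLp 2), ae_comp_add a (f.coeFn_toLp 2 volume),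
    (SchwartzMap.compSubConstCLM ℂ (-a) f).coeFn_toLp 2 volume] with x h1 h2 h3
  rw [h1, h2, h3, SchwartzMap.compSubConstCLM_apply, sub_neg_eq_add]

theorem fourier_comp_add (f : R3 → Spin M) (a ξ : R3) :
    𝓕 (fun x => f (x + a)) ξ = phase ((2 * Real.pi) • a) ξ • 𝓕 f ξ := by
  have h := congrFun (VectorFourier.fourierIntegral_comp_add_right Real.fourierChar
    (volume : Measure R3) (innerₗ R3) f a) ξ
  refine Eq.trans h ?_
  rw [Circle.smul_def, Real.fourierChar_apply, phase]
  congr 1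
  simp only [innerₗ_apply_apply, inner_smul_left]
  congr 1; simp; ring

theorem fourierOp_transOp (a : R3) :
    fourierOp M * transOp M a = expOp M ((2 * Real.pi) • a) * fourierOp M := by
  refine op_ext_schwartz fun f => ?_
  rw [mul_apply_eq_comp, mul_apply_eq_comp, transOp_schwartz, fourierOp_schwartz,
    fourierOp_schwartz]
  refine Lp.ext ?_
  filter_upwards [(𝓕 (SchwartzMap.compSubConstCLM ℂ (-a) f)).coeFn_toLp 2 volume,
    mulOp_ae (memLp_phase ((2 * Real.pi) • a)) ((𝓕 f).toLp 2), (𝓕 f).coeFn_toLp 2 volume]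
    with x h1 h2 h3
  rw [h1, expOp_eq, h2, h3, SchwartzMap.fourier_coe, SchwartzMap.fourier_coe, ← fourier_comp_add]
  exact congrArg (fun g : R3 → Spin M => 𝓕 g _) (funext fun y => congrArg f (sub_neg_eq_add y a))

theorem fourierInvOp_transOp (a : R3) :
    fourierInvOp M * transOp M a = expOp M (-((2 * Real.pi) • a)) * fourierInvOp M := by
  refine op_ext_schwartz fun f => ?_
  rw [mul_apply_eq_comp, mul_apply_eq_comp, transOp_schwartz, fourierInvOp_schwartz,
    fourierInvOp_schwartz]
  refine Lp.ext ?_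
  filter_upwards [(𝓕⁻ (SchwartzMap.compSubConstCLM ℂ (-a) f)).coeFn_toLp 2 volume,
    mulOp_ae (memLp_phase (-((2 * Real.pi) • a))) ((𝓕⁻ f).toLp 2), (𝓕⁻ f).coeFn_toLp 2 volume]
    with x h1 h2 h3
  rw [h1, expOp_eq, h2, h3, SchwartzMap.fourierInv_coe, SchwartzMap.fourierInv_coe,
    Real.fourierInv_eq_fourier_neg, Real.fourierInv_eq_fourier_neg, phase_neg, ← phase_neg_right,
    ← fourier_comp_add]
  exact congrArg (fun g : R3 → Spin M => 𝓕 g _) (funext fun y => congrArg f (sub_neg_eq_add y a))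

theorem fourierOp_expOp (a : R3) :
    fourierOp M * expOp M ((2 * Real.pi) • a) = transOp M (-a) * fourierOp M := by
  have h := fourierInvOp_transOp (M := M) (-a)
  rw [smul_neg, neg_neg] at h
  calc fourierOp M * expOp M ((2 * Real.pi) • a)
      = fourierOp M * (expOp M ((2 * Real.pi) • a) * fourierInvOp M) * fourierOp M := by
        rw [mul_assoc, mul_assoc, fourierInvOp_mul, mul_one]
    _ = _ := by rw [← h, ← mul_assoc, fourierOp_mul, one_mul]

/-- The reflection `f ↦ f(-·)`. -/
def reflOp (M : ℕ) : Op M :=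
  (Lp.compMeasurePreservingₗᵢ ℂ (fun x : R3 => -x)
    (Measure.measurePreserving_neg volume)).toContinuousLinearMap

theorem reflOp_ae (f : H M) : reflOp M f =ᵐ[volume] fun x => f (-x) :=
  Lp.coeFn_compMeasurePreserving f (Measure.measurePreserving_neg volume)

theorem ae_comp_neg {p : R3 → Prop} (h : ∀ᵐ x : R3, p x) : ∀ᵐ x : R3, p (-x) :=
  (Measure.measurePreserving_neg (volume : Measure R3)).quasiMeasurePreserving.ae h

theorem fourierOp_mul_fourierOp : fourierOp M * fourierOp M = reflOp M := by
  refine op_ext_schwartz fun f => ?_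
  rw [mul_apply_eq_comp, fourierOp_schwartz, fourierOp_schwartz]
  refine Lp.ext ?_
  filter_upwards [(𝓕 (𝓕 f)).coeFn_toLp 2 volume, reflOp_ae (f.toLp 2), ae_comp_neg (f.coeFn_toLp 2 volume)]
    with x h1 h2 h3
  rw [h1, h2, h3, SchwartzMap.fourier_coe]
  have h4 : (𝓕⁻ (𝓕 f) : 𝓢(R3, Spin M)) (-x) = f (-x) := by rw [FourierPair.fourierInv_fourier_eq]
  rw [← h4, SchwartzMap.fourierInv_coe, Real.fourierInv_eq_fourier_neg, neg_neg]

theorem reflOp_mulOp {φ : R3 → ℂ} (h : MemLp φ ∞ (volume : Measure R3))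
    (he : ∀ x, φ (-x) = φ x) : reflOp M * mulOp M φ = mulOp M φ * reflOp M := by
  refine ext_ae fun f => ?_
  rw [mul_apply_eq_comp, mul_apply_eq_comp]
  filter_upwards [reflOp_ae (mulOp M φ f), ae_comp_neg (mulOp_ae h f),
    mulOp_ae h (reflOp M f), reflOp_ae f] with x h1 h2 h3 h4
  rw [h1, h2, h3, h4, he]

theorem norm_conjSpin (v : Spin M) : ‖conjSpin M v‖ = ‖v‖ := by
  simp [EuclideanSpace.norm_eq, conjSpin_apply]

/-- Complex conjugation on the spin space as a real-linear isometry. -/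
def conjSpinIsometry (M : ℕ) : Spin M →ₗᵢ[ℝ] Spin M where
  toFun := conjSpin M
  map_add' := map_add _
  map_smul' := fun c v => by ext i; simp [conjSpin_apply]
  norm_map' := norm_conjSpin

/-- Complex conjugation of Schwartz functions. -/
def conjSchwartz (f : 𝓢(R3, Spin M)) : 𝓢(R3, Spin M) :=
  SchwartzMap.postcompCLM (𝕜 := ℝ) (conjSpinIsometry M).toContinuousLinearMap f

theorem conjSchwartz_apply (f : 𝓢(R3, Spin M)) (x : R3) :
    conjSchwartz f x = conjSpin M (f x) := rfl

theorem conjH_schwartz (f : 𝓢(R3, Spin M)) : conjH M (f.toLp 2) = (conjSchwartz f).toLp 2 := by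
  refine Lp.ext ?_
  filter_upwards [conjH_ae (f.toLp 2), f.coeFn_toLp 2 volume, (conjSchwartz f).coeFn_toLp 2 volume]
    with x h1 h2 h3
  rw [h1, h2, h3, conjSchwartz_apply]

theorem fourier_conj (f : R3 → Spin M) (ξ : R3) :
    𝓕 (fun x => conjSpin M (f x)) ξ = conjSpin M (𝓕⁻ f ξ) := by
  rw [Real.fourier_eq', Real.fourierInv_eq']
  refine Eq.trans (integral_congr_ae (Eventually.of_forall fun x => ?_))
    ((conjSpinIsometry M).integral_comp_comm _)
  change _ = conjSpin M _
  simp only []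
  rw [map_smulₛₗ, ← Complex.exp_conj]
  congr 2
  simp
  exact Or.inl (map_ofNat _ 2).symm

theorem conjOp_fourierOp : conjOp (fourierOp M) = fourierInvOp M := by
  refine op_ext_schwartz fun f => ?_
  rw [conjOp_apply, conjH_schwartz, fourierOp_schwartz, conjH_schwartz, fourierInvOp_schwartz]
  congr 1
  ext1 ξ
  rw [conjSchwartz_apply, SchwartzMap.fourier_coe, SchwartzMap.fourierInv_coe]
  change conjSpin M (𝓕 (fun x => conjSpin M (f x)) ξ) = _
  rw [fourier_conj, conjSpin_conjSpin]

end FourierTransform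

/-! ### The free Schrödinger group and its action on translations, boosts and conjugation. -/

section FreePropagator

variable {M : ℕ}

/-- The Fourier symbol of the free propagator. -/
def freeSymbol (ε t : ℝ) (ξ : R3) : ℂ :=
  Complex.exp (-Complex.I * ((ε * t * (2 * Real.pi * ‖ξ‖) ^ 2 : ℝ) : ℂ))

theorem norm_freeSymbol (ε t : ℝ) (ξ : R3) : ‖freeSymbol ε t ξ‖ = 1 := by
  rw [freeSymbol, neg_mul, ← mul_neg, ← Complex.ofReal_neg, mul_comm]
  exact Complex.norm_exp_ofReal_mul_I _

theorem continuous_freeSymbol (ε t : ℝ) : Continuous (freeSymbol ε t) := by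
  unfold freeSymbol; fun_prop

theorem memLp_freeSymbol (ε t : ℝ) : MemLp (freeSymbol ε t) ∞ (volume : Measure R3) :=
  memLp_top_of_norm_le (continuous_freeSymbol ε t).aestronglyMeasurable
    fun x => (norm_freeSymbol ε t x).le

theorem freeSymbol_add (ε s t : ℝ) (ξ : R3) :
    freeSymbol ε s ξ * freeSymbol ε t ξ = freeSymbol ε (s + t) ξ := by
  rw [freeSymbol, freeSymbol, freeSymbol, ← Complex.exp_add]; push_cast; ring_nf

theorem freeSymbol_conj (ε t : ℝ) (ξ : R3) :
    (starRingEnd ℂ) (freeSymbol ε t ξ) = freeSymbol ε (-t) ξ := by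
  rw [freeSymbol, freeSymbol, ← Complex.exp_conj, map_mul, map_neg, Complex.conj_I,
    Complex.conj_ofReal]
  push_cast; ring_nf

theorem freeSymbol_neg_arg (ε t : ℝ) (ξ : R3) : freeSymbol ε t (-ξ) = freeSymbol ε t ξ := by
  rw [freeSymbol, norm_neg]; rfl

theorem freeProp_eq (ε t : ℝ) :
    freeProp M ε t = fourierInvOp M * (mulOp M (freeSymbol ε t) * fourierOp M) := rfl

theorem freeProp_mul (ε s t : ℝ) :
    freeProp M ε s * freeProp M ε t = freeProp M ε (s + t) := by
  have e : (fun x => freeSymbol ε s x * freeSymbol ε t x) = freeSymbol ε (s + t) :=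
    funext fun x => freeSymbol_add ε s t x
  have h := mulOp_mul (M := M) (memLp_freeSymbol ε s) (memLp_freeSymbol ε t)
    (by rw [e]; exact memLp_freeSymbol _ _)
  rw [e] at h
  rw [freeProp_eq, freeProp_eq, freeProp_eq, ← h]
  calc _ = fourierInvOp M * mulOp M (freeSymbol ε s) * (fourierOp M * fourierInvOp M)
        * mulOp M (freeSymbol ε t) * fourierOp M := by noncomm_ring
    _ = _ := by rw [fourierOp_mul]; noncomm_ring

theorem freeProp_zero (ε : ℝ) : freeProp M ε 0 = 1 := by
  have e : freeSymbol ε 0 = fun _ => 1 := by ext x; simp [freeSymbol]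
  rw [freeProp_eq, e, mulOp_one, one_mul, fourierInvOp_mul]

theorem freeProp_mul_neg (ε t : ℝ) : freeProp M ε t * freeProp M ε (-t) = 1 := by
  rw [freeProp_mul, add_neg_cancel, freeProp_zero]

theorem freeProp_neg_mul (ε t : ℝ) : freeProp M ε (-t) * freeProp M ε t = 1 := by
  rw [freeProp_mul, neg_add_cancel, freeProp_zero]

theorem norm_freeProp_apply (ε t : ℝ) (f : H M) : ‖freeProp M ε t f‖ = ‖f‖ := by
  rw [freeProp_eq, mul_apply_eq_comp, mul_apply_eq_comp, norm_fourierInvOp_apply,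
    norm_mulOp_apply (memLp_freeSymbol ε t) (norm_freeSymbol ε t), norm_fourierOp_apply]

theorem star_freeProp (ε t : ℝ) : star (freeProp M ε t) = freeProp M ε (-t) :=
  star_of_isometry_of_inverse (norm_freeProp_apply ε t) (freeProp_mul_neg ε t)

theorem continuous_freeProp_apply (ε : ℝ) (f : H M) : Continuous fun t => freeProp M ε t f := by
  have h : Continuous fun t => mulOp M (freeSymbol ε t) (fourierOp M f) := by
    refine continuous_iff_continuousAt.2 fun t => ?_
    refine tendsto_mulOp_apply (C := 1) (fun q => memLp_freeSymbol ε q) (memLp_freeSymbol ε t)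
      (fun q x => (norm_freeSymbol ε q x).le) (fun x => (norm_freeSymbol ε t x).le)
      (fun x => ?_) _
    have : Continuous fun t => freeSymbol ε t x := by unfold freeSymbol; fun_prop
    exact this.tendsto t
  exact (fourierInvOp M).continuous.comp h

theorem freeProp_transOp (ε t : ℝ) (a : R3) :
    freeProp M ε t * transOp M a = transOp M a * freeProp M ε t := by
  have h1 : transOp M a * fourierInvOp M = fourierInvOp M * expOp M ((2 * Real.pi) • a) := by
    calc _ = fourierInvOp M * (fourierOp M * transOp M a) * fourierInvOp M := by
          rw [← mul_assoc, fourierInvOp_mul, one_mul]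
      _ = _ := by
          rw [fourierOp_transOp, ← mul_assoc, mul_assoc _ _ (fourierInvOp M), fourierOp_mul,
            mul_one]
  have h2 := expOp_mul_mulOp (M := M) ((2 * Real.pi) • a) (memLp_freeSymbol ε t)
  have h3 := fourierOp_transOp (M := M) a
  rw [freeProp_eq]
  calc _ = fourierInvOp M * (mulOp M (freeSymbol ε t) * (fourierOp M * transOp M a)) := by
        noncomm_ring
    _ = fourierInvOp M * (expOp M ((2 * Real.pi) • a) * mulOp M (freeSymbol ε t))
        * fourierOp M := by rw [h3, h2]; noncomm_ring
    _ = transOp M a * fourierInvOp M * mulOp M (freeSymbol ε t) * fourierOp M := by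
        rw [h1]; noncomm_ring
    _ = _ := by noncomm_ring

/-- Conjugation inverts both the phase and the Fourier transform. The square of the Fourier
transform is the reflection, which commutes with the even symbol, so the order of transform and
inverse can be restored. -/
theorem conjOp_freeProp (ε t : ℝ) : conjOp (freeProp M ε t) = freeProp M ε (-t) := by
  have h1 : conjOp (fourierInvOp M) = fourierOp M := by
    rw [← conjOp_fourierOp, conjOp_conjOp]
  have h2 : conjOp (mulOp M (freeSymbol ε t)) = mulOp M (freeSymbol ε (-t)) := by
    rw [conjOp_mulOp (memLp_freeSymbol ε t)]; congr 1; ext x; exact freeSymbol_conj ε t x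
  have h3 : reflOp M * mulOp M (freeSymbol ε (-t)) = mulOp M (freeSymbol ε (-t)) * reflOp M :=
    reflOp_mulOp (memLp_freeSymbol ε (-t)) (freeSymbol_neg_arg ε (-t))
  rw [← fourierOp_mul_fourierOp] at h3
  rw [freeProp_eq, conjOp_mul, conjOp_mul, h1, h2, conjOp_fourierOp, freeProp_eq]
  set m := mulOp M (freeSymbol ε (-t))
  calc fourierOp M * (m * fourierInvOp M)
      = fourierInvOp M * (fourierOp M * fourierOp M * m) * fourierInvOp M := by
        rw [← mul_assoc (fourierInvOp M), ← mul_assoc (fourierInvOp M), fourierInvOp_mul,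
          one_mul, mul_assoc]
    _ = fourierInvOp M * (m * fourierOp M) * (fourierOp M * fourierInvOp M) := by
        rw [h3]; noncomm_ring
    _ = _ := by rw [fourierOp_mul, mul_one]

/-- The symbol is a quadratic phase, so its quotient by a translate is a constant times a linear
phase, that is, a boost in Fourier space. -/
theorem freeSymbol_mul_shift (ε t : ℝ) (b x : R3) :
    freeSymbol ε (-t) x * freeSymbol ε t (x + -b)
      = Complex.exp (Complex.I * ((-(ε * t * (2 * Real.pi * ‖b‖) ^ 2) : ℝ) : ℂ))
        * phase ((2 * Real.pi) • ((2 * ε * t) • ((2 * Real.pi) • b))) x := by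
  rw [freeSymbol, freeSymbol, phase, ← Complex.exp_add, ← Complex.exp_add]
  congr 1
  have h1 : ⟪(2 * Real.pi) • ((2 * ε * t) • ((2 * Real.pi) • b)), x⟫_ℝ
      = 8 * (ε * t * Real.pi ^ 2) * ⟪x, b⟫_ℝ := by
    rw [inner_smul_left, inner_smul_left, inner_smul_left, real_inner_comm]
    simp; ring
  have h2 : ‖x + -b‖ ^ 2 = ‖x‖ ^ 2 - 2 * ⟪x, b⟫_ℝ + ‖b‖ ^ 2 := by
    rw [← sub_eq_add_neg]; exact norm_sub_sq_real x b
  rw [h1, mul_pow _ ‖x‖, mul_pow _ ‖b‖, mul_pow _ ‖x + -b‖, h2]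
  push_cast
  ring

/-- The Galilei relation: a boost transported by the free flow picks up a translation by `2εtp`.
This is the only channel through which the kinetic energy affects the commutators with `e^{ip·x̂}`.
The phase `c` cancels when an operator is conjugated. -/
theorem freeProp_expOp (ε t : ℝ) (p : R3) :
    ∃ c : ℂ, ‖c‖ = 1 ∧ freeProp M ε (-t) * expOp M p * freeProp M ε t
      = c • (expOp M p * transOp M ((2 * ε * t) • p)) := by
  obtain ⟨b, rfl⟩ : ∃ b : R3, p = (2 * Real.pi) • b := ⟨(2 * Real.pi)⁻¹ • p, by
    rw [smul_smul, mul_inv_cancel₀ (by positivity), one_smul]⟩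
  set c := Complex.exp (Complex.I * ((-(ε * t * (2 * Real.pi * ‖b‖) ^ 2) : ℝ) : ℂ)) with hc
  have hcn : ‖c‖ = 1 := by rw [hc, mul_comm]; exact Complex.norm_exp_ofReal_mul_I _
  set a : R3 := (2 * ε * t) • ((2 * Real.pi) • b) with ha
  refine ⟨c * phase ((2 * Real.pi) • b) a, by rw [norm_mul, hcn, norm_phase, one_mul], ?_⟩
  have hshift : MemLp (fun x => freeSymbol ε t (x + -b)) ∞ (volume : Measure R3) :=
    memLp_top_of_norm_le (((continuous_freeSymbol ε t).comp
      (continuous_add_const (-b))).aestronglyMeasurable) fun x => (norm_freeSymbol ε t _).le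
  have hψ : (fun x => freeSymbol ε (-t) x * freeSymbol ε t (x + -b))
      = fun x => c * phase ((2 * Real.pi) • a) x := funext fun x => freeSymbol_mul_shift ε t b x
  have hψm : MemLp (fun x => c * phase ((2 * Real.pi) • a) x) ∞ (volume : Measure R3) :=
    (memLp_phase _).const_mul c
  have e0 : mulOp M (fun x => c * phase ((2 * Real.pi) • a) x)
      = c • expOp M ((2 * Real.pi) • a) := by
    refine ext_ae fun f => ?_
    filter_upwards [mulOp_ae hψm f, Lp.coeFn_smul c (expOp M ((2 * Real.pi) • a) f),
      mulOp_ae (memLp_phase ((2 * Real.pi) • a)) f] with x h1 h2 h3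
    rw [h1, _root_.smul_apply, h2, Pi.smul_apply, expOp_eq, h3, mul_smul]
  have e1 : fourierInvOp M * expOp M ((2 * Real.pi) • a) * fourierOp M = transOp M a := by
    rw [mul_assoc, ← fourierOp_transOp, ← mul_assoc, fourierInvOp_mul, one_mul]
  have e2 : fourierOp M * expOp M ((2 * Real.pi) • b) * fourierInvOp M = transOp M (-b) := by
    rw [fourierOp_expOp, mul_assoc, fourierOp_mul, mul_one]
  have e3 : mulOp M (freeSymbol ε (-t)) * (transOp M (-b) * mulOp M (freeSymbol ε t))
      = c • (expOp M ((2 * Real.pi) • a) * transOp M (-b)) := by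
    rw [transOp_mulOp (-b) (memLp_freeSymbol ε t) hshift, ← mul_assoc,
      mulOp_mul (memLp_freeSymbol ε (-t)) hshift (by rw [hψ]; exact hψm), hψ, e0, smul_mul_assoc]
  rw [mul_smul c, ← transOp_expOp]
  rw [freeProp_eq, freeProp_eq]
  calc _ = fourierInvOp M * (mulOp M (freeSymbol ε (-t)) * ((fourierOp M
        * expOp M ((2 * Real.pi) • b) * fourierInvOp M) * mulOp M (freeSymbol ε t)))
        * fourierOp M := by noncomm_ring
    _ = c • (fourierInvOp M * expOp M ((2 * Real.pi) • a) * (transOp M (-b) * fourierOp M)) := by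
        rw [e2, e3]; noncomm_ring
    _ = c • (fourierInvOp M * expOp M ((2 * Real.pi) • a) * fourierOp M
        * expOp M ((2 * Real.pi) • b)) := by rw [← fourierOp_expOp]; noncomm_ring
    _ = _ := by rw [e1]

end FreePropagator

/-! ### From strong convergence to convergence in Hilbert-Schmidt norm. -/

section HSConvergence

variable {M : ℕ}

theorem HS.norm_sq_eq_tsum (A : HS M) :
    HasSum (fun i => ‖HS.op A (basis M i)‖ ^ 2) (‖A‖ ^ 2) := by
  have h := Complex.hasSum_re (HS.hasSum_inner A A)
  convert! h using 1
  · ext i; rw [inner_self_eq_norm_sq_to_K]; norm_cast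
  · rw [inner_self_eq_norm_sq_to_K]; norm_cast

/-- Dominated convergence in the sum over the basis: each `(U_i - V) A e_k` tends to zero and is
dominated by a multiple of the square summable `‖A e_k‖`. -/
theorem HS.tendsto_lmul {ι : Type*} {l : Filter ι} {U : ι → Op M} {V : Op M} {C : ℝ}
    (hC : ∀ i, ‖U i‖ ≤ C) (h : ∀ x, Tendsto (fun i => U i x) l (𝓝 (V x))) (A : HS M) :
    Tendsto (fun i => HS.lmul (U i) A) l (𝓝 (HS.lmul V A)) := by
  rw [tendsto_iff_norm_sub_tendsto_zero]
  have h2 : Tendsto (fun i => ∑' k, ‖(U i - V) (HS.op A (basis M k))‖ ^ 2) l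
      (𝓝 (∑' _k : basisIndex M, (0 : ℝ))) := by
    refine tendsto_tsum_of_dominated_convergence
      (bound := fun k => (|C| + ‖V‖) ^ 2 * ‖HS.op A (basis M k)‖ ^ 2)
      ((HS.norm_sq_eq_tsum A).summable.mul_left _) (fun k => ?_)
      (Eventually.of_forall fun i k => ?_)
    · have := ((h (HS.op A (basis M k))).sub_const (V (HS.op A (basis M k)))).norm.pow 2
      simpa using this
    · rw [Real.norm_of_nonneg (by positivity), ← mul_pow]
      gcongr
      refine ((U i - V).le_opNorm _).trans ?_
      gcongr
      exact (norm_sub_le _ _).trans (add_le_add_left ((hC i).trans (le_abs_self C)) _)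
  have h3 := (Real.continuous_sqrt.tendsto _).comp h2
  simp only [tsum_zero, Real.sqrt_zero] at h3
  refine h3.congr fun i => ?_
  have h4 := HS.norm_sq_eq_tsum (HS.lmul (U i - V) A)
  simp only [HS.op_lmul, mul_apply_eq_comp] at h4
  rw [Function.comp_apply, h4.tsum_eq, Real.sqrt_sq (norm_nonneg _), HS.lmul_sub]

theorem HS.rmul_eq_adj (A : HS M) (B : Op M) :
    HS.rmul B A = HS.adj (HS.lmul (star B) (HS.adj A)) := by
  ext1; simp

theorem norm_star_op (A : Op M) : ‖star A‖ = ‖A‖ := by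
  rw [ContinuousLinearMap.star_eq_adjoint, LinearIsometryEquiv.norm_map]

theorem HS.tendsto_rmul {ι : Type*} {l : Filter ι} {U : ι → Op M} {V : Op M} {C : ℝ}
    (hC : ∀ i, ‖U i‖ ≤ C) (h : ∀ x, Tendsto (fun i => star (U i) x) l (𝓝 (star V x)))
    (A : HS M) : Tendsto (fun i => HS.rmul (U i) A) l (𝓝 (HS.rmul V A)) := by
  simp only [HS.rmul_eq_adj]
  exact (HS.continuous_adj.tendsto _).comp
    (HS.tendsto_lmul (C := C) (fun i => by rw [norm_star_op]; exact hC i) h _)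

theorem norm_op_le_one_of_isometry {U : Op M} (h : ∀ x, ‖U x‖ = ‖x‖) : ‖U‖ ≤ 1 :=
  ContinuousLinearMap.opNorm_le_bound _ zero_le_one fun x => by rw [h, one_mul]

theorem HS.norm_lmul_of_isometry {U : Op M} (h : ∀ x, ‖U x‖ = ‖x‖) (A : HS M) :
    ‖HS.lmul U A‖ = ‖A‖ := by
  rw [← sq_eq_sq₀ (norm_nonneg _) (norm_nonneg _)]
  refine (HS.norm_sq_eq_tsum (HS.lmul U A)).unique ?_
  simp only [HS.op_lmul, mul_apply_eq_comp, h]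
  exact HS.norm_sq_eq_tsum A

theorem HS.norm_rmul_of_isometry {U : Op M} (h : ∀ x, ‖star U x‖ = ‖x‖) (A : HS M) :
    ‖HS.rmul U A‖ = ‖A‖ := by
  rw [HS.rmul_eq_adj, HS.norm_adj, HS.norm_lmul_of_isometry h, HS.norm_adj]

/-- The two-sided product `L A R`. -/
def HS.bimul (L R : Op M) (A : HS M) : HS M := HS.lmul L (HS.rmul R A)

@[simp] theorem HS.op_bimul (L R : Op M) (A : HS M) :
    HS.op (HS.bimul L R A) = L * (HS.op A * R) := rfl

theorem HS.bimul_sub (L R : Op M) (A B : HS M) :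
    HS.bimul L R (A - B) = HS.bimul L R A - HS.bimul L R B := by
  simp [HS.bimul]

theorem HS.norm_bimul_le {L R : Op M} (hL : ‖L‖ ≤ 1) (hR : ‖R‖ ≤ 1) (A : HS M) :
    ‖HS.bimul L R A‖ ≤ ‖A‖ := by
  refine (HS.norm_lmul_le _ _).trans ?_
  calc ‖L‖ * ‖HS.rmul R A‖ ≤ 1 * (‖A‖ * 1) := by
        gcongr
        exact (HS.norm_rmul_le _ _).trans (by gcongr)
    _ = ‖A‖ := by ring

theorem HS.tendsto_bimul {ι : Type*} {l : Filter ι} {L R : ι → Op M} {L' R' : Op M}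
    {A : ι → HS M} {A' : HS M} (hL1 : ∀ i, ‖L i‖ ≤ 1) (hR1 : ∀ i, ‖R i‖ ≤ 1)
    (hL : ∀ x, Tendsto (fun i => L i x) l (𝓝 (L' x)))
    (hR : ∀ x, Tendsto (fun i => star (R i) x) l (𝓝 (star R' x)))
    (hA : Tendsto A l (𝓝 A')) :
    Tendsto (fun i => HS.bimul (L i) (R i) (A i)) l (𝓝 (HS.bimul L' R' A')) := by
  have h1 : Tendsto (fun i => HS.rmul (R i) A' - HS.rmul R' A') l (𝓝 0) := by
    simpa using (HS.tendsto_rmul hR1 hR A').sub_const (HS.rmul R' A')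
  have h2 : Tendsto (fun i => HS.bimul (L i) (R i) (A i - A')) l (𝓝 0) := by
    refine squeeze_zero_norm (fun i => HS.norm_bimul_le (hL1 i) (hR1 i) _) ?_
    have := (hA.sub_const A').norm
    simpa using this
  have h3 : Tendsto (fun i => HS.lmul (L i) (HS.rmul (R i) A' - HS.rmul R' A')) l (𝓝 0) := by
    refine squeeze_zero_norm (a := fun i => ‖HS.rmul (R i) A' - HS.rmul R' A'‖) (fun i => ?_) ?_
    · refine (HS.norm_lmul_le _ _).trans ?_
      exact mul_le_of_le_one_left (norm_nonneg _) (hL1 i)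
    · simpa using h1.norm
  have h4 := (h2.add h3).add (HS.tendsto_lmul hL1 hL (HS.rmul R' A'))
  simp only [add_zero, zero_add] at h4
  refine h4.congr fun i => ?_
  simp only [HS.bimul, map_sub]
  abel

end HSConvergence

/-! ### Existence of weak integrals and of weak limit points. -/

section WeakLimits

variable {M : ℕ}

theorem exists_isWeakIntegral {Q : Type*} [MeasurableSpace Q] {μ : Measure Q} {Φ : Q → Op M}
    (hm : ∀ g, AEStronglyMeasurable (fun q => Φ q g) μ) {c : Q → ℝ} (hc : Integrable c μ)
    (hb : ∀ q, ‖Φ q‖ ≤ c q) : ∃ B, IsWeakIntegral μ Φ B := by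
  have hbg : ∀ g q, ‖Φ q g‖ ≤ c q * ‖g‖ := fun g q => (Φ q).le_of_opNorm_le (hb q) g
  have hi : ∀ g, Integrable (fun q => Φ q g) μ := fun g =>
    (hc.mul_const ‖g‖).mono' (hm g) (Eventually.of_forall (hbg g))
  refine ⟨LinearMap.mkContinuous
    { toFun := fun g => ∫ q, Φ q g ∂μ
      map_add' := fun f g => by
        rw [← integral_add (hi f) (hi g)]; simp only [map_add]
      map_smul' := fun z g => by
        simp only [map_smul, RingHom.id_apply]
        exact integral_smul z _ } (∫ q, c q ∂μ) (fun g => ?_), fun f g => ⟨?_, ?_⟩⟩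
  · rw [← integral_mul_const]
    exact norm_integral_le_of_norm_le (hc.mul_const _) (Eventually.of_forall (hbg g))
  · exact (innerSL ℂ f).integrable_comp (hi g)
  · exact ((innerSL ℂ f).integral_comp_comm (hi g)).symm

/-- Along an ultrafilter all matrix elements converge simultaneously by compactness of discs; the
limits form a bounded sesquilinear form, which is represented by an operator. -/
theorem exists_weakLimit {ι : Type*} (u : Ultrafilter ι) (Q : ι → Op M) {C : ℝ}
    (hC : ∀ k, ‖Q k‖ ≤ C) :
    ∃ B : Op M, ∀ f g, Tendsto (fun k => ⟪f, Q k g⟫_ℂ) u (𝓝 ⟪f, B g⟫_ℂ) := by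
  have hb : ∀ v w k, ‖⟪Q k v, w⟫_ℂ‖ ≤ C * ‖v‖ * ‖w‖ := fun v w k =>
    (norm_inner_le_norm _ _).trans (by gcongr; exact (Q k).le_of_opNorm_le (hC k) v)
  have hex : ∀ v w, ∃ z, ‖z‖ ≤ C * ‖v‖ * ‖w‖ ∧ Tendsto (fun k => ⟪Q k v, w⟫_ℂ) u (𝓝 z) :=
    fun v w => by
    obtain ⟨z, hz, hz'⟩ := (isCompact_closedBall (0 : ℂ) (C * ‖v‖ * ‖w‖)).ultrafilter_le_nhds
      (u.map fun k => ⟪Q k v, w⟫_ℂ) (by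
        rw [Ultrafilter.coe_map, le_principal_iff, mem_map]
        exact Filter.univ_mem' fun k => mem_closedBall_zero_iff.2 (hb v w k))
    exact ⟨z, mem_closedBall_zero_iff.1 hz, hz'⟩
  choose ℓ hℓ hlim using hex
  let b : H M →ₗ⋆[ℂ] H M →ₗ[ℂ] ℂ := LinearMap.mk₂'ₛₗ (starRingEnd ℂ) (RingHom.id ℂ) ℓ
    (fun v v' w => tendsto_nhds_unique (hlim _ _)
      (by simpa only [map_add, inner_add_left] using (hlim v w).add (hlim v' w)))
    (fun c v w => tendsto_nhds_unique (hlim _ _)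
      (by simpa only [map_smul, inner_smul_left, smul_eq_mul] using (hlim v w).const_mul _))
    (fun v w w' => tendsto_nhds_unique (hlim _ _)
      (by simpa only [inner_add_right] using (hlim v w).add (hlim v w')))
    (fun c v w => tendsto_nhds_unique (hlim _ _)
      (by simpa only [inner_smul_right, smul_eq_mul, RingHom.id_apply] using (hlim v w).const_mul _))
  refine ⟨InnerProductSpace.continuousLinearMapOfBilin (b.mkContinuous₂ C hℓ), fun f g => ?_⟩
  have h1 : Tendsto (fun k => ⟪Q k g, f⟫_ℂ) u
      (𝓝 ⟪InnerProductSpace.continuousLinearMapOfBilin (b.mkContinuous₂ C hℓ) g, f⟫_ℂ) := by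
    rw [InnerProductSpace.continuousLinearMapOfBilin_apply]
    exact hlim g f
  have h2 := (Complex.continuous_conj.tendsto _).comp h1
  simpa only [Function.comp_def, inner_conj_symm] using h2

/-- Weak lower semicontinuity of the Hilbert-Schmidt norm, by the same duality with `B` as in
`IsWeakIntegral.hsNorm_le`. -/
theorem hsNorm_weakLimit_le {ι : Type*} {l : Filter ι} [l.NeBot] {Q : ι → Op M} {B : Op M}
    (hlim : ∀ f g, Tendsto (fun k => ⟪f, Q k g⟫_ℂ) l (𝓝 ⟪f, B g⟫_ℂ)) {n : ℝ} (hn : 0 ≤ n)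
    (hQ : ∀ k, hsNorm (Q k) ≤ ENNReal.ofReal n) : hsNorm B ≤ ENNReal.ofReal n := by
  refine hsNorm_le_of_sq_le ?_
  rw [ENNReal.tsum_eq_iSup_sum, ← ENNReal.ofReal_pow hn]
  refine iSup_le fun F => ?_
  have hconv : ∀ A : Op M, ∑ i ∈ F, ‖A (basis M i)‖ₑ ^ 2
      = ENNReal.ofReal (∑ i ∈ F, ‖A (basis M i)‖ ^ 2) := fun A => by
    rw [ENNReal.ofReal_sum_of_nonneg (fun i _ => by positivity)]
    exact Finset.sum_congr rfl fun i _ => enorm_sq_eq_ofReal _ _ rfl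
  rw [hconv]
  refine ENNReal.ofReal_le_ofReal ?_
  set n2 : ℝ := ∑ i ∈ F, ‖B (basis M i)‖ ^ 2 with hn2
  have h0 : 0 ≤ n2 := by positivity
  have hk : ∀ k, ‖∑ i ∈ F, ⟪B (basis M i), Q k (basis M i)⟫_ℂ‖ ≤ √n2 * n := fun k => by
    have e1 : ∑ i ∈ F, ‖Q k (basis M i)‖ ^ 2 ≤ n ^ 2 := by
      rw [← ENNReal.ofReal_le_ofReal_iff (by positivity), ← hconv, ENNReal.ofReal_pow hn]
      refine le_trans ?_ (pow_le_pow_left' (hQ k) 2)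
      rw [hsNorm_sq]
      exact ENNReal.sum_le_tsum F
    calc _ ≤ ∑ i ∈ F, ‖B (basis M i)‖ * ‖Q k (basis M i)‖ :=
          (norm_sum_le _ _).trans (Finset.sum_le_sum fun i _ => norm_inner_le_norm _ _)
      _ ≤ √(∑ i ∈ F, ‖B (basis M i)‖ ^ 2) * √(∑ i ∈ F, ‖Q k (basis M i)‖ ^ 2) :=
          Real.sum_mul_le_sqrt_mul_sqrt _ _ _
      _ ≤ √n2 * n := by
          gcongr
          exact Real.sqrt_le_iff.2 ⟨hn, e1⟩
  have h1 : Tendsto (fun k => ‖∑ i ∈ F, ⟪B (basis M i), Q k (basis M i)⟫_ℂ‖) l (𝓝 n2) := by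
    have h2 := (tendsto_finsetSum F fun i _ => hlim (B (basis M i)) (basis M i)).norm
    convert! h2 using 2
    have h3 : ∑ i ∈ F, ⟪B (basis M i), B (basis M i)⟫_ℂ = ((n2 : ℝ) : ℂ) := by
      rw [hn2]; push_cast
      exact Finset.sum_congr rfl fun i _ => by rw [inner_self_eq_norm_sq_to_K]; norm_cast
    rw [h3, Complex.norm_real, Real.norm_of_nonneg h0]
  have h2 : n2 ≤ √n2 * n := le_of_tendsto h1 (Eventually.of_forall hk)
  by_cases hz : n2 = 0
  · rw [hz]; positivity
  · have hp : 0 < √n2 := Real.sqrt_pos.2 (lt_of_le_of_ne h0 (Ne.symm hz))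
    have h3 : √n2 * √n2 ≤ √n2 * n := by rwa [Real.mul_self_sqrt h0]
    have h4 := le_of_mul_le_mul_left h3 hp
    rw [← Real.sq_sqrt h0]; gcongr

end WeakLimits

/-! ### Translations of Schwartz functions are differentiable in `L²`, and `[A, ε∇]` appears as a
derivative. -/

section GradientCommutator

open FourierTransform LineDeriv

variable {M : ℕ}

theorem norm_exp_sub_one_sub_le (θ : ℝ) :
    ‖Complex.exp (Complex.I * θ) - 1 - Complex.I * θ‖ ≤ 3 * θ ^ 2 := by
  by_cases h : |θ| ≤ 1
  · have h1 : ‖Complex.I * (θ : ℂ)‖ = |θ| := by simp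
    have := Complex.norm_exp_sub_one_sub_id_le (x := Complex.I * θ) (by rwa [h1])
    rw [h1, sq_abs] at this
    nlinarith [sq_nonneg θ]
  · have h1 : ‖Complex.I * (θ : ℂ)‖ = |θ| := by simp
    have h2 : ‖Complex.exp (Complex.I * θ)‖ = 1 := by
      rw [mul_comm]; exact Complex.norm_exp_ofReal_mul_I _
    have h3 := norm_sub_le (Complex.exp (Complex.I * θ) - 1) (Complex.I * θ)
    have h4 := norm_sub_le (Complex.exp (Complex.I * θ)) 1
    rw [h2, norm_one] at h4
    rw [h1] at h3
    rw [← sq_abs]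
    push Not at h
    nlinarith

theorem fourier_lineDeriv_apply (f : 𝓢(R3, Spin M)) (a ξ : R3) :
    𝓕 (∂_{a} f) ξ = (2 * Real.pi * Complex.I * ((⟪ξ, a⟫_ℝ : ℝ) : ℂ)) • (𝓕 f) ξ := by
  rw [SchwartzMap.fourier_lineDerivOp_eq]
  have : (inner ℝ · a : R3 → ℝ).HasTemperateGrowth := ((innerSL ℝ).flip a).hasTemperateGrowth
  simp [this, mul_smul]

/-- A Schwartz function as an element of the one-particle space. -/
def schwartzL2 (f : 𝓢(R3, Spin M)) : H M := f.toLp 2 volume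

/-- Second order Taylor bound, obtained pointwise on the Fourier side, where translation is
multiplication by a phase and `∂_a` by the linear term of its exponent. -/
theorem norm_transOp_sub_sub_le (f : 𝓢(R3, Spin M)) (a : R3) (h : ℝ) :
    ‖transOp M (h • a) (schwartzL2 f) - schwartzL2 f - (h : ℂ) • schwartzL2 (∂_{a} f)‖
      ≤ 3 * h ^ 2 * ‖schwartzL2 (∂_{a} (∂_{a} f))‖ := by
  rw [← norm_fourierOp_apply (_ - _), ← norm_fourierOp_apply (schwartzL2 (∂_{a} (∂_{a} f))),
    map_sub, map_sub, map_smul, ← mul_apply_eq_comp, fourierOp_transOp, mul_apply_eq_comp,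
    schwartzL2, schwartzL2, schwartzL2, fourierOp_schwartz, fourierOp_schwartz, fourierOp_schwartz]
  refine Lp.norm_le_mul_norm_of_ae_le_mul ?_
  set p : R3 := (2 * Real.pi) • h • a
  filter_upwards [Lp.coeFn_sub (expOp M p ((𝓕 f).toLp 2 volume) - (𝓕 f).toLp 2 volume)
      ((h : ℂ) • (𝓕 (∂_{a} f)).toLp 2 volume),
    Lp.coeFn_sub (expOp M p ((𝓕 f).toLp 2 volume)) ((𝓕 f).toLp 2 volume),
    Lp.coeFn_smul (h : ℂ) ((𝓕 (∂_{a} f)).toLp 2 volume), mulOp_ae (memLp_phase p) ((𝓕 f).toLp 2 volume),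
    (𝓕 f).coeFn_toLp 2 volume, (𝓕 (∂_{a} f)).coeFn_toLp 2 volume,
    (𝓕 (∂_{a} (∂_{a} f))).coeFn_toLp 2 volume] with ξ h1 h2 h3 h4 h5 h6 h7
  rw [h1, Pi.sub_apply, h2, Pi.sub_apply, h3, Pi.smul_apply, expOp_eq, h4, h5, h6, h7,
    fourier_lineDeriv_apply, fourier_lineDeriv_apply, fourier_lineDeriv_apply]
  set θ : ℝ := h * (2 * Real.pi * ⟪ξ, a⟫_ℝ)
  have e1 : phase p ξ = Complex.exp (Complex.I * θ) := by
    rw [phase]; congr 3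
    simp only [p, inner_smul_left]
    rw [real_inner_comm ξ a]
    simp [θ]; ring
  have e2 : phase p ξ • (𝓕 f) ξ - (𝓕 f) ξ
        - (h : ℂ) • (2 * Real.pi * Complex.I * ((⟪ξ, a⟫_ℝ : ℝ) : ℂ)) • (𝓕 f) ξ
      = (Complex.exp (Complex.I * θ) - 1 - Complex.I * θ) • (𝓕 f) ξ := by
    rw [e1, sub_smul, sub_smul, one_smul, smul_smul]
    congr 2
    simp [θ]; ring
  rw [e2, smul_smul, norm_smul, norm_smul]
  have e3 : ‖(2 * Real.pi * Complex.I * ((⟪ξ, a⟫_ℝ : ℝ) : ℂ)) * (2 * Real.pi * Complex.I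
      * ((⟪ξ, a⟫_ℝ : ℝ) : ℂ))‖ = (2 * Real.pi * ⟪ξ, a⟫_ℝ) ^ 2 := by
    rw [← sq, norm_pow]; simp [mul_pow]
  rw [e3, ← mul_assoc]
  gcongr
  refine (norm_exp_sub_one_sub_le θ).trans (le_of_eq ?_)
  simp [θ]; ring

theorem hasDerivAt_transOp_schwartz (f : 𝓢(R3, Spin M)) (a : R3) (s : ℝ) :
    HasDerivAt (fun s : ℝ => transOp M (s • a) (schwartzL2 f))
      (transOp M (s • a) (schwartzL2 (∂_{a} f))) s := by
  rw [hasDerivAt_iff_isLittleO_nhds_zero]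
  have h1 : ∀ h : ℝ, ‖transOp M ((s + h) • a) (schwartzL2 f) - transOp M (s • a) (schwartzL2 f)
      - h • transOp M (s • a) (schwartzL2 (∂_{a} f))‖
      ≤ 3 * ‖schwartzL2 (∂_{a} (∂_{a} f))‖ * ‖h ^ 2‖ := fun h => by
    have e : transOp M ((s + h) • a) (schwartzL2 f) - transOp M (s • a) (schwartzL2 f)
        - h • transOp M (s • a) (schwartzL2 (∂_{a} f))
        = transOp M (s • a) (transOp M (h • a) (schwartzL2 f) - schwartzL2 f
          - (h : ℂ) • schwartzL2 (∂_{a} f)) := by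
      rw [map_sub, map_sub, map_smul, ← mul_apply_eq_comp, transOp_mul, ← add_smul]
      rfl
    rw [e, norm_transOp_apply]
    refine (norm_transOp_sub_sub_le f a h).trans (le_of_eq ?_)
    rw [Real.norm_of_nonneg (sq_nonneg h)]; ring
  refine (Asymptotics.IsBigO.of_bound _ (Eventually.of_forall h1)).trans_isLittleO ?_
  exact Asymptotics.isLittleO_pow_id one_lt_two

theorem lineDeriv_schwartz_sum (f : 𝓢(R3, Spin M)) (a : R3) :
    (∂_{a} f : 𝓢(R3, Spin M))
      = ∑ j, (a j : ℂ) • (∂_{EuclideanSpace.single j (1 : ℝ)} f : 𝓢(R3, Spin M)) := by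
  ext1 x
  have ha : a = ∑ j, a j • EuclideanSpace.single j (1 : ℝ) := by
    have := (EuclideanSpace.basisFun (Fin 3) ℝ).sum_repr a
    simpa using this.symm
  rw [SchwartzMap.lineDerivOp_apply_eq_fderiv]
  conv_lhs => rw [ha]
  rw [map_sum]
  simp only [map_smul, _root_.sum_apply, _root_.smul_apply,
    SchwartzMap.lineDerivOp_apply_eq_fderiv]
  rfl

theorem hasDerivAt_inner_trans (A : Op M) (a : R3) (f g : 𝓢(R3, Spin M)) (s : ℝ) :
    HasDerivAt (fun s : ℝ => ⟪transOp M (s • a) (schwartzL2 f), A (transOp M (s • a) (schwartzL2 g))⟫_ℂ)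
      (⟪transOp M (s • a) (schwartzL2 f), A (transOp M (s • a) (schwartzL2 (∂_{a} g)))⟫_ℂ
        + ⟪transOp M (s • a) (schwartzL2 (∂_{a} f)),
          A (transOp M (s • a) (schwartzL2 g))⟫_ℂ) s := by
  have h1 := hasDerivAt_transOp_schwartz f a s
  have h2 := (A.restrictScalars ℝ).hasFDerivAt.comp_hasDerivAt s
    (hasDerivAt_transOp_schwartz g a s)
  exact h1.inner ℂ h2

theorem schwartzL2_sum {ι : Type*} (s : Finset ι) (c : ι → ℂ) (f : ι → 𝓢(R3, Spin M)) :
    schwartzL2 (∑ j ∈ s, c j • f j) = ∑ j ∈ s, c j • schwartzL2 (f j) := by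
  have h : ∀ f : 𝓢(R3, Spin M), schwartzL2 f = SchwartzMap.toLpCLM ℂ (Spin M) 2 volume f :=
    fun f => rfl
  simp only [h, map_sum, map_smul]

theorem transOp_schwartzL2 (a : R3) (f : 𝓢(R3, Spin M)) :
    transOp M a (schwartzL2 f) = schwartzL2 (SchwartzMap.compSubConstCLM ℂ (-a) f) :=
  transOp_schwartz a f

theorem lineDeriv_compSubConst (f : 𝓢(R3, Spin M)) (a b : R3) :
    (∂_{b} (SchwartzMap.compSubConstCLM ℂ a f) : 𝓢(R3, Spin M))
      = SchwartzMap.compSubConstCLM ℂ a (∂_{b} f) := by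
  ext1 x
  rw [SchwartzMap.lineDerivOp_apply_eq_fderiv, SchwartzMap.compSubConstCLM_apply,
    SchwartzMap.lineDerivOp_apply_eq_fderiv]
  have h : (⇑(SchwartzMap.compSubConstCLM ℂ a f) : R3 → Spin M) = fun x => f (x - a) := rfl
  rw [h, fderiv_comp_sub]

theorem op_ext_inner_schwartz {A B : Op M} (h : ∀ f g : 𝓢(R3, Spin M),
    ⟪schwartzL2 f, A (schwartzL2 g)⟫_ℂ = ⟪schwartzL2 f, B (schwartzL2 g)⟫_ℂ) : A = B := by
  refine op_ext_schwartz fun g => ?_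
  refine (denseRange_schwartz (M := M)).eq_of_inner_right (𝕜 := ℂ) ?_
  exact fun i => h i g

theorem isGradComm_iff {ε : ℝ} {A B : Op M} {j : Fin 3} :
    IsGradComm ε A j B ↔ ∀ f g : 𝓢(R3, Spin M), ⟪schwartzL2 f, B (schwartzL2 g)⟫_ℂ
      = (ε : ℂ) * ⟪schwartzL2 f, A (schwartzL2 (∂_{EuclideanSpace.single j (1 : ℝ)} g))⟫_ℂ
      + (ε : ℂ) * ⟪schwartzL2 (∂_{EuclideanSpace.single j (1 : ℝ)} f), A (schwartzL2 g)⟫_ℂ :=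
  Iff.rfl

/-- Passes from the three coordinate commutators to the commutator with an arbitrary directional
derivative, as needed to differentiate `τ_{sa} A τ_{-sa}`. -/
theorem sum_gradComm {ε : ℝ} (hε : ε ≠ 0) {A : Op M} {B : Fin 3 → Op M}
    (hB : ∀ j, IsGradComm ε A j (B j)) (b : R3) (f g : 𝓢(R3, Spin M)) :
    ⟪schwartzL2 f, A (schwartzL2 (∂_{b} g))⟫_ℂ + ⟪schwartzL2 (∂_{b} f), A (schwartzL2 g)⟫_ℂ
      = ⟪schwartzL2 f, ((ε : ℂ)⁻¹ • ∑ j, (b j : ℂ) • B j) (schwartzL2 g)⟫_ℂ := by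
  have hε' : (ε : ℂ) ≠ 0 := by exact_mod_cast hε
  have h1 : ∀ j, ⟪schwartzL2 f, (B j) (schwartzL2 g)⟫_ℂ = _ := fun j => isGradComm_iff.1 (hB j) f g
  rw [lineDeriv_schwartz_sum g b, lineDeriv_schwartz_sum f b, schwartzL2_sum, schwartzL2_sum]
  simp only [map_sum, map_smul, inner_sum, sum_inner, inner_smul_right, inner_smul_left,
    _root_.smul_apply, _root_.sum_apply, h1, Complex.conj_ofReal]
  rw [← Finset.sum_add_distrib, Finset.mul_sum]
  refine Finset.sum_congr rfl fun j _ => ?_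
  field_simp

end GradientCommutator

/-! ### Composition of uniformly bounded, strongly continuous families. -/

section StrongContinuity

variable {M : ℕ} {X : Type*} [TopologicalSpace X]

theorem continuous_op_apply {T : X → Op M} {C : ℝ} (hC : ∀ s, ‖T s‖ ≤ C)
    (hT : ∀ g, Continuous fun s => T s g) {x : X → H M} (hx : Continuous x) :
    Continuous fun s => T s (x s) := by
  refine continuous_iff_continuousAt.2 fun s => ?_
  have h1 : Tendsto (fun r => T r (x r - x s)) (𝓝 s) (𝓝 0) := by
    have h2 : Tendsto (fun r => C * ‖x r - x s‖) (𝓝 s) (𝓝 0) := by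
      have := ((hx.tendsto s).sub_const (x s)).norm.const_mul C
      simpa using this
    exact squeeze_zero_norm (fun r => (T r).le_of_opNorm_le (hC r) _) h2
  have h3 := h1.add ((hT (x s)).tendsto s)
  simp only [map_sub, sub_add_cancel, zero_add] at h3
  exact h3

theorem continuous_mul_apply {S T : X → Op M} {C : ℝ} (hC : ∀ s, ‖S s‖ ≤ C)
    (hS : ∀ g, Continuous fun s => S s g) (hT : ∀ g, Continuous fun s => T s g) (g : H M) :
    Continuous fun s => (S s * T s) g :=
  continuous_op_apply hC hS (hT g)

end StrongContinuity

/-! ### Bounds on `[A, ε∇]` are Lipschitz bounds for `a ↦ τ_a A τ_{-a}`. -/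

section TranslationCommutator

open FourierTransform LineDeriv

variable {M : ℕ}

theorem one_op_apply (f : H M) : (1 : Op M) f = f := rfl

theorem norm_transOp_le (a : R3) : ‖transOp M a‖ ≤ 1 :=
  norm_op_le_one_of_isometry (norm_transOp_apply a)

theorem continuous_transOp_apply (g : H M) : Continuous fun a : R3 => transOp M a g := by
  have h : ∀ a : R3, transOp M a g
      = fourierInvOp M (expOp M ((2 * Real.pi) • a) (fourierOp M g)) := fun a => by
    have := congrArg (fun T : Op M => (fourierInvOp M * T) g) (fourierOp_transOp (M := M) a)
    simp only [← mul_assoc, fourierInvOp_mul, one_mul] at this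
    exact this
  simp only [h]
  exact (fourierInvOp M).continuous.comp
    ((continuous_expOp_apply (fourierOp M g)).comp (continuous_const_smul _))

/-- Fundamental theorem of calculus along the segment from `0` to `a`, tested on Schwartz functions
and extended by density. -/
theorem isWeakIntegral_sub_trans {ε : ℝ} (hε : ε ≠ 0) {A : Op M} {B : Fin 3 → Op M}
    (hB : ∀ j, IsGradComm ε A j (B j)) (a : R3) :
    IsWeakIntegral (volume.restrict (Set.Ioc (0 : ℝ) 1))
      (fun s => transOp M (s • a) * ((ε : ℂ)⁻¹ • ∑ j, (a j : ℂ) • B j) * transOp M (-(s • a)))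
      (A - transOp M a * A * transOp M (-a)) := by
  set G : Op M := (ε : ℂ)⁻¹ • ∑ j, (a j : ℂ) • B j with hG
  set Φ : ℝ → Op M := fun s => transOp M (s • a) * G * transOp M (-(s • a)) with hΦ
  have hc1 : ∀ g, Continuous fun s : ℝ => transOp M (s • a) g := fun g =>
    (continuous_transOp_apply g).comp (by fun_prop)
  have hc2 : ∀ g, Continuous fun s : ℝ => transOp M (-(s • a)) g := fun g =>
    (continuous_transOp_apply g).comp (by fun_prop)
  have hΦc : ∀ g, Continuous fun s => Φ s g := fun g =>
    continuous_op_apply (T := fun s : ℝ => transOp M (s • a)) (fun s => norm_transOp_le (s • a)) hc1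
      (G.continuous.comp (hc2 g))
  have hΦb : ∀ s, ‖Φ s‖ ≤ ‖G‖ := fun s => by
    calc ‖Φ s‖ ≤ ‖transOp M (s • a)‖ * ‖G‖ * ‖transOp M (-(s • a))‖ :=
          (norm_mul_le _ _).trans (by gcongr; exact norm_mul_le _ _)
      _ ≤ 1 * ‖G‖ * 1 := by gcongr <;> exact norm_transOp_le _
      _ = ‖G‖ := by ring
  obtain ⟨B', hB'⟩ := exists_isWeakIntegral (μ := volume.restrict (Set.Ioc (0 : ℝ) 1)) (Φ := Φ)
    (fun g => (hΦc g).aestronglyMeasurable) (c := fun _ => ‖G‖) (integrable_const _) hΦb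
  have key : A - transOp M a * A * transOp M (-a) = B' := by
    refine op_ext_inner_schwartz fun f g => ?_
    rw [(hB' _ _).2, ← intervalIntegral.integral_of_le zero_le_one]
    have hadj : ∀ (s : ℝ) (T : Op M) (x y : H M), ⟪x, (transOp M (s • a) * T) y⟫_ℂ
        = ⟪transOp M (-(s • a)) x, T y⟫_ℂ := fun s T x y => by
      rw [← star_transOp, ContinuousLinearMap.star_eq_adjoint, ContinuousLinearMap.adjoint_inner_left]
      rfl
    have hder : ∀ s : ℝ, HasDerivAt (fun s : ℝ => -⟪transOp M (s • (-a)) (schwartzL2 f),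
        A (transOp M (s • (-a)) (schwartzL2 g))⟫_ℂ) ⟪schwartzL2 f, Φ s (schwartzL2 g)⟫_ℂ s :=
      fun s => by
      convert! (hasDerivAt_inner_trans A (-a) f g s).neg using 1
      -- The translations are absorbed into the Schwartz functions, so that the form identity for
      -- the commutator can be used at every `s`. The direction `-a` here accounts for the sign in
      -- front of the inner product.
      rw [transOp_schwartzL2, transOp_schwartzL2, transOp_schwartzL2, transOp_schwartzL2,
        ← lineDeriv_compSubConst, ← lineDeriv_compSubConst, sum_gradComm hε hB,
        ← transOp_schwartzL2, ← transOp_schwartzL2]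
      simp only [hΦ, mul_assoc, hadj]
      have e : ((ε : ℂ)⁻¹ • ∑ j, ((-a) j : ℂ) • B j) = -G := by
        rw [hG, ← smul_neg, ← Finset.sum_neg_distrib]
        congr 1
        refine Finset.sum_congr rfl fun j _ => ?_
        rw [← neg_smul]; congr 1; simp
      rw [e, _root_.neg_apply, inner_neg_right, neg_neg, smul_neg]
      rfl
    rw [intervalIntegral.integral_eq_sub_of_hasDerivAt (fun s _ => hder s)
      ((continuous_const.inner (hΦc _)).intervalIntegrable 0 1)]
    have := hadj 1 (A * transOp M (-a)) (schwartzL2 f) (schwartzL2 g)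
    rw [one_smul] at this
    rw [mul_assoc, _root_.sub_apply, inner_sub_right, this, one_smul, zero_smul, transOp_zero]
    rw [mul_apply_eq_comp, one_op_apply, one_op_apply]
    ring
  rw [key]; exact hB'

theorem gradCommHS_le_three {ε : ℝ} {A : Op M} {n : ℝ} (h : ∀ j, partialCommHS ε A j ≤ ENNReal.ofReal n) :
    gradCommHS ε A ≤ ENNReal.ofReal (3 * n) := by
  rw [gradCommHS]
  calc (∑ j, partialCommHS ε A j ^ 2) ^ (1 / 2 : ℝ)
      ≤ ((3 * ENNReal.ofReal n) ^ 2) ^ (1 / 2 : ℝ) := by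
        gcongr
        calc ∑ j, partialCommHS ε A j ^ 2 ≤ ∑ _j : Fin 3, ENNReal.ofReal n ^ 2 :=
              Finset.sum_le_sum fun j _ => pow_le_pow_left' (h j) 2
          _ = 3 * ENNReal.ofReal n ^ 2 := by simp
          _ ≤ 9 * ENNReal.ofReal n ^ 2 := by gcongr; norm_num
          _ = (3 * ENNReal.ofReal n) ^ 2 := by rw [mul_pow]; norm_num
    _ = 3 * ENNReal.ofReal n := by
        rw [← ENNReal.rpow_natCast, ← ENNReal.rpow_mul]; norm_num
    _ = ENNReal.ofReal (3 * n) := by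
        rw [ENNReal.ofReal_mul (by norm_num)]; norm_num

theorem partialCommHS_le_gradCommHS (ε : ℝ) (A : Op M) (j : Fin 3) :
    partialCommHS ε A j ≤ gradCommHS ε A := by
  calc partialCommHS ε A j = (partialCommHS ε A j ^ 2) ^ (1 / 2 : ℝ) := by
        rw [← ENNReal.rpow_natCast, ← ENNReal.rpow_mul]; norm_num
    _ ≤ _ := by
        rw [gradCommHS]
        gcongr
        exact Finset.single_le_sum (f := fun j => partialCommHS ε A j ^ 2)
          (fun i _ => zero_le) (Finset.mem_univ j)

/-- The Hilbert-Schmidt norm of the line integral is at most that of `ε⁻¹ a·[A, ε∇]`. The factor 3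
comes from bounding each component of `a` by `‖a‖`. -/
theorem hsNorm_sub_trans_le {ε : ℝ} (hε : 0 < ε) {A : Op M} {n : ℝ} (hn : 0 ≤ n)
    (h : gradCommHS ε A ≤ ENNReal.ofReal n) (a : R3) :
    hsNorm (A - transOp M a * A * transOp M (-a)) ≤ ENNReal.ofReal (3 * (‖a‖ / ε) * n) := by
  -- The norm of a partial commutator is an infimum over operators; the slack `η` provides an
  -- operator close to it.
  have hstep : ∀ η : ℝ, 0 < η → hsNorm (A - transOp M a * A * transOp M (-a))
      ≤ ENNReal.ofReal (3 * (‖a‖ / ε) * (n + η)) := fun η hη => by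
    have hj : ∀ j, ∃ B, IsGradComm ε A j B ∧ hsNorm B ≤ ENNReal.ofReal (n + η) := fun j => by
      have h1 : partialCommHS ε A j < ENNReal.ofReal (n + η) :=
        ((partialCommHS_le_gradCommHS ε A j).trans h).trans_lt
          ((ENNReal.ofReal_lt_ofReal_iff (by linarith)).2 (by linarith))
      rw [partialCommHS] at h1
      obtain ⟨B, hB⟩ := iInf_lt_iff.1 h1
      obtain ⟨hB1, hB2⟩ := iInf_lt_iff.1 hB
      exact ⟨B, hB1, hB2.le⟩
    choose B hB hBn using hj
    have hBt : ∀ j, hsNorm (B j) < ∞ := fun j => (hBn j).trans_lt ENNReal.ofReal_lt_top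
    have hBh : ∀ j, ‖HS.mk (B j) (hBt j)‖ ≤ n + η := fun j =>
      HS.norm_le_of_hsNorm_le (by linarith) (by simpa using hBn j)
    set G : HS M := (ε : ℂ)⁻¹ • ∑ j, (a j : ℂ) • HS.mk (B j) (hBt j) with hG
    have hGn : ‖G‖ ≤ 3 * (‖a‖ / ε) * (n + η) := by
      rw [hG, norm_smul, norm_inv, Complex.norm_real, Real.norm_of_nonneg hε.le]
      have h2 : ‖∑ j, (a j : ℂ) • HS.mk (B j) (hBt j)‖ ≤ ∑ _j : Fin 3, ‖a‖ * (n + η) :=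
        norm_sum_le_of_le _ fun j _ => by
          rw [norm_smul, Complex.norm_real]
          gcongr
          · exact PiLp.norm_apply_le a j
          · exact hBh j
      calc ε⁻¹ * _ ≤ ε⁻¹ * ∑ _j : Fin 3, ‖a‖ * (n + η) := by gcongr
        _ = _ := by simp; field_simp
    have hGop : HS.op G = (ε : ℂ)⁻¹ • ∑ j, (a j : ℂ) • B j := by
      rw [hG, map_smul, map_sum]; simp only [map_smul, HS.op_mk]
    have hw := isWeakIntegral_sub_trans hε.ne' hB a
    refine (hw.hsNorm_le (c := fun _ => 3 * (‖a‖ / ε) * (n + η)) (integrable_const _)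
      (fun _ => by positivity) (fun s => ?_)).trans (le_of_eq ?_)
    · rw [← hGop, mul_assoc]
      have : transOp M (s • a) * (HS.op G * transOp M (-(s • a)))
          = HS.op (HS.bimul (transOp M (s • a)) (transOp M (-(s • a))) G) :=
        (HS.op_bimul _ _ _).symm
      rw [this, HS.hsNorm_op]
      exact ENNReal.ofReal_le_ofReal
        ((HS.norm_bimul_le (norm_transOp_le _) (norm_transOp_le _) _).trans hGn)
    · simp
  refine ge_of_tendsto (x := 𝓝[>] (0 : ℝ))
    (f := fun η => ENNReal.ofReal (3 * (‖a‖ / ε) * (n + η))) ?_ ?_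
  · have : Tendsto (fun η : ℝ => 3 * (‖a‖ / ε) * (n + η)) (𝓝[>] (0 : ℝ))
        (𝓝 (3 * (‖a‖ / ε) * (n + 0))) := by
      refine Tendsto.mono_left ?_ nhdsWithin_le_nhds
      exact (by fun_prop : Continuous fun η : ℝ => 3 * (‖a‖ / ε) * (n + η)).tendsto 0
    rw [add_zero] at this
    exact (ENNReal.continuous_ofReal.tendsto _).comp this
  · filter_upwards [self_mem_nhdsWithin] with η hη using hstep η hη

/-- The difference quotients in direction `e_j` are bounded in Hilbert-Schmidt norm by `n`. A weak
limit point inherits the bound, and on Schwartz functions it is the commutator. -/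
theorem partialCommHS_le_of_trans {ε : ℝ} (hε : 0 < ε) {A : Op M} {n : ℝ} (hn : 0 ≤ n)
    (h : ∀ a, hsNorm (A - transOp M a * A * transOp M (-a)) ≤ ENNReal.ofReal (‖a‖ / ε * n))
    (j : Fin 3) : partialCommHS ε A j ≤ ENNReal.ofReal n := by
  set e : R3 := EuclideanSpace.single j (1 : ℝ) with he
  have hen : ‖e‖ = 1 := by simp [he]
  set t : ℕ → ℝ := fun k => 1 / ((k : ℝ) + 1) with ht
  have ht0 : ∀ k, 0 < t k := fun k => by positivity
  set D : ℕ → Op M := fun k => A - transOp M (t k • e) * A * transOp M (-(t k • e)) with hD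
  have hDt : ∀ k, hsNorm (D k) < ∞ := fun k => (h _).trans_lt ENNReal.ofReal_lt_top
  set Q : ℕ → HS M := fun k => ((ε / t k : ℝ) : ℂ) • HS.mk (D k) (hDt k) with hQ
  have hQn : ∀ k, ‖Q k‖ ≤ n := fun k => by
    have h1 : ‖HS.mk (D k) (hDt k)‖ ≤ t k / ε * n := by
      refine HS.norm_le_of_hsNorm_le (by positivity [ht0 k]) ?_
      rw [HS.op_mk]
      refine (h _).trans_eq ?_
      rw [norm_smul, hen, mul_one, Real.norm_of_nonneg (ht0 k).le]
    rw [hQ, norm_smul, Complex.norm_real, Real.norm_of_nonneg (by positivity [ht0 k])]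
    calc ε / t k * _ ≤ ε / t k * (t k / ε * n) := by
          gcongr
      _ = n := by have := (ht0 k).ne'; field_simp
  have hlow : ((hyperfilter ℕ : Ultrafilter ℕ) : Filter ℕ) ≤ atTop := Nat.hyperfilter_le_atTop
  obtain ⟨B, hB⟩ := exists_weakLimit (hyperfilter ℕ) (fun k => HS.op (Q k)) (C := n)
    fun k => (HS.norm_op_le _).trans (hQn k)
  have hBn : hsNorm B ≤ ENNReal.ofReal n := hsNorm_weakLimit_le hB hn fun k => by
    rw [HS.hsNorm_op]; exact ENNReal.ofReal_le_ofReal (hQn k)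
  refine (iInf₂_le B ?_).trans hBn
  rw [isGradComm_iff]
  intro f g
  -- The same matrix elements also converge to the derivative at zero of the translated form, which
  -- identifies the weak limit.
  refine tendsto_nhds_unique (hB (schwartzL2 f) (schwartzL2 g)) ?_
  have hd := hasDerivAt_inner_trans A (-e) f g 0
  have ht1 : Tendsto t (hyperfilter ℕ) (𝓝[≠] 0) := by
    refine tendsto_nhdsWithin_of_tendsto_nhds_of_eventually_within _ ?_
      (Eventually.of_forall fun k => (ht0 k).ne')
    exact tendsto_one_div_add_atTop_nhds_zero_nat.mono_left hlow
  have h2 := ((hasDerivAt_iff_tendsto_slope.1 hd).comp ht1).const_mul (-(ε : ℂ))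
  simp only [zero_smul, transOp_zero, one_op_apply] at h2
  have hneg : ∀ f : 𝓢(R3, Spin M), schwartzL2 (∂_{-e} f : 𝓢(R3, Spin M))
      = -schwartzL2 (∂_{e} f : 𝓢(R3, Spin M)) := fun f => by
    have : (∂_{-e} f : 𝓢(R3, Spin M)) = -(∂_{e} f : 𝓢(R3, Spin M)) := by
      ext1 x
      rw [_root_.neg_apply, SchwartzMap.lineDerivOp_apply_eq_fderiv,
        SchwartzMap.lineDerivOp_apply_eq_fderiv, map_neg]
    rw [this]
    exact (map_neg (SchwartzMap.toLpCLM ℂ (Spin M) 2 volume) _)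
  rw [hneg, hneg, map_neg, inner_neg_right, inner_neg_left] at h2
  convert! h2 using 1
  · funext k
    simp only [Function.comp_apply, slope_def_module, sub_zero, hQ, map_smul, HS.op_mk, hD,
      zero_smul, transOp_zero, one_op_apply, _root_.smul_apply, inner_smul_right, _root_.sub_apply,
      inner_sub_right, mul_assoc]
    have hadj : ⟪schwartzL2 f, (transOp M (t k • e) * (A * transOp M (-(t k • e)))) (schwartzL2 g)⟫_ℂ
        = ⟪transOp M (t k • (-e)) (schwartzL2 f), A (transOp M (t k • (-e)) (schwartzL2 g))⟫_ℂ := by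
      rw [smul_neg, ← star_transOp (M := M) (t k • e), ContinuousLinearMap.star_eq_adjoint,
        ContinuousLinearMap.adjoint_inner_left]
      rfl
    rw [hadj]
    have := (ht0 k).ne'
    simp only [Complex.real_smul]
    push_cast
    field_simp
    ring
  · congr 1
    rw [← he]
    ring

theorem gradCommHS_le_of_trans {ε : ℝ} (hε : 0 < ε) {A : Op M} {n : ℝ} (hn : 0 ≤ n)
    (h : ∀ a, hsNorm (A - transOp M a * A * transOp M (-a)) ≤ ENNReal.ofReal (‖a‖ / ε * n)) :
    gradCommHS ε A ≤ ENNReal.ofReal (3 * n) :=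
  gradCommHS_le_three fun j => partialCommHS_le_of_trans hε hn h j

end TranslationCommutator

/-! ### Square integrable kernels of Hilbert-Schmidt operators. -/

section Kernels

variable {M : ℕ}

/-- The value space of matrix valued integral kernels. -/
abbrev KernelSpace (M : ℕ) : Type := EuclideanSpace ℂ (Fin M × Fin M)

/-- The rank one matrix `v w*`. -/
def rankOneMatrix (v w : Spin M) : KernelSpace M :=
  WithLp.toLp 2 fun p => v p.1 * (starRingEnd ℂ) (w p.2)

theorem norm_rankOneMatrix (v w : Spin M) : ‖rankOneMatrix v w‖ = ‖v‖ * ‖w‖ := by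
  rw [EuclideanSpace.norm_eq, EuclideanSpace.norm_eq, EuclideanSpace.norm_eq,
    ← Real.sqrt_mul (by positivity), Fintype.sum_prod_type, Finset.sum_mul]
  congr 1
  refine Finset.sum_congr rfl fun i _ => ?_
  rw [Finset.mul_sum]
  refine Finset.sum_congr rfl fun j _ => ?_
  simp [rankOneMatrix, mul_pow]

theorem inner_rankOneMatrix (v w : Spin M) (κ : KernelSpace M) :
    ⟪rankOneMatrix v w, κ⟫_ℂ
      = ∑ σ, (starRingEnd ℂ) (v σ) * ∑ τ, κ (σ, τ) * w τ := by
  rw [PiLp.inner_apply, Fintype.sum_prod_type]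
  refine Finset.sum_congr rfl fun i _ => ?_
  rw [Finset.mul_sum]
  refine Finset.sum_congr rfl fun j _ => ?_
  simp [rankOneMatrix]; ring

theorem inner_rankOneMatrix_rankOneMatrix (v w v' w' : Spin M) :
    ⟪rankOneMatrix v w, rankOneMatrix v' w'⟫_ℂ = ⟪v, v'⟫_ℂ * ⟪w', w⟫_ℂ := by
  rw [inner_rankOneMatrix, PiLp.inner_apply, PiLp.inner_apply, Finset.sum_mul_sum]
  refine Finset.sum_congr rfl fun i _ => ?_
  rw [Finset.mul_sum]
  refine Finset.sum_congr rfl fun j _ => ?_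
  simp [rankOneMatrix]; ring

theorem rankOneMatrix_smul_smul (c d : ℂ) (v w : Spin M) :
    rankOneMatrix (c • v) (d • w) = (c * (starRingEnd ℂ) d) • rankOneMatrix v w := by
  ext p; simp [rankOneMatrix]; ring

theorem continuous_rankOneMatrix :
    Continuous fun p : Spin M × Spin M => rankOneMatrix p.1 p.2 := by
  unfold rankOneMatrix
  refine (PiLp.continuous_toLp 2 _).comp (continuous_pi fun p => ?_)
  refine Continuous.mul ?_ (Complex.continuous_conj.comp ?_)
  · exact (EuclideanSpace.proj p.1 : Spin M →L[ℂ] ℂ).continuous.comp continuous_fst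
  · exact (EuclideanSpace.proj p.2 : Spin M →L[ℂ] ℂ).continuous.comp continuous_snd

/-- The kernel of the rank one operator `u ⟨v, ·⟩`. -/
def tensorFun (u v : H M) (z : R3 × R3) : KernelSpace M := rankOneMatrix (u z.1) (v z.2)

theorem memLp_tensorFun (u v : H M) : MemLp (tensorFun u v) 2 (volume : Measure (R3 × R3)) := by
  have hm : AEStronglyMeasurable (tensorFun u v) (volume : Measure (R3 × R3)) := by
    have h1 : AEStronglyMeasurable (fun z : R3 × R3 => u z.1) (volume.prod volume) :=
      (Lp.memLp u).1.comp_fst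
    have h2 : AEStronglyMeasurable (fun z : R3 × R3 => v z.2) (volume.prod volume) :=
      (Lp.memLp v).1.comp_snd
    exact continuous_rankOneMatrix.comp_aestronglyMeasurable (h1.prodMk h2)
  rw [memLp_two_iff_integrable_sq_norm hm]
  have h1 := (memLp_two_iff_integrable_sq_norm (Lp.memLp u).1).1 (Lp.memLp u)
  have h2 := (memLp_two_iff_integrable_sq_norm (Lp.memLp v).1).1 (Lp.memLp v)
  refine (h1.mul_prod h2).congr (Eventually.of_forall fun z => ?_)
  simp only [tensorFun, norm_rankOneMatrix, mul_pow]

theorem integrable_inner_of_memLp {α E : Type*} [MeasurableSpace α] {μ : Measure α}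
    [NormedAddCommGroup E] [InnerProductSpace ℂ E] {f g : α → E} (hf : MemLp f 2 μ)
    (hg : MemLp g 2 μ) : Integrable (fun x => ⟪f x, g x⟫_ℂ) μ := by
  refine (L2.integrable_inner (𝕜 := ℂ) (hf.toLp f) (hg.toLp g)).congr ?_
  filter_upwards [hf.coeFn_toLp, hg.coeFn_toLp] with x h1 h2
  rw [h1, h2]

/-- `k` is a square integrable kernel of `A`, in the weak sense. -/
def IsWeakKernel (A : Op M) (k : R3 × R3 → KernelSpace M) : Prop :=
  MemLp k 2 (volume : Measure (R3 × R3)) ∧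
    ∀ f g, ⟪f, A g⟫_ℂ = ∫ z, ⟪tensorFun f g z, k z⟫_ℂ

/-- A kernel on `(ℝ³ × {1,…,M})²` as a matrix valued kernel on `ℝ³ × ℝ³`. -/
def kernelVec (K : R3 × Fin M → R3 × Fin M → ℂ) (z : R3 × R3) : KernelSpace M :=
  WithLp.toLp 2 fun p => K (z.1, p.1) (z.2, p.2)

/-- A matrix valued kernel on `ℝ³ × ℝ³` as a kernel on `(ℝ³ × {1,…,M})²`. -/
def kernelOf (k : R3 × R3 → KernelSpace M) (z w : R3 × Fin M) : ℂ := k (z.1, w.1) (z.2, w.2)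

theorem kernelVec_kernelOf (k : R3 × R3 → KernelSpace M) : kernelVec (kernelOf k) = k := rfl

theorem ae_memLp_slice {E : Type*} [NormedAddCommGroup E] {k : R3 × R3 → E}
    (hk : MemLp k 2 (volume : Measure (R3 × R3))) :
    ∀ᵐ x : R3, MemLp (fun y => k (x, y)) 2 volume := by
  have h1 : Integrable (fun z => ‖k z‖ ^ 2) (volume.prod volume : Measure (R3 × R3)) :=
    (memLp_two_iff_integrable_sq_norm hk.1).1 hk
  have h2 : AEStronglyMeasurable k (volume.prod volume : Measure (R3 × R3)) := hk.1
  filter_upwards [h1.prod_right_ae, h2.prodMk_left] with x hx hx'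
  exact (memLp_two_iff_integrable_sq_norm hx').2 hx

theorem ae_integrable_kernel_mul {k : R3 × R3 → KernelSpace M}
    (hk : MemLp k 2 (volume : Measure (R3 × R3))) (g : H M) :
    ∀ᵐ x : R3, ∀ p : Fin M × Fin M, Integrable (fun y => k (x, y) p * g y p.2) := by
  filter_upwards [ae_memLp_slice hk] with x hx p
  exact (hx.eval_piLp p).integrable_mul ((Lp.memLp g).eval_piLp p.2)

theorem integral_inner_slice {k : R3 → KernelSpace M} {g : R3 → Spin M} (v : Spin M)
    (h : ∀ p : Fin M × Fin M, Integrable (fun y => k y p * g y p.2)) :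
    ∫ y, ⟪rankOneMatrix v (g y), k y⟫_ℂ
      = ∑ σ, (starRingEnd ℂ) (v σ) * ∑ τ, ∫ y, k y (σ, τ) * g y τ := by
  simp only [inner_rankOneMatrix]
  rw [integral_finsetSum _ fun σ _ =>
    (integrable_finsetSum _ fun τ _ => h (σ, τ)).const_mul _]
  refine Finset.sum_congr rfl fun σ _ => ?_
  rw [integral_const_mul, integral_finsetSum _ fun τ _ => h (σ, τ)]

theorem memLp_kernelVec {K : R3 × Fin M → R3 × Fin M → ℂ} :
    MemLp (kernelVec K) 2 (volume : Measure (R3 × R3)) ↔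
      ∀ σ τ : Fin M, MemLp (fun z : R3 × R3 => K (z.1, σ) (z.2, τ)) 2 volume := by
  rw [memLp_piLp_iff]
  exact ⟨fun h σ τ => h (σ, τ), fun h p => h p.1 p.2⟩

theorem HasKernel.isWeakKernel {A : Op M} {K : R3 × Fin M → R3 × Fin M → ℂ}
    (h : HasKernel A K) : IsWeakKernel A (kernelVec K) := by
  have hk := memLp_kernelVec.2 h.1
  refine ⟨hk, fun f g => ?_⟩
  have hi := integrable_inner_of_memLp (memLp_tensorFun f g) hk
  have e : ∫ z, ⟪tensorFun f g z, kernelVec K z⟫_ℂ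
      = ∫ x, ∫ y, ⟪tensorFun f g (x, y), kernelVec K (x, y)⟫_ℂ := integral_prod _ hi
  rw [e, L2.inner_def]
  refine integral_congr_ae ?_
  filter_upwards [ae_integrable_kernel_mul hk g, h.2 g] with x hx hx'
  have := integral_inner_slice (k := fun y => kernelVec K (x, y)) (g := g) (f x) hx
  simp only [tensorFun]
  rw [this, PiLp.inner_apply]
  refine Finset.sum_congr rfl fun σ _ => ?_
  rw [hx' σ]
  simp [kernelVec, mul_comm]

/-- Testing with the indicator of a set of finite measure in one spin component determines the
integrals of `(A g)(·, σ)` over all such sets, hence its values almost everywhere. -/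
theorem IsWeakKernel.hasKernel {A : Op M} {k : R3 × R3 → KernelSpace M}
    (h : IsWeakKernel A k) : HasKernel A (kernelOf k) := by
  refine ⟨memLp_kernelVec.1 (by rw [kernelVec_kernelOf]; exact h.1), fun g => ?_⟩
  rw [ae_all_iff]
  intro σ
  set F : R3 → ℂ := fun x => ∑ τ, ∫ y, kernelOf k (x, σ) (y, τ) * g y τ with hF
  have key : ∀ s : Set R3, MeasurableSet s → volume s < ∞ →
      IntegrableOn F s ∧ ∫ x in s, A g x σ = ∫ x in s, F x := by
    intro s hs hs'
    set f : H M := indicatorConstLp 2 hs hs'.ne (EuclideanSpace.single σ (1 : ℂ)) with hf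
    have hfx : f =ᵐ[volume] s.indicator fun _ => EuclideanSpace.single σ (1 : ℂ) :=
      indicatorConstLp_coeFn
    have hi := integrable_inner_of_memLp (memLp_tensorFun f g) h.1
    have hi' : Integrable (fun z => ⟪tensorFun f g z, k z⟫_ℂ)
      (volume.prod volume : Measure (R3 × R3)) := hi
    have h1 : (fun x => ∫ y, ⟪tensorFun f g (x, y), k (x, y)⟫_ℂ) =ᵐ[volume] s.indicator F := by
      filter_upwards [ae_integrable_kernel_mul h.1 g, hfx] with x hx hx'
      have := integral_inner_slice (k := fun y => k (x, y)) (g := g) (f x) hx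
      simp only [tensorFun]
      rw [this, hx']
      by_cases hxs : x ∈ s
      · simp [hxs, hF, kernelOf]
      · simp [hxs]
    have hFi : Integrable (s.indicator F) := hi'.integral_prod_left.congr h1
    refine ⟨(integrable_indicator_iff hs).1 hFi, ?_⟩
    have h2 : ⟪f, A g⟫_ℂ = ∫ x in s, A g x σ := by
      rw [hf, L2.inner_indicatorConstLp_eq_setIntegral_inner]
      refine integral_congr_ae (Eventually.of_forall fun x => ?_)
      simp [EuclideanSpace.inner_single_left]
    rw [← h2, h.2 f g, ← integral_indicator hs, ← integral_congr_ae h1]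
    exact integral_prod _ hi'
  refine ae_eq_of_forall_setIntegral_eq_of_sigmaFinite (fun s hs hs' => ?_)
    (fun s hs hs' => (key s hs hs').1) fun s hs hs' => (key s hs hs').2
  have := ((Lp.memLp (A g)).eval_piLp σ).restrict s
  have hfin : IsFiniteMeasure (volume.restrict s) := ⟨by simpa using hs'⟩
  exact this.integrable one_le_two

theorem hasKernel_iff {A : Op M} {K : R3 × Fin M → R3 × Fin M → ℂ} :
    HasKernel A K ↔ IsWeakKernel A (kernelVec K) :=
  ⟨HasKernel.isWeakKernel, fun h => h.hasKernel⟩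

/-- The kernel of a rank one operator as an element of `L²`. -/
def tensorLp (u v : H M) : Lp (KernelSpace M) 2 (volume : Measure (R3 × R3)) :=
  (memLp_tensorFun u v).toLp _

theorem inner_tensorLp (u v : H M) (k : Lp (KernelSpace M) 2 (volume : Measure (R3 × R3))) :
    ⟪tensorLp u v, k⟫_ℂ = ∫ z, ⟪tensorFun u v z, k z⟫_ℂ := by
  rw [L2.inner_def]
  refine integral_congr_ae ?_
  filter_upwards [(memLp_tensorFun u v).coeFn_toLp] with z hz
  rw [tensorLp, hz]

theorem inner_tensorLp_tensorLp (u v u' v' : H M) :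
    ⟪tensorLp u v, tensorLp u' v'⟫_ℂ = ⟪u, u'⟫_ℂ * ⟪v', v⟫_ℂ := by
  rw [inner_tensorLp, L2.inner_def, L2.inner_def]
  refine Eq.trans ?_ (integral_prod_mul (μ := volume) (ν := volume) (fun x : R3 => ⟪u x, u' x⟫_ℂ)
    (fun y : R3 => ⟪v' y, v y⟫_ℂ))
  refine integral_congr_ae ?_
  filter_upwards [(memLp_tensorFun u' v').coeFn_toLp] with z hz
  rw [tensorLp, hz]
  exact inner_rankOneMatrix_rankOneMatrix _ _ _ _

theorem summable_of_orthogonal {ι E : Type*} [NormedAddCommGroup E] [InnerProductSpace ℂ E]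
    [CompleteSpace E] {v : ι → E} (horth : ∀ i j, i ≠ j → ⟪v i, v j⟫_ℂ = 0)
    (hs : Summable fun i => ‖v i‖ ^ 2) : Summable v := by
  have hOF : OrthogonalFamily ℂ (fun i => (ℂ ∙ v i : Submodule ℂ E))
      fun i => (ℂ ∙ v i : Submodule ℂ E).subtypeₗᵢ := by
    intro i j hij x y
    obtain ⟨a, ha⟩ := Submodule.mem_span_singleton.1 x.2
    obtain ⟨b, hb⟩ := Submodule.mem_span_singleton.1 y.2
    change ⟪(x : E), (y : E)⟫_ℂ = 0
    rw [← ha, ← hb, inner_smul_left, inner_smul_right, horth i j hij, mul_zero, mul_zero]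
  exact (hOF.summable_iff_norm_sq_summable
    fun i => ⟨v i, Submodule.mem_span_singleton_self _⟩).2 hs

/-- Every Hilbert-Schmidt operator has a square integrable kernel; Hilbert-Schmidt inner products
are `L²` inner products with the kernel. -/
theorem HS.exists_kernel (A : HS M) : ∃ k : Lp (KernelSpace M) 2 (volume : Measure (R3 × R3)),
    (∀ f g, ⟪f, op A g⟫_ℂ = ⟪tensorLp f g, k⟫_ℂ) ∧
      HasSum (fun i => tensorLp (op A (basis M i)) (basis M i)) k := by
  -- The kernel is the sum of the rank one kernels `(A e_i) ⊗ conj(e_i)`. They are pairwise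
  -- orthogonal with square summable norms, so the series converges in `L²`.
  set v : basisIndex M → Lp (KernelSpace M) 2 (volume : Measure (R3 × R3)) :=
    fun i => tensorLp (op A (basis M i)) (basis M i) with hv
  have horth : ∀ i j, i ≠ j → ⟪v i, v j⟫_ℂ = 0 := fun i j hij => by
    rw [hv, inner_tensorLp_tensorLp, (basis M).orthonormal.2 hij.symm, mul_zero]
  have hnorm : ∀ i, ‖v i‖ ^ 2 = ‖op A (basis M i)‖ ^ 2 := fun i => by
    have h1 : ⟪v i, v i⟫_ℂ = ⟪op A (basis M i), op A (basis M i)⟫_ℂ := by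
      rw [hv, inner_tensorLp_tensorLp, inner_self_eq_norm_sq_to_K (basis M i),
        (basis M).orthonormal.1 i]
      simp
    rw [inner_self_eq_norm_sq_to_K, inner_self_eq_norm_sq_to_K] at h1
    exact_mod_cast h1
  have hs : Summable v := by
    refine summable_of_orthogonal horth ?_
    have : Summable fun i => ‖op A (basis M i)‖ ^ 2 := by
      have := (hasSum_inner A A).summable.norm
      refine this.congr fun i => ?_
      rw [inner_self_eq_norm_sq_to_K]; simp
    exact this.congr fun i => (hnorm i).symm
  refine ⟨∑' i, v i, fun f g => ?_, hs.hasSum⟩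
  have h1 : HasSum (fun i => ⟪tensorLp f g, v i⟫_ℂ) ⟪tensorLp f g, ∑' i, v i⟫_ℂ :=
    hs.hasSum.mapL (innerSL ℂ (tensorLp f g))
  refine HasSum.unique ?_ h1
  have h2 : HasSum (fun i => ((basis M).repr g i) • basis M i) g := (basis M).hasSum_repr g
  have h3 := (h2.mapL (op A)).mapL (innerSL ℂ f)
  convert! h3 using 1
  funext i
  simp only [hv, inner_tensorLp_tensorLp, map_smul, innerSL_apply_apply, smul_eq_mul,
    HilbertBasis.repr_apply_apply]
  ring

theorem HS.exists_isWeakKernel (A : HS M) : ∃ k, IsWeakKernel (op A) k := by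
  obtain ⟨k, hk, -⟩ := A.exists_kernel
  exact ⟨k, Lp.memLp k, fun f g => by rw [hk, inner_tensorLp]⟩

end Kernels

/-! ### Fourier representation of the potential and the moments of its transform. -/

section Potential

open FourierTransform

variable {V : R3 → ℝ}

theorem conj_vHat (V : R3 → ℝ) (q : R3) : (starRingEnd ℂ) (vHat V q) = vHat V (-q) := by
  rw [vHat, vHat, map_mul, map_inv₀, Complex.conj_ofReal, ← integral_conj]
  congr 1
  refine integral_congr_ae (Eventually.of_forall fun x => ?_)
  simp only [map_mul, Complex.conj_ofReal, ← Complex.exp_conj, map_neg, Complex.conj_I,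
    inner_neg_left]
  push_cast
  ring_nf

theorem vHat_neg (hV : ∀ x, V x = V (-x)) (q : R3) : vHat V (-q) = vHat V q := by
  rw [vHat, vHat]
  congr 1
  rw [← integral_neg_eq_self]
  refine integral_congr_ae (Eventually.of_forall fun x => ?_)
  simp only [inner_neg_neg, ← hV]

theorem fourier_eq_vHat (V : R3 → ℝ) (ξ : R3) :
    𝓕 (fun x => (V x : ℂ)) ξ = (((2 * Real.pi) ^ 3 : ℝ) : ℂ) * vHat V ((2 * Real.pi) • ξ) := by
  have h : (((2 * Real.pi) ^ 3 : ℝ) : ℂ) ≠ 0 := by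
    exact_mod_cast (by positivity : (2 * Real.pi) ^ 3 ≠ 0)
  rw [vHat, mul_inv_cancel_left₀ h, Real.fourier_eq']
  refine integral_congr_ae (Eventually.of_forall fun x => ?_)
  simp only [smul_eq_mul, inner_smul_left, real_inner_comm x ξ]
  congr 2
  simp
  ring

/-- The substitution `q ↦ 2πq` translates between the normalisation of `vHat` and the Fourier
transform with `2π` in the exponent. -/
theorem integral_vHat_phase (V : R3 → ℝ) (x : R3) :
    ∫ q, vHat V q * phase q x = 𝓕⁻ (𝓕 fun x => (V x : ℂ)) x := by
  have h0 : (0 : ℝ) ≤ 2 * Real.pi := by positivity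
  have h := Measure.integral_comp_smul_of_nonneg (volume : Measure R3)
    (fun q => vHat V q * phase q x) (2 * Real.pi) (hR := h0)
  have h3 : Module.finrank ℝ R3 = 3 := by simp
  rw [h3] at h
  have hp : (2 * Real.pi) ^ 3 ≠ 0 := by positivity
  have h4 : ∫ q, vHat V q * phase q x
      = (2 * Real.pi) ^ 3 • ∫ q, vHat V ((2 * Real.pi) • q) * phase ((2 * Real.pi) • q) x := by
    rw [h, smul_smul, mul_inv_cancel₀ hp, one_smul]
  rw [h4, Real.fourierInv_eq', ← integral_smul]
  refine integral_congr_ae (Eventually.of_forall fun q => ?_)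
  simp only [fourier_eq_vHat, smul_eq_mul, phase, Complex.real_smul, inner_smul_left]
  rw [← mul_assoc, mul_comm (Complex.exp _)]
  congr 2
  simp
  ring

/-- Inversion almost everywhere, without continuity of `v`: both sides are tested against smooth
compactly supported functions and the transforms are moved onto the test function, where Schwartz
inversion applies. -/
theorem ae_eq_fourierInv_fourier {v : R3 → ℂ} (hv : Integrable v) (hv' : Integrable (𝓕 v)) :
    v =ᵐ[volume] 𝓕⁻ (𝓕 v) := by
  have hL : Continuous fun p : R3 × R3 => innerₗ R3 p.1 p.2 := continuous_inner
  have hc : Continuous (𝓕⁻ (𝓕 v)) := by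
    have : Continuous (VectorFourier.fourierIntegral Real.fourierChar volume (-innerₗ R3) (𝓕 v)) :=
      VectorFourier.fourierIntegral_continuous Real.continuous_fourierChar (by
        have := hL.neg; exact this) hv'
    exact this
  refine ae_eq_of_integral_contDiff_smul_eq hv.locallyIntegrable hc.locallyIntegrable
    fun g hg hgc => ?_
  have hgc' : HasCompactSupport fun x => (g x : ℂ) := hgc.comp_left Complex.ofReal_zero
  set φ : 𝓢(R3, ℂ) := hgc'.toSchwartzMap (Complex.ofRealCLM.contDiff.comp hg) with hφ
  have hφx : ∀ x, φ x = (g x : ℂ) := fun x => rfl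
  have e1 : ∫ ξ, 𝓕 v ξ • (𝓕⁻ φ) ξ = ∫ x, v x • (𝓕 (𝓕⁻ φ)) x := by
    have := VectorFourier.integral_fourierIntegral_smul_eq_flip (L := innerₗ R3)
      Real.continuous_fourierChar hL hv ((𝓕⁻ φ).integrable (μ := volume))
    rw [flip_innerₗ] at this
    convert! this using 1
  have e2 : ∫ x, φ x • 𝓕⁻ (𝓕 v) x = ∫ ξ, (𝓕⁻ φ) ξ • 𝓕 v ξ := by
    have := VectorFourier.integral_fourierIntegral_smul_eq_flip (L := -innerₗ R3)
      Real.continuous_fourierChar (by have := hL.neg; exact this) (φ.integrable (μ := volume)) hv'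
    have h2 : (-innerₗ R3 : R3 →ₗ[ℝ] R3 →ₗ[ℝ] ℝ).flip = -innerₗ R3 := by
      ext x y; simp [real_inner_comm]
    rw [h2] at this
    simp only [SchwartzMap.fourierInv_coe]
    exact this.symm
  rw [FourierTransform.fourier_fourierInv_eq] at e1
  simp only [Complex.real_smul, ← hφx]
  simp only [smul_eq_mul] at e1 e2
  rw [e2]
  simp only [mul_comm (φ _), mul_comm ((𝓕⁻ φ) _)]
  exact e1.symm

variable {C₀ : ℝ}

theorem IsPotential.continuous_vHat (hV : IsPotential C₀ V) : Continuous (vHat V) := by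
  have h : vHat V = fun q => (((2 * Real.pi) ^ 3 : ℝ) : ℂ)⁻¹
      * 𝓕 (fun x => (V x : ℂ)) ((2 * Real.pi)⁻¹ • q) := by
    funext q
    have h : (((2 * Real.pi) ^ 3 : ℝ) : ℂ) ≠ 0 := by
      exact_mod_cast (by positivity : (2 * Real.pi) ^ 3 ≠ 0)
    rw [fourier_eq_vHat, smul_inv_smul₀ (by positivity), inv_mul_cancel_left₀ h]
  rw [h]
  have h2 : Continuous (𝓕 fun x => (V x : ℂ)) :=
    VectorFourier.fourierIntegral_continuous Real.continuous_fourierChar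
      (continuous_inner : Continuous fun p : R3 × R3 => innerₗ R3 p.1 p.2) hV.integrable.ofReal
  exact continuous_const.mul (h2.comp (continuous_const_smul _))

theorem IsPotential.integrable_norm_vHat (hV : IsPotential C₀ V) :
    Integrable fun q => ‖vHat V q‖ := by
  have hc := hV.continuous_vHat
  refine hV.fourier_integrable.mono' hc.norm.aestronglyMeasurable
    (Eventually.of_forall fun q => ?_)
  rw [norm_norm]
  nlinarith [norm_nonneg (vHat V q), sq_nonneg ‖q‖]

theorem IsPotential.integrable_vHat (hV : IsPotential C₀ V) : Integrable (vHat V) :=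
  (integrable_norm_iff hV.continuous_vHat.aestronglyMeasurable).1 hV.integrable_norm_vHat

theorem IsPotential.ae_eq (hV : IsPotential C₀ V) :
    ∀ᵐ x : R3, (V x : ℂ) = ∫ q, vHat V q * phase q x := by
  have hi : Integrable (𝓕 fun x => (V x : ℂ)) := by
    have h1 : Integrable fun ξ : R3 => vHat V ((2 * Real.pi) • ξ) :=
      hV.integrable_vHat.comp_smul (by positivity)
    refine (h1.const_mul (((2 * Real.pi) ^ 3 : ℝ) : ℂ)).congr
      (Eventually.of_forall fun ξ => (fourier_eq_vHat V ξ).symm)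
  filter_upwards [ae_eq_fourierInv_fourier (hV.integrable.ofReal (𝕜 := ℂ)) hi] with x hx
  rw [integral_vHat_phase]
  exact hx

theorem IsPotential.nonneg (hV : IsPotential C₀ V) : 0 ≤ C₀ :=
  (integral_nonneg fun q => by positivity).trans hV.fourier_bound

theorem IsPotential.integral_norm_le (hV : IsPotential C₀ V) : ∫ q, ‖vHat V q‖ ≤ C₀ := by
  refine (integral_mono hV.integrable_norm_vHat hV.fourier_integrable fun q => ?_).trans
    hV.fourier_bound
  nlinarith [norm_nonneg (vHat V q), sq_nonneg ‖q‖]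

theorem IsPotential.integrable_mul_norm (hV : IsPotential C₀ V) :
    Integrable fun q => ‖vHat V q‖ * (‖q‖ * (1 + ‖q‖)) := by
  refine (hV.fourier_integrable.const_mul 2).mono'
    (hV.continuous_vHat.norm.mul (by fun_prop)).aestronglyMeasurable
    (Eventually.of_forall fun q => ?_)
  rw [Real.norm_of_nonneg (by positivity)]
  have h1 : ‖q‖ * (1 + ‖q‖) ≤ 2 * (1 + ‖q‖ ^ 2) := by nlinarith [sq_nonneg (‖q‖ - 1)]
  nlinarith [mul_le_mul_of_nonneg_left h1 (norm_nonneg (vHat V q))]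

/-- The moment needed for translating the potential: one `|q|` from the phase difference and `1 +
|q|` from the commutator with `e^{iq·x̂}`. -/
theorem IsPotential.integral_mul_norm_le (hV : IsPotential C₀ V) :
    ∫ q, ‖vHat V q‖ * (‖q‖ * (1 + ‖q‖)) ≤ 2 * C₀ := by
  calc _ ≤ ∫ q, 2 * (‖vHat V q‖ * (1 + ‖q‖ ^ 2)) := by
        refine integral_mono hV.integrable_mul_norm (hV.fourier_integrable.const_mul 2) fun q => ?_
        have h1 : ‖q‖ * (1 + ‖q‖) ≤ 2 * (1 + ‖q‖ ^ 2) := by nlinarith [sq_nonneg (‖q‖ - 1)]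
        nlinarith [mul_le_mul_of_nonneg_left h1 (norm_nonneg (vHat V q))]
    _ ≤ 2 * C₀ := by
        rw [integral_const_mul]; linarith [hV.fourier_bound]

end Potential

/-! ### Exchange and pairing operators as averages of boosted operators. -/

section Exchange

variable {M : ℕ} {V : R3 → ℝ} {C₀ : ℝ}

theorem memLp_smul_of_ae_bound {α E : Type*} [MeasurableSpace α] {μ : Measure α}
    [NormedAddCommGroup E] [NormedSpace ℂ E] {c : α → ℂ} {k : α → E} {C : ℝ}
    (hc : AEStronglyMeasurable c μ) (hC : ∀ᵐ z ∂μ, ‖c z‖ ≤ C) (hk : MemLp k 2 μ) :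
    MemLp (fun z => c z • k z) 2 μ := by
  refine hk.of_le_mul (c := C) (hc.smul hk.1) ?_
  filter_upwards [hC] with z hz
  rw [norm_smul]; gcongr

theorem exists_ae_bound {α : Type*} [MeasurableSpace α] {μ : Measure α} {φ : α → ℂ}
    (h : MemLp φ ∞ μ) : ∃ C : ℝ, ∀ᵐ x ∂μ, ‖φ x‖ ≤ C := by
  refine ⟨(eLpNorm φ ∞ μ).toReal, ?_⟩
  filter_upwards [ae_le_eLpNormEssSup (f := φ) (μ := μ)] with x hx
  rw [← toReal_enorm]
  refine ENNReal.toReal_mono h.2.ne ?_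
  rwa [eLpNorm_exponent_top]

theorem quasiMeasurePreserving_sub_prod :
    Measure.QuasiMeasurePreserving (fun z : R3 × R3 => z.1 - z.2) (volume : Measure (R3 × R3))
      volume := quasiMeasurePreserving_sub volume volume

theorem aestronglyMeasurable_potential (hV : IsPotential C₀ V) (N : ℝ) :
    AEStronglyMeasurable (fun z : R3 × R3 => ((N⁻¹ * V (z.1 - z.2) : ℝ) : ℂ)) volume := by
  have h : AEStronglyMeasurable (fun x : R3 => ((N⁻¹ * V x : ℝ) : ℂ)) volume :=
    Complex.continuous_ofReal.comp_aestronglyMeasurable (hV.integrable.1.const_mul N⁻¹)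
  exact h.comp_quasiMeasurePreserving quasiMeasurePreserving_sub_prod

theorem IsPotential.ae_eq_sub (hV : IsPotential C₀ V) :
    ∀ᵐ z : R3 × R3, (V (z.1 - z.2) : ℂ) = ∫ q, vHat V q * phase q (z.1 - z.2) :=
  quasiMeasurePreserving_sub_prod.ae hV.ae_eq

theorem norm_integral_vHat_phase_le (hV : IsPotential C₀ V) (x : R3) :
    ‖∫ q, vHat V q * phase q x‖ ≤ C₀ := by
  refine (norm_integral_le_integral_norm _).trans ?_
  simp only [norm_mul, norm_phase, mul_one]
  exact hV.integral_norm_le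

theorem ae_norm_potential_le (hV : IsPotential C₀ V) (N : ℝ) :
    ∀ᵐ z : R3 × R3, ‖((N⁻¹ * V (z.1 - z.2) : ℝ) : ℂ)‖ ≤ |N⁻¹| * C₀ := by
  filter_upwards [hV.ae_eq_sub] with z hz
  rw [Complex.ofReal_mul, norm_mul, hz, Complex.norm_real, Real.norm_eq_abs]
  gcongr
  exact norm_integral_vHat_phase_le hV _

/-- The integrand `N⁻¹ V̂(q) e^{iq·x̂} A e^{-iq·x̂}` of the exchange operator. -/
def exchangeFun (V : R3 → ℝ) (N : ℝ) (A : Op M) (q : R3) : Op M :=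
  ((N : ℂ)⁻¹ * vHat V q) • (expOp M q * A * expOp M (-q))

theorem expOp_ae (p : R3) (f : H M) : expOp M p f =ᵐ[volume] fun x => phase p x • f x :=
  mulOp_ae (memLp_phase p) f

theorem tensorFun_expOp_ae (p : R3) (f g : H M) :
    tensorFun (expOp M p f) (expOp M p g) =ᵐ[(volume : Measure (R3 × R3))]
      fun z => phase p (z.1 - z.2) • tensorFun f g z := by
  have h1 : ∀ᵐ z : R3 × R3, expOp M p f z.1 = phase p z.1 • f z.1 :=
    Measure.quasiMeasurePreserving_fst.ae (expOp_ae p f)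
  have h2 : ∀ᵐ z : R3 × R3, expOp M p g z.2 = phase p z.2 • g z.2 :=
    Measure.quasiMeasurePreserving_snd.ae (expOp_ae p g)
  filter_upwards [h1, h2] with z h1 h2
  rw [tensorFun, h1, h2, rankOneMatrix_smul_smul, sub_eq_add_neg, phase_add_right,
    phase_neg_right]
  rfl

theorem inner_expOp_mul_mul (p : R3) (A : Op M) (f g : H M) :
    ⟪f, (expOp M p * A * expOp M (-p)) g⟫_ℂ = ⟪expOp M (-p) f, A (expOp M (-p) g)⟫_ℂ := by
  rw [mul_apply_eq_comp, mul_apply_eq_comp, ← star_expOp p, ContinuousLinearMap.star_eq_adjoint,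
    ContinuousLinearMap.adjoint_inner_left]

theorem inner_exchangeFun {A : Op M} {k : R3 × R3 → KernelSpace M} (hk : IsWeakKernel A k)
    (N : ℝ) (q : R3) (f g : H M) :
    ⟪f, exchangeFun V N A q g⟫_ℂ = ∫ z : R3 × R3, (N : ℂ)⁻¹ * vHat V q
      * phase q (z.1 - z.2) * ⟪tensorFun f g z, k z⟫_ℂ := by
  rw [exchangeFun, _root_.smul_apply, inner_smul_right, inner_expOp_mul_mul, hk.2,
    ← integral_const_mul]
  refine integral_congr_ae ?_
  filter_upwards [tensorFun_expOp_ae (-q) f g] with z hz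
  rw [hz, inner_smul_left, phase_neg, Complex.conj_conj, mul_assoc, mul_assoc, mul_assoc]

/-- Conjugation by `e^{iq·x̂}` multiplies the kernel by `e^{iq·(x-y)}`; integration against `V̂`
reproduces `V(x - y)`. -/
theorem exchange_fubini (hV : IsPotential C₀ V) {A : Op M} {k : R3 × R3 → KernelSpace M}
    (hk : IsWeakKernel A k) (N : ℝ) (f g : H M) :
    Integrable (fun q => ⟪f, exchangeFun V N A q g⟫_ℂ) ∧
      ∫ q, ⟪f, exchangeFun V N A q g⟫_ℂ
        = ∫ z, ⟪tensorFun f g z, ((N⁻¹ * V (z.1 - z.2) : ℝ) : ℂ) • k z⟫_ℂ := by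
  have hi := integrable_inner_of_memLp (memLp_tensorFun f g) hk.1
  have hint : Integrable (fun p : R3 × (R3 × R3) => (N : ℂ)⁻¹ * vHat V p.1
      * phase p.1 (p.2.1 - p.2.2) * ⟪tensorFun f g p.2, k p.2⟫_ℂ) (volume.prod volume) := by
    have h1 := (hV.integrable_vHat.const_mul (N : ℂ)⁻¹).mul_prod hi
    have hc : Continuous fun p : R3 × (R3 × R3) => phase p.1 (p.2.1 - p.2.2) :=
      continuous_phase.comp (by fun_prop : Continuous fun p : R3 × (R3 × R3) =>
        (p.1, p.2.1 - p.2.2))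
    refine (h1.bdd_mul (c := 1) hc.aestronglyMeasurable
      (Eventually.of_forall fun p => (norm_phase _ _).le)).congr (Eventually.of_forall fun p => ?_)
    simp only
    ring
  simp only [inner_exchangeFun hk]
  refine ⟨hint.integral_prod_left, ?_⟩
  rw [integral_integral_swap hint]
  refine integral_congr_ae ?_
  filter_upwards [hV.ae_eq_sub] with z hz
  rw [inner_smul_right, integral_mul_const, Complex.ofReal_mul, hz, Complex.ofReal_inv]
  simp only [mul_assoc]
  rw [integral_const_mul, mul_assoc]

theorem isWeakKernel_potential_iff (hV : IsPotential C₀ V) {A B : Op M}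
    {k : R3 × R3 → KernelSpace M} (hk : IsWeakKernel A k) (N : ℝ) :
    IsWeakKernel B (fun z => ((N⁻¹ * V (z.1 - z.2) : ℝ) : ℂ) • k z) ↔
      IsWeakIntegral volume (exchangeFun V N A) B := by
  constructor
  · intro h f g
    obtain ⟨h1, h2⟩ := exchange_fubini hV hk N f g
    exact ⟨h1, by rw [h.2 f g, h2]⟩
  · intro h
    refine ⟨memLp_smul_of_ae_bound (aestronglyMeasurable_potential hV N)
      (ae_norm_potential_le hV N) hk.1, fun f g => ?_⟩
    rw [(h f g).2, (exchange_fubini hV hk N f g).2]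

theorem norm_expOp_mul_mul_le (q : R3) (A : Op M) :
    ‖expOp M q * A * expOp M (-q)‖ ≤ ‖A‖ := by
  calc _ ≤ ‖expOp M q‖ * ‖A‖ * ‖expOp M (-q)‖ :=
        (norm_mul_le _ _).trans (by gcongr; exact norm_mul_le _ _)
    _ ≤ 1 * ‖A‖ * 1 := by gcongr <;> exact norm_expOp_le _
    _ = ‖A‖ := by ring

theorem norm_exchangeFun_le (V : R3 → ℝ) (N : ℝ) (A : Op M) (q : R3) :
    ‖exchangeFun V N A q‖ ≤ |N|⁻¹ * ‖vHat V q‖ * ‖A‖ := by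
  rw [exchangeFun, norm_smul, norm_mul, norm_inv, Complex.norm_real, Real.norm_eq_abs]
  gcongr
  exact norm_expOp_mul_mul_le q A

/-- `kernelMul` is defined by a choice of operator and kernel. Whatever is chosen, the operator must
equal the weak integral, and the weak integral itself proves that a choice exists. -/
theorem kernelMul_spec (hV : IsPotential C₀ V) (N : ℝ) (A : HS M) :
    IsWeakIntegral volume (exchangeFun V N (HS.op A)) (kernelMul V N (HS.op A)) := by
  obtain ⟨k, hk⟩ := A.exists_isWeakKernel
  have hm : ∀ g, AEStronglyMeasurable (fun q => exchangeFun V N (HS.op A) q g) volume := fun g => by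
    have h1 : Continuous fun q : R3 => (expOp M q * (HS.op A * expOp M (-q))) g :=
      continuous_mul_apply (S := fun q => expOp M q) (T := fun q => HS.op A * expOp M (-q))
        (fun q => norm_expOp_le q) continuous_expOp_apply
        (fun g => (HS.op A).continuous.comp ((continuous_expOp_apply g).comp continuous_neg)) g
    refine AEStronglyMeasurable.smul
      (hV.continuous_vHat.aestronglyMeasurable.const_mul (N : ℂ)⁻¹) ?_
    exact h1.aestronglyMeasurable
  obtain ⟨B, hB⟩ := exists_isWeakIntegral hm
    ((hV.integrable_norm_vHat.const_mul |N|⁻¹).mul_const ‖HS.op A‖)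
    (norm_exchangeFun_le V N (HS.op A))
  have hex : ∃ B : Op M, ∃ K : R3 × Fin M → R3 × Fin M → ℂ,
      HasKernel (HS.op A) K ∧ HasKernel B fun z w => ((N⁻¹ * V (z.1 - w.1) : ℝ) : ℂ) * K z w := by
    refine ⟨B, kernelOf k, hk.hasKernel, ?_⟩
    rw [hasKernel_iff]
    exact (isWeakKernel_potential_iff hV hk N).2 hB
  rw [kernelMul, dif_pos hex]
  obtain ⟨K, hK1, hK2⟩ := hex.choose_spec
  rw [hasKernel_iff] at hK1 hK2
  exact (isWeakKernel_potential_iff hV hK1 N).1 hK2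

end Exchange

/-! ### Existence of the density of a trace class operator. -/

section Density

variable {M : ℕ}

/-- The density is the marginal `ρ(x) = ∫ |k(x, y)|² dy` of the squared kernel `k` of `S`. For
selfadjoint `S` it is the density of `S²`, which `exists_isDensity` combines over the four squares
of a trace class operator. -/
theorem HS.inner_lmul_mulOp (S : HS M) : ∃ ρ : R3 → ℂ, Integrable ρ ∧ ∀ φ : R3 → ℂ,
    MemLp φ ∞ (volume : Measure R3) → ⟪S, lmul (mulOp M φ) S⟫_ℂ = ∫ x, φ x * ρ x := by
  obtain ⟨k, hk, hks⟩ := S.exists_kernel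
  have hi : Integrable (fun z => ((‖k z‖ ^ 2 : ℝ) : ℂ)) (volume.prod volume : Measure (R3 × R3)) :=
    ((memLp_two_iff_integrable_sq_norm (Lp.memLp k).1).1 (Lp.memLp k)).ofReal
  refine ⟨fun x => ∫ y, ((‖k (x, y)‖ ^ 2 : ℝ) : ℂ), hi.integral_prod_left, fun φ hφ => ?_⟩
  obtain ⟨C, hC⟩ := exists_ae_bound hφ
  have hb : ∀ᵐ z : R3 × R3, ‖φ z.1‖ ≤ C := Measure.quasiMeasurePreserving_fst.ae hC
  have hm : AEStronglyMeasurable (fun z : R3 × R3 => φ z.1) volume :=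
    hφ.1.comp_fst (ν := (volume : Measure R3))
  have hφk : MemLp (fun z => φ z.1 • k z) 2 (volume : Measure (R3 × R3)) :=
    memLp_smul_of_ae_bound hm hb (Lp.memLp k)
  have h1 : ∀ f g, ⟪tensorLp f g, hφk.toLp _⟫_ℂ = ⟪f, (mulOp M φ * op S) g⟫_ℂ := fun f g => by
    have e : ⟪f, (mulOp M φ * op S) g⟫_ℂ = ⟪star (mulOp M φ) f, op S g⟫_ℂ := by
      rw [ContinuousLinearMap.star_eq_adjoint, ContinuousLinearMap.adjoint_inner_left]; rfl
    rw [e, hk, inner_tensorLp, inner_tensorLp]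
    refine integral_congr_ae ?_
    have h2 : ∀ᵐ z : R3 × R3, (star (mulOp M φ) f) z.1 = (starRingEnd ℂ) (φ z.1) • f z.1 := by
      rw [star_mulOp hφ]
      exact Measure.quasiMeasurePreserving_fst.ae (mulOp_ae (memLp_top_conj hφ) f)
    filter_upwards [hφk.coeFn_toLp, h2] with z hz h2
    have := rankOneMatrix_smul_smul ((starRingEnd ℂ) (φ z.1)) 1 (f z.1) (g z.2)
    rw [one_smul, map_one, mul_one] at this
    rw [hz, tensorFun, tensorFun, h2, this, inner_smul_left, inner_smul_right, Complex.conj_conj]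
  have h2 : HasSum (fun i => ⟪op S (basis M i), op (lmul (mulOp M φ) S) (basis M i)⟫_ℂ)
      ⟪k, hφk.toLp _⟫_ℂ := by
    have h3 := (hks.mapL (innerSL ℂ (hφk.toLp _))).map (starRingEnd ℂ) Complex.continuous_conj
    simp only [Function.comp_def, innerSL_apply_apply, inner_conj_symm] at h3
    convert! h3 using 2 with i
    rw [h1]; rfl
  rw [(hasSum_inner S (lmul (mulOp M φ) S)).unique h2, L2.inner_def]
  have hi' : Integrable (fun z => φ z.1 * ((‖k z‖ ^ 2 : ℝ) : ℂ))
      (volume.prod volume : Measure (R3 × R3)) :=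
    hi.bdd_mul (c := C) hm hb
  have e : ∫ z : R3 × R3, φ z.1 * ((‖k z‖ ^ 2 : ℝ) : ℂ)
      = ∫ x, ∫ y, φ x * ((‖k (x, y)‖ ^ 2 : ℝ) : ℂ) := integral_prod _ hi'
  simp only [integral_const_mul] at e
  rw [← e]
  refine integral_congr_ae ?_
  filter_upwards [hφk.coeFn_toLp] with z hz
  rw [hz, inner_smul_right, inner_self_eq_norm_sq_to_K]
  norm_cast

theorem exists_isDensity {A : Op M} (h : traceNorm A < ∞) : ∃ ρ, IsDensity A ρ := by
  obtain ⟨S, c, hS, hA, -, -⟩ := exists_hs_sq h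
  choose ρ hρ hρ' using fun k => (S k).inner_lmul_mulOp
  have hadj : ∀ k, HS.adj (S k) = S k := fun k => HS.ext (hS k)
  refine ⟨fun x => ∑ k, c k * ρ k x, integrable_finsetSum _ fun k _ => (hρ k).const_mul _,
    fun φ hφ => ?_⟩
  obtain ⟨C, hC⟩ := exists_ae_bound hφ
  have h1 : ∀ k, ⟪HS.adj (S k), HS.rmul (mulOp M φ) (S k)⟫_ℂ = ∫ x, φ x * ρ k x := fun k => by
    rw [← hρ' k φ hφ, hadj, HS.inner_rmul, ← HS.inner_adj]
    have : HS.adj (HS.rmul (star (mulOp M φ)) (S k)) = HS.lmul (mulOp M φ) (S k) := by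
      refine HS.ext ?_
      rw [HS.op_adj, HS.op_rmul, star_mul, star_star, hS, HS.op_lmul]
    rw [this, hadj]
  have h2 : HasSum (fun i => ∑ k, c k * ⟪basis M i, (HS.op (S k)
      * HS.op (HS.rmul (mulOp M φ) (S k))) (basis M i)⟫_ℂ) (∑ k, c k * ∫ x, φ x * ρ k x) :=
    hasSum_sum fun k _ => by
      rw [← h1]; exact (hasSum_trace_mul (S k) (HS.rmul (mulOp M φ) (S k))).mul_left (c k)
  have h3 : trace (A ∘L mulOp M φ) = ∑ k, c k * ∫ x, φ x * ρ k x := by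
    rw [← h2.tsum_eq, trace]
    refine tsum_congr fun i => ?_
    have : A ∘L mulOp M φ = ∑ k, c k • (HS.op (S k) * HS.op (HS.rmul (mulOp M φ) (S k))) := by
      change A * mulOp M φ = _
      nth_rewrite 1 [hA]
      rw [Finset.sum_mul]
      refine Finset.sum_congr rfl fun k _ => ?_
      rw [smul_mul_assoc, HS.op_rmul, mul_assoc]
    rw [this]
    simp only [_root_.sum_apply, _root_.smul_apply, inner_sum, inner_smul_right]
  rw [h3]
  have h4 : ∀ k, Integrable fun x => φ x * ρ k x := fun k => (hρ k).bdd_mul (c := C) hφ.1 hC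
  have h5 : (fun x => φ x * ∑ k, c k * ρ k x) = fun x => ∑ k, c k * (φ x * ρ k x) := by
    funext x; rw [Finset.mul_sum]; exact Finset.sum_congr rfl fun k _ => by ring
  rw [h5, integral_finsetSum _ fun k _ => (h4 k).const_mul _]
  simp only [integral_const_mul]

theorem density_spec {A : Op M} (h : traceNorm A < ∞) : IsDensity A (density A) := by
  have := exists_isDensity h
  rw [density, dif_pos this]
  exact this.choose_spec

end Density

/-! ### The direct potential as a superposition of boosts. -/

section Direct

variable {M : ℕ} {V : R3 → ℝ} {C₀ : ℝ}

theorem aestronglyMeasurable_integral_phase {w : R3 → ℂ} (hw : AEStronglyMeasurable w volume) :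
    AEStronglyMeasurable (fun x : R3 => ∫ q, w q * phase q x) volume := by
  have h1 : AEStronglyMeasurable (fun z : R3 × R3 => w z.2 * phase z.2 z.1)
      (volume.prod volume) :=
    AEStronglyMeasurable.mul hw.comp_snd
      (continuous_phase.comp continuous_swap).aestronglyMeasurable
  exact h1.integral_prod_right'

theorem memLp_integral_phase {w : R3 → ℂ} (hw : Integrable w) :
    MemLp (fun x : R3 => ∫ q, w q * phase q x) ∞ volume :=
  memLp_top_of_norm_le (aestronglyMeasurable_integral_phase hw.1) (C := ∫ q, ‖w q‖) fun x =>
    (norm_integral_le_integral_norm _).trans_eq (by simp only [norm_mul, norm_phase, mul_one])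

theorem isWeakIntegral_mulOp {w : R3 → ℂ} (hw : Integrable w) :
    IsWeakIntegral volume (fun q => w q • expOp M q) (mulOp M fun x => ∫ q, w q * phase q x) := by
  intro f g
  have hi := integrable_inner_of_memLp (Lp.memLp f) (Lp.memLp g)
  have h1 : ∀ q, ⟪f, (w q • expOp M q) g⟫_ℂ = ∫ x, w q * phase q x * ⟪f x, g x⟫_ℂ := fun q => by
    rw [_root_.smul_apply, inner_smul_right, expOp_eq, inner_mulOp (memLp_phase q),
      ← integral_const_mul]
    simp only [mul_assoc]
  have hint : Integrable (fun p : R3 × R3 => w p.1 * phase p.1 p.2 * ⟪f p.2, g p.2⟫_ℂ)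
      (volume.prod volume) := by
    refine ((hw.mul_prod hi).bdd_mul (c := 1) continuous_phase.aestronglyMeasurable
      (Eventually.of_forall fun p => (norm_phase _ _).le)).congr (Eventually.of_forall fun p => ?_)
    simp only
    ring
  simp only [h1]
  refine ⟨hint.integral_prod_left, ?_⟩
  rw [integral_integral_swap hint, inner_mulOp (memLp_integral_phase hw)]
  simp only [integral_mul_const]

/-- The Fourier coefficients `N⁻¹ tr (A e^{-iq·x̂})` of the density of `A`. -/
def densityCoeff (N : ℝ) (A : Op M) (q : R3) : ℂ := (N : ℂ)⁻¹ * trace (A * expOp M (-q))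

theorem densityCoeff_eq (N : ℝ) {A : Op M} (h : traceNorm A < ∞) (q : R3) :
    densityCoeff N A q = ∫ y, (N : ℂ)⁻¹ * (phase (-q) y * density A y) := by
  rw [densityCoeff, integral_const_mul]
  congr 1
  exact (density_spec h).2 (phase (-q)) (memLp_phase (-q))

theorem continuous_densityCoeff (N : ℝ) {A : Op M} (h : traceNorm A < ∞) :
    Continuous (densityCoeff N A) := by
  rw [funext (densityCoeff_eq N h)]
  refine continuous_of_dominated (bound := fun y => ‖(N : ℂ)⁻¹‖ * ‖density A y‖) (fun q => ?_)
    (fun q => Eventually.of_forall fun y => ?_) ((density_spec h).1.norm.const_mul _)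
    (Eventually.of_forall fun y => ?_)
  · exact (((continuous_phase_right (-q)).aestronglyMeasurable.mul
      (density_spec h).1.1).const_mul _)
  · simp [norm_phase]
  · have : Continuous fun q : R3 => phase (-q) y :=
      continuous_phase.comp (by fun_prop : Continuous fun q : R3 => (-q, y))
    fun_prop

theorem norm_densityCoeff_le (N : ℝ) {A : Op M} (h : traceNorm A < ∞) (q : R3) :
    ‖densityCoeff N A q‖ ≤ |N|⁻¹ * (4 * (traceNorm A).toReal) := by
  rw [densityCoeff, norm_mul, norm_inv, Complex.norm_real, Real.norm_eq_abs]
  gcongr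
  have h1 := traceNorm_mul_mul_le h 1 (expOp M (-q))
  rw [one_mul] at h1
  have h2 : traceNorm (A * expOp M (-q)) < ∞ := h1.trans_lt ENNReal.ofReal_lt_top
  refine (norm_trace_le h2).trans (ENNReal.toReal_le_of_le_ofReal (by positivity) (h1.trans ?_))
  refine ENNReal.ofReal_le_ofReal ?_
  have h3 : ‖(1 : Op M)‖ ≤ 1 := ContinuousLinearMap.norm_id_le
  have h4 := norm_expOp_le (M := M) (-q)
  calc 4 * ‖(1 : Op M)‖ * ‖expOp M (-q)‖ * (traceNorm A).toReal
      ≤ 4 * 1 * 1 * (traceNorm A).toReal := by gcongr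
    _ = _ := by ring

theorem integrable_direct_symbol (hV : IsPotential C₀ V) (N : ℝ) {A : Op M}
    (h : traceNorm A < ∞) : Integrable fun q => vHat V q * densityCoeff N A q :=
  hV.integrable_vHat.mul_bdd (c := |N|⁻¹ * (4 * (traceNorm A).toReal))
    (continuous_densityCoeff N h).aestronglyMeasurable
    (Eventually.of_forall fun q => norm_densityCoeff_le N h q)

/-- The convolution theorem, by inserting the Fourier representation of `V(x - y)` and Fubini. From
here on the density enters only through its Fourier coefficients. -/
theorem directOp_eq (hV : IsPotential C₀ V) (N : ℝ) {A : Op M} (h : traceNorm A < ∞) :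
    directOp V N A = mulOp M fun x => ∫ q, vHat V q * densityCoeff N A q * phase q x := by
  rw [directOp]
  congr 1
  funext x
  have hρ := (density_spec h).1
  have hint : Integrable (fun p : R3 × R3 => vHat V p.1 * phase p.1 (x - p.2)
      * ((N : ℂ)⁻¹ * density A p.2)) (volume.prod volume) := by
    refine ((hV.integrable_vHat.mul_prod (hρ.const_mul (N : ℂ)⁻¹)).bdd_mul (c := 1)
      (continuous_phase.comp (by fun_prop : Continuous fun p : R3 × R3 =>
        (p.1, x - p.2))).aestronglyMeasurable
      (Eventually.of_forall fun p => (norm_phase _ _).le)).congr (Eventually.of_forall fun p => ?_)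
    simp only [Function.comp_apply]
    ring
  have hae : ∀ᵐ y : R3, (V (x - y) : ℂ) = ∫ q, vHat V q * phase q (x - y) :=
    (Measure.measurePreserving_sub_left volume x).quasiMeasurePreserving.ae hV.ae_eq
  calc ∫ y, (V (x - y) : ℂ) * ((N : ℂ)⁻¹ * density A y)
      = ∫ y, ∫ q, vHat V q * phase q (x - y) * ((N : ℂ)⁻¹ * density A y) := by
        refine integral_congr_ae ?_
        filter_upwards [hae] with y hy
        rw [hy, integral_mul_const]
    _ = ∫ q, ∫ y, vHat V q * phase q (x - y) * ((N : ℂ)⁻¹ * density A y) :=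
        (integral_integral_swap hint).symm
    _ = _ := by
        refine integral_congr_ae (Eventually.of_forall fun q => ?_)
        simp only
        rw [densityCoeff_eq N h, ← integral_const_mul, ← integral_mul_const]
        refine integral_congr_ae (Eventually.of_forall fun y => ?_)
        simp only
        rw [sub_eq_add_neg, phase_add_right, phase_neg_right, phase_neg]
        ring

theorem directOp_spec (hV : IsPotential C₀ V) (N : ℝ) {A : Op M} (h : traceNorm A < ∞) :
    IsWeakIntegral volume (fun q => (vHat V q * densityCoeff N A q) • expOp M q)
      (directOp V N A) := by
  rw [directOp_eq hV N h]
  exact isWeakIntegral_mulOp (integrable_direct_symbol hV N h)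

end Direct

/-! ### Conjugate and transpose on Hilbert-Schmidt operators and weak integrals. -/

section HilbertSchmidtConjugation

variable {M : ℕ}

namespace HS

/-- The complex conjugate of a Hilbert-Schmidt operator. -/
def conj (A : HS M) : HS M := mk (conjOp (op A)) (by rw [hsNorm_conjOp]; exact hsNorm_op_lt_top A)

@[simp] theorem op_conj (A : HS M) : op (conj A) = conjOp (op A) := rfl

/-- The transpose of a Hilbert-Schmidt operator. -/
def transpose (A : HS M) : HS M := conj (adj A)

@[simp] theorem op_transpose (A : HS M) : op (transpose A) = conjOp (star (op A)) := rfl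

theorem norm_conj (A : HS M) : ‖conj A‖ = ‖A‖ := by
  rw [norm_eq, norm_eq, op_conj, hsNorm_conjOp]

theorem norm_transpose (A : HS M) : ‖transpose A‖ = ‖A‖ := by
  rw [transpose, norm_conj, norm_adj]

theorem transpose_add (A B : HS M) : transpose (A + B) = transpose A + transpose B :=
  ext (by simp [conjOp_add])

theorem transpose_sub (A B : HS M) : transpose (A - B) = transpose A - transpose B :=
  ext (by simp [conjOp_sub])

theorem transpose_smul (c : ℂ) (A : HS M) : transpose (c • A) = c • transpose A :=
  ext (by simp [conjOp_smul])

theorem continuous_transpose : Continuous (transpose : HS M → HS M) := by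
  have : Isometry (transpose : HS M → HS M) := Isometry.of_dist_eq fun A B => by
    rw [dist_eq_norm, dist_eq_norm, ← transpose_sub, norm_transpose]
  exact this.continuous

theorem hsNorm_le_iff {A : HS M} {c : ℝ} (hc : 0 ≤ c) :
    hsNorm (op A) ≤ ENNReal.ofReal c ↔ ‖A‖ ≤ c := by
  rw [hsNorm_op, ENNReal.ofReal_le_ofReal_iff hc]

end HS

namespace IsWeakIntegral

variable {Q : Type*} [MeasurableSpace Q] {μ : Measure Q} {Φ : Q → Op M} {B : Op M}

theorem conj (h : IsWeakIntegral μ Φ B) :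
    IsWeakIntegral μ (fun q => conjOp (Φ q)) (conjOp B) := fun f g => by
  simp only [inner_conjOp]
  refine ⟨(RCLike.conjCLE (K := ℂ)).toContinuousLinearMap.integrable_comp (h _ _).1, ?_⟩
  rw [(h _ _).2]; exact integral_conj.symm

theorem comp_neg {Φ : R3 → Op M} (h : IsWeakIntegral volume Φ B) :
    IsWeakIntegral volume (fun q => Φ (-q)) B := fun f g => by
  refine ⟨(h f g).1.comp_neg, ?_⟩
  rw [(h f g).2]
  exact (integral_neg_eq_self (fun q => ⟪f, Φ q g⟫_ℂ) volume).symm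

end IsWeakIntegral

end HilbertSchmidtConjugation

/-! ### Bounds and symmetries of the exchange map. -/

section ExchangeMap

theorem conj_vHat_eq {V : R3 → ℝ} {C₀ : ℝ} (hV : IsPotential C₀ V) (q : R3) :
    (starRingEnd ℂ) (vHat V q) = vHat V q := by
  rw [conj_vHat, vHat_neg hV.even]

variable {M : ℕ} {V : R3 → ℝ} {C₀ : ℝ}

theorem exchangeFun_op (V : R3 → ℝ) (N : ℝ) (A : HS M) (q : R3) :
    exchangeFun V N (HS.op A) q
      = HS.op (((N : ℂ)⁻¹ * vHat V q) • HS.bimul (expOp M q) (expOp M (-q)) A) := by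
  rw [exchangeFun, map_smul, HS.op_bimul, mul_assoc]

theorem hsNorm_kernelMul_le (hV : IsPotential C₀ V) (N : ℝ) (A : HS M) :
    hsNorm (kernelMul V N (HS.op A)) ≤ ENNReal.ofReal (|N|⁻¹ * C₀ * ‖A‖) := by
  refine ((kernelMul_spec hV N A).hsNorm_le
    (c := fun q => |N|⁻¹ * ‖vHat V q‖ * ‖A‖)
    ((hV.integrable_norm_vHat.const_mul _).mul_const _) (fun q => by positivity)
    fun q => ?_).trans ?_
  · rw [exchangeFun_op, HS.hsNorm_le_iff (by positivity), norm_smul, norm_mul, norm_inv,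
      Complex.norm_real, Real.norm_eq_abs]
    gcongr
    exact HS.norm_bimul_le (norm_expOp_le _) (norm_expOp_le _) _
  · refine ENNReal.ofReal_le_ofReal ?_
    rw [integral_mul_const, integral_const_mul]
    gcongr
    exact hV.integral_norm_le

/-- The map `A ↦ kernelMul V N A` on Hilbert-Schmidt operators. -/
def exch (hV : IsPotential C₀ V) (N : ℝ) (A : HS M) : HS M :=
  HS.mk (kernelMul V N (HS.op A)) ((hsNorm_kernelMul_le hV N A).trans_lt ENNReal.ofReal_lt_top)

variable (hV : IsPotential C₀ V) (N : ℝ)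

theorem op_exch (A : HS M) : HS.op (exch hV N A) = kernelMul V N (HS.op A) := rfl

theorem exch_spec (A : HS M) :
    IsWeakIntegral volume (exchangeFun V N (HS.op A)) (HS.op (exch hV N A)) :=
  kernelMul_spec hV N A

theorem exch_eq_of_isWeakIntegral {A B : HS M}
    (h : IsWeakIntegral volume (exchangeFun V N (HS.op A)) (HS.op B)) : exch hV N A = B :=
  HS.ext ((exch_spec hV N A).unique h)

theorem exch_add (A B : HS M) : exch hV N (A + B) = exch hV N A + exch hV N B := by
  refine exch_eq_of_isWeakIntegral hV N ?_
  rw [map_add]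
  refine ((exch_spec hV N A).add (exch_spec hV N B)).congr fun q => ?_
  simp only [exchangeFun, mul_add, add_mul, smul_add]

theorem exch_smul (c : ℂ) (A : HS M) : exch hV N (c • A) = c • exch hV N A := by
  refine exch_eq_of_isWeakIntegral hV N ?_
  rw [map_smul]
  refine ((exch_spec hV N A).smul c).congr fun q => ?_
  simp only [exchangeFun, mul_smul_comm, smul_mul_assoc]
  exact smul_comm _ _ _

theorem exch_neg (A : HS M) : exch hV N (-A) = -exch hV N A := by
  have := exch_smul hV N (-1) A
  simpa using this

theorem exch_sub (A B : HS M) : exch hV N (A - B) = exch hV N A - exch hV N B := by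
  rw [sub_eq_add_neg, exch_add, exch_neg, ← sub_eq_add_neg]

theorem norm_exch_le (A : HS M) : ‖exch hV N A‖ ≤ |N|⁻¹ * C₀ * ‖A‖ :=
  HS.norm_le_of_hsNorm_le (mul_nonneg (mul_nonneg (by positivity) hV.nonneg) (norm_nonneg _))
    (hsNorm_kernelMul_le hV N A)

/-- The operator norm version lets products with a small Hilbert-Schmidt factor be estimated with
`‖α‖ ≤ 1` in the other factor. -/
theorem norm_op_exch_le (A : HS M) : ‖HS.op (exch hV N A)‖ ≤ |N|⁻¹ * C₀ * ‖HS.op A‖ := by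
  refine ((exch_spec hV N A).norm_le ((hV.integrable_norm_vHat.const_mul |N|⁻¹).mul_const
    ‖HS.op A‖) (fun q => by positivity) (norm_exchangeFun_le V N _)).trans ?_
  rw [integral_mul_const, integral_const_mul]
  gcongr
  exact hV.integral_norm_le

theorem continuous_exch : Continuous (exch hV N : HS M → HS M) := by
  refine (LipschitzWith.of_dist_le_mul (K := (|N|⁻¹ * C₀).toNNReal) fun A B => ?_).continuous
  rw [dist_eq_norm, dist_eq_norm, ← exch_sub,
    Real.coe_toNNReal _ (mul_nonneg (by positivity) hV.nonneg)]
  exact norm_exch_le hV N _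

/-- `V̂` is real because `V` is real and even; the boosts in the integrand exchange their roles
under the adjoint. -/
theorem adj_exch (A : HS M) : HS.adj (exch hV N A) = exch hV N (HS.adj A) := by
  symm
  refine exch_eq_of_isWeakIntegral hV N ((exch_spec hV N A).star.congr fun q => ?_)
  rw [exchangeFun, exchangeFun, HS.op_adj, star_smul, star_mul (expOp M q * _), star_mul (expOp M q),
    star_expOp, star_expOp, neg_neg, ← starRingEnd_apply, map_mul, conj_vHat_eq hV, map_inv₀,
    Complex.conj_ofReal, mul_assoc]

theorem conj_exch (A : HS M) : HS.conj (exch hV N A) = exch hV N (HS.conj A) := by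
  symm
  refine exch_eq_of_isWeakIntegral hV N ((exch_spec hV N A).conj.comp_neg.congr fun q => ?_)
  rw [exchangeFun, exchangeFun, HS.op_conj, conjOp_smul, conjOp_mul, conjOp_mul, conjOp_expOp,
    conjOp_expOp, map_mul, conj_vHat_eq hV, vHat_neg hV.even, map_inv₀, Complex.conj_ofReal, neg_neg]

theorem transpose_exch (A : HS M) :
    HS.transpose (exch hV N A) = exch hV N (HS.transpose A) := by
  rw [HS.transpose, adj_exch, conj_exch]; rfl

theorem expOp_exch (p : R3) (A : HS M) :
    HS.bimul (expOp M p) (expOp M (-p)) (exch hV N A)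
      = exch hV N (HS.bimul (expOp M p) (expOp M (-p)) A) := by
  symm
  refine exch_eq_of_isWeakIntegral hV N ?_
  have := (exch_spec hV N A).mul_mul (expOp M p) (expOp M (-p))
  rw [mul_assoc] at this
  refine this.congr fun q => ?_
  simp only [exchangeFun, mul_smul_comm, smul_mul_assoc, HS.op_bimul]
  congr 1
  calc expOp M p * (expOp M q * HS.op A * expOp M (-q)) * expOp M (-p)
      = (expOp M p * expOp M q) * HS.op A * (expOp M (-q) * expOp M (-p)) := by
        simp only [mul_assoc]
    _ = (expOp M q * expOp M p) * HS.op A * (expOp M (-p) * expOp M (-q)) := by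
        rw [expOp_mul, expOp_mul, expOp_mul, expOp_mul, add_comm p q, add_comm (-q) (-p)]
    _ = _ := by simp only [mul_assoc]

/-- Translations and boosts commute up to a phase, and the phases on the two sides of `B` are
conjugate. So the exchange map is covariant under translations (`transOp_exch`). -/
theorem transOp_expOp_conj (a q : R3) (B : Op M) :
    transOp M a * (expOp M q * B * expOp M (-q)) * transOp M (-a)
      = expOp M q * (transOp M a * B * transOp M (-a)) * expOp M (-q) := by
  have h1 : expOp M (-q) * transOp M (-a)
      = (starRingEnd ℂ) (phase q a) • (transOp M (-a) * expOp M (-q)) := by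
    rw [transOp_expOp, smul_smul, phase_neg_right, phase_neg, Complex.conj_conj,
      ← Complex.normSq_eq_conj_mul_self, Complex.normSq_eq_norm_sq, norm_phase]
    simp
  calc transOp M a * (expOp M q * B * expOp M (-q)) * transOp M (-a)
      = (transOp M a * expOp M q) * B * (expOp M (-q) * transOp M (-a)) := by
        simp only [mul_assoc]
    _ = (phase q a * (starRingEnd ℂ) (phase q a)) • (expOp M q *
          (transOp M a * B * transOp M (-a)) * expOp M (-q)) := by
        rw [transOp_expOp, h1]
        simp only [smul_mul_assoc, mul_smul_comm, smul_smul, mul_assoc]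
        rw [mul_comm]
    _ = _ := by
        rw [mul_comm (phase q a), ← Complex.normSq_eq_conj_mul_self, Complex.normSq_eq_norm_sq,
          norm_phase]
        simp

theorem transOp_exch (a : R3) (A : HS M) :
    HS.bimul (transOp M a) (transOp M (-a)) (exch hV N A)
      = exch hV N (HS.bimul (transOp M a) (transOp M (-a)) A) := by
  symm
  refine exch_eq_of_isWeakIntegral hV N ?_
  have := (exch_spec hV N A).mul_mul (transOp M a) (transOp M (-a))
  rw [mul_assoc] at this
  refine this.congr fun q => ?_
  simp only [exchangeFun, mul_smul_comm, smul_mul_assoc, HS.op_bimul, transOp_expOp_conj]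
  simp only [mul_assoc]

/-- In terms of the kernel `k` of `A`, this is the pairing energy `N⁻¹ ∫ V(x - y) |k(x, y)|²`, which
is real as `V` is. It is used in the conservation of the particle number. -/
theorem inner_exch_self (A : HS M) : (starRingEnd ℂ) ⟪A, exch hV N A⟫_ℂ = ⟪A, exch hV N A⟫_ℂ := by
  obtain ⟨k, hk, hks⟩ := A.exists_kernel
  have hw : IsWeakKernel (HS.op A) k := ⟨Lp.memLp k, fun f g => by rw [hk, inner_tensorLp]⟩
  obtain ⟨hm, hw'⟩ := (isWeakKernel_potential_iff hV hw N).2 (exch_spec hV N A)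
  have h1 : HasSum (fun i => ⟪HS.op A (basis M i), HS.op (exch hV N A) (basis M i)⟫_ℂ)
      ⟪k, hm.toLp _⟫_ℂ := by
    have h3 := (hks.mapL (innerSL ℂ (hm.toLp _))).map (starRingEnd ℂ) Complex.continuous_conj
    simp only [Function.comp_def, innerSL_apply_apply, inner_conj_symm] at h3
    convert! h3 using 2 with i
    rw [hw', inner_tensorLp]
    refine integral_congr_ae ?_
    filter_upwards [hm.coeFn_toLp] with z hz
    rw [hz]
  rw [(HS.hasSum_inner A (exch hV N A)).unique h1, L2.inner_def, ← integral_conj]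
  refine integral_congr_ae ?_
  filter_upwards [hm.coeFn_toLp] with z hz
  rw [hz, inner_smul_right, map_mul, Complex.conj_ofReal, inner_conj_symm]

end ExchangeMap

/-! ### Bounds and symmetries of the direct potential. -/

section DirectMap

variable {M : ℕ} {V : R3 → ℝ} {C₀ : ℝ}

theorem traceNorm_mul_right_lt {A : Op M} (h : traceNorm A < ∞) (B : Op M) :
    traceNorm (A * B) < ∞ := by
  have := traceNorm_mul_mul_le h 1 B
  rw [one_mul] at this
  exact this.trans_lt ENNReal.ofReal_lt_top

theorem trace_mul_comm {A : Op M} (h : traceNorm A < ∞) (B : Op M) :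
    trace (A * B) = trace (B * A) := by
  obtain ⟨S, c, -, hA, -, -⟩ := exists_hs_sq h
  have h1 : HasSum (fun i => ∑ k, c k * ⟪basis M i, (HS.op (S k)
      * HS.op (HS.rmul B (S k))) (basis M i)⟫_ℂ)
      (∑ k, c k * ⟪HS.adj (S k), HS.rmul B (S k)⟫_ℂ) :=
    hasSum_sum fun k _ => (hasSum_trace_mul (S k) (HS.rmul B (S k))).mul_left (c k)
  have h2 : HasSum (fun i => ∑ k, c k * ⟪basis M i, (HS.op (HS.lmul B (S k))
      * HS.op (S k)) (basis M i)⟫_ℂ)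
      (∑ k, c k * ⟪HS.adj (HS.lmul B (S k)), S k⟫_ℂ) :=
    hasSum_sum fun k _ => (hasSum_trace_mul (HS.lmul B (S k)) (S k)).mul_left (c k)
  have h3 : ∀ k, ⟪HS.adj (HS.lmul B (S k)), S k⟫_ℂ = ⟪HS.adj (S k), HS.rmul B (S k)⟫_ℂ :=
    fun k => by
    rw [HS.inner_rmul]; congr 1
    exact HS.ext (by simp [star_mul])
  simp only [h3] at h2
  have e1 : A * B = ∑ k, c k • (HS.op (S k) * HS.op (HS.rmul B (S k))) := by
    nth_rewrite 1 [hA]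
    rw [Finset.sum_mul]
    exact Finset.sum_congr rfl fun k _ => by rw [smul_mul_assoc, HS.op_rmul, mul_assoc]
  have e2 : B * A = ∑ k, c k • (HS.op (HS.lmul B (S k)) * HS.op (S k)) := by
    nth_rewrite 1 [hA]
    rw [Finset.mul_sum]
    exact Finset.sum_congr rfl fun k _ => by rw [mul_smul_comm, HS.op_lmul, mul_assoc]
  rw [trace, trace, e1, e2]
  simp only [_root_.sum_apply, _root_.smul_apply, inner_sum, inner_smul_right]
  rw [h1.tsum_eq, h2.tsum_eq]

theorem trace_star (A : Op M) : trace (star A) = (starRingEnd ℂ) (trace A) := by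
  rw [trace, trace, Complex.conj_tsum]
  refine tsum_congr fun i => ?_
  rw [ContinuousLinearMap.star_eq_adjoint, ContinuousLinearMap.adjoint_inner_right,
    inner_conj_symm]

theorem conj_densityCoeff (N : ℝ) {A : Op M} (h : traceNorm A < ∞) (q : R3) :
    (starRingEnd ℂ) (densityCoeff N A q) = densityCoeff N (star A) (-q) := by
  have h' : traceNorm (star A) < ∞ := (traceNorm_star A).trans_lt h
  rw [densityCoeff, densityCoeff, map_mul, ← trace_star, star_mul, star_expOp, neg_neg,
    trace_mul_comm h', map_inv₀, Complex.conj_ofReal]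

theorem densityCoeff_sub (N : ℝ) {A B : Op M} (hA : traceNorm A < ∞) (hB : traceNorm B < ∞)
    (q : R3) : densityCoeff N (A - B) q = densityCoeff N A q - densityCoeff N B q := by
  rw [densityCoeff, densityCoeff, densityCoeff, sub_mul,
    trace_sub (traceNorm_mul_right_lt hA _) (traceNorm_mul_right_lt hB _), mul_sub]

theorem traceNorm_sub_lt {A B : Op M} (hA : traceNorm A < ∞) (hB : traceNorm B < ∞) :
    traceNorm (A - B) < ∞ := by
  rw [sub_eq_add_neg]
  refine (traceNorm_add _ _).trans_lt (ENNReal.add_lt_top.2 ⟨hA, ?_⟩)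
  rwa [traceNorm_neg]

theorem directOp_sub (hV : IsPotential C₀ V) (N : ℝ) {A B : Op M} (hA : traceNorm A < ∞)
    (hB : traceNorm B < ∞) : directOp V N (A - B) = directOp V N A - directOp V N B := by
  refine (directOp_spec hV N (traceNorm_sub_lt hA hB)).unique
    (((directOp_spec hV N hA).sub (directOp_spec hV N hB)).congr fun q => ?_)
  rw [densityCoeff_sub N hA hB, mul_sub, sub_smul]

theorem star_directOp (hV : IsPotential C₀ V) (N : ℝ) {A : Op M} (h : traceNorm A < ∞) :
    star (directOp V N A) = directOp V N (star A) := by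
  have h' : traceNorm (star A) < ∞ := (traceNorm_star A).trans_lt h
  refine IsWeakIntegral.unique (directOp_spec hV N h).star.comp_neg ?_
  refine (directOp_spec hV N h').congr fun q => ?_
  rw [star_smul, star_expOp, neg_neg, ← starRingEnd_apply, map_mul, conj_vHat_eq hV,
    conj_densityCoeff N h, neg_neg, vHat_neg hV.even]

theorem norm_directOp_le (hV : IsPotential C₀ V) (N : ℝ) {A : Op M} (h : traceNorm A < ∞) {m : ℝ}
    (hm : ∀ q, ‖densityCoeff N A q‖ ≤ m) : ‖directOp V N A‖ ≤ C₀ * m := by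
  have hm0 : 0 ≤ m := (norm_nonneg _).trans (hm 0)
  refine ((directOp_spec hV N h).norm_le (hV.integrable_norm_vHat.mul_const m)
    (fun q => by positivity) fun q => ?_).trans ?_
  · rw [norm_smul, norm_mul]
    calc ‖vHat V q‖ * ‖densityCoeff N A q‖ * ‖expOp M q‖ ≤ ‖vHat V q‖ * m * 1 := by
          gcongr
          · exact hm q
          · exact norm_expOp_le q
      _ = ‖vHat V q‖ * m := mul_one _
  · rw [integral_mul_const]
    gcongr
    exact hV.integral_norm_le

theorem norm_directOp_le_traceNorm (hV : IsPotential C₀ V) (N : ℝ) {A : Op M}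
    (h : traceNorm A < ∞) :
    ‖directOp V N A‖ ≤ C₀ * (|N|⁻¹ * (4 * (traceNorm A).toReal)) :=
  norm_directOp_le hV N h (norm_densityCoeff_le N h)

theorem expOp_directOp (hV : IsPotential C₀ V) (N : ℝ) {A : Op M} (h : traceNorm A < ∞) (p : R3) :
    expOp M p * directOp V N A * expOp M (-p) = directOp V N A := by
  rw [directOp_eq hV N h, expOp_mul_mulOp p
    (memLp_integral_phase (integrable_direct_symbol hV N h)), mul_assoc, expOp_mul_neg, mul_one]

theorem transOp_expOp_transOp (a q : R3) :
    transOp M a * expOp M q * transOp M (-a) = phase q a • expOp M q := by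
  rw [transOp_expOp, smul_mul_assoc, mul_assoc, transOp_mul_neg, mul_one]

/-- Translating `e^{iq·x̂}` multiplies it by `e^{iq·a}`. The factor `1 - e^{iq·a}` supplies the
Lipschitz dependence on `a`. -/
theorem directOp_sub_trans_spec (hV : IsPotential C₀ V) (N : ℝ) {A : Op M} (h : traceNorm A < ∞)
    (a : R3) :
    IsWeakIntegral volume (fun q => (vHat V q * densityCoeff N A q * (1 - phase q a)) • expOp M q)
      (directOp V N A - transOp M a * directOp V N A * transOp M (-a)) := by
  refine ((directOp_spec hV N h).sub
    ((directOp_spec hV N h).mul_mul (transOp M a) (transOp M (-a)))).congr fun q => ?_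
  rw [mul_smul_comm, smul_mul_assoc, transOp_expOp_transOp, smul_smul, ← sub_smul, mul_sub, mul_one]

theorem norm_one_sub_phase_le (q a : R3) : ‖1 - phase q a‖ ≤ ‖q‖ * ‖a‖ := by
  rw [norm_sub_rev, phase]
  refine Real.norm_exp_I_mul_ofReal_sub_one_le.trans ?_
  exact abs_real_inner_le_norm q a

end DirectMap

/-! ### Right derivatives, Dini derivatives and comparison theorems. -/

section OneSidedDerivatives

/-- `Z` is the right derivative at `0` of `Y`. -/
def RightDeriv {E : Type*} [NormedAddCommGroup E] [NormedSpace ℂ E] (Y : ℝ → E) (Z : E) : Prop :=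
  Tendsto (fun h : ℝ => (h : ℂ)⁻¹ • (Y h - Y 0)) (𝓝[>] 0) (𝓝 Z)

namespace RightDeriv

variable {E F : Type*} [NormedAddCommGroup E] [NormedSpace ℂ E] [NormedAddCommGroup F]
  [NormedSpace ℂ F] {Y W : ℝ → E} {Z Z' : E}

theorem add (h : RightDeriv Y Z) (h' : RightDeriv W Z') :
    RightDeriv (fun t => Y t + W t) (Z + Z') := by
  refine (Tendsto.add h h').congr fun t => ?_
  simp only [smul_add, smul_sub]; abel

theorem sub (h : RightDeriv Y Z) (h' : RightDeriv W Z') :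
    RightDeriv (fun t => Y t - W t) (Z - Z') := by
  refine (Tendsto.sub h h').congr fun t => ?_
  simp only [smul_sub]; abel

theorem map {g : E → F} (h : RightDeriv Y Z) (hs : ∀ x y, g (x - y) = g x - g y)
    (hr : ∀ (r : ℝ) x, g ((r : ℂ) • x) = (r : ℂ) • g x) (hc : Continuous g) :
    RightDeriv (fun t => g (Y t)) (g Z) := by
  refine ((hc.tendsto Z).comp h).congr fun t => ?_
  rw [Function.comp_apply, ← hs, ← Complex.ofReal_inv, hr]

theorem tendsto (h : RightDeriv Y Z) : Tendsto Y (𝓝[>] 0) (𝓝 (Y 0)) := by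
  have h1 : Tendsto (fun t : ℝ => (t : ℂ)) (𝓝[>] 0) (𝓝 0) := by
    have := Complex.continuous_ofReal.tendsto 0
    rw [Complex.ofReal_zero] at this
    exact this.mono_left nhdsWithin_le_nhds
  have h2 := (h1.smul h).add_const (Y 0)
  rw [zero_smul, zero_add] at h2
  refine h2.congr' ?_
  filter_upwards [self_mem_nhdsWithin] with t ht
  have : (t : ℂ) ≠ 0 := by exact_mod_cast (ne_of_gt ht)
  rw [smul_inv_smul₀ this, sub_add_cancel]

theorem mul {A : Type*} [NormedRing A] [NormedAlgebra ℂ A] {Y W : ℝ → A} {Z Z' : A}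
    (h : RightDeriv Y Z) (h' : RightDeriv W Z') :
    RightDeriv (fun t => Y t * W t) (Z * W 0 + Y 0 * Z') := by
  have h1 := (Tendsto.mul h h'.tendsto).add (Tendsto.const_mul (Y 0) h')
  refine h1.congr fun t => ?_
  rw [smul_mul_assoc, mul_smul_comm, ← smul_add]
  congr 1
  noncomm_ring

theorem inner {E : Type*} [NormedAddCommGroup E] [InnerProductSpace ℂ E] {Y W : ℝ → E} {Z Z' : E}
    (h : RightDeriv Y Z) (h' : RightDeriv W Z') :
    RightDeriv (fun t => ⟪Y t, W t⟫_ℂ) (⟪Z, W 0⟫_ℂ + ⟪Y 0, Z'⟫_ℂ) := by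
  have h1 := (Tendsto.inner (𝕜 := ℂ) h h'.tendsto).add
    (Tendsto.inner (𝕜 := ℂ) (tendsto_const_nhds (x := Y 0)) h')
  refine h1.congr fun t => ?_
  rw [inner_smul_left, inner_smul_right, ← Complex.ofReal_inv, Complex.conj_ofReal, inner_sub_left,
    inner_sub_right, smul_eq_mul]
  ring

end RightDeriv

/-- The upper right Dini derivative of `f` at `t` is at most `m`. -/
def DiniLE (f : ℝ → ℝ) (t m : ℝ) : Prop :=
  ∀ r, m < r → ∀ᶠ h in 𝓝[>] (0 : ℝ), f (t + h) ≤ f t + h * r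

namespace DiniLE

variable {f g : ℝ → ℝ} {t m n : ℝ}

theorem mono (h : DiniLE f t m) (hmn : m ≤ n) : DiniLE f t n := fun r hr => h r (hmn.trans_lt hr)

theorem add (h : DiniLE f t m) (h' : DiniLE g t n) : DiniLE (fun t => f t + g t) t (m + n) := by
  intro r hr
  have e : (m + (r - m - n) / 2) + (n + (r - m - n) / 2) = r := by ring
  filter_upwards [h (m + (r - m - n) / 2) (by linarith), h' (n + (r - m - n) / 2) (by linarith)]
    with s h1 h2
  rw [← e, mul_add]; linarith

theorem frequently_slope_lt (h : DiniLE f t m) (r : ℝ) (hr : m < r) :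
    ∃ᶠ z in 𝓝[>] t, slope f t z < r := by
  refine Eventually.frequently ?_
  have h1 : Tendsto (fun z : ℝ => z - t) (𝓝[>] t) (𝓝[>] 0) := by
    refine tendsto_nhdsWithin_of_tendsto_nhds_of_eventually_within _ ?_ ?_
    · have : Tendsto (fun z : ℝ => z - t) (𝓝 t) (𝓝 (t - t)) :=
        (continuous_id.sub continuous_const).tendsto t
      rw [sub_self] at this
      exact this.mono_left nhdsWithin_le_nhds
    · filter_upwards [self_mem_nhdsWithin] with z hz
      exact sub_pos.2 (Set.mem_Ioi.1 hz)
  filter_upwards [h1.eventually (h ((m + r) / 2) (by linarith)), self_mem_nhdsWithin] with z hz hz'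
  have hp : 0 < z - t := sub_pos.2 (Set.mem_Ioi.1 hz')
  rw [add_sub_cancel] at hz
  rw [slope_def_field, div_lt_iff₀ hp]
  nlinarith

/-- The Dini derivative of `‖Y‖` is governed by the affine curve `Y(0) + sZ` to first order.
Allowing the quadratic error `K s²` is what lets skew generators contribute nothing. -/
theorem of_rightDeriv {E : Type*} [NormedAddCommGroup E] [NormedSpace ℂ E] {Y : ℝ → E} {Z : E}
    (h : RightDeriv Y Z) (hf : ∀ s, 0 ≤ s → f (t + s) = ‖Y s‖) {K : ℝ}
    (hm : ∀ s : ℝ, 0 ≤ s → s ≤ 1 → ‖Y 0 + (s : ℂ) • Z‖ ≤ ‖Y 0‖ + s * m + s ^ 2 * K) :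
    DiniLE f t m := by
  intro r hr
  have h1 : Tendsto (fun s : ℝ => ‖(s : ℂ)⁻¹ • (Y s - Y 0) - Z‖ + s * K) (𝓝[>] 0) (𝓝 0) := by
    have e1 : Tendsto (fun s : ℝ => ‖(s : ℂ)⁻¹ • (Y s - Y 0) - Z‖) (𝓝[>] 0) (𝓝 0) := by
      simpa using (Tendsto.sub_const h Z).norm
    have e2 : Tendsto (fun s : ℝ => s * K) (𝓝[>] 0) (𝓝 0) := by
      have : Tendsto (fun s : ℝ => s * K) (𝓝 0) (𝓝 (0 * K)) :=
        (continuous_id.mul continuous_const).tendsto 0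
      rw [zero_mul] at this
      exact this.mono_left nhdsWithin_le_nhds
    simpa using e1.add e2
  have h2 : ∀ᶠ s : ℝ in 𝓝[>] 0, s ≤ 1 :=
    mem_nhdsWithin_of_mem_nhds (Iic_mem_nhds one_pos)
  filter_upwards [h1.eventually_lt_const (sub_pos.2 hr), h2, self_mem_nhdsWithin] with s hs hs1 hs0
  have hs0 : 0 < s := hs0
  have hne : (s : ℂ) ≠ 0 := by exact_mod_cast hs0.ne'
  have h0 : f t = ‖Y 0‖ := by simpa using hf 0 le_rfl
  rw [hf s hs0.le, h0]
  have e : Y s = (Y 0 + (s : ℂ) • Z) + (s : ℂ) • ((s : ℂ)⁻¹ • (Y s - Y 0) - Z) := by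
    rw [smul_sub, smul_inv_smul₀ hne]; abel
  have h3 : ‖Y s‖ ≤ ‖Y 0 + (s : ℂ) • Z‖ + s * ‖(s : ℂ)⁻¹ • (Y s - Y 0) - Z‖ := by
    conv_lhs => rw [e]
    refine (norm_add_le _ _).trans_eq ?_
    rw [norm_smul (s : ℂ), Complex.norm_real, Real.norm_of_nonneg hs0.le]
  have h4 := hm s hs0.le hs1
  nlinarith

theorem of_rightDeriv_norm {E : Type*} [NormedAddCommGroup E] [NormedSpace ℂ E] {Y : ℝ → E} {Z : E}
    (h : RightDeriv Y Z) (hf : ∀ s, 0 ≤ s → f (t + s) = ‖Y s‖) (hm : ‖Z‖ ≤ m) :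
    DiniLE f t m := by
  refine of_rightDeriv (K := 0) h hf fun s hs _ => ?_
  refine (norm_add_le _ _).trans ?_
  rw [norm_smul, Complex.norm_real, Real.norm_of_nonneg hs, mul_zero, add_zero]
  gcongr

theorem gronwall {T K ε : ℝ} (hf : ContinuousOn f (Set.Icc 0 T))
    (h : ∀ t, 0 ≤ t → t < T → DiniLE f t (K * f t + ε)) :
    ∀ t, 0 ≤ t → t ≤ T → f t ≤ gronwallBound (f 0) K ε t := by
  intro t ht ht'
  have := le_gronwallBound_of_liminf_deriv_right_le (f' := fun t => K * f t + ε) hf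
    (fun x hx r hr => by
      have := (h x hx.1 hx.2).frequently_slope_lt r hr
      simpa only [slope_def_field, div_eq_inv_mul] using this) le_rfl
    (fun x _ => le_rfl) t ⟨ht, ht'⟩
  rwa [sub_zero] at this

theorem eq_zero {T K : ℝ} (hf : ContinuousOn f (Set.Icc 0 T)) (hf0 : f 0 = 0)
    (hfn : ∀ t, 0 ≤ f t) (h : ∀ t, 0 ≤ t → t < T → DiniLE f t (K * f t)) :
    ∀ t, 0 ≤ t → t ≤ T → f t = 0 := by
  intro t ht ht'
  have := gronwall (ε := 0) hf (fun t ht ht' => by simpa using h t ht ht') t ht ht'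
  rw [hf0, gronwallBound_ε0, zero_mul] at this
  exact le_antisymm this (hfn t)

theorem le_of_deriv_lt {T : ℝ} {B B' : ℝ → ℝ} (hf : ContinuousOn f (Set.Icc 0 T)) {m : ℝ → ℝ}
    (h : ∀ t, 0 ≤ t → t < T → DiniLE f t (m t)) (h0 : f 0 ≤ B 0)
    (hB : ∀ t, HasDerivAt B (B' t) t)
    (hlt : ∀ t, 0 ≤ t → t < T → f t = B t → m t < B' t) :
    ∀ t, 0 ≤ t → t ≤ T → f t ≤ B t := by
  intro t ht ht'
  exact image_le_of_liminf_slope_right_lt_deriv_boundary hf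
    (fun x hx r hr => (h x hx.1 hx.2).frequently_slope_lt r hr) h0 hB
    (fun x hx => hlt x hx.1 hx.2) ⟨ht, ht'⟩

end DiniLE

end OneSidedDerivatives

/-! ### Selfadjoint generators do not change Hilbert-Schmidt norms to first order. -/

section SkewGenerators

variable {M : ℕ}

/-- `⟨x, Sx⟩` is real, so the cross term in `‖x + ihSx‖²` vanishes and only a quadratic correction
remains. -/
theorem norm_one_add_I_smul_le {S : Op M} (hS : star S = S) (h : ℝ) :
    ‖(1 : Op M) + ((h : ℂ) * Complex.I) • S‖ ≤ 1 + h ^ 2 * ‖S‖ ^ 2 := by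
  refine ContinuousLinearMap.opNorm_le_bound _ (by positivity) fun x => ?_
  have h1 : ‖x + ((h : ℂ) * Complex.I) • S x‖ ^ 2 = ‖x‖ ^ 2 + h ^ 2 * ‖S x‖ ^ 2 := by
    rw [norm_add_sq (𝕜 := ℂ), norm_smul, norm_mul, Complex.norm_real, Complex.norm_I, mul_one,
      mul_pow, Real.norm_eq_abs, sq_abs]
    have h2 : (starRingEnd ℂ) ⟪x, S x⟫_ℂ = ⟪x, S x⟫_ℂ := by
      rw [inner_conj_symm]
      nth_rewrite 1 [← hS]
      rw [ContinuousLinearMap.star_eq_adjoint, ContinuousLinearMap.adjoint_inner_left]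
    have h3 : RCLike.re (⟪x, ((h : ℂ) * Complex.I) • S x⟫_ℂ) = 0 := by
      rw [inner_smul_right]
      have := Complex.conj_eq_iff_im.1 h2
      simp [this]
    rw [h3]; ring
  have h2 : ‖x + ((h : ℂ) * Complex.I) • S x‖ ^ 2 ≤ ((1 + h ^ 2 * ‖S‖ ^ 2) * ‖x‖) ^ 2 := by
    rw [h1]
    have h3 : ‖S x‖ ^ 2 ≤ ‖S‖ ^ 2 * ‖x‖ ^ 2 := by
      rw [← mul_pow]; gcongr; exact S.le_opNorm x
    have h4 : h ^ 2 * ‖S x‖ ^ 2 ≤ h ^ 2 * (‖S‖ ^ 2 * ‖x‖ ^ 2) := by gcongr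
    nlinarith [mul_nonneg (mul_nonneg (sq_nonneg h) (sq_nonneg ‖S‖)) (sq_nonneg ‖x‖),
      mul_nonneg (sq_nonneg (h ^ 2 * ‖S‖ ^ 2)) (sq_nonneg ‖x‖)]
  exact abs_le_of_sq_le_sq' h2 (by positivity) |>.2

theorem DiniLE.of_rightDeriv_skew {f : ℝ → ℝ} {t : ℝ} {Y : ℝ → HS M} {S S' : Op M} {R : HS M}
    (h : RightDeriv Y (Complex.I • HS.lmul S (Y 0) + Complex.I • HS.rmul S' (Y 0) + R))
    (hS : star S = S) (hS' : star S' = S') (hf : ∀ s, 0 ≤ s → f (t + s) = ‖Y s‖) {m : ℝ}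
    (hm : ‖R‖ ≤ m) : DiniLE f t m := by
  refine of_rightDeriv (K := (‖S‖ ^ 2 + ‖S'‖ ^ 2 + ‖S‖ ^ 2 * ‖S'‖ ^ 2) * ‖Y 0‖
    + ‖S‖ * (‖Y 0‖ * ‖S'‖)) h hf fun s hs hs1 => ?_
  set z : ℂ := (s : ℂ) * Complex.I with hz
  have hzn : ‖z‖ = s := by simp [hz, abs_of_nonneg hs]
  -- With `z = is`, the first order expression is completed to the almost isometric product `(1 +
  -- zS) Y (1 + zS')`; the added term `z² S Y S'` is quadratic in `s`.
  have e : Y 0 + (s : ℂ) • (Complex.I • HS.lmul S (Y 0) + Complex.I • HS.rmul S' (Y 0) + R)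
      = HS.bimul (1 + z • S) (1 + z • S') (Y 0) + (s : ℂ) • R
        - (z * z) • HS.bimul S S' (Y 0) := by
    refine HS.ext ?_
    simp only [map_add, map_sub, map_smul, HS.op_lmul, HS.op_rmul, HS.op_bimul, smul_add, add_mul,
      mul_add, one_mul, mul_one, smul_smul, smul_mul_assoc, mul_smul_comm, ← hz]
    abel
  rw [e]
  have h1 : ‖HS.bimul (1 + z • S) (1 + z • S') (Y 0)‖
      ≤ (1 + s ^ 2 * ‖S‖ ^ 2) * (‖Y 0‖ * (1 + s ^ 2 * ‖S'‖ ^ 2)) := by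
    refine (HS.norm_lmul_le _ _).trans ?_
    gcongr
    · exact norm_one_add_I_smul_le hS s
    · refine (HS.norm_rmul_le _ _).trans ?_
      gcongr
      exact norm_one_add_I_smul_le hS' s
  have h2 : ‖(s : ℂ) • R‖ ≤ s * m := by
    rw [norm_smul, Complex.norm_real, Real.norm_of_nonneg hs]; gcongr
  have h3 : ‖(z * z) • HS.bimul S S' (Y 0)‖ ≤ s ^ 2 * (‖S‖ * (‖Y 0‖ * ‖S'‖)) := by
    rw [norm_smul, norm_mul, hzn, ← sq]
    gcongr
    refine (HS.norm_lmul_le _ _).trans ?_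
    gcongr
    exact HS.norm_rmul_le _ _
  have h4 := norm_sub_le (HS.bimul (1 + z • S) (1 + z • S') (Y 0) + (s : ℂ) • R)
    ((z * z) • HS.bimul S S' (Y 0))
  have h5 := norm_add_le (HS.bimul (1 + z • S) (1 + z • S') (Y 0)) ((s : ℂ) • R)
  have h6 : (s ^ 2) ^ 2 * (‖S‖ ^ 2 * ‖S'‖ ^ 2 * ‖Y 0‖)
      ≤ s ^ 2 * (‖S‖ ^ 2 * ‖S'‖ ^ 2 * ‖Y 0‖) := by
    gcongr
    nlinarith [sq_nonneg s]
  nlinarith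

end SkewGenerators

/-! ### Weak integrals over a set, with majorants required only on that set. -/

section RestrictedWeakIntegral

variable {M : ℕ} {Q : Type*} [MeasurableSpace Q] {μ : Measure Q} {S : Set Q} {Φ : Q → Op M}
  {B : Op M}

namespace IsWeakIntegral

theorem indicator (h : IsWeakIntegral (μ.restrict S) Φ B) (hS : MeasurableSet S) :
    IsWeakIntegral (μ.restrict S) (S.indicator Φ) B := fun f g => by
  have e : (fun q => ⟪f, Φ q g⟫_ℂ) =ᵐ[μ.restrict S] fun q => ⟪f, S.indicator Φ q g⟫_ℂ := by
    filter_upwards [ae_restrict_mem hS] with q hq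
    rw [Set.indicator_of_mem hq]
  exact ⟨(h f g).1.congr e, by rw [(h f g).2, integral_congr_ae e]⟩

theorem hsNorm_le_on (h : IsWeakIntegral (μ.restrict S) Φ B) (hS : MeasurableSet S) {c : Q → ℝ}
    (hc : Integrable c (μ.restrict S)) (hc0 : ∀ q ∈ S, 0 ≤ c q)
    (hΦ : ∀ q ∈ S, hsNorm (Φ q) ≤ ENNReal.ofReal (c q)) :
    hsNorm B ≤ ENNReal.ofReal (∫ q in S, c q ∂μ) := by
  have e : c =ᵐ[μ.restrict S] S.indicator c := by
    filter_upwards [ae_restrict_mem hS] with q hq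
    rw [Set.indicator_of_mem hq]
  rw [integral_congr_ae e]
  refine (h.indicator hS).hsNorm_le (hc.congr e) (fun q => Set.indicator_nonneg hc0 q) fun q => ?_
  by_cases hq : q ∈ S
  · rw [Set.indicator_of_mem hq, Set.indicator_of_mem hq]; exact hΦ q hq
  · rw [Set.indicator_of_notMem hq, Set.indicator_of_notMem hq]
    have := HS.hsNorm_op (0 : HS M)
    rw [map_zero, norm_zero] at this
    exact this.le

theorem traceNorm_le_on (h : IsWeakIntegral (μ.restrict S) Φ B) (hS : MeasurableSet S)
    {c : Q → ℝ} (hc : Integrable c (μ.restrict S)) (hc0 : ∀ q ∈ S, 0 ≤ c q)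
    (hΦ : ∀ q ∈ S, traceNorm (Φ q) ≤ ENNReal.ofReal (c q)) :
    traceNorm B ≤ ENNReal.ofReal (∫ q in S, c q ∂μ) := by
  have e : c =ᵐ[μ.restrict S] S.indicator c := by
    filter_upwards [ae_restrict_mem hS] with q hq
    rw [Set.indicator_of_mem hq]
  rw [integral_congr_ae e]
  refine (h.indicator hS).traceNorm_le (hc.congr e) (fun q => Set.indicator_nonneg hc0 q)
    fun q => ?_
  by_cases hq : q ∈ S
  · rw [Set.indicator_of_mem hq, Set.indicator_of_mem hq]; exact hΦ q hq
  · rw [Set.indicator_of_notMem hq, Set.indicator_of_notMem hq]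
    refine HFB.traceNorm_le fun n e f _ _ => ?_
    simp

end IsWeakIntegral

end RestrictedWeakIntegral

/-! ### Differentiation along the free flow. -/

section Comoving

variable {M : ℕ}

/-- The pull-back of `A` along the free evolution over a time `h`: `U(-h) A U(σh)`. -/
def pullback (ε σ h : ℝ) (A : HS M) : HS M :=
  HS.bimul (freeProp M ε (-h)) (freeProp M ε (σ * h)) A

theorem norm_freeProp_le (ε t : ℝ) : ‖freeProp M ε t‖ ≤ 1 :=
  norm_op_le_one_of_isometry (norm_freeProp_apply ε t)

theorem norm_pullback (ε σ h : ℝ) (A : HS M) : ‖pullback ε σ h A‖ = ‖A‖ := by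
  rw [pullback, HS.bimul, HS.norm_lmul_of_isometry (norm_freeProp_apply ε _),
    HS.norm_rmul_of_isometry]
  intro x
  rw [star_freeProp]
  exact norm_freeProp_apply ε _ x

theorem op_pullback (ε σ h : ℝ) (A : HS M) :
    HS.op (pullback ε σ h A) = freeProp M ε (-h) * HS.op A * freeProp M ε (σ * h) := by
  rw [pullback, HS.op_bimul, mul_assoc]

theorem pullback_zero (ε σ : ℝ) (A : HS M) : pullback ε σ 0 A = A := by
  refine HS.ext ?_
  rw [op_pullback, neg_zero, mul_zero, freeProp_zero, one_mul, mul_one]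

theorem pullback_sub (ε σ h : ℝ) (A B : HS M) :
    pullback ε σ h (A - B) = pullback ε σ h A - pullback ε σ h B :=
  HS.bimul_sub _ _ _ _

/-- `Z` is the derivative of `X` at `t` along the free evolution. -/
def ComovingDeriv (ε σ : ℝ) (X : ℝ → HS M) (t : ℝ) (Z : HS M) : Prop :=
  RightDeriv (fun h => pullback ε σ h (X (t + h))) Z

theorem continuous_freeProp_comp {ε : ℝ} {φ : ℝ → ℝ} (hφ : Continuous φ) (g : H M) :
    Continuous fun s => freeProp M ε (φ s) g :=
  (continuous_freeProp_apply ε g).comp hφ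

theorem continuous_pullback {ε σ : ℝ} {φ : ℝ → ℝ} (hφ : Continuous φ) {Y : ℝ → HS M}
    (hY : Continuous Y) : Continuous fun s => pullback ε σ (φ s) (Y s) := by
  refine continuous_iff_continuousAt.2 fun s => ?_
  refine HS.tendsto_bimul (fun _ => norm_freeProp_le _ _) (fun _ => norm_freeProp_le _ _)
    (fun x => ?_) (fun x => ?_) (hY.tendsto s)
  · exact (continuous_freeProp_comp hφ.neg x).tendsto s
  · simp only [star_freeProp]
    exact (continuous_freeProp_comp ((continuous_const.mul hφ).neg) x).tendsto s

theorem freeProp_sandwich (ε a b c d : ℝ) (B : Op M) :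
    freeProp M ε a * (freeProp M ε b * B * freeProp M ε c) * freeProp M ε d
      = freeProp M ε (a + b) * B * freeProp M ε (c + d) := by
  rw [← freeProp_mul, ← freeProp_mul]
  simp only [mul_assoc]

/-- After the pull-back to time `t` the Duhamel integrand no longer depends on the upper limit, so
the formula becomes an ordinary integral of a norm continuous curve. The sign `σ` is `1` for `ω`,
which the kinetic energy enters as a commutator, and `-1` for `α`. -/
theorem comovingDeriv_of_duhamel {ε σ : ℝ} {X Y : ℝ → HS M} (hY : Continuous Y) (c : ℂ)
    (h : ∀ t, 0 ≤ t → ∀ f g : H M, ⟪f, HS.op (X t) g⟫_ℂ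
      = ⟪f, (freeProp M ε t * HS.op (X 0) * freeProp M ε (-(σ * t))) g⟫_ℂ
        + c * ∫ s in (0 : ℝ)..t, ⟪f, (freeProp M ε (t - s) * HS.op (Y s)
          * freeProp M ε (-(σ * (t - s)))) g⟫_ℂ) {t : ℝ} (ht : 0 ≤ t) :
    ComovingDeriv ε σ X t (c • Y t) := by
  set W : ℝ → HS M := fun s => pullback ε σ (s - t) (Y s) with hW
  have hWc : Continuous W := continuous_pullback (by fun_prop) hY
  have hWt : W t = Y t := by simp only [hW, sub_self, pullback_zero]
  have hWi : ∀ f g, Continuous fun s => ⟪f, HS.op (W s) g⟫_ℂ := fun f g =>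
    continuous_const.inner ((ContinuousLinearMap.apply ℂ (H M) g).continuous.comp
      (HS.continuous_op.comp hWc))
  have key : ∀ r, 0 ≤ r → ∀ f g, ⟪f, HS.op (pullback ε σ r (X (t + r))) g⟫_ℂ
      = ⟪f, (freeProp M ε t * HS.op (X 0) * freeProp M ε (-(σ * t))) g⟫_ℂ
        + c * ∫ s in (0 : ℝ)..(t + r), ⟪f, HS.op (W s) g⟫_ℂ := fun r hr f g => by
    have h1 : ∀ B : Op M, ⟪f, (freeProp M ε (-r) * B * freeProp M ε (σ * r)) g⟫_ℂ
        = ⟪freeProp M ε r f, B (freeProp M ε (σ * r) g)⟫_ℂ := fun B => by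
      rw [mul_assoc, mul_apply_eq_comp, ← star_freeProp ε r, ContinuousLinearMap.star_eq_adjoint,
        ContinuousLinearMap.adjoint_inner_right]
      rfl
    rw [op_pullback, h1, h _ (by linarith), ← h1]
    congr 2
    · rw [freeProp_sandwich]
      rw [show -r + (t + r) = t by ring, show -(σ * (t + r)) + σ * r = -(σ * t) by ring]
    · refine intervalIntegral.integral_congr fun s _ => ?_
      rw [← h1, hW, op_pullback, freeProp_sandwich, show -r + (t + r - s) = -(s - t) by ring,
        show -(σ * (t + r - s)) + σ * r = σ * (s - t) by ring]
  have hwi : ∀ r, 0 ≤ r → IsWeakIntegral (volume.restrict (Set.Ioc t (t + r)))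
      (fun s => HS.op (c • (W s - W t))) (HS.op (pullback ε σ r (X (t + r))
        - pullback ε σ 0 (X (t + 0)) - (r : ℂ) • c • Y t)) := fun r hr f g => by
    have hci : Continuous fun s => ⟪f, HS.op (c • (W s - W t)) g⟫_ℂ := by
      have h2 : ∀ s, ⟪f, HS.op (c • (W s - W t)) g⟫_ℂ
          = c * (⟪f, HS.op (W s) g⟫_ℂ - ⟪f, HS.op (W t) g⟫_ℂ) := fun s => by
        rw [map_smul, map_sub, _root_.smul_apply, _root_.sub_apply, inner_smul_right,
          inner_sub_right]
      simp only [h2]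
      exact continuous_const.mul ((hWi f g).sub continuous_const)
    refine ⟨(hci.integrableOn_Ioc), ?_⟩
    rw [← intervalIntegral.integral_of_le (by linarith)]
    have h3 : ∀ s, ⟪f, HS.op (c • (W s - W t)) g⟫_ℂ
        = c * ⟪f, HS.op (W s) g⟫_ℂ - c * ⟪f, HS.op (W t) g⟫_ℂ := fun s => by
      rw [map_smul, map_sub, _root_.smul_apply, _root_.sub_apply, inner_smul_right,
        inner_sub_right, mul_sub]
    simp only [h3]
    have hc1 : Continuous fun s => c * ⟪f, HS.op (W s) g⟫_ℂ := continuous_const.mul (hWi f g)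
    rw [intervalIntegral.integral_sub (hc1.intervalIntegrable _ _)
      (continuous_const.intervalIntegrable _ _), intervalIntegral.integral_const,
      intervalIntegral.integral_const_mul, map_sub, map_sub, map_smul, map_smul,
      _root_.sub_apply, _root_.sub_apply, _root_.smul_apply, _root_.smul_apply, inner_sub_right,
      inner_sub_right, inner_smul_right, inner_smul_right, key r hr, key 0 le_rfl,
      ← intervalIntegral.integral_add_adjacent_intervals
        ((hWi f g).intervalIntegrable 0 t) ((hWi f g).intervalIntegrable t (t + r)), hWt]
    simp only [add_zero, add_sub_cancel_left, Complex.real_smul]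
    ring
  rw [ComovingDeriv, RightDeriv, Metric.tendsto_nhds]
  intro δ hδ
  have h4 : ∀ᶠ s in 𝓝 t, ‖c • (W s - W t)‖ < δ := by
    have : Tendsto (fun s => ‖c • (W s - W t)‖) (𝓝 t) (𝓝 ‖c • (W t - W t)‖) :=
      (((hWc.sub continuous_const).const_smul c).norm).tendsto t
    rw [sub_self, smul_zero, norm_zero] at this
    exact this.eventually_lt_const hδ
  obtain ⟨η, hη, hη'⟩ := Metric.eventually_nhds_iff.1 h4
  have h5 : ∀ᶠ r : ℝ in 𝓝[>] 0, r < η := mem_nhdsWithin_of_mem_nhds (Iio_mem_nhds hη)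
  filter_upwards [h5, self_mem_nhdsWithin] with r hr hr0
  have hr0 : 0 < r := hr0
  have hne : (r : ℂ) ≠ 0 := by exact_mod_cast hr0.ne'
  -- The error is the average over `[t, t + r]` of `c(W(s) - W(t))`. Its maximum is attained, which
  -- gives a constant majorant strictly below `δ`.
  obtain ⟨s₀, hs₀, hmax⟩ := (isCompact_Icc (a := t) (b := t + r)).exists_isMaxOn
    ⟨t, by constructor <;> linarith⟩
    (((hWc.sub continuous_const).const_smul c).norm (E := HS M)).continuousOn
  set m : ℝ := ‖c • (W s₀ - W t)‖ with hm
  have hmδ : m < δ := hη' (by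
    rw [Real.dist_eq, abs_lt]; constructor <;> linarith [hs₀.1, hs₀.2])
  have h6 : ‖pullback ε σ r (X (t + r)) - pullback ε σ 0 (X (t + 0)) - (r : ℂ) • c • Y t‖
      ≤ r * m := by
    refine HS.norm_le_of_hsNorm_le (by positivity) ?_
    refine ((hwi r hr0.le).hsNorm_le_on measurableSet_Ioc (c := fun _ => m)
      (integrable_const _) (fun _ _ => norm_nonneg _) fun s hs => ?_).trans_eq ?_
    · rw [HS.hsNorm_op]
      exact ENNReal.ofReal_le_ofReal (hmax ⟨hs.1.le, hs.2⟩)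
    · simp [hr0.le]
  rw [dist_eq_norm]
  have e : (r : ℂ)⁻¹ • (pullback ε σ r (X (t + r)) - pullback ε σ 0 (X (t + 0))) - c • Y t
      = (r : ℂ)⁻¹ • (pullback ε σ r (X (t + r)) - pullback ε σ 0 (X (t + 0))
        - (r : ℂ) • c • Y t) := by
    rw [smul_sub _ (_ - _), inv_smul_smul₀ hne]
  rw [e, norm_smul, norm_inv, Complex.norm_real, Real.norm_of_nonneg hr0.le]
  calc r⁻¹ * _ ≤ r⁻¹ * (r * m) := by gcongr
    _ = m := by field_simp
    _ < δ := hmδ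

end Comoving

/-! ### Continuity of trace class curves, of the direct potential and of products. -/

section TraceNormCurves

variable {M : ℕ}

/-- Continuity in trace norm of a curve of trace class operators. -/
structure TraceNormContinuous (A : ℝ → Op M) : Prop where
  lt_top : ∀ t, traceNorm (A t) < ∞
  tendsto : ∀ s, Tendsto (fun t => traceNorm (A t - A s)) (𝓝 s) (𝓝 0)

theorem traceNorm_le_add_sub (A B : Op M) : traceNorm A ≤ traceNorm B + traceNorm (A - B) := by
  have := traceNorm_add B (A - B)
  rwa [add_sub_cancel] at this

theorem toReal_traceNorm_le_add {A B : Op M} (hA : traceNorm A < ∞) (hB : traceNorm B < ∞) :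
    (traceNorm A).toReal ≤ (traceNorm B).toReal + (traceNorm (A - B)).toReal := by
  rw [← ENNReal.toReal_add hB.ne (traceNorm_sub_lt hA hB).ne]
  exact ENNReal.toReal_mono (ENNReal.add_lt_top.2 ⟨hB, traceNorm_sub_lt hA hB⟩).ne
    (traceNorm_le_add_sub A B)

theorem traceNorm_sub_comm (A B : Op M) : traceNorm (A - B) = traceNorm (B - A) := by
  rw [← traceNorm_neg, neg_sub]

namespace TraceNormContinuous

variable {A : ℝ → Op M}

theorem tendsto_toReal (hA : TraceNormContinuous A) (s : ℝ) :
    Tendsto (fun t => (traceNorm (A t - A s)).toReal) (𝓝 s) (𝓝 0) := by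
  have := (ENNReal.tendsto_toReal ENNReal.zero_ne_top).comp (hA.tendsto s)
  rw [ENNReal.toReal_zero] at this
  exact this

theorem continuous_toReal (hA : TraceNormContinuous A) :
    Continuous fun t => (traceNorm (A t)).toReal := by
  refine continuous_iff_continuousAt.2 fun s => ?_
  rw [ContinuousAt, tendsto_iff_dist_tendsto_zero]
  refine squeeze_zero (fun _ => dist_nonneg) (fun t => ?_) (hA.tendsto_toReal s)
  rw [Real.dist_eq, abs_le]
  have h1 := toReal_traceNorm_le_add (hA.lt_top t) (hA.lt_top s)
  have h2 := toReal_traceNorm_le_add (hA.lt_top s) (hA.lt_top t)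
  rw [traceNorm_sub_comm] at h2
  constructor <;> linarith

theorem sub_star (hA : TraceNormContinuous A) : TraceNormContinuous fun t => A t - star (A t) where
  lt_top t := traceNorm_sub_lt (hA.lt_top t) ((traceNorm_star _).trans_lt (hA.lt_top t))
  tendsto s := by
    have h := (hA.tendsto s).add (hA.tendsto s)
    rw [add_zero] at h
    refine tendsto_of_tendsto_of_tendsto_of_le_of_le tendsto_const_nhds h (fun _ => zero_le)
      fun t => ?_
    have e : A t - star (A t) - (A s - star (A s)) = (A t - A s) + -star (A t - A s) := by
      rw [star_sub]; abel
    simp only [e]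
    refine (traceNorm_add _ _).trans ?_
    rw [traceNorm_neg]
    gcongr
    exact traceNorm_star _

theorem continuous_directOp (hA : TraceNormContinuous A) {V : R3 → ℝ} {C₀ : ℝ}
    (hV : IsPotential C₀ V) (N : ℝ) : Continuous fun t => directOp V N (A t) := by
  refine continuous_iff_continuousAt.2 fun s => ?_
  rw [ContinuousAt, tendsto_iff_norm_sub_tendsto_zero]
  have h1 := ((hA.tendsto_toReal s).const_mul 4).const_mul |N|⁻¹ |>.const_mul C₀
  simp only [mul_zero] at h1
  refine squeeze_zero (fun _ => norm_nonneg _) (fun t => ?_) h1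
  rw [← directOp_sub hV N (hA.lt_top t) (hA.lt_top s)]
  exact norm_directOp_le_traceNorm hV N (traceNorm_sub_lt (hA.lt_top t) (hA.lt_top s))

end TraceNormContinuous

theorem HS.continuous_lmul {X : Type*} [TopologicalSpace X] {P : X → Op M} {A : X → HS M}
    (hP : Continuous P) (hA : Continuous A) : Continuous fun t => HS.lmul (P t) (A t) := by
  refine continuous_iff_continuousAt.2 fun s => ?_
  rw [ContinuousAt, tendsto_iff_norm_sub_tendsto_zero]
  have h1 : Tendsto (fun t => ‖P t - P s‖ * ‖A t‖ + ‖P s‖ * ‖A t - A s‖) (𝓝 s)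
      (𝓝 (‖P s - P s‖ * ‖A s‖ + ‖P s‖ * ‖A s - A s‖)) :=
    (((hP.sub continuous_const).norm.mul hA.norm).add
      (continuous_const.mul (hA.sub continuous_const).norm)).tendsto s
  simp only [sub_self, norm_zero, zero_mul, mul_zero, add_zero] at h1
  refine squeeze_zero (fun _ => norm_nonneg _) (fun t => ?_) h1
  have e : HS.lmul (P t) (A t) - HS.lmul (P s) (A s)
      = HS.lmul (P t - P s) (A t) + HS.lmul (P s) (A t - A s) := by
    rw [HS.lmul_sub, map_sub]; abel
  rw [e]
  exact (norm_add_le _ _).trans (add_le_add (HS.norm_lmul_le _ _) (HS.norm_lmul_le _ _))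

theorem continuous_star_op {X : Type*} [TopologicalSpace X] {P : X → Op M} (hP : Continuous P) :
    Continuous fun t => star (P t) := by
  have : Isometry (star : Op M → Op M) := Isometry.of_dist_eq fun A B => by
    rw [dist_eq_norm, dist_eq_norm, ← star_sub, norm_star_op]
  exact this.continuous.comp hP

theorem continuous_conjOp {X : Type*} [TopologicalSpace X] {P : X → Op M} (hP : Continuous P) :
    Continuous fun t => conjOp (P t) := by
  have : Isometry (conjOp : Op M → Op M) := Isometry.of_dist_eq fun A B => by
    rw [dist_eq_norm, dist_eq_norm, ← conjOp_sub, norm_conjOp]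
  exact this.continuous.comp hP

theorem HS.continuous_rmul {X : Type*} [TopologicalSpace X] {P : X → Op M} {A : X → HS M}
    (hP : Continuous P) (hA : Continuous A) : Continuous fun t => HS.rmul (P t) (A t) := by
  simp only [HS.rmul_eq_adj]
  exact HS.continuous_adj.comp
    (HS.continuous_lmul (continuous_star_op hP) (HS.continuous_adj.comp hA))

end TraceNormCurves

/-! ### The equations in the Hilbert-Schmidt space; the solution is extended to negative times to
have continuous curves on the whole line. -/

section Forces

variable {M : ℕ} {V : R3 → ℝ} {C₀ : ℝ}

/-- The interaction part of the equation for `ω` as a Hilbert-Schmidt operator. -/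
def omegaForceHS (hV : IsPotential C₀ V) (N : ℝ) (ω α : HS M) : HS M :=
  HS.lmul (hfPotential V N (HS.op ω)) ω - HS.rmul (hfPotential V N (HS.op ω)) ω
    + HS.rmul (star (HS.op α)) (exch hV N α) - HS.lmul (HS.op α) (HS.adj (exch hV N α))

theorem op_omegaForceHS (hV : IsPotential C₀ V) (N : ℝ) (ω α : HS M) :
    HS.op (omegaForceHS hV N ω α) = omegaForce V N (HS.op ω) (HS.op α) := rfl

/-- The interaction part of the equation for `α` as a Hilbert-Schmidt operator. -/
def alphaForceHS (hV : IsPotential C₀ V) (N : ℝ) (ω α : HS M) : HS M :=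
  HS.lmul (hfPotential V N (HS.op ω)) α + HS.rmul (conjOp (hfPotential V N (HS.op ω))) α
    + HS.rmul (1 - conjOp (HS.op ω)) (exch hV N α) - HS.lmul (HS.op ω) (exch hV N α)

theorem op_alphaForceHS (hV : IsPotential C₀ V) (N : ℝ) (ω α : HS M) :
    HS.op (alphaForceHS hV N ω α) = alphaForce V N (HS.op ω) (HS.op α) := rfl

theorem star_hfPotential (hV : IsPotential C₀ V) (N : ℝ) {ω : HS M}
    (h : traceNorm (HS.op ω) < ∞) :
    star (hfPotential V N (HS.op ω)) = hfPotential V N (HS.op (HS.adj ω)) := by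
  have h1 : star (kernelMul V N (HS.op ω)) = kernelMul V N (HS.op (HS.adj ω)) :=
    congrArg HS.op (adj_exch hV N ω)
  rw [hfPotential, star_sub, star_directOp hV N h, h1]
  rfl

variable {N : ℝ} {ωN αN : Op M} {ω α : ℝ → Op M}

theorem hsNorm_lt_of_traceNorm {A : Op M} (h : traceNorm A < ∞) : hsNorm A < ∞ :=
  (hsNorm_le_traceNorm h).trans_lt ENNReal.ofReal_lt_top

namespace IsSolution

/-- The curve `ω`, extended by its initial value to negative times. -/
def om (h : IsSolution V N ωN αN ω α) (t : ℝ) : HS M :=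
  HS.mk (ω (max t 0)) (hsNorm_lt_of_traceNorm (h.omega_traceClass _ (le_max_right t 0)))

/-- The curve `α`, extended by its initial value to negative times. -/
def al (h : IsSolution V N ωN αN ω α) (t : ℝ) : HS M :=
  HS.mk (α (max t 0)) (h.alpha_hilbertSchmidt _ (le_max_right t 0))

variable (h : IsSolution V N ωN αN ω α)

theorem op_om {t : ℝ} (ht : 0 ≤ t) : HS.op (h.om t) = ω t := by
  rw [om, HS.op_mk, max_eq_left ht]

theorem op_al {t : ℝ} (ht : 0 ≤ t) : HS.op (h.al t) = α t := by
  rw [al, HS.op_mk, max_eq_left ht]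

theorem tendsto_max (s : ℝ) : Tendsto (fun t : ℝ => max t 0) (𝓝 s) (𝓝[Set.Ici 0] (max s 0)) :=
  tendsto_nhdsWithin_of_tendsto_nhds_of_eventually_within _
    ((continuous_id.max continuous_const).tendsto s) (Eventually.of_forall fun t => le_max_right t 0)

theorem traceNormContinuous : TraceNormContinuous fun t => HS.op (h.om t) where
  lt_top t := h.omega_traceClass _ (le_max_right t 0)
  tendsto s := (h.omega_continuous _ (le_max_right s 0)).comp (tendsto_max s)

theorem continuous_om : Continuous h.om := by
  refine continuous_iff_continuousAt.2 fun s => ?_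
  rw [ContinuousAt, tendsto_iff_norm_sub_tendsto_zero]
  have h1 := (h.traceNormContinuous.tendsto_toReal s).const_mul 4
  rw [mul_zero] at h1
  refine squeeze_zero (fun _ => norm_nonneg _) (fun t => ?_) h1
  refine HS.norm_le_of_hsNorm_le (by positivity) ?_
  rw [map_sub]
  exact hsNorm_le_traceNorm (traceNorm_sub_lt (h.traceNormContinuous.lt_top t)
    (h.traceNormContinuous.lt_top s))

theorem continuous_al : Continuous h.al := by
  refine continuous_iff_continuousAt.2 fun s => ?_
  rw [ContinuousAt, tendsto_iff_norm_sub_tendsto_zero]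
  have h1 := (ENNReal.tendsto_toReal ENNReal.zero_ne_top).comp
    ((h.alpha_continuous _ (le_max_right s 0)).comp (tendsto_max s))
  rw [ENNReal.toReal_zero] at h1
  refine h1.congr fun t => ?_
  rw [HS.norm_eq]
  rfl

/-- The mean-field potential along the solution. -/
def pot (h : IsSolution V N ωN αN ω α) (t : ℝ) : Op M := hfPotential V N (HS.op (h.om t))

theorem continuous_pot (hV : IsPotential C₀ V) : Continuous h.pot := by
  have h1 := h.traceNormContinuous.continuous_directOp hV N
  have h2 := HS.continuous_op.comp ((continuous_exch hV N).comp h.continuous_om)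
  exact h1.sub h2

theorem continuous_omegaForceHS (hV : IsPotential C₀ V) :
    Continuous fun t => omegaForceHS hV N (h.om t) (h.al t) := by
  have hP := h.continuous_pot hV
  have he := (continuous_exch hV N).comp h.continuous_al
  have ha := HS.continuous_op.comp h.continuous_al
  exact (((HS.continuous_lmul hP h.continuous_om).sub (HS.continuous_rmul hP h.continuous_om)).add
    (HS.continuous_rmul (continuous_star_op ha) he)).sub
    (HS.continuous_lmul ha (HS.continuous_adj.comp he))

theorem continuous_alphaForceHS (hV : IsPotential C₀ V) :
    Continuous fun t => alphaForceHS hV N (h.om t) (h.al t) := by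
  have hP := h.continuous_pot hV
  have he := (continuous_exch hV N).comp h.continuous_al
  have ho := HS.continuous_op.comp h.continuous_om
  exact (((HS.continuous_lmul hP h.continuous_al).add
    (HS.continuous_rmul (continuous_conjOp hP) h.continuous_al)).add
    (HS.continuous_rmul (continuous_const.sub (continuous_conjOp ho)) he)).sub
    (HS.continuous_lmul ho he)

theorem comovingDeriv_om (hV : IsPotential C₀ V) {t : ℝ} (ht : 0 ≤ t) :
    ComovingDeriv (eps N) 1 h.om t
      ((Complex.I * (eps N : ℂ))⁻¹ • omegaForceHS hV N (h.om t) (h.al t)) := by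
  refine comovingDeriv_of_duhamel (h.continuous_omegaForceHS hV) _ (fun t ht f g => ?_) ht
  rw [h.op_om ht, h.op_om le_rfl, h.omega_zero, h.omega_eq t ht f g, one_mul, mul_assoc]
  refine congrArg₂ (· + ·) rfl (congrArg _ ?_)
  refine intervalIntegral.integral_congr fun s hs => ?_
  rw [Set.uIcc_of_le ht] at hs
  simp only [op_omegaForceHS, h.op_om hs.1, h.op_al hs.1, one_mul, mul_assoc]
  rfl

theorem comovingDeriv_al (hV : IsPotential C₀ V) {t : ℝ} (ht : 0 ≤ t) :
    ComovingDeriv (eps N) (-1) h.al t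
      ((Complex.I * (eps N : ℂ))⁻¹ • alphaForceHS hV N (h.om t) (h.al t)) := by
  refine comovingDeriv_of_duhamel (h.continuous_alphaForceHS hV) _ (fun t ht f g => ?_) ht
  rw [h.op_al ht, h.op_al le_rfl, h.alpha_zero, h.alpha_eq t ht f g, mul_assoc]
  simp only [neg_mul, one_mul, neg_neg]
  refine congrArg₂ (· + ·) rfl (congrArg _ ?_)
  refine intervalIntegral.integral_congr fun s hs => ?_
  rw [Set.uIcc_of_le ht] at hs
  simp only [op_alphaForceHS, h.op_om hs.1, h.op_al hs.1, mul_assoc]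
  rfl

end IsSolution

end Forces

/-! ### Selfadjointness of `ω` is propagated. -/

section SelfAdjointness

variable {M : ℕ} {V : R3 → ℝ} {C₀ : ℝ} {N : ℝ} {ωN αN : Op M} {ω α : ℝ → Op M}

/-- Grönwall for the primitive of `y`. The integral form suits the trace norm, for which the
comoving derivative in Hilbert-Schmidt norm gives no control. -/
theorem eq_zero_of_le_integral {y : ℝ → ℝ} (hy : Continuous y) (hy0 : ∀ t, 0 ≤ y t) {T K : ℝ}
    (hK : 0 ≤ K) (h : ∀ t, 0 ≤ t → t ≤ T → y t ≤ K * ∫ s in (0 : ℝ)..t, y s) :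
    ∀ t, 0 ≤ t → t ≤ T → y t = 0 := by
  have hd : ∀ t, HasDerivAt (fun t => ∫ s in (0 : ℝ)..t, y s) (y t) t := fun t =>
    intervalIntegral.integral_hasDerivAt_right (hy.intervalIntegrable _ _)
      (hy.stronglyMeasurableAtFilter _ _) hy.continuousAt
  have hn : ∀ t, 0 ≤ t → 0 ≤ ∫ s in (0 : ℝ)..t, y s := fun t ht =>
    intervalIntegral.integral_nonneg ht fun s _ => hy0 s
  intro t ht ht'
  have h1 := norm_le_gronwallBound_of_norm_deriv_right_le (δ := 0) (K := K) (ε := 0) (a := 0) (b := T)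
    (f := fun t => ∫ s in (0 : ℝ)..t, y s) (f' := y)
    (fun x _ => (hd x).continuousAt.continuousWithinAt) (fun x _ => (hd x).hasDerivWithinAt)
    (by simp) (fun x hx => by
      rw [Real.norm_of_nonneg (hy0 x), Real.norm_of_nonneg (hn x hx.1), add_zero]
      exact h x hx.1 hx.2.le) t ⟨ht, ht'⟩
  rw [gronwallBound_ε0, zero_mul, Real.norm_of_nonneg (hn t ht)] at h1
  have h2 := h t ht ht'
  have h3 := hy0 t
  nlinarith

theorem traceNorm_mul_left_le {A : Op M} (h : traceNorm A < ∞) (B : Op M) :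
    traceNorm (B * A) ≤ ENNReal.ofReal (4 * ‖B‖ * (traceNorm A).toReal) := by
  have := traceNorm_mul_mul_le h B 1
  rw [mul_one] at this
  refine this.trans (ENNReal.ofReal_le_ofReal ?_)
  have h3 : ‖(1 : Op M)‖ ≤ 1 := ContinuousLinearMap.norm_id_le
  calc 4 * ‖B‖ * ‖(1 : Op M)‖ * (traceNorm A).toReal ≤ 4 * ‖B‖ * 1 * (traceNorm A).toReal := by
        gcongr
    _ = _ := by ring

theorem traceNorm_mul_right_le {A : Op M} (h : traceNorm A < ∞) (B : Op M) :
    traceNorm (A * B) ≤ ENNReal.ofReal (4 * ‖B‖ * (traceNorm A).toReal) := by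
  have := traceNorm_mul_mul_le h 1 B
  rw [one_mul] at this
  refine this.trans (ENNReal.ofReal_le_ofReal ?_)
  have h3 : ‖(1 : Op M)‖ ≤ 1 := ContinuousLinearMap.norm_id_le
  calc 4 * ‖(1 : Op M)‖ * ‖B‖ * (traceNorm A).toReal ≤ 4 * 1 * ‖B‖ * (traceNorm A).toReal := by
        gcongr
    _ = _ := by ring

theorem traceNorm_comm_le {A : Op M} (h : traceNorm A < ∞) (B : Op M) :
    traceNorm (B * A - A * B) ≤ ENNReal.ofReal (8 * ‖B‖ * (traceNorm A).toReal) := by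
  rw [sub_eq_add_neg]
  refine (traceNorm_add _ _).trans ?_
  rw [traceNorm_neg]
  refine (add_le_add (traceNorm_mul_left_le h B) (traceNorm_mul_right_le h B)).trans_eq ?_
  rw [← ENNReal.ofReal_add (by positivity) (by positivity)]
  ring_nf

/-- The coefficient `(iε)⁻¹` is imaginary, so `ω - ω*` is driven by `F + F*`. The pairing part `Πα*
- αΠ*` is skew-adjoint and drops out; what remains is linear in `ω - ω*`, and `α` disappears from
the equation. -/
theorem omegaForce_add_star (hV : IsPotential C₀ V) (ω α : HS M)
    (hω : traceNorm (HS.op ω) < ∞) :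
    omegaForce V N (HS.op ω) (HS.op α) + star (omegaForce V N (HS.op ω) (HS.op α))
      = (hfPotential V N (HS.op ω) * (HS.op ω - star (HS.op ω))
          - (HS.op ω - star (HS.op ω)) * hfPotential V N (HS.op ω))
        + (hfPotential V N (HS.op ω - star (HS.op ω)) * star (HS.op ω)
          - star (HS.op ω) * hfPotential V N (HS.op ω - star (HS.op ω))) := by
  have hω' : traceNorm (star (HS.op ω)) < ∞ := (traceNorm_star _).trans_lt hω
  have h1 : hfPotential V N (HS.op ω - star (HS.op ω))
      = hfPotential V N (HS.op ω) - star (hfPotential V N (HS.op ω)) := by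
    rw [star_hfPotential hV N hω, hfPotential, hfPotential, hfPotential, HS.op_adj,
      directOp_sub hV N hω hω']
    have := exch_sub hV N ω (HS.adj ω)
    have h2 := congrArg HS.op this
    rw [op_exch, map_sub, map_sub, op_exch, op_exch, HS.op_adj] at h2
    rw [h2]; abel
  rw [h1]
  set P := hfPotential V N (HS.op ω)
  have h2 : omegaForce V N (HS.op ω) (HS.op α) = (P * HS.op ω - HS.op ω * P)
      + kernelMul V N (HS.op α) * star (HS.op α) - HS.op α * star (kernelMul V N (HS.op α)) := rfl
  rw [h2]
  simp only [star_sub, star_add, star_mul, star_star]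
  noncomm_ring

/-- The direct and the exchange term contribute 4 each. The trace norm is needed for the direct
term, since the density is not controlled by the Hilbert-Schmidt norm. -/
theorem norm_hfPotential_le (hV : IsPotential C₀ V) (N : ℝ) (ω : HS M)
    (hω : traceNorm (HS.op ω) < ∞) :
    ‖hfPotential V N (HS.op ω)‖ ≤ 8 * |N|⁻¹ * C₀ * (traceNorm (HS.op ω)).toReal := by
  have h1 := norm_directOp_le_traceNorm hV N hω
  have h2 := (HS.norm_op_le _).trans (norm_exch_le hV N ω)
  have h3 : ‖ω‖ ≤ 4 * (traceNorm (HS.op ω)).toReal :=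
    HS.norm_le_of_hsNorm_le (by positivity) (hsNorm_le_traceNorm hω)
  have h4 : |N|⁻¹ * C₀ * ‖ω‖ ≤ |N|⁻¹ * C₀ * (4 * (traceNorm (HS.op ω)).toReal) := by
    have := hV.nonneg
    gcongr
  rw [hfPotential]
  refine (norm_sub_le _ _).trans ?_
  rw [op_exch] at h2
  linarith

theorem traceNorm_omegaForce_add_star_le (hV : IsPotential C₀ V) (ω α : HS M)
    (hω : traceNorm (HS.op ω) < ∞) :
    traceNorm (omegaForce V N (HS.op ω) (HS.op α) + star (omegaForce V N (HS.op ω) (HS.op α)))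
      ≤ ENNReal.ofReal ((128 * |N|⁻¹ * C₀ * (traceNorm (HS.op ω)).toReal)
        * (traceNorm (HS.op ω - star (HS.op ω))).toReal) := by
  have hω' : traceNorm (star (HS.op ω)) < ∞ := (traceNorm_star _).trans_lt hω
  have hY := traceNorm_sub_lt hω hω'
  rw [omegaForce_add_star hV ω α hω]
  refine (traceNorm_add _ _).trans ((add_le_add (traceNorm_comm_le hY _)
    (traceNorm_comm_le hω' _)).trans ?_)
  rw [← ENNReal.ofReal_add (by positivity) (by positivity)]
  refine ENNReal.ofReal_le_ofReal ?_
  have h1 := norm_hfPotential_le hV N ω hω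
  have h2 := norm_hfPotential_le hV N (ω - HS.adj ω) (by rw [map_sub, HS.op_adj]; exact hY)
  rw [map_sub, HS.op_adj] at h2
  have h3 : (traceNorm (star (HS.op ω))).toReal ≤ (traceNorm (HS.op ω)).toReal :=
    ENNReal.toReal_mono hω.ne (traceNorm_star _)
  -- Used with `k = 8 |N|⁻¹ C₀`; the constant 128 is `16 · 8`.
  have real : ∀ {a b y n' n k : ℝ}, a ≤ k * n → b ≤ k * y → n' ≤ n → 0 ≤ y → 0 ≤ n' → 0 ≤ b →
      8 * a * y + 8 * b * n' ≤ 16 * k * n * y := fun h1 h2 h3 hy hn hb => by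
    have e1 := mul_le_mul_of_nonneg_right h1 hy
    have e2 := mul_le_mul h2 h3 hn (hb.trans h2)
    linarith
  refine (real h1 h2 h3 ENNReal.toReal_nonneg ENNReal.toReal_nonneg (norm_nonneg _)).trans_eq ?_
  ring

theorem inner_star_apply (A : Op M) (f g : H M) :
    ⟪f, star A g⟫_ℂ = (starRingEnd ℂ) ⟪g, A f⟫_ℂ := by
  rw [ContinuousLinearMap.star_eq_adjoint, ContinuousLinearMap.adjoint_inner_right, inner_conj_symm]

theorem conj_inv_I_mul (ε : ℝ) :
    (starRingEnd ℂ) (Complex.I * (ε : ℂ))⁻¹ = -(Complex.I * (ε : ℂ))⁻¹ := by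
  rw [map_inv₀, map_mul, Complex.conj_I, Complex.conj_ofReal, neg_mul, inv_neg]

namespace IsSolution

variable (h : IsSolution V N ωN αN ω α)

theorem integrable_inner_force (h : IsSolution V N ωN αN ω α) (hV : IsPotential C₀ V) (r : ℝ) (f g : H M) :
    Integrable (fun s => ⟪f, (freeProp M (eps N) (r - s) * omegaForce V N (ω s) (α s)
      * freeProp M (eps N) (-(r - s))) g⟫_ℂ) (volume.restrict (Set.Ioc 0 r)) := by
  have hφc : Continuous fun s => ⟪f, HS.op (pullback (eps N) 1 (s - r)
      (omegaForceHS hV N (h.om s) (h.al s))) g⟫_ℂ :=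
    continuous_const.inner ((ContinuousLinearMap.apply ℂ (H M) g).continuous.comp
      (HS.continuous_op.comp (continuous_pullback (by fun_prop)
        (h.continuous_omegaForceHS hV))))
  refine Integrable.congr (hφc.integrableOn_Ioc (a := 0) (b := r)) ?_
  filter_upwards [ae_restrict_mem measurableSet_Ioc] with s hs
  rw [op_pullback, op_omegaForceHS, h.op_om hs.1.le, h.op_al hs.1.le, neg_sub s r, neg_sub r s,
    one_mul]

theorem inner_omega (h : IsSolution V N ωN αN ω α) {r : ℝ} (hr : 0 ≤ r) (f g : H M) :
    ⟪f, HS.op (h.om r) g⟫_ℂ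
      = ⟪f, (freeProp M (eps N) r * ωN * freeProp M (eps N) (-r)) g⟫_ℂ
        + (Complex.I * (eps N : ℂ))⁻¹ * ∫ s in Set.Ioc 0 r, ⟪f, (freeProp M (eps N) (r - s)
          * omegaForce V N (ω s) (α s) * freeProp M (eps N) (-(r - s))) g⟫_ℂ := by
  rw [h.op_om hr, h.omega_eq r hr f g, intervalIntegral.integral_of_le hr]
  rfl

theorem om_sub_star_spec (hV : IsPotential C₀ V) (h0 : star ωN = ωN) {r : ℝ} (hr : 0 ≤ r) :
    IsWeakIntegral (volume.restrict (Set.Ioc 0 r))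
      (fun s => freeProp M (eps N) (r - s) * ((Complex.I * (eps N : ℂ))⁻¹
        • (omegaForce V N (ω s) (α s) + star (omegaForce V N (ω s) (α s))))
        * freeProp M (eps N) (-(r - s))) (HS.op (h.om r) - star (HS.op (h.om r))) := by
  intro f g
  have hcc := conj_inv_I_mul (eps N)
  have hi := h.integrable_inner_force hV r
  have e1 := h.inner_omega hr
  generalize (Complex.I * (eps N : ℂ))⁻¹ = c at *
  generalize HS.op (h.om r) = W at *
  have hpt : ∀ s, ⟪f, (freeProp M (eps N) (r - s) * (c • (omegaForce V N (ω s) (α s)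
        + star (omegaForce V N (ω s) (α s)))) * freeProp M (eps N) (-(r - s))) g⟫_ℂ
      = c * ⟪f, (freeProp M (eps N) (r - s) * omegaForce V N (ω s) (α s)
          * freeProp M (eps N) (-(r - s))) g⟫_ℂ
        + c * (starRingEnd ℂ) ⟪g, (freeProp M (eps N) (r - s) * omegaForce V N (ω s) (α s)
          * freeProp M (eps N) (-(r - s))) f⟫_ℂ := fun s => by
    generalize omegaForce V N (ω s) (α s) = F
    have e : freeProp M (eps N) (r - s) * (c • (F + star F)) * freeProp M (eps N) (-(r - s))
        = c • (freeProp M (eps N) (r - s) * F * freeProp M (eps N) (-(r - s)))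
          + c • star (freeProp M (eps N) (r - s) * F * freeProp M (eps N) (-(r - s))) := by
      rw [star_mul (freeProp M (eps N) (r - s) * F), star_mul (freeProp M (eps N) (r - s)),
        star_freeProp, star_freeProp, neg_neg, mul_smul_comm, smul_mul_assoc, ← smul_add, mul_add,
        add_mul, mul_assoc _ (star F)]
    rw [e, _root_.add_apply, _root_.smul_apply, _root_.smul_apply, inner_add_right,
      inner_smul_right, inner_smul_right, inner_star_apply]
  have hi' : Integrable (fun s => (starRingEnd ℂ) ⟪g, (freeProp M (eps N) (r - s)
      * omegaForce V N (ω s) (α s) * freeProp M (eps N) (-(r - s))) f⟫_ℂ)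
      (volume.restrict (Set.Ioc 0 r)) :=
    (RCLike.conjCLE (K := ℂ)).toContinuousLinearMap.integrable_comp (hi g f)
  simp only [hpt]
  refine ⟨((hi f g).const_mul c).add (hi'.const_mul c), ?_⟩
  rw [integral_add ((hi f g).const_mul c) (hi'.const_mul c), integral_const_mul,
    integral_const_mul, integral_conj, _root_.sub_apply, inner_sub_right, inner_star_apply]
  have e2 : (starRingEnd ℂ) ⟪g, (freeProp M (eps N) r * ωN * freeProp M (eps N) (-r)) f⟫_ℂ
      = ⟪f, (freeProp M (eps N) r * ωN * freeProp M (eps N) (-r)) g⟫_ℂ := by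
    rw [← inner_star_apply, star_mul (freeProp M (eps N) r * ωN), star_mul (freeProp M (eps N) r),
      star_freeProp, star_freeProp, neg_neg, h0, mul_assoc]
  rw [e1, e1, map_add, e2, map_mul, hcc]
  ring

theorem traceNorm_om_sub_star_le (hV : IsPotential C₀ V) (hN : 0 < N) (h0 : star ωN = ωN) {t n : ℝ}
    (hn : ∀ s, 0 ≤ s → s ≤ t → (traceNorm (HS.op (h.om s))).toReal ≤ n) {r : ℝ} (hr : 0 ≤ r)
    (hrt : r ≤ t) :
    (traceNorm (HS.op (h.om r) - star (HS.op (h.om r)))).toReal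
      ≤ ((eps N)⁻¹ * (128 * |N|⁻¹ * C₀ * n))
        * ∫ s in (0 : ℝ)..r, (traceNorm (HS.op (h.om s) - star (HS.op (h.om s)))).toReal := by
  have hε : 0 < eps N := Real.rpow_pos_of_pos hN _
  have h4 := hV.nonneg
  have hn0 : 0 ≤ n := ENNReal.toReal_nonneg.trans (hn r hr hrt)
  have hlt := h.traceNormContinuous.lt_top
  have hyc := h.traceNormContinuous.sub_star.continuous_toReal
  have hK0 : 0 ≤ (eps N)⁻¹ * (128 * |N|⁻¹ * C₀ * n) := by positivity
  have hint : ∀ s ∈ Set.Ioc 0 r, traceNorm (freeProp M (eps N) (r - s)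
      * ((Complex.I * (eps N : ℂ))⁻¹ • (omegaForce V N (ω s) (α s)
        + star (omegaForce V N (ω s) (α s)))) * freeProp M (eps N) (-(r - s)))
      ≤ ENNReal.ofReal ((eps N)⁻¹ * (128 * |N|⁻¹ * C₀ * n)
        * (traceNorm (HS.op (h.om s) - star (HS.op (h.om s)))).toReal) := fun s hs => by
    have e : freeProp M (eps N) (r - s) = star (freeProp M (eps N) (-(r - s))) := by
      rw [star_freeProp, neg_neg]
    rw [e]
    refine (traceNorm_unitary_le (norm_freeProp_apply _ _) (norm_freeProp_apply _ _) _).trans ?_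
    refine (traceNorm_smul _ _).trans ?_
    have h1 := traceNorm_omegaForce_add_star_le (N := N) hV (h.om s) (h.al s) (hlt s)
    have h2 := hn s hs.1.le (hs.2.trans hrt)
    rw [← h.op_om hs.1.le, ← h.op_al hs.1.le]
    have hcn : ‖(Complex.I * (eps N : ℂ))⁻¹‖ₑ = ENNReal.ofReal (eps N)⁻¹ := by
      rw [← ofReal_norm, norm_inv, norm_mul, Complex.norm_I, one_mul, Complex.norm_real,
        Real.norm_of_nonneg hε.le]
    rw [hcn]
    refine (mul_le_mul_right h1 _).trans ?_
    rw [← ENNReal.ofReal_mul (by positivity), mul_assoc (eps N)⁻¹]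
    refine ENNReal.ofReal_le_ofReal (mul_le_mul_of_nonneg_left ?_ (by positivity))
    refine mul_le_mul_of_nonneg_right ?_ ENNReal.toReal_nonneg
    exact mul_le_mul_of_nonneg_left h2 (by positivity)
  have hle := (h.om_sub_star_spec hV h0 hr).traceNorm_le_on measurableSet_Ioc
    ((continuous_const.mul hyc).integrableOn_Ioc)
    (fun s _ => mul_nonneg hK0 ENNReal.toReal_nonneg) hint
  simp only [Pi.mul_apply] at hle
  rw [integral_const_mul, ← intervalIntegral.integral_of_le hr] at hle
  exact ENNReal.toReal_le_of_le_ofReal (mul_nonneg hK0 (intervalIntegral.integral_nonneg hr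
    fun s _ => ENNReal.toReal_nonneg)) hle

theorem star_om (hV : IsPotential C₀ V) (hN : 0 < N)
    (h0 : star ωN = ωN) {t : ℝ} (ht : 0 ≤ t) : star (HS.op (h.om t)) = HS.op (h.om t) := by
  have hyc := h.traceNormContinuous.sub_star.continuous_toReal
  have hltY := h.traceNormContinuous.sub_star.lt_top
  -- A crude bound for the trace norm on `[0, t]` suffices, because the inequality is homogeneous
  -- and the initial value is zero.
  obtain ⟨s₀, hs₀, hmax⟩ := (isCompact_Icc (a := 0) (b := t)).exists_isMaxOn
    ⟨0, by constructor <;> linarith⟩ h.traceNormContinuous.continuous_toReal.continuousOn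
  have hK0 : 0 ≤ (eps N)⁻¹ * (128 * |N|⁻¹ * C₀ * (traceNorm (HS.op (h.om s₀))).toReal) := by
    have := hV.nonneg
    have : 0 ≤ (traceNorm (HS.op (h.om s₀))).toReal := ENNReal.toReal_nonneg
    have : 0 < eps N := Real.rpow_pos_of_pos hN _
    positivity
  have hz := eq_zero_of_le_integral hyc (fun _ => ENNReal.toReal_nonneg) hK0
    (fun r hr hrt => h.traceNorm_om_sub_star_le hV hN h0 (fun s hs hst => hmax ⟨hs, hst⟩) hr hrt)
    t ht le_rfl
  have hz' : traceNorm (HS.op (h.om t) - star (HS.op (h.om t))) = 0 :=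
    (ENNReal.toReal_eq_zero_iff _).1 hz |>.resolve_right (hltY t).ne
  have h4 := hsNorm_le_traceNorm (hltY t)
  rw [hz', ENNReal.toReal_zero, mul_zero] at h4
  have h5 : ‖h.om t - HS.adj (h.om t)‖ ≤ 0 :=
    HS.norm_le_of_hsNorm_le le_rfl (by rw [map_sub, HS.op_adj]; exact h4)
  have h7 := congrArg HS.op (sub_eq_zero.1 (norm_le_zero_iff.1 h5))
  rw [HS.op_adj] at h7
  exact h7.symm

end IsSolution

end SelfAdjointness

/-! ### The block identities contained in `Γ = Γ* = Γ²`. -/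

section InitialDatum

variable {M : ℕ} {N : ℝ} {ωN αN : Op M}

theorem genDensity_toLp (ω α : Op M) (f g : H M) :
    genDensity ω α (WithLp.toLp 2 (f, g))
      = WithLp.toLp 2 (ω f + α g, star α f + (g - conjOp ω g)) := rfl

namespace IsPureQuasiFree

theorem star_omega (h : IsPureQuasiFree N ωN αN) : star ωN = ωN := by
  have hs := h.nonneg.isSymmetric
  refine ContinuousLinearMap.ext fun g => ext_inner_left ℂ fun f => ?_
  have := hs (WithLp.toLp 2 (f, 0)) (WithLp.toLp 2 (g, 0))
  simp only [ContinuousLinearMap.coe_coe, genDensity_toLp, WithLp.prod_inner_apply, map_zero,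
    add_zero, inner_zero_left, inner_zero_right] at this
  rw [ContinuousLinearMap.star_eq_adjoint, ContinuousLinearMap.adjoint_inner_right]
  exact this

theorem omega_sq (h : IsPureQuasiFree N ωN αN) : ωN * ωN + αN * star αN = ωN := by
  refine ContinuousLinearMap.ext fun g => ?_
  have := congrArg (fun T => (T (WithLp.toLp 2 (g, 0))).ofLp.1) h.proj
  simp only [ContinuousLinearMap.comp_apply, genDensity_toLp, map_zero, add_zero, sub_zero] at this
  exact this

theorem omega_alpha (h : IsPureQuasiFree N ωN αN) : ωN * αN = αN * conjOp ωN := by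
  refine ContinuousLinearMap.ext fun g => ?_
  have := congrArg (fun T => (T (WithLp.toLp 2 (0, g))).ofLp.1) h.proj
  simp only [ContinuousLinearMap.comp_apply, genDensity_toLp, map_zero, zero_add, map_sub] at this
  rw [mul_apply_eq_comp, mul_apply_eq_comp, ← sub_eq_zero]
  have h2 := sub_eq_zero.2 this
  rw [← h2]; abel

end IsPureQuasiFree

end InitialDatum

/-! ### Operator bounds from the projection property, and compatibility of the pull-back with
transposition. -/

section ProjectionIdentities

variable {M : ℕ}

/-- Taking expectations gives `‖a x‖² + ‖b* x‖² = ⟨x, a x⟩ ≤ ‖x‖‖a x‖`, which bounds first `a` and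
then `b`. -/
theorem norm_le_one_of_sq_add {a b : Op M} (ha : star a = a) (h : a * a + b * star b = a) :
    ‖a‖ ≤ 1 ∧ ‖b‖ ≤ 1 := by
  have key : ∀ x, ‖a x‖ ^ 2 + ‖star b x‖ ^ 2 ≤ ‖x‖ * ‖a x‖ := fun x => by
    have h1 : ⟪x, a x⟫_ℂ = ⟪a x, a x⟫_ℂ + ⟪star b x, star b x⟫_ℂ := by
      conv_lhs => rw [← h]
      rw [_root_.add_apply, inner_add_right, mul_apply_eq_comp, mul_apply_eq_comp]
      congr 1
      · nth_rewrite 1 [← ha]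
        rw [ContinuousLinearMap.star_eq_adjoint, ContinuousLinearMap.adjoint_inner_right]
      · rw [ContinuousLinearMap.star_eq_adjoint, ContinuousLinearMap.adjoint_inner_left]
    rw [inner_self_eq_norm_sq_to_K, inner_self_eq_norm_sq_to_K] at h1
    have h2 : ‖⟪x, a x⟫_ℂ‖ = ‖a x‖ ^ 2 + ‖star b x‖ ^ 2 := by
      rw [h1]
      have : ((‖a x‖ : ℂ) ^ 2 + (‖star b x‖ : ℂ) ^ 2)
          = ((‖a x‖ ^ 2 + ‖star b x‖ ^ 2 : ℝ) : ℂ) := by push_cast; rfl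
      refine (congrArg norm this).trans ?_
      rw [Complex.norm_real, Real.norm_of_nonneg (by positivity)]
    rw [← h2]
    exact norm_inner_le_norm _ _
  have h1 : ∀ x, ‖a x‖ ≤ ‖x‖ := fun x => by
    have := key x
    by_contra! hc
    nlinarith [sq_nonneg ‖star b x‖, norm_nonneg x]
  refine ⟨ContinuousLinearMap.opNorm_le_bound _ zero_le_one fun x => by rw [one_mul]; exact h1 x, ?_⟩
  rw [← norm_star_op]
  refine ContinuousLinearMap.opNorm_le_bound _ zero_le_one fun x => ?_
  rw [one_mul]
  have h2 := key x
  have h3 := h1 x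
  refine abs_le_of_sq_le_sq' (b := ‖x‖) ?_ (norm_nonneg _) |>.2
  nlinarith [norm_nonneg x, norm_nonneg (a x), sq_nonneg ‖a x‖]

/-- The relation `a² + b b* = a` is invariant under `a ↦ 1 - a`. -/
theorem norm_one_sub_le_one {a b : Op M} (ha : star a = a) (h : a * a + b * star b = a) :
    ‖1 - a‖ ≤ 1 := by
  refine (norm_le_one_of_sq_add (b := b) (by rw [star_sub, star_one, ha]) ?_).1
  have : b * star b = a - a * a := by rw [eq_sub_iff_add_eq, add_comm]; exact h
  rw [this]; noncomm_ring

theorem norm_freeProp_mul_mul (ε r s : ℝ) (A : Op M) :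
    ‖freeProp M ε r * A * freeProp M ε s‖ = ‖A‖ := by
  have key : ∀ (r s : ℝ) (B : Op M), ‖freeProp M ε r * B * freeProp M ε s‖ ≤ ‖B‖ := fun r s B => by
    refine (norm_mul_le _ _).trans ?_
    refine (mul_le_of_le_one_right (norm_nonneg _) (norm_freeProp_le _ _)).trans ?_
    exact (norm_mul_le _ _).trans (mul_le_of_le_one_left (norm_nonneg _) (norm_freeProp_le _ _))
  refine le_antisymm (key r s A) ?_
  have := key (-r) (-s) (freeProp M ε r * A * freeProp M ε s)
  rwa [freeProp_sandwich, neg_add_cancel, add_neg_cancel, freeProp_zero, one_mul, mul_one] at this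

theorem RightDeriv.star_op {Y : ℝ → Op M} {Z : Op M} (h : RightDeriv Y Z) :
    RightDeriv (fun t => star (Y t)) (star Z) :=
  h.map (g := star) star_sub (fun r x => by rw [star_smul, Complex.star_def, Complex.conj_ofReal])
    (continuous_star_op continuous_id)

theorem RightDeriv.conj_op {Y : ℝ → Op M} {Z : Op M} (h : RightDeriv Y Z) :
    RightDeriv (fun t => conjOp (Y t)) (conjOp Z) :=
  h.map (g := conjOp) conjOp_sub (fun r x => by rw [conjOp_smul, Complex.conj_ofReal])
    (continuous_conjOp continuous_id)

theorem RightDeriv.op {Y : ℝ → HS M} {Z : HS M} (h : RightDeriv Y Z) :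
    RightDeriv (fun t => HS.op (Y t)) (HS.op Z) :=
  h.map (g := HS.op) (map_sub _) (fun _ _ => map_smul _ _ _) HS.continuous_op

theorem transpose_pullback (ε h : ℝ) (A : HS M) :
    HS.transpose (pullback ε (-1) h A) = pullback ε (-1) h (HS.transpose A) := by
  refine HS.ext ?_
  rw [HS.op_transpose, op_pullback, op_pullback, HS.op_transpose,
    star_mul (freeProp M ε (-h) * HS.op A), star_mul (freeProp M ε (-h)), star_freeProp,
    star_freeProp, conjOp_mul, conjOp_mul, conjOp_freeProp, conjOp_freeProp, neg_neg, mul_assoc]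
  simp only [neg_mul, one_mul, neg_neg]

theorem HS.transpose_lmul (B : Op M) (A : HS M) :
    HS.transpose (HS.lmul B A) = HS.rmul (conjOp (star B)) (HS.transpose A) := by
  refine HS.ext ?_
  rw [HS.op_transpose, HS.op_lmul, HS.op_rmul, HS.op_transpose, star_mul B, conjOp_mul]

theorem HS.transpose_rmul (B : Op M) (A : HS M) :
    HS.transpose (HS.rmul B A) = HS.lmul (conjOp (star B)) (HS.transpose A) := by
  refine HS.ext ?_
  rw [HS.op_transpose, HS.op_rmul, HS.op_lmul, HS.op_transpose, star_mul (HS.op A), conjOp_mul]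

end ProjectionIdentities

/-! ### The relation `αᵀ = -α` is propagated. -/

section Antisymmetry

variable {M : ℕ} {V : R3 → ℝ} {C₀ : ℝ} {N : ℝ} {ωN αN : Op M} {ω α : ℝ → Op M}

theorem exists_bound_Icc {f : ℝ → ℝ} (hf : Continuous f) (T : ℝ) :
    ∃ K, 0 ≤ K ∧ ∀ t, 0 ≤ t → t ≤ T → f t ≤ K := by
  obtain ⟨K, hK⟩ := isCompact_Icc (a := 0) (b := T) |>.bddAbove_image hf.continuousOn
  exact ⟨max K 0, le_max_right _ _, fun t h0 h1 =>
    (hK (Set.mem_image_of_mem f ⟨h0, h1⟩)).trans (le_max_left _ _)⟩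

theorem norm_inv_I_mul (ε : ℝ) (hε : 0 < ε) : ‖(Complex.I * (ε : ℂ))⁻¹‖ = ε⁻¹ := by
  rw [norm_inv, norm_mul, Complex.norm_I, one_mul, Complex.norm_real, Real.norm_of_nonneg hε.le]

theorem eps_pos (hN : 0 < N) : 0 < eps N := Real.rpow_pos_of_pos hN _

/-- The symmetric part of the force on `α` depends linearly on the symmetric part of `α`. -/
theorem alphaForceHS_add_transpose (hV : IsPotential C₀ V) (ω α : HS M)
    (hω : star (HS.op ω) = HS.op ω)
    (hP : star (hfPotential V N (HS.op ω)) = hfPotential V N (HS.op ω)) :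
    alphaForceHS hV N ω α + HS.transpose (alphaForceHS hV N ω α)
      = HS.lmul (hfPotential V N (HS.op ω)) (α + HS.transpose α)
        + HS.rmul (conjOp (hfPotential V N (HS.op ω))) (α + HS.transpose α)
        + HS.rmul (1 - conjOp (HS.op ω)) (exch hV N (α + HS.transpose α))
        - HS.lmul (HS.op ω) (exch hV N (α + HS.transpose α)) := by
  have e1 : star (conjOp (hfPotential V N (HS.op ω))) = conjOp (hfPotential V N (HS.op ω)) := by
    rw [star_conjOp, hP]
  have e2 : star (1 - conjOp (HS.op ω)) = 1 - conjOp (HS.op ω) := by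
    rw [star_sub, star_one, star_conjOp, hω]
  rw [exch_add, alphaForceHS, HS.transpose_sub, HS.transpose_add, HS.transpose_add,
    HS.transpose_lmul, HS.transpose_rmul, HS.transpose_rmul, HS.transpose_lmul, e1, e2, hP, hω,
    conjOp_conjOp, conjOp_sub, conjOp_conjOp, conjOp_one, transpose_exch]
  refine HS.ext ?_
  simp only [map_add, map_sub, HS.op_lmul, HS.op_rmul]
  generalize HS.op (exch hV N α) = X
  generalize HS.op (exch hV N (HS.transpose α)) = Y
  generalize hfPotential V N (HS.op ω) = P
  generalize conjOp P = Q
  generalize HS.op (HS.transpose α) = W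
  noncomm_ring

namespace IsSolution

variable (h : IsSolution V N ωN αN ω α)

theorem adj_om (h : IsSolution V N ωN αN ω α) (hV : IsPotential C₀ V) (hN : 0 < N)
    (h0 : star ωN = ωN) {t : ℝ} (ht : 0 ≤ t) : HS.adj (h.om t) = h.om t :=
  HS.ext (by rw [HS.op_adj]; exact h.star_om hV hN h0 ht)

theorem star_pot (hV : IsPotential C₀ V) (hN : 0 < N)
    (h0 : star ωN = ωN) {t : ℝ} (ht : 0 ≤ t) : star (h.pot t) = h.pot t := by
  rw [pot, star_hfPotential hV N (h.traceNormContinuous.lt_top t), h.adj_om hV hN h0 ht]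

/-- Transposition commutes with the pull-back of `α`, and for selfadjoint `ω` the force on `α + αᵀ`
is linear in `α + αᵀ`. Grönwall with a crude rate on `[0, t]` gives zero. -/
theorem transpose_al (hV : IsPotential C₀ V) (hN : 0 < N) (h0 : star ωN = ωN)
    (hα : transposeOp αN = -αN) {t : ℝ} (ht : 0 ≤ t) :
    HS.transpose (h.al t) = -h.al t := by
  have hε := eps_pos hN
  have hC := hV.nonneg
  have hc1 : Continuous fun t => h.al t + HS.transpose (h.al t) :=
    h.continuous_al.add (HS.continuous_transpose.comp h.continuous_al)
  obtain ⟨K₁, hK₁, hb₁⟩ := exists_bound_Icc (h.continuous_pot hV).norm t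
  obtain ⟨K₂, hK₂, hb₂⟩ := exists_bound_Icc h.continuous_om.norm t
  have hz := DiniLE.eq_zero (f := fun t => ‖h.al t + HS.transpose (h.al t)‖) (T := t)
    (K := (eps N)⁻¹ * (2 * K₁ + |N|⁻¹ * C₀ * (1 + 2 * K₂))) hc1.norm.continuousOn ?_
    (fun _ => norm_nonneg _) (fun s hs hst => ?_) t ht le_rfl
  · rw [eq_neg_iff_add_eq_zero, add_comm]
    exact norm_eq_zero.1 hz
  · rw [norm_eq_zero, add_comm, ← eq_neg_iff_add_eq_zero]
    refine HS.ext ?_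
    rw [HS.op_transpose, map_neg, h.op_al le_rfl, h.alpha_zero]
    exact hα
  · have hd := h.comovingDeriv_al hV hs
    have hd' := hd.map (g := HS.transpose) HS.transpose_sub
      (fun r x => HS.transpose_smul _ _) HS.continuous_transpose
    refine DiniLE.of_rightDeriv_norm (hd.add hd') (fun r hr => ?_) ?_
    · rw [transpose_pullback, pullback, pullback, HS.bimul, HS.bimul, ← map_add, ← map_add]
      exact (norm_pullback (eps N) (-1) r _).symm
    · rw [HS.transpose_smul, ← smul_add, alphaForceHS_add_transpose hV _ _ (h.star_om hV hN h0 hs)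
        (h.star_pot hV hN h0 hs), norm_smul, norm_inv_I_mul _ hε, mul_assoc]
      refine mul_le_mul_of_nonneg_left ?_ (by positivity)
      set A := h.al s + HS.transpose (h.al s)
      have hP : ‖hfPotential V N (HS.op (h.om s))‖ ≤ K₁ := hb₁ s hs hst.le
      have ho : ‖HS.op (h.om s)‖ ≤ K₂ := (HS.norm_op_le _).trans (hb₂ s hs hst.le)
      have hX := norm_exch_le hV N A
      have h1 := (HS.norm_lmul_le (hfPotential V N (HS.op (h.om s))) A).trans
        (mul_le_mul_of_nonneg_right hP (norm_nonneg _))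
      have h2 := (HS.norm_rmul_le (conjOp (hfPotential V N (HS.op (h.om s)))) A).trans
        (mul_le_mul_of_nonneg_left ((norm_conjOp _).trans_le hP) (norm_nonneg _))
      have h5 : ‖1 - conjOp (HS.op (h.om s))‖ ≤ 1 + K₂ := by
        refine (norm_sub_le _ _).trans (add_le_add ContinuousLinearMap.norm_id_le ?_)
        rw [norm_conjOp]; exact ho
      have h3 := (HS.norm_rmul_le (1 - conjOp (HS.op (h.om s))) (exch hV N A)).trans
        (mul_le_mul hX h5 (norm_nonneg _) (by positivity))
      have h4 := (HS.norm_lmul_le (HS.op (h.om s)) (exch hV N A)).trans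
        (mul_le_mul ho hX (norm_nonneg _) hK₂)
      refine (norm_sub_le _ _).trans ((add_le_add ((norm_add_le _ _).trans (add_le_add
        ((norm_add_le _ _).trans (add_le_add h1 h2)) h3)) h4).trans_eq ?_)
      ring

theorem conj_al (hV : IsPotential C₀ V) (hN : 0 < N) (h0 : star ωN = ωN)
    (hα : transposeOp αN = -αN) {t : ℝ} (ht : 0 ≤ t) :
    HS.conj (h.al t) = -HS.adj (h.al t) := by
  have h1 := congrArg HS.op (h.transpose_al hV hN h0 hα ht)
  rw [HS.op_transpose, map_neg, ← star_conjOp] at h1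
  refine HS.ext ?_
  rw [map_neg, HS.op_conj, HS.op_adj, ← star_neg, ← h1, star_star]

end IsSolution

end Antisymmetry

/-! ### The evolution of `Γ² - Γ`. -/

section PurityIdentities

variable {M : ℕ}

/-- The upper left block of `Γ² - Γ`. -/
def purityDefect (a b : Op M) : Op M := a * a + b * star b - a

/-- The upper right block of `Γ² - Γ`. -/
def pairingDefect (a b : Op M) : Op M := a * b - b * conjOp a

theorem RightDeriv.purityDefect {a b : ℝ → Op M} {F G : Op M} {c : ℂ}
    (hc : (starRingEnd ℂ) c = -c) (ha : RightDeriv a (c • F)) (hb : RightDeriv b (c • G)) :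
    RightDeriv (fun r => purityDefect (a r) (b r))
      (c • (F * a 0 + a 0 * F + (G * star (b 0) - b 0 * star G) - F)) := by
  have h1 := ((ha.mul ha).add (hb.mul hb.star_op)).sub ha
  have e : star (c • G) = -(c • star G) := by rw [star_smul, Complex.star_def, hc, neg_smul]
  rw [e] at h1
  convert! h1 using 1
  simp only [smul_sub, smul_add, smul_mul_assoc, mul_smul_comm, mul_neg]
  abel

theorem RightDeriv.pairingDefect {a b : ℝ → Op M} {F G : Op M} {c : ℂ}
    (hc : (starRingEnd ℂ) c = -c) (ha : RightDeriv a (c • F)) (hb : RightDeriv b (c • G)) :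
    RightDeriv (fun r => pairingDefect (a r) (b r))
      (c • (F * b 0 + a 0 * G - G * conjOp (a 0) + b 0 * conjOp F)) := by
  have h1 := (ha.mul hb).sub (hb.mul ha.conj_op)
  have e : conjOp (c • F) = -(c • conjOp F) := by rw [conjOp_smul, hc, neg_smul]
  rw [e] at h1
  convert! h1 using 1
  simp only [smul_sub, smul_add, smul_mul_assoc, mul_smul_comm, mul_neg]
  abel

/-- The upper left block of `iε ∂ₜ D = [𝓗, D]` for `D = Γ² - Γ` and `𝓗` with blocks `P, X; X*, -P̄`,
where the kinetic part is already removed. -/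
theorem purityDefect_generator {a b P X F G : Op M} (ha : star a = a) (hP : star P = P)
    (hF : F = P * a - a * P + X * star b - b * star X)
    (hG : G = P * b + b * conjOp P + X * (1 - conjOp a) - a * X) :
    F * a + a * F + (G * star b - b * star G) - F
      = P * purityDefect a b - purityDefect a b * P + X * star (pairingDefect a b)
        - pairingDefect a b * star X := by
  have h1 : star G = star b * P + conjOp P * star b + (1 - conjOp a) * star X - star X * a := by
    rw [hG, star_sub, star_add, star_add, star_mul P, star_mul b, star_mul X, star_mul a, star_sub,
      star_one, star_conjOp, star_conjOp, ha, hP]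
  have h2 : star (pairingDefect a b) = star b * a - conjOp a * star b := by
    rw [pairingDefect, star_sub, star_mul a, star_mul b, star_conjOp, ha]
  rw [h1, h2, hF, hG, purityDefect, pairingDefect]
  noncomm_ring

/-- The upper right block of the same equation. Antisymmetry of `b` and `X` identifies the lower
right block of `Γ² - Γ` with the conjugate of the upper left one, so the system closes on two
blocks. -/
theorem pairingDefect_generator {a b P X F G : Op M}
    (hb : conjOp b = -star b) (hX : conjOp X = -star X)
    (hF : F = P * a - a * P + X * star b - b * star X)
    (hG : G = P * b + b * conjOp P + X * (1 - conjOp a) - a * X) :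
    F * b + a * G - G * conjOp a + b * conjOp F
      = P * pairingDefect a b + pairingDefect a b * conjOp P + X * conjOp (purityDefect a b)
        - purityDefect a b * X := by
  have hb' : conjOp (star b) = -b := by rw [← star_conjOp, hb, star_neg, star_star]
  have hX' : conjOp (star X) = -X := by rw [← star_conjOp, hX, star_neg, star_star]
  have h1 : conjOp F = conjOp P * conjOp a - conjOp a * conjOp P + star X * b - star b * X := by
    rw [hF, conjOp_sub, conjOp_add, conjOp_sub, conjOp_mul P, conjOp_mul a, conjOp_mul X,
      conjOp_mul b, hb, hX, hb', hX']
    noncomm_ring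
  have h2 : conjOp (purityDefect a b) = conjOp a * conjOp a + star b * b - conjOp a := by
    rw [purityDefect, conjOp_sub, conjOp_add, conjOp_mul a, conjOp_mul b, hb, hb']
    noncomm_ring
  rw [h1, h2, hF, hG, purityDefect, pairingDefect]
  noncomm_ring

/-- The two pull-backs fit together, because the free factors between `A` and `A*` or between `B`
and `B*` cancel; so the defect is merely conjugated by unitaries. -/
theorem purityDefect_pullback (ε r : ℝ) (A B : HS M) :
    purityDefect (HS.op (pullback ε 1 r A)) (HS.op (pullback ε (-1) r B))
      = freeProp M ε (-r) * purityDefect (HS.op A) (HS.op B) * freeProp M ε r := by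
  have h1 : freeProp M ε r * freeProp M ε (-r) = 1 := freeProp_mul_neg ε r
  have h2 : freeProp M ε (-r) * freeProp M ε r = 1 := freeProp_neg_mul ε r
  rw [op_pullback, op_pullback, one_mul, neg_one_mul, purityDefect, purityDefect,
    star_mul (freeProp M ε (-r) * HS.op B), star_mul (freeProp M ε (-r)), star_freeProp, neg_neg]
  generalize freeProp M ε r = U at *
  generalize freeProp M ε (-r) = W at *
  have e1 : ∀ x y : Op M, W * x * U * (W * y * U) = W * (x * y) * U := fun x y => by
    rw [show W * x * U * (W * y * U) = W * x * (U * W) * y * U by noncomm_ring, h1]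
    noncomm_ring
  have e2 : ∀ x y : Op M, W * x * W * (U * (y * U)) = W * (x * y) * U := fun x y => by
    rw [show W * x * W * (U * (y * U)) = W * x * (W * U) * y * U by noncomm_ring, h2]
    noncomm_ring
  rw [e1, e2]
  noncomm_ring

theorem pairingDefect_pullback (ε r : ℝ) (A B : HS M) :
    pairingDefect (HS.op (pullback ε 1 r A)) (HS.op (pullback ε (-1) r B))
      = freeProp M ε (-r) * pairingDefect (HS.op A) (HS.op B) * freeProp M ε (-r) := by
  have h1 : freeProp M ε r * freeProp M ε (-r) = 1 := freeProp_mul_neg ε r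
  have h2 : freeProp M ε (-r) * freeProp M ε r = 1 := freeProp_neg_mul ε r
  rw [op_pullback, op_pullback, one_mul, neg_one_mul, pairingDefect, pairingDefect,
    conjOp_mul, conjOp_mul, conjOp_freeProp, conjOp_freeProp, neg_neg]
  generalize freeProp M ε r = U at *
  generalize freeProp M ε (-r) = W at *
  have e1 : ∀ x y : Op M, W * x * U * (W * y * W) = W * (x * y) * W := fun x y => by
    rw [show W * x * U * (W * y * W) = W * x * (U * W) * y * W by noncomm_ring, h1]
    noncomm_ring
  have e2 : ∀ x y : Op M, W * x * W * (U * y * W) = W * (x * y) * W := fun x y => by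
    rw [show W * x * W * (U * y * W) = W * x * (W * U) * y * W by noncomm_ring, h2]
    noncomm_ring
  rw [e1, e2]
  noncomm_ring

end PurityIdentities

/-! ### The norm estimate in the form used for all equations. -/

section Generators

variable {M : ℕ}

/-- `(iε)⁻¹ P = -i ε⁻¹ P` is `i` times a selfadjoint operator, so the two-sided action of `P` and
`Q` costs nothing, however large their norms are. Only `R` survives. -/
theorem DiniLE.of_generator {f : ℝ → ℝ} {t ε : ℝ} (hε : 0 < ε) {Y : ℝ → HS M} {P Q : Op M}
    {R : HS M} (h : RightDeriv Y ((Complex.I * (ε : ℂ))⁻¹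
      • (HS.lmul P (Y 0) + HS.rmul Q (Y 0) + R)))
    (hP : star P = P) (hQ : star Q = Q) (hf : ∀ s, 0 ≤ s → f (t + s) = ‖Y s‖) {m : ℝ}
    (hm : ‖R‖ ≤ m) : DiniLE f t (ε⁻¹ * m) := by
  have hsm : ∀ {P : Op M}, star P = P → star (-((ε : ℂ)⁻¹ • P)) = -((ε : ℂ)⁻¹ • P) :=
    fun {P} hP => by
      rw [star_neg, star_smul, hP, Complex.star_def, ← Complex.ofReal_inv, Complex.conj_ofReal]
  refine DiniLE.of_rightDeriv_skew (S := -((ε : ℂ)⁻¹ • P)) (S' := -((ε : ℂ)⁻¹ • Q))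
    (R := (Complex.I * (ε : ℂ))⁻¹ • R) ?_ (hsm hP) (hsm hQ) hf ?_
  · convert! h using 1
    refine HS.ext ?_
    have hc : (Complex.I * (ε : ℂ))⁻¹ = -(Complex.I * (ε : ℂ)⁻¹) := by
      rw [mul_inv, Complex.inv_I, neg_mul]
    simp only [map_add, map_smul, map_neg, HS.op_lmul, HS.op_rmul, hc, neg_mul, mul_neg,
      smul_mul_assoc, mul_smul_comm, smul_neg, neg_smul, smul_smul, smul_add]
  · rw [norm_smul, norm_inv_I_mul _ hε]
    exact mul_le_mul_of_nonneg_left hm (by positivity)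

end Generators

/-! ### Purity, particle number and the growth of the pairing. -/

section Conservation

variable {M : ℕ} {V : R3 → ℝ} {C₀ : ℝ} {N : ℝ} {ωN αN : Op M} {ω α : ℝ → Op M}

namespace IsSolution

variable (h : IsSolution V N ωN αN ω α)

/-- The system for the two defects is homogeneous and linear, so the operator norm suffices and the
rate may depend on the solution. -/
theorem diniLE_purityDefect (h : IsSolution V N ωN αN ω α) (hV : IsPotential C₀ V) (hN : 0 < N)
    (hq : IsPureQuasiFree N ωN αN) {t K : ℝ}
    (ht : 0 ≤ t) (hK : ‖h.pot t‖ + ‖HS.op (exch hV N (h.al t))‖ ≤ K) :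
    DiniLE (fun t => ‖purityDefect (HS.op (h.om t)) (HS.op (h.al t))‖
        + ‖pairingDefect (HS.op (h.om t)) (HS.op (h.al t))‖) t
      ((eps N)⁻¹ * (2 * K) * (‖purityDefect (HS.op (h.om t)) (HS.op (h.al t))‖
        + ‖pairingDefect (HS.op (h.om t)) (HS.op (h.al t))‖)) := by
  have hε := eps_pos hN
  have hc := conj_inv_I_mul (eps N)
  have ha := (h.comovingDeriv_om hV ht).op
  have hb := (h.comovingDeriv_al hV ht).op
  rw [map_smul] at ha hb
  have hd1 := RightDeriv.purityDefect hc ha hb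
  have hd2 := RightDeriv.pairingDefect hc ha hb
  simp only [purityDefect_pullback, pairingDefect_pullback, add_zero, pullback_zero] at hd1 hd2
  have hF : HS.op (omegaForceHS hV N (h.om t) (h.al t)) = h.pot t * HS.op (h.om t)
      - HS.op (h.om t) * h.pot t + HS.op (exch hV N (h.al t)) * star (HS.op (h.al t))
      - HS.op (h.al t) * star (HS.op (exch hV N (h.al t))) := rfl
  have hG : HS.op (alphaForceHS hV N (h.om t) (h.al t)) = h.pot t * HS.op (h.al t)
      + HS.op (h.al t) * conjOp (h.pot t)
      + HS.op (exch hV N (h.al t)) * (1 - conjOp (HS.op (h.om t)))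
      - HS.op (h.om t) * HS.op (exch hV N (h.al t)) := rfl
  have hP := h.star_pot hV hN hq.star_omega ht
  have hca := h.conj_al hV hN hq.star_omega hq.antisymm ht
  have hb' : conjOp (HS.op (h.al t)) = -star (HS.op (h.al t)) := by
    have := congrArg HS.op hca
    rwa [map_neg, HS.op_conj, HS.op_adj] at this
  have hX' : conjOp (HS.op (exch hV N (h.al t))) = -star (HS.op (exch hV N (h.al t))) := by
    have e : HS.conj (exch hV N (h.al t)) = -HS.adj (exch hV N (h.al t)) := by
      rw [conj_exch, hca, exch_neg, adj_exch]
    have := congrArg HS.op e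
    rwa [map_neg, HS.op_conj, HS.op_adj] at this
  rw [purityDefect_generator (h.star_om hV hN hq.star_omega ht) hP hF hG] at hd1
  rw [pairingDefect_generator hb' hX' hF hG] at hd2
  refine (DiniLE.add (DiniLE.of_rightDeriv_norm hd1 (fun s _ => ?_) le_rfl)
    (DiniLE.of_rightDeriv_norm hd2 (fun s _ => ?_) le_rfl)).mono ?_
  · exact (norm_freeProp_mul_mul _ _ _ _).symm
  · exact (norm_freeProp_mul_mul _ _ _ _).symm
  rw [norm_smul, norm_smul, norm_inv_I_mul _ hε, ← mul_add, mul_assoc]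
  refine mul_le_mul_of_nonneg_left ?_ (by positivity)
  generalize HS.op (exch hV N (h.al t)) = X at *
  generalize h.pot t = P at *
  generalize purityDefect (HS.op (h.om t)) (HS.op (h.al t)) = Q at *
  generalize pairingDefect (HS.op (h.om t)) (HS.op (h.al t)) = R at *
  have e1 := norm_mul_le P Q
  have e2 := norm_mul_le Q P
  have e3 := norm_mul_le X (star R)
  have e4 := norm_mul_le R (star X)
  have e5 := norm_mul_le P R
  have e6 := norm_mul_le R (conjOp P)
  have e7 := norm_mul_le X (conjOp Q)
  have e8 := norm_mul_le Q X
  rw [norm_star_op] at e3 e4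
  rw [norm_conjOp] at e6 e7
  have e9 : ‖P * Q - Q * P + X * star R - R * star X‖
      ≤ ‖P * Q‖ + ‖Q * P‖ + ‖X * star R‖ + ‖R * star X‖ :=
    (norm_sub_le _ _).trans (add_le_add_left ((norm_add_le _ _).trans
      (add_le_add_left (norm_sub_le _ _) _)) _)
  have e10 : ‖P * R + R * conjOp P + X * conjOp Q - Q * X‖
      ≤ ‖P * R‖ + ‖R * conjOp P‖ + ‖X * conjOp Q‖ + ‖Q * X‖ :=
    (norm_sub_le _ _).trans (add_le_add_left ((norm_add_le _ _).trans
      (add_le_add_left (norm_add_le _ _) _)) _)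
  have hq0 := norm_nonneg Q
  have hr0 := norm_nonneg R
  have e11 := mul_le_mul_of_nonneg_right hK (add_nonneg hq0 hr0)
  linarith

theorem purity (hV : IsPotential C₀ V) (hN : 0 < N) (hq : IsPureQuasiFree N ωN αN) {t : ℝ}
    (ht : 0 ≤ t) : purityDefect (HS.op (h.om t)) (HS.op (h.al t)) = 0
      ∧ pairingDefect (HS.op (h.om t)) (HS.op (h.al t)) = 0 := by
  have co := HS.continuous_op.comp h.continuous_om
  have ca := HS.continuous_op.comp h.continuous_al
  have c1 : Continuous fun t => purityDefect (HS.op (h.om t)) (HS.op (h.al t)) :=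
    ((co.mul co).add (ca.mul (continuous_star_op ca))).sub co
  have c2 : Continuous fun t => pairingDefect (HS.op (h.om t)) (HS.op (h.al t)) :=
    (co.mul ca).sub (ca.mul (continuous_conjOp co))
  obtain ⟨K, hK, hb⟩ := exists_bound_Icc ((h.continuous_pot hV).norm.add
    (HS.continuous_op.comp ((continuous_exch hV N).comp h.continuous_al)).norm) t
  have hz := DiniLE.eq_zero (f := fun t => ‖purityDefect (HS.op (h.om t)) (HS.op (h.al t))‖
      + ‖pairingDefect (HS.op (h.om t)) (HS.op (h.al t))‖) (c1.norm.add c2.norm).continuousOn ?_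
    (fun _ => by positivity)
    (fun s hs hst => h.diniLE_purityDefect hV hN hq hs (hb s hs hst.le)) t ht le_rfl
  · have e1 := norm_nonneg (purityDefect (HS.op (h.om t)) (HS.op (h.al t)))
    have e2 := norm_nonneg (pairingDefect (HS.op (h.om t)) (HS.op (h.al t)))
    exact ⟨norm_eq_zero.1 (by linarith), norm_eq_zero.1 (by linarith)⟩
  · rw [h.op_om le_rfl, h.op_al le_rfl, h.omega_zero, h.alpha_zero, purityDefect, pairingDefect,
      hq.omega_sq, hq.omega_alpha, sub_self, sub_self, norm_zero, add_zero]

theorem om_sq (hV : IsPotential C₀ V) (hN : 0 < N) (hq : IsPureQuasiFree N ωN αN) {t : ℝ}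
    (ht : 0 ≤ t) : HS.op (h.om t) * HS.op (h.om t) + HS.op (h.al t) * star (HS.op (h.al t))
      = HS.op (h.om t) :=
  sub_eq_zero.1 (h.purity hV hN hq ht).1

theorem norm_op_om_le (hV : IsPotential C₀ V) (hN : 0 < N) (hq : IsPureQuasiFree N ωN αN) {t : ℝ}
    (ht : 0 ≤ t) : ‖HS.op (h.om t)‖ ≤ 1 :=
  (norm_le_one_of_sq_add (h.star_om hV hN hq.star_omega ht) (h.om_sq hV hN hq ht)).1

theorem norm_op_al_le (hV : IsPotential C₀ V) (hN : 0 < N) (hq : IsPureQuasiFree N ωN αN) {t : ℝ}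
    (ht : 0 ≤ t) : ‖HS.op (h.al t)‖ ≤ 1 :=
  (norm_le_one_of_sq_add (h.star_om hV hN hq.star_omega ht) (h.om_sq hV hN hq ht)).2

theorem norm_one_sub_conj_om_le (hV : IsPotential C₀ V) (hN : 0 < N)
    (hq : IsPureQuasiFree N ωN αN) {t : ℝ} (ht : 0 ≤ t) :
    ‖1 - conjOp (HS.op (h.om t))‖ ≤ 1 := by
  rw [← conjOp_one, ← conjOp_sub, norm_conjOp]
  exact norm_one_sub_le_one (h.star_om hV hN hq.star_omega ht) (h.om_sq hV hN hq ht)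

/-- Purity replaces `ω` by `ω² + αα*`, a sum of products of Hilbert-Schmidt operators. Traces
thereby become Hilbert-Schmidt inner products, which can be differentiated and bounded sharply. -/
theorem trace_om_mul (hV : IsPotential C₀ V) (hN : 0 < N) (hq : IsPureQuasiFree N ωN αN) {t : ℝ}
    (ht : 0 ≤ t) (B : Op M) : trace (HS.op (h.om t) * B)
      = ⟪h.om t, HS.rmul B (h.om t)⟫_ℂ + ⟪HS.adj (h.al t), HS.rmul B (HS.adj (h.al t))⟫_ℂ := by
  have e : HS.op (h.om t) * B = HS.op (h.om t) * HS.op (HS.rmul B (h.om t))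
      + HS.op (h.al t) * HS.op (HS.rmul B (HS.adj (h.al t))) := by
    conv_lhs => rw [← h.om_sq hV hN hq ht]
    rw [HS.op_rmul, HS.op_rmul, HS.op_adj]
    noncomm_ring
  rw [e, trace_add ((traceNorm_mul_le _ _).trans_lt ENNReal.ofReal_lt_top)
    ((traceNorm_mul_le _ _).trans_lt ENNReal.ofReal_lt_top), trace_mul, trace_mul,
    h.adj_om hV hN hq.star_omega ht]

/-- The terms with a selfadjoint potential and the pairing energy are real one by one; the terms
mixing `ω` and `α` are real only together. -/
theorem re_inner_force (hV : IsPotential C₀ V) (hN : 0 < N) (hq : IsPureQuasiFree N ωN αN) {t : ℝ}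
    (ht : 0 ≤ t) :
    (starRingEnd ℂ) (⟪h.om t, omegaForceHS hV N (h.om t) (h.al t)⟫_ℂ
        + ⟪h.al t, alphaForceHS hV N (h.om t) (h.al t)⟫_ℂ)
      = ⟪h.om t, omegaForceHS hV N (h.om t) (h.al t)⟫_ℂ
        + ⟪h.al t, alphaForceHS hV N (h.om t) (h.al t)⟫_ℂ := by
  have hP : star (hfPotential V N (HS.op (h.om t))) = hfPotential V N (HS.op (h.om t)) :=
    h.star_pot hV hN hq.star_omega ht
  have ho := h.star_om hV hN hq.star_omega ht
  have hadj := h.adj_om hV hN hq.star_omega ht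
  have hL : ∀ {P : Op M} (A : HS M), star P = P →
      (starRingEnd ℂ) ⟪A, HS.lmul P A⟫_ℂ = ⟪A, HS.lmul P A⟫_ℂ := fun {P} A hP => by
    rw [inner_conj_symm, HS.inner_lmul, hP]
  have hR : ∀ {P : Op M} (A : HS M), star P = P →
      (starRingEnd ℂ) ⟪A, HS.rmul P A⟫_ℂ = ⟪A, HS.rmul P A⟫_ℂ := fun {P} A hP => by
    rw [inner_conj_symm, HS.inner_rmul, hP]
  have hPb : star (conjOp (hfPotential V N (HS.op (h.om t))))
      = conjOp (hfPotential V N (HS.op (h.om t))) := by rw [star_conjOp, hP]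
  have e1 := hL (h.om t) hP
  have e2 := hR (h.om t) hP
  have e3 := hL (h.al t) hP
  have e4 := hR (h.al t) hPb
  have e5 := inner_exch_self (hV := hV) (N := N) (h.al t)
  -- With `z = ⟨ω, Πα*⟩`, the four mixed terms are `z`, `-z̄`, `-z`, `-z`, with sum `-(z + z̄)`. The
  -- last one needs `ωα = αω̄`, that is, the vanishing of the pairing defect.
  have e6 : ⟪h.om t, HS.lmul (HS.op (h.al t)) (HS.adj (exch hV N (h.al t)))⟫_ℂ
      = (starRingEnd ℂ) ⟪h.om t, HS.rmul (star (HS.op (h.al t))) (exch hV N (h.al t))⟫_ℂ := by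
    have : HS.lmul (HS.op (h.al t)) (HS.adj (exch hV N (h.al t)))
        = HS.adj (HS.rmul (star (HS.op (h.al t))) (exch hV N (h.al t))) := by
      refine HS.ext ?_
      rw [HS.op_lmul, HS.op_adj, HS.op_adj, HS.op_rmul, star_mul (HS.op (exch hV N (h.al t))),
        star_star]
    rw [this, inner_conj_symm]
    conv_lhs => rw [← hadj]
    exact HS.inner_adj _ _
  have e7 : ⟪h.al t, HS.lmul (HS.op (h.om t)) (exch hV N (h.al t))⟫_ℂ
      = ⟪h.om t, HS.rmul (star (HS.op (h.al t))) (exch hV N (h.al t))⟫_ℂ := by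
    rw [HS.inner_lmul, HS.inner_rmul, star_star, ho]
    rfl
  have e8 : ⟪h.al t, HS.rmul (conjOp (HS.op (h.om t))) (exch hV N (h.al t))⟫_ℂ
      = ⟪h.om t, HS.rmul (star (HS.op (h.al t))) (exch hV N (h.al t))⟫_ℂ := by
    rw [← e7, HS.inner_lmul, HS.inner_rmul, ho, star_conjOp, ho]
    congr 1
    exact HS.ext (sub_eq_zero.1 (h.purity hV hN hq ht).2).symm
  have e9 : HS.rmul (1 - conjOp (HS.op (h.om t))) (exch hV N (h.al t))
      = exch hV N (h.al t) - HS.rmul (conjOp (HS.op (h.om t))) (exch hV N (h.al t)) := by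
    rw [HS.rmul_sub]
    congr 1
  rw [omegaForceHS, alphaForceHS, e9]
  simp only [inner_add_right, inner_sub_right, e6, e7, e8, map_add, map_sub, e1, e2, e3, e4, e5,
    Complex.conj_conj]
  ring

/-- By purity the left side is `tr ω`. Its derivative is the real part of an imaginary number times
the real number of `re_inner_force`, so the initial value `tr ω_N = N` persists. -/
theorem norm_sq_add_eq (hV : IsPotential C₀ V) (hN : 0 < N) (hq : IsPureQuasiFree N ωN αN)
    {t : ℝ} (ht : 0 ≤ t) : ‖h.om t‖ ^ 2 + ‖h.al t‖ ^ 2 = N := by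
  have hcont : Continuous fun t => ⟪h.om t, h.om t⟫_ℂ + ⟪h.al t, h.al t⟫_ℂ - (N : ℂ) :=
    ((h.continuous_om.inner h.continuous_om).add (h.continuous_al.inner h.continuous_al)).sub
      continuous_const
  have hz := DiniLE.eq_zero (f := fun t => ‖⟪h.om t, h.om t⟫_ℂ + ⟪h.al t, h.al t⟫_ℂ - (N : ℂ)‖)
    (K := 0) hcont.norm.continuousOn ?_ (fun _ => norm_nonneg _) (fun s hs _ => ?_) t ht le_rfl
  · have h1 := sub_eq_zero.1 (norm_eq_zero.1 hz)
    have e : ∀ A : HS M, ⟪A, A⟫_ℂ = ((‖A‖ ^ 2 : ℝ) : ℂ) := fun A => by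
      rw [inner_self_eq_norm_sq_to_K]; push_cast; rfl
    rw [e, e, ← Complex.ofReal_add] at h1
    exact Complex.ofReal_injective h1
  · have h1 := h.trace_om_mul hV hN hq le_rfl 1
    have e : ∀ A : HS M, HS.rmul 1 A = A := fun A => HS.ext (by rw [HS.op_rmul, mul_one])
    rw [mul_one, e, e, HS.inner_adj, h.op_om le_rfl, h.omega_zero, hq.trace_eq] at h1
    rw [norm_eq_zero, sub_eq_zero]
    exact h1.symm
  · have ha : RightDeriv (fun r => pullback (eps N) 1 r (h.om (s + r))) _ :=
      h.comovingDeriv_om hV hs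
    have hb : RightDeriv (fun r => pullback (eps N) (-1) r (h.al (s + r))) _ :=
      h.comovingDeriv_al hV hs
    have hconst : RightDeriv (fun _ : ℝ => (N : ℂ)) 0 := by
      rw [RightDeriv]
      simp only [sub_self, smul_zero]
      exact tendsto_const_nhds
    have hd := ((ha.inner ha).add (hb.inner hb)).sub hconst
    refine DiniLE.of_rightDeriv_norm hd (fun r _ => ?_) ?_
    · have e : ∀ A : HS M, ⟪A, A⟫_ℂ = ((‖A‖ : ℂ)) ^ 2 := fun A => inner_self_eq_norm_sq_to_K A
      simp only [e, norm_pullback]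
    · rw [zero_mul]
      simp only [add_zero, pullback_zero, sub_zero, inner_smul_left, inner_smul_right,
        conj_inv_I_mul]
      have hr := h.re_inner_force hV hN hq hs
      rw [map_add, inner_conj_symm, inner_conj_symm] at hr
      rw [norm_le_zero_iff]
      -- The derivative is `(iε)⁻¹` times the difference of `⟨ω, F⟩ + ⟨α, G⟩` and its conjugate.
      linear_combination (-(Complex.I * (eps N : ℂ))⁻¹) * hr

/-- The sharp constant 1, independent of time and of the solution, is what keeps the rates below
depending on `C₀` only. -/
theorem norm_densityCoeff_om_le (hV : IsPotential C₀ V) (hN : 0 < N)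
    (hq : IsPureQuasiFree N ωN αN) {t : ℝ} (ht : 0 ≤ t) (p : R3) :
    ‖densityCoeff N (HS.op (h.om t)) p‖ ≤ 1 := by
  rw [densityCoeff, h.trace_om_mul hV hN hq ht, norm_mul, norm_inv, Complex.norm_real,
    Real.norm_of_nonneg hN.le, inv_mul_le_iff₀ hN, mul_one]
  have key : ∀ A : HS M, ‖⟪A, HS.rmul (expOp M (-p)) A⟫_ℂ‖ ≤ ‖A‖ ^ 2 := fun A => by
    refine (norm_inner_le_norm _ _).trans ?_
    rw [sq]
    refine mul_le_mul_of_nonneg_left ?_ (norm_nonneg _)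
    exact (HS.norm_rmul_le _ _).trans (mul_le_of_le_one_right (norm_nonneg _) (norm_expOp_le _))
  refine ((norm_add_le _ _).trans (add_le_add (key _) ?_)).trans_eq (h.norm_sq_add_eq hV hN hq ht)
  have := key (HS.adj (h.al t))
  rwa [HS.norm_adj] at this

/-- The potential acts on `α` from both sides by selfadjoint operators and drops out. The pairing
terms `Π(1 - ω̄) - ωΠ` have norm at most `2C₀/N · ‖α‖`. -/
theorem norm_al_le (hV : IsPotential C₀ V) (hN : 0 < N)
    (hq : IsPureQuasiFree N ωN αN) {t : ℝ} (ht : 0 ≤ t) :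
    ‖h.al t‖ ≤ ‖h.al 0‖ * Real.exp (2 * C₀ / (N * eps N) * t) := by
  have hε := eps_pos hN
  have := DiniLE.gronwall (f := fun t => ‖h.al t‖) (K := 2 * C₀ / (N * eps N)) (ε := 0) (T := t)
    h.continuous_al.norm.continuousOn (fun s hs _ => ?_) t ht le_rfl
  · rwa [gronwallBound_ε0] at this
  have hd : RightDeriv (fun r => pullback (eps N) (-1) r (h.al (s + r))) _ :=
    h.comovingDeriv_al hV hs
  have e0 : pullback (eps N) (-1) 0 (h.al (s + 0)) = h.al s := by rw [pullback_zero, add_zero]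
  have hP := h.star_pot hV hN hq.star_omega hs
  have e1 : alphaForceHS hV N (h.om s) (h.al s) = HS.lmul (h.pot s) (h.al s)
      + HS.rmul (conjOp (h.pot s)) (h.al s)
      + (HS.rmul (1 - conjOp (HS.op (h.om s))) (exch hV N (h.al s))
        - HS.lmul (HS.op (h.om s)) (exch hV N (h.al s))) := by
    rw [alphaForceHS, pot]; abel
  rw [e1] at hd
  refine (DiniLE.of_generator (Y := fun r => pullback (eps N) (-1) r (h.al (s + r))) hε
    (by simp only [e0]; exact hd) hP (by rw [star_conjOp, hP])
    (fun r _ => (norm_pullback _ _ _ _).symm) le_rfl).mono ?_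
  rw [add_zero]
  have h1 := norm_exch_le hV N (h.al s)
  rw [abs_of_pos hN] at h1
  have h2 := (HS.norm_rmul_le (1 - conjOp (HS.op (h.om s))) (exch hV N (h.al s))).trans
    (mul_le_of_le_one_right (norm_nonneg _) (h.norm_one_sub_conj_om_le hV hN hq hs))
  have h3 := (HS.norm_lmul_le (HS.op (h.om s)) (exch hV N (h.al s))).trans
    (mul_le_of_le_one_left (norm_nonneg _) (h.norm_op_om_le hV hN hq hs))
  have h4 := (norm_sub_le (HS.rmul (1 - conjOp (HS.op (h.om s))) (exch hV N (h.al s)))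
    (HS.lmul (HS.op (h.om s)) (exch hV N (h.al s)))).trans
    ((add_le_add h2 h3).trans (add_le_add h1 h1))
  refine (mul_le_mul_of_nonneg_left h4 (by positivity)).trans_eq ?_
  field_simp
  ring

end IsSolution

end Conservation

/-! ### The equations for differences with a conjugated solution. -/

section Conjugation

variable {M : ℕ} {V : R3 → ℝ} {C₀ : ℝ} {N : ℝ}

/-- The conjugated operator `W A W*`. -/
def HS.sandwich (W : Op M) (A : HS M) : HS M := HS.bimul W (star W) A

theorem HS.op_sandwich (W : Op M) (A : HS M) :
    HS.op (HS.sandwich W A) = W * HS.op A * star W := by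
  rw [HS.sandwich, HS.op_bimul, mul_assoc]

theorem HS.sandwich_sub (W : Op M) (A B : HS M) :
    HS.sandwich W (A - B) = HS.sandwich W A - HS.sandwich W B :=
  HS.bimul_sub _ _ _ _

theorem HS.sandwich_smul (W : Op M) (c : ℂ) (A : HS M) :
    HS.sandwich W (c • A) = c • HS.sandwich W A := by
  rw [HS.sandwich, HS.bimul, map_smul, map_smul]; rfl

theorem HS.continuous_sandwich (W : Op M) : Continuous (HS.sandwich W : HS M → HS M) :=
  (HS.lmul W).continuous.comp (HS.rmul (star W)).continuous

theorem HS.norm_sandwich_le {W : Op M} (hW : ‖W‖ ≤ 1) (A : HS M) : ‖HS.sandwich W A‖ ≤ ‖A‖ :=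
  HS.norm_bimul_le hW (by rwa [norm_star_op]) A

theorem HS.norm_op_sandwich_le {W : Op M} (hW : ‖W‖ ≤ 1) (A : HS M) :
    ‖HS.op (HS.sandwich W A)‖ ≤ ‖HS.op A‖ := by
  rw [HS.op_sandwich]
  refine (norm_mul_le _ _).trans ?_
  rw [norm_star_op]
  refine (mul_le_of_le_one_right (norm_nonneg _) hW).trans ?_
  exact (norm_mul_le _ _).trans (mul_le_of_le_one_left (norm_nonneg _) hW)

theorem HS.norm_lmul_op_le (A B : HS M) : ‖HS.lmul (HS.op A) B‖ ≤ ‖A‖ * ‖HS.op B‖ :=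
  HS.norm_rmul_le (HS.op B) A

theorem HS.norm_rmul_op_le (A B : HS M) : ‖HS.rmul (HS.op A) B‖ ≤ ‖HS.op B‖ * ‖A‖ :=
  HS.norm_lmul_le (HS.op B) A

/-- The right-hand side of the equation for `ω` with the potential `P`. -/
def omegaGen (hV : IsPotential C₀ V) (N : ℝ) (P : Op M) (ω α : HS M) : HS M :=
  HS.lmul P ω - HS.rmul P ω + HS.rmul (star (HS.op α)) (exch hV N α)
    - HS.lmul (HS.op α) (HS.adj (exch hV N α))

/-- The right-hand side of the equation for `α` with the potential `P`. -/
def alphaGen (hV : IsPotential C₀ V) (N : ℝ) (P : Op M) (ω α : HS M) : HS M :=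
  HS.lmul P α + HS.rmul (conjOp P) α + HS.rmul (1 - conjOp (HS.op ω)) (exch hV N α)
    - HS.lmul (HS.op ω) (exch hV N α)

/-- Covariance: the conjugated pair satisfies the same equation with the conjugated potential. For
`α` (`sandwich_alphaGen`) the operator `W` must also be real, which holds for translations but not
for boosts. -/
theorem sandwich_omegaGen (hV : IsPotential C₀ V) {W : Op M} (hW : star W * W = 1)
    (hex : ∀ A : HS M, HS.sandwich W (exch hV N A) = exch hV N (HS.sandwich W A))
    (P : Op M) (ω α : HS M) :
    HS.sandwich W (omegaGen hV N P ω α)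
      = omegaGen hV N (W * P * star W) (HS.sandwich W ω) (HS.sandwich W α) := by
  have key : ∀ A B : Op M, W * A * star W * (W * B * star W) = W * (A * B) * star W :=
    fun A B => by
      rw [show W * A * star W * (W * B * star W) = W * A * (star W * W) * B * star W by
        noncomm_ring, hW]
      noncomm_ring
  have hst : ∀ A : Op M, star (W * A * star W) = W * star A * star W := fun A => by
    rw [star_mul (W * A), star_mul W, star_star, mul_assoc]
  refine HS.ext ?_
  rw [omegaGen, omegaGen, ← hex]
  simp only [HS.op_sandwich, map_add, map_sub, HS.op_lmul, HS.op_rmul, HS.op_adj, hst, key]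
  noncomm_ring

theorem sandwich_alphaGen (hV : IsPotential C₀ V) {W : Op M} (hW : star W * W = 1)
    (hW' : W * star W = 1) (hc : conjOp W = W)
    (hex : ∀ A : HS M, HS.sandwich W (exch hV N A) = exch hV N (HS.sandwich W A))
    (P : Op M) (ω α : HS M) :
    HS.sandwich W (alphaGen hV N P ω α)
      = alphaGen hV N (W * P * star W) (HS.sandwich W ω) (HS.sandwich W α) := by
  have key : ∀ A B : Op M, W * A * star W * (W * B * star W) = W * (A * B) * star W :=
    fun A B => by
      rw [show W * A * star W * (W * B * star W) = W * A * (star W * W) * B * star W by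
        noncomm_ring, hW]
      noncomm_ring
  have hcj : ∀ A : Op M, conjOp (W * A * star W) = W * conjOp A * star W := fun A => by
    rw [conjOp_mul, conjOp_mul, ← star_conjOp, hc]
  have h1 : (1 : Op M) = W * 1 * star W := by rw [mul_one, hW']
  refine HS.ext ?_
  rw [alphaGen, alphaGen, ← hex]
  simp only [HS.op_sandwich, map_add, map_sub, HS.op_lmul, HS.op_rmul, hcj, key]
  rw [mul_sub (W * HS.op (exch hV N α) * star W), mul_one, key]
  noncomm_ring

/-- The difference of potentials acts on `ω`, and the skew part on `ω - ω'` uses `P'` only. Every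
other term contains one difference `α - α'`, so the remainder is linear in the differences. -/
theorem omegaGen_sub (hV : IsPotential C₀ V) (P P' : Op M) (ω ω' α α' : HS M) :
    omegaGen hV N P ω α - omegaGen hV N P' ω' α'
      = HS.lmul P' (ω - ω') + HS.rmul (-P') (ω - ω')
        + ((HS.lmul (P - P') ω - HS.rmul (P - P') ω)
          + (HS.rmul (star (HS.op α)) (exch hV N (α - α'))
            + HS.rmul (HS.op (HS.adj (α - α'))) (exch hV N α')
            - HS.lmul (HS.op (α - α')) (HS.adj (exch hV N α))
            - HS.lmul (HS.op α') (HS.adj (exch hV N (α - α'))))) := by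
  refine HS.ext ?_
  rw [omegaGen, omegaGen, exch_sub]
  simp only [map_add, map_sub, HS.op_lmul, HS.op_rmul, HS.op_adj, star_sub]
  generalize HS.op (exch hV N α) = X
  generalize HS.op (exch hV N α') = X'
  noncomm_ring

theorem alphaGen_sub (hV : IsPotential C₀ V) (P P' : Op M) (ω ω' α α' : HS M) :
    alphaGen hV N P ω α - alphaGen hV N P' ω' α'
      = HS.lmul P' (α - α') + HS.rmul (conjOp P') (α - α')
        + ((HS.lmul (P - P') α + HS.rmul (conjOp (P - P')) α)
          + (HS.rmul (1 - conjOp (HS.op ω)) (exch hV N (α - α'))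
            - HS.rmul (HS.op (HS.conj (ω - ω'))) (exch hV N α')
            - HS.lmul (HS.op (ω - ω')) (exch hV N α)
            - HS.lmul (HS.op ω') (exch hV N (α - α')))) := by
  refine HS.ext ?_
  rw [alphaGen, alphaGen, exch_sub]
  simp only [map_add, map_sub, HS.op_lmul, HS.op_rmul, HS.op_conj, conjOp_sub]
  generalize HS.op (exch hV N α) = X
  generalize HS.op (exch hV N α') = X'
  noncomm_ring

/-- `Δ` is the change of the direct potential, kept as a commutator. The exchange part contributes
twice `‖ω - ω'‖` and the pairing terms four times `‖α - α'‖`; all other factors have operator norm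
at most 1. -/
theorem norm_omega_remainder_le (hV : IsPotential C₀ V) (hN : 0 < N) {Δ : Op M}
    {ω ω' α α' : HS M} (ho : ‖HS.op ω‖ ≤ 1) (ha : ‖HS.op α‖ ≤ 1) (ha' : ‖HS.op α'‖ ≤ 1) {m : ℝ}
    (hm : ‖HS.lmul Δ ω - HS.rmul Δ ω‖ ≤ m) :
    ‖(HS.lmul (Δ - HS.op (exch hV N (ω - ω'))) ω - HS.rmul (Δ - HS.op (exch hV N (ω - ω'))) ω)
      + (HS.rmul (star (HS.op α)) (exch hV N (α - α'))
        + HS.rmul (HS.op (HS.adj (α - α'))) (exch hV N α')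
        - HS.lmul (HS.op (α - α')) (HS.adj (exch hV N α))
        - HS.lmul (HS.op α') (HS.adj (exch hV N (α - α'))))‖
      ≤ m + N⁻¹ * C₀ * (2 * ‖ω - ω'‖ + 4 * ‖α - α'‖) := by
  have hK : 0 ≤ N⁻¹ * C₀ := mul_nonneg (inv_nonneg.2 hN.le) hV.nonneg
  have hX : ∀ A : HS M, ‖exch hV N A‖ ≤ N⁻¹ * C₀ * ‖A‖ := fun A => by
    have := norm_exch_le hV N A; rwa [abs_of_pos hN] at this
  have hXo : ∀ A : HS M, ‖HS.op A‖ ≤ 1 → ‖HS.op (exch hV N A)‖ ≤ N⁻¹ * C₀ := fun A hA => by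
    have := norm_op_exch_le hV N A
    rw [abs_of_pos hN] at this
    exact this.trans (mul_le_of_le_one_right hK hA)
  have e1 := (HS.norm_lmul_op_le (exch hV N (ω - ω')) ω).trans
    ((mul_le_of_le_one_right (norm_nonneg _) ho).trans (hX _))
  have e2 := (HS.norm_rmul_op_le (exch hV N (ω - ω')) ω).trans
    ((mul_le_of_le_one_left (norm_nonneg _) ho).trans (hX _))
  have e3 := (HS.norm_rmul_le (star (HS.op α)) (exch hV N (α - α'))).trans
    ((mul_le_of_le_one_right (norm_nonneg _) ((norm_star_op _).trans_le ha)).trans (hX _))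
  have e4 := (HS.norm_rmul_op_le (HS.adj (α - α')) (exch hV N α')).trans
    (mul_le_mul_of_nonneg_right (hXo _ ha') (norm_nonneg _))
  have e5 := (HS.norm_lmul_op_le (α - α') (HS.adj (exch hV N α))).trans
    (mul_le_mul_of_nonneg_left ((norm_star_op _).trans_le (hXo _ ha)) (norm_nonneg _))
  have e6 := (HS.norm_lmul_le (HS.op α') (HS.adj (exch hV N (α - α')))).trans
    (mul_le_of_le_one_left (norm_nonneg _) ha')
  rw [HS.norm_adj] at e4 e6
  have e7 := e6.trans (hX _)
  have e : HS.lmul (Δ - HS.op (exch hV N (ω - ω'))) ω - HS.rmul (Δ - HS.op (exch hV N (ω - ω'))) ω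
      = (HS.lmul Δ ω - HS.rmul Δ ω) - HS.lmul (HS.op (exch hV N (ω - ω'))) ω
        + HS.rmul (HS.op (exch hV N (ω - ω'))) ω := by
    rw [HS.lmul_sub, HS.rmul_sub]; abel
  rw [e]
  refine ((norm_add_le _ _).trans (add_le_add ((norm_add_le _ _).trans (add_le_add
    ((norm_sub_le _ _).trans (add_le_add hm e1)) e2)) ((norm_sub_le _ _).trans (add_le_add
    ((norm_sub_le _ _).trans (add_le_add ((norm_add_le _ _).trans (add_le_add e3 e4)) e5))
    e7)))).trans_eq ?_
  ring

/-- Here `Δ` acts on `α` without a commutator structure, so its operator norm multiplies `‖α‖`. This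
is the origin of the term with `‖α_N‖` in the final estimate. -/
theorem norm_alpha_remainder_le (hV : IsPotential C₀ V) (hN : 0 < N) {Δ : Op M}
    {ω ω' α α' : HS M} (ho : ‖1 - conjOp (HS.op ω)‖ ≤ 1) (ho' : ‖HS.op ω'‖ ≤ 1)
    (ha : ‖HS.op α‖ ≤ 1) (ha' : ‖HS.op α'‖ ≤ 1) {m : ℝ} (hm : ‖Δ‖ ≤ m) :
    ‖(HS.lmul (Δ - HS.op (exch hV N (ω - ω'))) α
        + HS.rmul (conjOp (Δ - HS.op (exch hV N (ω - ω')))) α)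
      + (HS.rmul (1 - conjOp (HS.op ω)) (exch hV N (α - α'))
        - HS.rmul (HS.op (HS.conj (ω - ω'))) (exch hV N α')
        - HS.lmul (HS.op (ω - ω')) (exch hV N α)
        - HS.lmul (HS.op ω') (exch hV N (α - α')))‖
      ≤ 2 * m * ‖α‖ + N⁻¹ * C₀ * (4 * ‖ω - ω'‖ + 2 * ‖α - α'‖) := by
  have hK : 0 ≤ N⁻¹ * C₀ := mul_nonneg (inv_nonneg.2 hN.le) hV.nonneg
  have hX : ∀ A : HS M, ‖exch hV N A‖ ≤ N⁻¹ * C₀ * ‖A‖ := fun A => by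
    have := norm_exch_le hV N A; rwa [abs_of_pos hN] at this
  have hXo : ∀ A : HS M, ‖HS.op A‖ ≤ 1 → ‖HS.op (exch hV N A)‖ ≤ N⁻¹ * C₀ := fun A hA => by
    have := norm_op_exch_le hV N A
    rw [abs_of_pos hN] at this
    exact this.trans (mul_le_of_le_one_right hK hA)
  have e0 := (HS.norm_lmul_le Δ α).trans (mul_le_mul_of_nonneg_right hm (norm_nonneg _))
  have e0' := (HS.norm_rmul_le (conjOp Δ) α).trans
    (mul_le_mul_of_nonneg_left ((norm_conjOp _).trans_le hm) (norm_nonneg _))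
  have e1 := (HS.norm_lmul_op_le (exch hV N (ω - ω')) α).trans
    ((mul_le_of_le_one_right (norm_nonneg _) ha).trans (hX _))
  have e2 := (HS.norm_rmul_op_le (HS.conj (exch hV N (ω - ω'))) α).trans
    (mul_le_of_le_one_left (norm_nonneg _) ha)
  have e3 := (HS.norm_rmul_le (1 - conjOp (HS.op ω)) (exch hV N (α - α'))).trans
    ((mul_le_of_le_one_right (norm_nonneg _) ho).trans (hX _))
  have e4 := (HS.norm_rmul_op_le (HS.conj (ω - ω')) (exch hV N α')).trans
    (mul_le_mul_of_nonneg_right (hXo _ ha') (norm_nonneg _))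
  have e5 := (HS.norm_lmul_op_le (ω - ω') (exch hV N α)).trans
    (mul_le_mul_of_nonneg_left (hXo _ ha) (norm_nonneg _))
  have e6 := (HS.norm_lmul_le (HS.op ω') (exch hV N (α - α'))).trans
    ((mul_le_of_le_one_left (norm_nonneg _) ho').trans (hX _))
  rw [HS.norm_conj] at e2 e4
  have e7 := e2.trans (hX _)
  have e : HS.lmul (Δ - HS.op (exch hV N (ω - ω'))) α
        + HS.rmul (conjOp (Δ - HS.op (exch hV N (ω - ω')))) α
      = (HS.lmul Δ α + HS.rmul (conjOp Δ) α) - HS.lmul (HS.op (exch hV N (ω - ω'))) α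
        - HS.rmul (HS.op (HS.conj (exch hV N (ω - ω')))) α := by
    rw [HS.lmul_sub, conjOp_sub, HS.rmul_sub, HS.op_conj]; abel
  rw [e]
  refine ((norm_add_le _ _).trans (add_le_add ((norm_sub_le _ _).trans (add_le_add
    ((norm_sub_le _ _).trans (add_le_add ((norm_add_le _ _).trans (add_le_add e0 e0')) e1)) e7))
    ((norm_sub_le _ _).trans (add_le_add ((norm_sub_le _ _).trans (add_le_add
    ((norm_sub_le _ _).trans (add_le_add e3 e4)) e5)) e6)))).trans_eq ?_
  ring

theorem sandwich_transOp_exch (hV : IsPotential C₀ V) (a : R3) (A : HS M) :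
    HS.sandwich (transOp M a) (exch hV N A) = exch hV N (HS.sandwich (transOp M a) A) := by
  rw [HS.sandwich, HS.sandwich, star_transOp]
  exact transOp_exch hV N a A

theorem sandwich_expOp_exch (hV : IsPotential C₀ V) (p : R3) (A : HS M) :
    HS.sandwich (expOp M p) (exch hV N A) = exch hV N (HS.sandwich (expOp M p) A) := by
  rw [HS.sandwich, HS.sandwich, star_expOp]
  exact expOp_exch hV N p A

theorem norm_sub_sandwich_expOp (q : R3) (A : HS M) :
    ‖HS.lmul (expOp M q) A - HS.rmul (expOp M q) A‖ = ‖A - HS.sandwich (expOp M q) A‖ := by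
  have e : HS.lmul (expOp M q) A - HS.rmul (expOp M q) A
      = -HS.rmul (expOp M q) (A - HS.sandwich (expOp M q) A) := by
    refine HS.ext ?_
    rw [map_neg, HS.op_rmul (A - _) (expOp M q), map_sub, map_sub, HS.op_sandwich, HS.op_lmul,
      HS.op_rmul, sub_mul,
      star_expOp, mul_assoc _ (expOp M (-q)), expOp_neg_mul, mul_one, neg_sub]
  rw [e, norm_neg, HS.norm_rmul_of_isometry]
  intro x
  rw [star_expOp, norm_expOp_apply]

/-- Inside the Fourier integral the commutator with `e^{iq·x̂}` is at most `n(1 + |q|)`, and the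
translation contributes `|q||a|`. The bound is linear in `|a|` and in the boost constant `n`. -/
theorem norm_direct_comm_le (hV : IsPotential C₀ V) {A : Op M} (hA : traceNorm A < ∞)
    (hd : ∀ q, ‖densityCoeff N A q‖ ≤ 1) (a : R3) {B : HS M} {n : ℝ}
    (hB : ∀ q, ‖B - HS.sandwich (expOp M q) B‖ ≤ n * (1 + ‖q‖)) :
    ‖HS.lmul (directOp V N A - transOp M a * directOp V N A * transOp M (-a)) B
      - HS.rmul (directOp V N A - transOp M a * directOp V N A * transOp M (-a)) B‖
      ≤ 2 * C₀ * ‖a‖ * n := by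
  have hn : 0 ≤ n := by
    have := (norm_nonneg _).trans (hB 0)
    rwa [norm_zero, add_zero, mul_one] at this
  have hw := directOp_sub_trans_spec hV N hA a
  have hi : Integrable fun q => ‖a‖ * n * (‖vHat V q‖ * (‖q‖ * (1 + ‖q‖))) :=
    hV.integrable_mul_norm.const_mul _
  refine HS.norm_le_of_hsNorm_le (by have := hV.nonneg; positivity) ?_
  rw [map_sub, HS.op_lmul, HS.op_rmul]
  refine (((hw.mul_right (HS.op B)).sub (hw.mul_left (HS.op B))).hsNorm_le hi
    (fun q => by positivity) fun q => ?_).trans (ENNReal.ofReal_le_ofReal ?_)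
  · have e : ∀ c : ℂ, (c • expOp M q) * HS.op B - HS.op B * (c • expOp M q)
        = HS.op (c • (HS.lmul (expOp M q) B - HS.rmul (expOp M q) B)) := fun c => by
      rw [map_smul, map_sub, HS.op_lmul, HS.op_rmul, smul_mul_assoc, mul_smul_comm, smul_sub]
    rw [e, HS.hsNorm_op, norm_smul, norm_sub_sandwich_expOp, norm_mul, norm_mul]
    refine ENNReal.ofReal_le_ofReal ?_
    calc ‖vHat V q‖ * ‖densityCoeff N A q‖ * ‖1 - phase q a‖ * ‖B - HS.sandwich (expOp M q) B‖
        ≤ ‖vHat V q‖ * 1 * (‖q‖ * ‖a‖) * (n * (1 + ‖q‖)) := by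
          gcongr
          · exact hd q
          · exact norm_one_sub_phase_le q a
          · exact hB q
      _ = _ := by ring
  · rw [integral_const_mul]
    refine (mul_le_mul_of_nonneg_left hV.integral_mul_norm_le (by positivity)).trans_eq ?_
    ring

theorem norm_direct_sub_trans_le (hV : IsPotential C₀ V) {A : Op M} (hA : traceNorm A < ∞)
    (hd : ∀ q, ‖densityCoeff N A q‖ ≤ 1) (a : R3) :
    ‖directOp V N A - transOp M a * directOp V N A * transOp M (-a)‖ ≤ 2 * C₀ * ‖a‖ := by
  have hi : Integrable fun q => ‖a‖ * (‖vHat V q‖ * (‖q‖ * (1 + ‖q‖))) :=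
    hV.integrable_mul_norm.const_mul _
  refine ((directOp_sub_trans_spec hV N hA a).norm_le hi (fun q => by positivity)
    fun q => ?_).trans ?_
  · rw [norm_smul, norm_mul, norm_mul]
    calc ‖vHat V q‖ * ‖densityCoeff N A q‖ * ‖1 - phase q a‖ * ‖expOp M q‖
        ≤ ‖vHat V q‖ * 1 * (‖q‖ * ‖a‖) * (1 + ‖q‖) := by
          gcongr
          · exact hd q
          · exact norm_one_sub_phase_le q a
          · exact (norm_expOp_le q).trans (le_add_of_nonneg_right (norm_nonneg q))
      _ = _ := by ring
  · rw [integral_const_mul]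
    refine (mul_le_mul_of_nonneg_left hV.integral_mul_norm_le (norm_nonneg a)).trans_eq ?_
    ring

end Conjugation

/-! ### Comparison with supersolutions. -/

section Comparison

namespace DiniLE

variable {f g : ℝ → ℝ} {t m n : ℝ}

theorem le_of_deriv_le {T K : ℝ} {m B B' : ℝ → ℝ} (hf : ContinuousOn f (Set.Icc 0 T))
    (h : ∀ t, 0 ≤ t → t < T → DiniLE f t (m t + K * f t)) (h0 : f 0 ≤ B 0)
    (hB : ∀ t, HasDerivAt B (B' t) t)
    (hle : ∀ t, 0 ≤ t → t < T → m t + K * B t ≤ B' t) :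
    ∀ t, 0 ≤ t → t ≤ T → f t ≤ B t := by
  intro t ht ht'
  -- The perturbation grows at rate `K + 1`, faster than `K`, which makes the differential
  -- inequality strict at any point of contact; then `η` is sent to zero.
  have key : ∀ η : ℝ, 0 < η → f t ≤ B t + η * Real.exp ((K + 1) * t) := fun η hη => by
    have hE : ∀ s, HasDerivAt (fun s => B s + η * Real.exp ((K + 1) * s))
        (B' s + η * (Real.exp ((K + 1) * s) * (K + 1))) s := fun s => by
      have h1 : HasDerivAt (fun s : ℝ => (K + 1) * s) (K + 1) s := by
        simpa using (hasDerivAt_id s).const_mul (K + 1)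
      exact (hB s).add (h1.exp.const_mul η)
    refine le_of_deriv_lt (B := fun s => B s + η * Real.exp ((K + 1) * s)) hf h ?_ hE
      (fun s hs hsT he => ?_) t ht ht'
    · have : 0 < η * Real.exp ((K + 1) * 0) := by positivity
      linarith
    · have h2 := hle s hs hsT
      have h3 : 0 < η * Real.exp ((K + 1) * s) := by positivity
      rw [he]
      nlinarith
  refine le_of_forall_pos_le_add fun δ hδ => ?_
  have hpos := Real.exp_pos ((K + 1) * t)
  refine (key (δ / Real.exp ((K + 1) * t)) (by positivity)).trans_eq ?_
  rw [div_mul_cancel₀ _ hpos.ne']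

/-- Separates the two sources of growth of a boost: `g` carries the interaction, while `r k(r)`
carries the translation created by the free flow. -/
theorem of_le_add {k : ℝ → ℝ} (hg : DiniLE g t m) (h0 : g t = f t)
    (hk : Tendsto k (𝓝[>] 0) (𝓝 n))
    (h : ∀ᶠ r in 𝓝[>] (0 : ℝ), f (t + r) ≤ g (t + r) + r * k r) : DiniLE f t (m + n) := by
  intro r hr
  filter_upwards [hg (m + (r - m - n) / 2) (by linarith),
    hk.eventually_lt_const (show n < n + (r - m - n) / 2 by linarith), h, self_mem_nhdsWithin]
    with s h1 h2 h3 h4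
  have h4 : 0 < s := h4
  rw [h0] at h1
  nlinarith

end DiniLE

end Comparison

/-! ### Differential inequalities for translated and boosted differences. -/

section CommutatorGrowth

variable {M : ℕ} {V : R3 → ℝ} {C₀ : ℝ} {N : ℝ} {ωN αN : Op M} {ω α : ℝ → Op M}

theorem pullback_sandwich_transOp (ε σ r : ℝ) (a : R3) (A : HS M) :
    pullback ε σ r (HS.sandwich (transOp M a) A) = HS.sandwich (transOp M a) (pullback ε σ r A) := by
  refine HS.ext ?_
  rw [op_pullback, HS.op_sandwich, HS.op_sandwich, op_pullback, star_transOp]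
  have h1 := freeProp_transOp (M := M) ε (-r) a
  have h2 := freeProp_transOp (M := M) ε (σ * r) (-a)
  generalize freeProp M ε (-r) = U at *
  generalize freeProp M ε (σ * r) = W at *
  generalize transOp M a = S at *
  generalize transOp M (-a) = S' at *
  calc U * (S * HS.op A * S') * W = (U * S) * HS.op A * (S' * W) := by noncomm_ring
    _ = (S * U) * HS.op A * (W * S') := by rw [h1, h2]
    _ = _ := by noncomm_ring

/-- Consequence of `freeProp_expOp`. A boosted difference pulled back in time splits into the
boosted difference of the pull-back and a translated difference with shift `2εrp`. -/
theorem pullback_sub_sandwich_expOp (ε r : ℝ) (p : R3) (A : HS M) :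
    pullback ε 1 r (A - HS.sandwich (expOp M p) A)
      = (pullback ε 1 r A - HS.sandwich (expOp M p) (pullback ε 1 r A))
        + HS.sandwich (expOp M p)
          (pullback ε 1 r (A - HS.sandwich (transOp M ((2 * ε * r) • p)) A)) := by
  obtain ⟨c, hc, h1⟩ := freeProp_expOp (M := M) ε r p
  have h2 : freeProp M ε (-r) * star (expOp M p) * freeProp M ε r
      = (starRingEnd ℂ) c • (star (transOp M ((2 * ε * r) • p)) * star (expOp M p)) := by
    have := congrArg star h1
    rw [star_mul (freeProp M ε (-r) * expOp M p), star_mul (freeProp M ε (-r)), star_freeProp,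
      star_freeProp, neg_neg, star_smul, star_mul (expOp M p), Complex.star_def] at this
    rw [mul_assoc]; exact this
  have hcc : c * (starRingEnd ℂ) c = 1 := by
    rw [Complex.mul_conj, Complex.normSq_eq_norm_sq, hc]; norm_num
  have key : pullback ε 1 r (HS.sandwich (expOp M p) A)
      = HS.sandwich (expOp M p) (pullback ε 1 r (HS.sandwich (transOp M ((2 * ε * r) • p)) A)) := by
    rw [pullback_sandwich_transOp]
    refine HS.ext ?_
    rw [op_pullback, HS.op_sandwich, HS.op_sandwich, HS.op_sandwich, op_pullback, one_mul]
    have h3 : freeProp M ε r * freeProp M ε (-r) = 1 := freeProp_mul_neg ε r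
    generalize freeProp M ε (-r) = U at *
    generalize freeProp M ε r = W at *
    generalize transOp M ((2 * ε * r) • p) = S at *
    generalize expOp M p = E at *
    calc U * (E * HS.op A * star E) * W
        = U * E * 1 * HS.op A * 1 * star E * W := by noncomm_ring
      _ = (U * E * W) * (U * HS.op A * W) * (U * star E * W) := by rw [← h3]; noncomm_ring
      _ = E * (S * (U * HS.op A * W) * star S) * star E := by
        rw [h1, h2, smul_mul_assoc, smul_mul_assoc, mul_smul_comm, smul_smul, hcc, one_smul]
        noncomm_ring
  rw [pullback_sub, key, pullback_sub, HS.sandwich_sub]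
  abel

namespace IsSolution

variable (h : IsSolution V N ωN αN ω α)

/-- The difference between `ω` and its translate by `a`. -/
def omTrans (h : IsSolution V N ωN αN ω α) (a : R3) (t : ℝ) : HS M :=
  h.om t - HS.sandwich (transOp M a) (h.om t)

/-- The difference between `α` and its translate by `a`. -/
def alTrans (h : IsSolution V N ωN αN ω α) (a : R3) (t : ℝ) : HS M :=
  h.al t - HS.sandwich (transOp M a) (h.al t)

/-- The difference between `ω` and its conjugation by `e^{ip·x}`. -/
def omBoost (h : IsSolution V N ωN αN ω α) (p : R3) (t : ℝ) : HS M :=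
  h.om t - HS.sandwich (expOp M p) (h.om t)

theorem continuous_omTrans (a : R3) : Continuous (h.omTrans a) :=
  h.continuous_om.sub ((HS.continuous_sandwich _).comp h.continuous_om)

theorem continuous_alTrans (a : R3) : Continuous (h.alTrans a) :=
  h.continuous_al.sub ((HS.continuous_sandwich _).comp h.continuous_al)

theorem continuous_omBoost (p : R3) : Continuous (h.omBoost p) :=
  h.continuous_om.sub ((HS.continuous_sandwich _).comp h.continuous_om)

theorem RightDeriv.sub_sandwich {Y : ℝ → HS M} {Z : HS M} (hY : RightDeriv Y Z) (W : Op M) :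
    RightDeriv (fun r => Y r - HS.sandwich W (Y r)) (Z - HS.sandwich W Z) :=
  hY.sub (hY.map (g := HS.sandwich W) (HS.sandwich_sub W) (fun _ _ => HS.sandwich_smul W _ _)
    (HS.continuous_sandwich W))

theorem pot_sub_sandwich (hV : IsPotential C₀ V) {W : Op M}
    (hex : ∀ A : HS M, HS.sandwich W (exch hV N A) = exch hV N (HS.sandwich W A)) (t : ℝ) :
    h.pot t - W * h.pot t * star W
      = (directOp V N (HS.op (h.om t)) - W * directOp V N (HS.op (h.om t)) * star W)
        - HS.op (exch hV N (h.om t - HS.sandwich W (h.om t))) := by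
  have e : W * kernelMul V N (HS.op (h.om t)) * star W
      = HS.op (exch hV N (HS.sandwich W (h.om t))) := by
    rw [← hex, HS.op_sandwich, op_exch]
  rw [pot, hfPotential, exch_sub, map_sub, ← e, op_exch]
  noncomm_ring

theorem star_sandwich_pot (hV : IsPotential C₀ V) (hN : 0 < N) (h0 : star ωN = ωN) {t : ℝ}
    (ht : 0 ≤ t) (W : Op M) : star (W * h.pot t * star W) = W * h.pot t * star W := by
  rw [star_mul (W * h.pot t), star_mul W, star_star, h.star_pot hV hN h0 ht, mul_assoc]

/-- Common to translations and boosts: the potential `W P W*` of the conjugated solution acts as a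
skew generator, and `m` bounds the commutator of `ω` with the change of the direct potential. -/
theorem diniLE_omega_sub_sandwich (hV : IsPotential C₀ V) (hN : 0 < N)
    (hq : IsPureQuasiFree N ωN αN) {W : Op M} (hW : star W * W = 1) (hW1 : ‖W‖ ≤ 1)
    (hex : ∀ A : HS M, HS.sandwich W (exch hV N A) = exch hV N (HS.sandwich W A))
    {t : ℝ} (ht : 0 ≤ t) {m : ℝ}
    (hm : ‖HS.lmul (directOp V N (HS.op (h.om t)) - W * directOp V N (HS.op (h.om t)) * star W)
        (h.om t)
      - HS.rmul (directOp V N (HS.op (h.om t)) - W * directOp V N (HS.op (h.om t)) * star W)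
        (h.om t)‖ ≤ m)
    {f : ℝ → ℝ} (hf : ∀ r, 0 ≤ r → f (t + r) = ‖pullback (eps N) 1 r (h.om (t + r))
      - HS.sandwich W (pullback (eps N) 1 r (h.om (t + r)))‖) :
    DiniLE f t ((eps N)⁻¹ * (m + N⁻¹ * C₀ * (2 * ‖h.om t - HS.sandwich W (h.om t)‖
      + 4 * ‖h.al t - HS.sandwich W (h.al t)‖))) := by
  have hε := eps_pos hN
  have ha := h.norm_op_al_le hV hN hq ht
  have hd : RightDeriv (fun r => pullback (eps N) 1 r (h.om (t + r)))
      ((Complex.I * (eps N : ℂ))⁻¹ • omegaGen hV N (h.pot t) (h.om t) (h.al t)) :=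
    h.comovingDeriv_om hV ht
  have hd2 := RightDeriv.sub_sandwich hd W
  rw [HS.sandwich_smul, ← smul_sub, sandwich_omegaGen hV hW hex, omegaGen_sub,
    h.pot_sub_sandwich hV hex] at hd2
  have hs := h.star_sandwich_pot hV hN hq.star_omega ht W
  refine DiniLE.of_generator hε (P := W * h.pot t * star W) (Q := -(W * h.pot t * star W))
    (by simp only [add_zero, pullback_zero]; exact hd2) hs (by rw [star_neg, hs]) hf ?_
  exact norm_omega_remainder_le hV hN (h.norm_op_om_le hV hN hq ht) ha
    ((HS.norm_op_sandwich_le hW1 _).trans ha) hm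

theorem diniLE_omTrans (hV : IsPotential C₀ V) (hN : 0 < N) (hq : IsPureQuasiFree N ωN αN)
    (a : R3) {t : ℝ} (ht : 0 ≤ t) {n : ℝ} (hn : ∀ q, ‖h.omBoost q t‖ ≤ n * (1 + ‖q‖)) :
    DiniLE (fun t => ‖h.omTrans a t‖) t ((eps N)⁻¹ * (2 * C₀ * ‖a‖ * n
      + N⁻¹ * C₀ * (2 * ‖h.omTrans a t‖ + 4 * ‖h.alTrans a t‖))) := by
  refine h.diniLE_omega_sub_sandwich hV hN hq (W := transOp M a)
    (by rw [star_transOp, transOp_neg_mul]) (norm_op_le_one_of_isometry (norm_transOp_apply a))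
    (sandwich_transOp_exch hV a) ht ?_ (fun r _ => ?_)
  · rw [star_transOp]
    exact norm_direct_comm_le hV (h.traceNormContinuous.lt_top t)
      (h.norm_densityCoeff_om_le hV hN hq ht) a hn
  · rw [← pullback_sandwich_transOp, ← pullback_sub, norm_pullback, omTrans]

theorem diniLE_alTrans (hV : IsPotential C₀ V) (hN : 0 < N) (hq : IsPureQuasiFree N ωN αN)
    (a : R3) {t : ℝ} (ht : 0 ≤ t) :
    DiniLE (fun t => ‖h.alTrans a t‖) t ((eps N)⁻¹ * (2 * (2 * C₀ * ‖a‖) * ‖h.al t‖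
      + N⁻¹ * C₀ * (4 * ‖h.omTrans a t‖ + 2 * ‖h.alTrans a t‖))) := by
  have hε := eps_pos hN
  have ha := h.norm_op_al_le hV hN hq ht
  have ho := h.norm_op_om_le hV hN hq ht
  have hW1 : ‖transOp M a‖ ≤ 1 := norm_op_le_one_of_isometry (norm_transOp_apply a)
  have hex := sandwich_transOp_exch (M := M) (N := N) hV a
  have hd : RightDeriv (fun r => pullback (eps N) (-1) r (h.al (t + r)))
      ((Complex.I * (eps N : ℂ))⁻¹ • alphaGen hV N (h.pot t) (h.om t) (h.al t)) :=
    h.comovingDeriv_al hV ht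
  have hd2 := RightDeriv.sub_sandwich hd (transOp M a)
  rw [HS.sandwich_smul, ← smul_sub, sandwich_alphaGen hV (by rw [star_transOp, transOp_neg_mul])
    (by rw [star_transOp, transOp_mul_neg]) (conjOp_transOp a) hex, alphaGen_sub,
    h.pot_sub_sandwich hV hex] at hd2
  have hs := h.star_sandwich_pot hV hN hq.star_omega ht (transOp M a)
  refine DiniLE.of_generator hε (Y := fun r => pullback (eps N) (-1) r (h.al (t + r))
      - HS.sandwich (transOp M a) (pullback (eps N) (-1) r (h.al (t + r))))
    (P := transOp M a * h.pot t * star (transOp M a))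
    (Q := conjOp (transOp M a * h.pot t * star (transOp M a)))
    (by simp only [add_zero, pullback_zero]; exact hd2) hs (by rw [star_conjOp, hs])
    (fun r _ => ?_) ?_
  · rw [← pullback_sandwich_transOp, ← pullback_sub, norm_pullback, alTrans]
  · refine norm_alpha_remainder_le hV hN (h.norm_one_sub_conj_om_le hV hN hq ht)
      ((HS.norm_op_sandwich_le hW1 _).trans ho) ha ((HS.norm_op_sandwich_le hW1 _).trans ha) ?_
    rw [star_transOp]
    exact norm_direct_sub_trans_le hV (h.traceNormContinuous.lt_top t)
      (h.norm_densityCoeff_om_le hV hN hq ht) a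

/-- The direct potential commutes with `e^{ip·x̂}` and contributes nothing. The boosted difference
of `α`, for which there is no closed equation, is estimated by `2‖α‖`. The free flow adds `2‖p‖ n`.
-/
theorem diniLE_omBoost (hV : IsPotential C₀ V) (hN : 0 < N) (hq : IsPureQuasiFree N ωN αN)
    (p : R3) {t T : ℝ} (ht : 0 ≤ t) (htT : t < T) {n : ℝ → ℝ} (hnc : Continuous n)
    (hn : ∀ s, 0 ≤ s → s ≤ T → ∀ a, ‖h.omTrans a s‖ ≤ ‖a‖ / eps N * n s) :
    DiniLE (fun t => ‖h.omBoost p t‖) t ((eps N)⁻¹ * (N⁻¹ * C₀ * (2 * ‖h.omBoost p t‖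
      + 8 * ‖h.al t‖)) + 2 * ‖p‖ * n t) := by
  have hε := eps_pos hN
  have hC := hV.nonneg
  have hW1 : ‖expOp M p‖ ≤ 1 := norm_expOp_le p
  have h1 := h.diniLE_omega_sub_sandwich hV hN hq (W := expOp M p)
    (by rw [star_expOp, expOp_neg_mul]) hW1 (sandwich_expOp_exch hV p) ht (m := 0) (by
      rw [star_expOp, expOp_directOp hV N (h.traceNormContinuous.lt_top t), sub_self,
        norm_le_zero_iff]
      exact HS.ext (by rw [map_sub, HS.op_lmul, HS.op_rmul, zero_mul, mul_zero, sub_zero, map_zero]))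
    -- This comparison function is pulled back to time `t` before it is conjugated by the boost, so
    -- the free flow does not enter it.
    (f := fun s => ‖pullback (eps N) 1 (s - t) (h.om s)
      - HS.sandwich (expOp M p) (pullback (eps N) 1 (s - t) (h.om s))‖)
    (fun r _ => by simp only [add_sub_cancel_left])
  have h2 : ‖h.al t - HS.sandwich (expOp M p) (h.al t)‖ ≤ 2 * ‖h.al t‖ := by
    have := norm_sub_le (h.al t) (HS.sandwich (expOp M p) (h.al t))
    have := HS.norm_sandwich_le hW1 (h.al t)
    linarith
  have h3 := h1.mono (n := (eps N)⁻¹ * (N⁻¹ * C₀ * (2 * ‖h.omBoost p t‖ + 8 * ‖h.al t‖))) (by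
    rw [zero_add]
    refine mul_le_mul_of_nonneg_left (mul_le_mul_of_nonneg_left ?_ (by positivity)) (by positivity)
    rw [omBoost]; linarith)
  refine DiniLE.of_le_add (k := fun r => 2 * ‖p‖ * n (t + r)) h3 ?_ ?_ ?_
  · simp only [sub_self, pullback_zero, omBoost]
  · have hc : Continuous fun r => 2 * ‖p‖ * n (t + r) := by fun_prop
    have := hc.tendsto 0
    simp only [add_zero] at this
    exact this.mono_left nhdsWithin_le_nhds
  · have h4 : ∀ᶠ r : ℝ in 𝓝[>] 0, r < T - t :=
      mem_nhdsWithin_of_mem_nhds (Iio_mem_nhds (sub_pos.2 htT))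
    filter_upwards [h4, self_mem_nhdsWithin] with r hr hr0
    have hr0 : 0 < r := hr0
    have e : ‖h.omBoost p (t + r)‖ = ‖pullback (eps N) 1 r (h.omBoost p (t + r))‖ :=
      (norm_pullback _ _ _ _).symm
    rw [add_sub_cancel_left, e, omBoost, pullback_sub_sandwich_expOp]
    refine (norm_add_le _ _).trans (add_le_add_right ?_ _)
    refine (HS.norm_sandwich_le hW1 _).trans ?_
    rw [norm_pullback]
    -- The shift `2εrp` carries one power of `ε`, which cancels the `ε` in the Lipschitz bound
    -- `‖a‖/ε · n`.
    refine (hn (t + r) (by linarith) (by linarith) ((2 * eps N * r) • p)).trans_eq ?_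
    rw [norm_smul, Real.norm_of_nonneg (by positivity)]
    field_simp

end IsSolution

end CommutatorGrowth

/-! ### Closing the loop between translations and boosts. -/

section Bootstrap

variable {M : ℕ} {V : R3 → ℝ} {C₀ : ℝ} {N : ℝ} {ωN αN : Op M} {ω α : ℝ → Op M}

/-- The supremum `A` satisfies `A ≤ c + A/8`. The crude bound `A₀` serves only to make the supremum
finite and does not enter the conclusion. -/
theorem le_of_contraction {ι : Type*} {f : ι → ℝ} {A₀ c : ℝ} (hf : ∀ i, 0 ≤ f i)
    (h0 : ∀ i, f i ≤ A₀)
    (h : ∀ A, 0 ≤ A → (∀ i, f i ≤ A) → ∀ i, f i ≤ c + A / 8) (i : ι) : f i ≤ 8 / 7 * c := by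
  have : Nonempty ι := ⟨i⟩
  have hbdd : BddAbove (Set.range f) := ⟨A₀, by rintro _ ⟨j, rfl⟩; exact h0 j⟩
  have h1 : ∀ j, f j ≤ ⨆ j, f j := fun j => le_ciSup hbdd j
  have h2 : (⨆ j, f j) ≤ c + (⨆ j, f j) / 8 := ciSup_le (h _ ((hf i).trans (h1 i)) h1)
  have h3 := h1 i
  linarith

theorem one_le_mul_eps (hN : 1 ≤ N) : 1 ≤ N * eps N := by
  have h0 : 0 < N := by linarith
  have : N * eps N = N ^ (1 + -(1 / 3) : ℝ) := by rw [Real.rpow_add h0, Real.rpow_one, eps]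
  rw [this]
  exact Real.one_le_rpow hN (by norm_num)

theorem inv_eps_mul_inv_le (hN : 1 ≤ N) : (eps N)⁻¹ * N⁻¹ ≤ 1 := by
  rw [← mul_inv_rev]
  exact inv_le_one_of_one_le₀ (one_le_mul_eps hN)

theorem hasDerivAt_growth (k l c d s : ℝ) :
    HasDerivAt (fun s => k * (Real.exp (l * s) * (c + d * s)))
      (k * (Real.exp (l * s) * l * (c + d * s) + Real.exp (l * s) * d)) s := by
  have h1 : HasDerivAt (fun s : ℝ => l * s) l s := by
    simpa using (hasDerivAt_id s).const_mul l
  have h2 : HasDerivAt (fun s : ℝ => c + d * s) d s := by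
    simpa using ((hasDerivAt_id s).const_mul d).const_add c
  exact (h1.exp.mul h2).const_mul k

namespace IsSolution

variable (h : IsSolution V N ωN αN ω α)

theorem norm_trans_le (h : IsSolution V N ωN αN ω α) (hV : IsPotential C₀ V) (hN : 1 ≤ N)
    (hq : IsPureQuasiFree N ωN αN) {T x β A : ℝ} (hx : 0 ≤ x) (hA : 0 ≤ A) (hβ0 : 0 ≤ β)
    (hβ : ∀ s, 0 ≤ s → s ≤ T → ‖h.al s‖ ≤ β)
    (hB : ∀ s, 0 ≤ s → s ≤ T → ∀ p,
      ‖h.omBoost p s‖ ≤ A * Real.exp ((20 * C₀ + 4) * s) * (1 + ‖p‖)) (a : R3)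
    (ho0 : ‖h.omTrans a 0‖ ≤ 3 * (‖a‖ / eps N) * x)
    (ha0 : ‖h.alTrans a 0‖ ≤ 3 * (‖a‖ / eps N) * x) {s : ℝ} (hs : 0 ≤ s) (hsT : s ≤ T) :
    ‖h.omTrans a s‖ + ‖h.alTrans a s‖ ≤ ‖a‖ / eps N
      * (Real.exp ((20 * C₀ + 4) * s) * (6 * x + A / 4 + 4 * C₀ * β * s)) := by
  have hN0 : 0 < N := by linarith
  have hε := eps_pos hN0
  have hC := hV.nonneg
  have hk : 0 ≤ ‖a‖ / eps N := by positivity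
  refine DiniLE.le_of_deriv_le (f := fun s => ‖h.omTrans a s‖ + ‖h.alTrans a s‖) (K := 6 * C₀)
    (m := fun s => ‖a‖ / eps N * (2 * C₀ * (A * Real.exp ((20 * C₀ + 4) * s)) + 4 * C₀ * β))
    ((h.continuous_omTrans a).norm.add (h.continuous_alTrans a).norm).continuousOn
    (fun t ht htT => ?_) ?_ (hasDerivAt_growth (‖a‖ / eps N) (20 * C₀ + 4) (6 * x + A / 4)
      (4 * C₀ * β)) (fun t ht htT => ?_) s hs hsT
  · refine ((h.diniLE_omTrans hV hN0 hq a ht (hB t ht htT.le)).add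
      (h.diniLE_alTrans hV hN0 hq a ht)).mono ?_
    have h1 := hβ t ht htT.le
    have h2 := mul_le_mul_of_nonneg_right (inv_eps_mul_inv_le hN)
      (show 0 ≤ C₀ * (6 * (‖h.omTrans a t‖ + ‖h.alTrans a t‖)) by positivity)
    have h3 : ‖a‖ / eps N * (4 * C₀ * ‖h.al t‖) ≤ ‖a‖ / eps N * (4 * C₀ * β) := by gcongr
    have e : (eps N)⁻¹ * ‖a‖ = ‖a‖ / eps N := by rw [div_eq_inv_mul]
    calc _ = (eps N)⁻¹ * ‖a‖ * (2 * C₀ * (A * Real.exp ((20 * C₀ + 4) * t)))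
          + (eps N)⁻¹ * ‖a‖ * (4 * C₀ * ‖h.al t‖)
          + (eps N)⁻¹ * N⁻¹ * (C₀ * (6 * (‖h.omTrans a t‖ + ‖h.alTrans a t‖))) := by ring
      _ ≤ _ := by rw [e]; linarith
  · simp only [mul_zero, Real.exp_zero, one_mul, add_zero]
    have : 0 ≤ ‖a‖ / eps N * (A / 4) := by positivity
    linarith
  · have hE : 1 ≤ Real.exp ((20 * C₀ + 4) * t) := Real.one_le_exp (by positivity)
    rw [← mul_assoc (6 * C₀), mul_comm (6 * C₀), mul_assoc (‖a‖ / eps N), ← mul_add]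
    refine mul_le_mul_of_nonneg_left ?_ hk
    generalize Real.exp ((20 * C₀ + 4) * t) = E at *
    have h1 : A / 4 ≤ 6 * x + A / 4 + 4 * C₀ * β * t := by
      have : 0 ≤ 4 * C₀ * β * t := by positivity
      linarith
    -- What remains of the rate after `6C₀`; multiplied by `A/4` it covers the source `2C₀ A`.
    have h2 : 0 ≤ (14 * C₀ + 4) * E := by positivity
    have h3 := mul_le_mul_of_nonneg_left h1 h2
    have h4 : 4 * C₀ * β * 1 ≤ 4 * C₀ * β * E := by gcongr
    have h5 : 0 ≤ C₀ * A * E := by positivity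
    have h6 : 0 ≤ A * E := by positivity
    linarith

/-- The source coming from translations is `2‖p‖` times their Lipschitz constant; the `4` in the
rate lets it be absorbed while the dependence on `A` drops from `A/4` to `A/8`. -/
theorem norm_omBoost_le_of_trans (hV : IsPotential C₀ V) (hN : 1 ≤ N)
    (hq : IsPureQuasiFree N ωN αN) {T x β A : ℝ} (hx : 0 ≤ x) (hA : 0 ≤ A) (hβ0 : 0 ≤ β)
    (hβ : ∀ s, 0 ≤ s → s ≤ T → ‖h.al s‖ ≤ β)
    (hS : ∀ s, 0 ≤ s → s ≤ T → ∀ a, ‖h.omTrans a s‖ ≤ ‖a‖ / eps N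
      * (Real.exp ((20 * C₀ + 4) * s) * (6 * x + A / 4 + 4 * C₀ * β * s))) (p : R3)
    (hb0 : ‖h.omBoost p 0‖ ≤ x * (1 + ‖p‖)) {s : ℝ} (hs : 0 ≤ s) (hsT : s ≤ T) :
    ‖h.omBoost p s‖ ≤ (1 + ‖p‖)
      * (Real.exp ((20 * C₀ + 4) * s) * (3 * x + A / 8 + 8 * C₀ * β * s)) := by
  have hN0 : 0 < N := by linarith
  have hε := eps_pos hN0
  have hC := hV.nonneg
  refine DiniLE.le_of_deriv_le (f := fun s => ‖h.omBoost p s‖) (K := 2 * C₀)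
    (m := fun s => 8 * C₀ * β + 2 * ‖p‖
      * (Real.exp ((20 * C₀ + 4) * s) * (6 * x + A / 4 + 4 * C₀ * β * s)))
    (h.continuous_omBoost p).norm.continuousOn
    (fun t ht htT => ?_) ?_ (hasDerivAt_growth (1 + ‖p‖) (20 * C₀ + 4) (3 * x + A / 8)
      (8 * C₀ * β)) (fun t ht htT => ?_) s hs hsT
  · refine (h.diniLE_omBoost hV hN0 hq p ht htT (by fun_prop) hS).mono ?_
    have h1 := hβ t ht htT.le
    have h2 := mul_le_mul_of_nonneg_right (inv_eps_mul_inv_le hN)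
      (show 0 ≤ C₀ * (2 * ‖h.omBoost p t‖ + 8 * ‖h.al t‖) by positivity)
    have h3 : 8 * C₀ * ‖h.al t‖ ≤ 8 * C₀ * β := by gcongr
    linarith
  · simp only [mul_zero, Real.exp_zero, one_mul, add_zero]
    have : 0 ≤ (1 + ‖p‖) * (2 * x + A / 8) := by positivity
    linarith
  · have hE : 1 ≤ Real.exp ((20 * C₀ + 4) * t) := Real.one_le_exp (by positivity)
    have hp := norm_nonneg p
    generalize Real.exp ((20 * C₀ + 4) * t) = E at *
    generalize ‖p‖ = P at *
    have hE0 : 0 ≤ E := zero_le_one.trans hE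
    have h1 : 8 * C₀ * β * 1 ≤ 8 * C₀ * β * ((1 + P) * E) := by
      gcongr
      nlinarith
    -- Doubling the translation constant gives four times `3x + A/8 + 2C₀βt`; this fixes the
    -- constants `3x` and `A/8` of the supersolution.
    have h2 : 2 * P * (E * (6 * x + A / 4 + 4 * C₀ * β * t))
        ≤ 4 * ((1 + P) * (E * (3 * x + A / 8 + 8 * C₀ * β * t))) := by
      have e : 2 * P * (E * (6 * x + A / 4 + 4 * C₀ * β * t))
        = 4 * (P * (E * (3 * x + A / 8 + 2 * C₀ * β * t))) := by ring
      rw [e]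
      gcongr
      · linarith
      · linarith
    have h3 : 0 ≤ C₀ * ((1 + P) * (E * (3 * x + A / 8 + 8 * C₀ * β * t))) := by positivity
    linarith

/-- A priori growth of the commutators with `e^{ip·x}`, closed by a contraction argument. -/
theorem norm_omBoost_le (hV : IsPotential C₀ V) (hN : 1 ≤ N)
    (hq : IsPureQuasiFree N ωN αN) {T x β : ℝ} (hx : 0 ≤ x) (hβ0 : 0 ≤ β)
    (hβ : ∀ s, 0 ≤ s → s ≤ T → ‖h.al s‖ ≤ β)
    (ho0 : ∀ a, ‖h.omTrans a 0‖ ≤ 3 * (‖a‖ / eps N) * x)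
    (ha0 : ∀ a, ‖h.alTrans a 0‖ ≤ 3 * (‖a‖ / eps N) * x)
    (hb0 : ∀ p, ‖h.omBoost p 0‖ ≤ x * (1 + ‖p‖)) {s : ℝ} (hs : 0 ≤ s) (hsT : s ≤ T) (p : R3) :
    ‖h.omBoost p s‖ ≤ (4 * x + 10 * C₀ * β * T) * Real.exp ((20 * C₀ + 4) * s) * (1 + ‖p‖) := by
  have hN0 : 0 < N := by linarith
  have hC := hV.nonneg
  have hT : 0 ≤ T := hs.trans hsT
  have hw : ∀ (p : R3) (s : ℝ), 0 < (1 + ‖p‖) * Real.exp ((20 * C₀ + 4) * s) := fun p s => by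
    positivity
  -- The supremum is taken over boosts and times together, with the exponential weight; thus no
  -- regularity in time of a supremum over `p` is needed.
  have key := le_of_contraction (ι := R3 × Set.Icc (0 : ℝ) T)
    (f := fun i => ‖h.omBoost i.1 i.2‖ / ((1 + ‖i.1‖) * Real.exp ((20 * C₀ + 4) * i.2)))
    (A₀ := 2 * N) (c := 3 * x + 8 * C₀ * β * T) (fun i => by positivity) (fun i => ?_)
    (fun A hA hAb i => ?_) (p, ⟨s, hs, hsT⟩)
  · have h1 : 8 / 7 * (3 * x + 8 * C₀ * β * T) ≤ 4 * x + 10 * C₀ * β * T := by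
      have : 0 ≤ C₀ * β * T := by positivity
      linarith
    have h2 := (div_le_iff₀ (hw p s)).1 (key.trans h1)
    linarith
  · rw [div_le_iff₀ (hw _ _)]
    have h1 := h.norm_sq_add_eq hV hN0 hq i.2.2.1
    -- The a priori bound: `‖ω‖² ≤ N ≤ N²`, and a boosted difference is at most `2‖ω‖`.
    have h2 : ‖h.om i.2‖ ≤ N := abs_le_of_sq_le_sq' (by nlinarith [sq_nonneg ‖h.al i.2‖]) hN0.le |>.2
    have h3 := norm_sub_le (h.om i.2) (HS.sandwich (expOp M i.1) (h.om i.2))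
    have h4 := HS.norm_sandwich_le (norm_expOp_le i.1) (h.om i.2)
    have h5 : 1 ≤ (1 + ‖i.1‖) * Real.exp ((20 * C₀ + 4) * i.2) :=
      one_le_mul_of_one_le_of_one_le (by linarith [norm_nonneg i.1])
        (Real.one_le_exp (mul_nonneg (by positivity) i.2.2.1))
    rw [omBoost]
    nlinarith
  · rw [div_le_iff₀ (hw _ _)]
    have hB : ∀ s, 0 ≤ s → s ≤ T → ∀ p,
        ‖h.omBoost p s‖ ≤ A * Real.exp ((20 * C₀ + 4) * s) * (1 + ‖p‖) := fun s hs hsT p => by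
      have := (div_le_iff₀ (hw p s)).1 (hAb (p, ⟨s, hs, hsT⟩))
      linarith
    have h1 := h.norm_omBoost_le_of_trans hV hN hq hx hA hβ0 hβ (fun s hs hsT a => by
      have := h.norm_trans_le hV hN hq hx hA hβ0 hβ hB a (ho0 a) (ha0 a) hs hsT
      linarith [norm_nonneg (h.alTrans a s)]) i.1 (hb0 i.1) i.2.2.1 i.2.2.2
    refine h1.trans ?_
    have h2 : 3 * x + A / 8 + 8 * C₀ * β * i.2 ≤ 3 * x + 8 * C₀ * β * T + A / 8 := by
      have : 8 * C₀ * β * i.2 ≤ 8 * C₀ * β * T := by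
        have := i.2.2.2
        gcongr
      linarith
    calc _ = (3 * x + A / 8 + 8 * C₀ * β * i.2)
          * ((1 + ‖i.1‖) * Real.exp ((20 * C₀ + 4) * i.2)) := by ring
      _ ≤ _ := mul_le_mul_of_nonneg_right h2 (hw _ _).le

theorem hsNorm_alpha (h : IsSolution V N ωN αN ω α) {t : ℝ} (ht : 0 ≤ t) :
    hsNorm (α t) = ENNReal.ofReal ‖h.al t‖ := by
  rw [← HS.hsNorm_op, h.op_al ht]

theorem hsNorm_initial_alpha (h : IsSolution V N ωN αN ω α) :
    hsNorm αN = ENNReal.ofReal ‖h.al 0‖ := by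
  rw [← h.hsNorm_alpha le_rfl, h.alpha_zero]

theorem hsNorm_comm_expOp (h : IsSolution V N ωN αN ω α) {t : ℝ} (ht : 0 ≤ t) (p : R3) :
    hsNorm (comm (ω t) (expOp M p)) = ENNReal.ofReal ‖h.omBoost p t‖ := by
  rw [omBoost, ← norm_sub_sandwich_expOp, norm_sub_rev, ← HS.hsNorm_op, map_sub, HS.op_rmul,
    HS.op_lmul, h.op_om ht]
  rfl

theorem hsNorm_omega_trans (h : IsSolution V N ωN αN ω α) {t : ℝ} (ht : 0 ≤ t) (a : R3) :
    hsNorm (ω t - transOp M a * ω t * transOp M (-a)) = ENNReal.ofReal ‖h.omTrans a t‖ := by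
  rw [← HS.hsNorm_op, omTrans, map_sub, HS.op_sandwich, star_transOp, h.op_om ht]

theorem hsNorm_alpha_trans (h : IsSolution V N ωN αN ω α) {t : ℝ} (ht : 0 ≤ t) (a : R3) :
    hsNorm (α t - transOp M a * α t * transOp M (-a)) = ENNReal.ofReal ‖h.alTrans a t‖ := by
  rw [← HS.hsNorm_op, alTrans, map_sub, HS.op_sandwich, star_transOp, h.op_al ht]

theorem norm_omBoost_zero_le (hsc : IsSemiclassical C₀ N ωN αN) (hx : 0 ≤ C₀ * N ^ (1 / 3 : ℝ))
    (p : R3) : ‖h.omBoost p 0‖ ≤ C₀ * N ^ (1 / 3 : ℝ) * (1 + ‖p‖) := by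
  have hp : 0 < 1 + ‖p‖ := by positivity
  have h1 := (le_iSup (fun p : R3 => hsNorm (comm ωN (expOp M p)) / ENNReal.ofReal (1 + ‖p‖))
    p).trans hsc.exp_comm
  rw [← h.omega_zero, h.hsNorm_comm_expOp le_rfl, ENNReal.div_le_iff (by simpa using hp)
    ENNReal.ofReal_ne_top, ← ENNReal.ofReal_mul hx] at h1
  exact (ENNReal.ofReal_le_ofReal_iff (by positivity)).1 h1

theorem norm_omTrans_zero_le (hN : 1 ≤ N) (hsc : IsSemiclassical C₀ N ωN αN)
    (hx : 0 ≤ C₀ * N ^ (1 / 3 : ℝ)) (a : R3) :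
    ‖h.omTrans a 0‖ ≤ 3 * (‖a‖ / eps N) * (C₀ * N ^ (1 / 3 : ℝ)) := by
  have hε := eps_pos (zero_lt_one.trans_le hN)
  have h1 := hsNorm_sub_trans_le hε hx hsc.omega_grad a
  rw [← h.omega_zero, h.hsNorm_omega_trans le_rfl] at h1
  exact (ENNReal.ofReal_le_ofReal_iff (by positivity)).1 h1

theorem norm_alTrans_zero_le (hN : 1 ≤ N) (hsc : IsSemiclassical C₀ N ωN αN)
    (hx : 0 ≤ C₀ * N ^ (1 / 3 : ℝ)) (a : R3) :
    ‖h.alTrans a 0‖ ≤ 3 * (‖a‖ / eps N) * (C₀ * N ^ (1 / 3 : ℝ)) := by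
  have hε := eps_pos (zero_lt_one.trans_le hN)
  have h1 := hsNorm_sub_trans_le hε hx hsc.alpha_grad a
  rw [← h.alpha_zero, h.hsNorm_alpha_trans le_rfl] at h1
  exact (ENNReal.ofReal_le_ofReal_iff (by positivity)).1 h1

theorem norm_al_le_exp (hV : IsPotential C₀ V) (hN : 1 ≤ N)
    (hq : IsPureQuasiFree N ωN αN) {s T : ℝ} (hs : 0 ≤ s) (hsT : s ≤ T) :
    ‖h.al s‖ ≤ ‖h.al 0‖ * Real.exp (2 * C₀ * T) := by
  have hC := hV.nonneg
  refine (h.norm_al_le hV (zero_lt_one.trans_le hN) hq hs).trans ?_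
  gcongr
  exact div_le_self (by positivity) (one_le_mul_eps hN)

/-- The boost bound from the contraction is fed once more into `norm_trans_le`. Here `β = ‖α_N‖
e^{2C₀t}` bounds `α` on all of `[0, t]`, which raises the rate from `20C₀ + 4` to `22C₀ + 4`. -/
theorem growth_bounds (hV : IsPotential C₀ V) (hN : 1 ≤ N) (hq : IsPureQuasiFree N ωN αN)
    (hsc : IsSemiclassical C₀ N ωN αN) {t : ℝ} (ht : 0 ≤ t) :
    (∀ p, ‖h.omBoost p t‖ ≤ 10 * C₀ * Real.exp ((22 * C₀ + 4) * t)
        * (N ^ (1 / 3 : ℝ) + t * ‖h.al 0‖) * (1 + ‖p‖)) ∧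
    (∀ a, ‖h.omTrans a t‖ + ‖h.alTrans a t‖ ≤ ‖a‖ / eps N
        * (7 * C₀ * Real.exp ((22 * C₀ + 4) * t) * (N ^ (1 / 3 : ℝ) + t * ‖h.al 0‖))) := by
  have hN0 : 0 < N := by linarith
  have hε := eps_pos hN0
  have hC := hV.nonneg
  have hx : 0 ≤ C₀ * N ^ (1 / 3 : ℝ) := by positivity
  have hβ : 0 ≤ ‖h.al 0‖ * Real.exp (2 * C₀ * t) := by positivity
  have hal := fun s hs hst => h.norm_al_le_exp (T := t) hV hN hq (s := s) hs hst
  have ho := h.norm_omTrans_zero_le hN hsc hx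
  have ha := h.norm_alTrans_zero_le hN hsc hx
  have hb := fun s hs hst => h.norm_omBoost_le (T := t) hV hN hq hx hβ hal ho ha
    (h.norm_omBoost_zero_le hsc hx) (s := s) hs hst
  have hA : 0 ≤ 4 * (C₀ * N ^ (1 / 3 : ℝ))
      + 10 * C₀ * (‖h.al 0‖ * Real.exp (2 * C₀ * t)) * t := by positivity
  have hE : Real.exp ((22 * C₀ + 4) * t)
      = Real.exp ((20 * C₀ + 4) * t) * Real.exp (2 * C₀ * t) := by
    rw [← Real.exp_add]; ring_nf
  have hF : 1 ≤ Real.exp (2 * C₀ * t) := Real.one_le_exp (by positivity)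
  have hF' : C₀ * N ^ (1 / 3 : ℝ) * 1 ≤ C₀ * N ^ (1 / 3 : ℝ) * Real.exp (2 * C₀ * t) := by gcongr
  constructor
  · intro p
    refine (hb t ht le_rfl p).trans (mul_le_mul_of_nonneg_right ?_ (by positivity))
    rw [hE]
    have h1 : 4 * (C₀ * N ^ (1 / 3 : ℝ)) + 10 * C₀ * (‖h.al 0‖ * Real.exp (2 * C₀ * t)) * t
        ≤ 10 * C₀ * Real.exp (2 * C₀ * t) * (N ^ (1 / 3 : ℝ) + t * ‖h.al 0‖) := by
      linarith
    refine (mul_le_mul_of_nonneg_right h1 (Real.exp_pos _).le).trans_eq (by ring)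
  · intro a
    refine (h.norm_trans_le hV hN hq hx hA hβ hal hb a (ho a) (ha a) ht le_rfl).trans
      (mul_le_mul_of_nonneg_left ?_ (by positivity))
    rw [hE]
    have h2 : 0 ≤ C₀ * (t * ‖h.al 0‖) * Real.exp (2 * C₀ * t) := by positivity
    have h1 : 6 * (C₀ * N ^ (1 / 3 : ℝ)) + (4 * (C₀ * N ^ (1 / 3 : ℝ))
          + 10 * C₀ * (‖h.al 0‖ * Real.exp (2 * C₀ * t)) * t) / 4
          + 4 * C₀ * (‖h.al 0‖ * Real.exp (2 * C₀ * t)) * t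
        ≤ 7 * C₀ * Real.exp (2 * C₀ * t) * (N ^ (1 / 3 : ℝ) + t * ‖h.al 0‖) := by
      linarith
    refine (mul_le_mul_of_nonneg_left h1 (Real.exp_pos _).le).trans_eq (by ring)

theorem expCommHS_le {t n : ℝ} (ht : 0 ≤ t) (hn : 0 ≤ n)
    (hb : ∀ p, ‖h.omBoost p t‖ ≤ n * (1 + ‖p‖)) : expCommHS (ω t) ≤ ENNReal.ofReal n := by
  refine iSup_le fun p => ?_
  have hp : 0 < 1 + ‖p‖ := by positivity
  rw [h.hsNorm_comm_expOp ht, ENNReal.div_le_iff (by simpa using hp) ENNReal.ofReal_ne_top,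
    ← ENNReal.ofReal_mul hn]
  exact ENNReal.ofReal_le_ofReal (hb p)

theorem hsNorm_omega_sq_le (h : IsSolution V N ωN αN ω α) (hV : IsPotential C₀ V) (hN : 0 < N) (hq : IsPureQuasiFree N ωN αN)
    {t : ℝ} (ht : 0 ≤ t) : hsNorm (ω t) ^ 2 ≤ traceNorm ωN := by
  have h1 := h.norm_sq_add_eq hV hN hq ht
  have h2 := norm_trace_le hq.traceClass
  rw [hq.trace_eq, Complex.norm_real, Real.norm_of_nonneg hN.le] at h2
  rw [← h.op_om ht, HS.hsNorm_op, ← ENNReal.ofReal_pow (norm_nonneg _)]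
  refine (ENNReal.ofReal_le_ofReal ?_).trans (ENNReal.ofReal_le_of_le_toReal h2)
  linarith [sq_nonneg ‖h.al t‖]

end IsSolution

end Bootstrap

end HFB

end

theorem proposition4p3 (C₀ : ℝ) :
    ∃ C c : ℝ, 0 < C ∧ 0 < c ∧
      ∀ (M : ℕ) (V : HFB.R3 → ℝ), HFB.IsPotential C₀ V →
      ∀ N : ℝ, 1 ≤ N →
      ∀ ωN αN : HFB.Op M, HFB.IsPureQuasiFree N ωN αN → HFB.IsSemiclassical C₀ N ωN αN →
      ∀ ω α : ℝ → HFB.Op M, HFB.IsSolution V N ωN αN ω α →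
      ∀ t : ℝ, 0 ≤ t →
        HFB.expCommHS (ω t) ≤ ENNReal.ofReal (C * Real.exp (c * |t|)) *
          (ENNReal.ofReal (N ^ (1 / 3 : ℝ)) + ENNReal.ofReal |t| * HFB.hsNorm αN) ∧
        HFB.gradCommHS (HFB.eps N) (ω t) ≤ ENNReal.ofReal (C * Real.exp (c * |t|)) *
          (ENNReal.ofReal (N ^ (1 / 3 : ℝ)) + ENNReal.ofReal |t| * HFB.hsNorm αN) ∧
        HFB.gradCommHS (HFB.eps N) (α t) ≤ ENNReal.ofReal (C * Real.exp (c * |t|)) *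
          (ENNReal.ofReal (N ^ (1 / 3 : ℝ)) + ENNReal.ofReal |t| * HFB.hsNorm αN) ∧
        HFB.hsNorm (ω t) ^ 2 ≤ HFB.traceNorm ωN ∧
        HFB.hsNorm (α t) ≤
          ENNReal.ofReal (Real.exp (C * |t| / (N * HFB.eps N))) * HFB.hsNorm αN := by
  -- The constant `21` is the `7` of `growth_bounds` times the `3` lost in returning from
  -- translations to gradients, and it also dominates the `10` for boosts and the `2` in the
  -- exponent for `α`. The absolute values and the `+ 1` only ensure positivity before `C₀ ≥ 0` is
  -- known.
  refine ⟨21 * |C₀| + 1, 22 * |C₀| + 4, by positivity, by positivity, ?_⟩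
  intro M V hV N hN ωN αN hq hsc ω α h t ht
  have hC := hV.nonneg
  have hN0 : 0 < N := by linarith
  have hε := HFB.eps_pos hN0
  obtain ⟨hb, hS⟩ := h.growth_bounds hV hN hq hsc ht
  rw [abs_of_nonneg hC, abs_of_nonneg ht, h.hsNorm_initial_alpha, ← ENNReal.ofReal_mul ht,
    ← ENNReal.ofReal_add (by positivity) (by positivity), ← ENNReal.ofReal_mul (by positivity)]
  have hJ : 0 ≤ Real.exp ((22 * C₀ + 4) * t) * (N ^ (1 / 3 : ℝ) + t * ‖h.al 0‖) := by positivity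
  have hJ' := mul_nonneg hC hJ
  have hn : 0 ≤ 7 * C₀ * Real.exp ((22 * C₀ + 4) * t) * (N ^ (1 / 3 : ℝ) + t * ‖h.al 0‖) := by
    positivity
  refine ⟨?_, ?_, ?_, h.hsNorm_omega_sq_le hV hN0 hq ht, ?_⟩
  · refine (h.expCommHS_le ht (by positivity) hb).trans (ENNReal.ofReal_le_ofReal ?_)
    linarith
  · refine (HFB.gradCommHS_le_of_trans hε hn fun a => ?_).trans (ENNReal.ofReal_le_ofReal ?_)
    · rw [h.hsNorm_omega_trans ht]
      exact ENNReal.ofReal_le_ofReal (by linarith [hS a, norm_nonneg (h.alTrans a t)])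
    · linarith
  · refine (HFB.gradCommHS_le_of_trans hε hn fun a => ?_).trans (ENNReal.ofReal_le_ofReal ?_)
    · rw [h.hsNorm_alpha_trans ht]
      exact ENNReal.ofReal_le_ofReal (by linarith [hS a, norm_nonneg (h.omTrans a t)])
    · linarith
  · rw [h.hsNorm_alpha ht, ← ENNReal.ofReal_mul (Real.exp_pos _).le]
    refine ENNReal.ofReal_le_ofReal ((h.norm_al_le hV hN0 hq ht).trans ?_)
    rw [mul_comm]
    refine mul_le_mul_of_nonneg_right (Real.exp_le_exp.2 ?_) (norm_nonneg _)
    rw [div_mul_eq_mul_div]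
    gcongr
    linarith
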